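/- Let $N\ge 1$, let $V=\{x\in \mathrm{Mat}_2(\mathbb Q):\operatorname{tr}x=0\}$ with $Q(x)=N\det x$ and bilinear form $(x,y)=-N\operatorname{tr}(xy)$ (signature $(1,2)$), and let $L=\{\begin{pmatrix} b&-a/N\\ c&-b\end{pmatrix}: a,b,c\in\mathbb Z\}$, with dual lattice $L'$ and Weil representation $\rho_L$ (for an even lattice $M$ of signature $(b^+,b^-)$: $\rho_M(T)\phi_\mu=e(Q(\mu))\phi_\mu$ and $\rho_M(S)\phi_\mu=e(\tfrac{b^--b^+}{8})|M'/M|^{-1/2}\sum_{\nu\in M'/M} e(-(\mu,\nu))\phi_\nu$, where $e(z)=e^{2\pi i z}$). Let $m_0\in\mathbb Q_{>0}$ and $\mu_0=\operatorname{diag}(\tfrac r{2N},-\tfrac r{2N})\in L'/L$ with $m_0\equiv Q(\mu_0)\pmod 1$, and assume that $D_0=-4Nm_0$ is a fundamental discriminant. Put $x=\begin{pmatrix} r/2N&1/N\\ (D_0-r^2)/4N&-r/2N\end{pmatrix}$, $V_+=\mathbb Qx$, $U=V\cap x^\perp$, $\mathcal P=L\cap V_+$, $\mathcal N=L\cap U$.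 For $g=\sum_\mu\sum_{m>0}b(m,\mu)q^m\phi_\mu\in S_{3/2,\rho_L}$ let $$L(g,U,s)=\int_{\mathcal F}\big\langle \theta_{\mathcal P}(\tau)\otimes E_{\mathcal N}(\tau,s;1),\,\overline{g(\tau)}\big\rangle\, v^{3/2}\,\frac{du\,dv}{v^2}\qquad(\operatorname{Re}s>1),$$ where $\mathcal F$ is the standard fundamental domain of $\Gamma=\mathrm{SL}_2(\mathbb Z)$, $g$ is regarded as an $S_{\mathcal P\oplus\mathcal N}$-valued form by inclusion, $\theta_{\mathcal P}=\sum_{\lambda\in\mathcal P'}q^{Q(\lambda)}\phi_\lambda$ and $E_{\mathcal N}(\tau,s;1)=\sum_{\gamma\in\Gamma_\infty\backslash\Gamma}[\operatorname{Im}(\tau)^{s/2}\phi_0]\,|_{1,\rho_{\mathcal N}}\gamma$; for other $s$ the function $L(g,U,s)$ is defined by meromorphic continuation. Let $\chi_{D_0}=(\tfrac{D_0}{\cdot})$ and $$B(n)=\sum_{d\mid n}\Big(\frac{D_0}{d}\Big)\,b\Big(m_0\frac{n^2}{d^2},\mu_0\frac nd\Big),\qquad L(\mathcal S_{m_0,\mu_0}(g),s)=\sum_{n\ge1}B(n)n^{-s},$$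 the Dirichlet series of the Shimura lift of $g$. Then the series and integrals defining $L(g,U,s)$ converge absolutely for $\operatorname{Re}s>1$, the series $L(\mathcal S_{m_0,\mu_0}(g),s+1)$ converges absolutely for $\operatorname{Re}s>3/2$, and $$L(g,U,s)=2^{-s}(\pi m_0)^{-(s+1)/2}\,\Gamma\Big(\frac{s+1}2\Big)\,L(\chi_{D_0},s+1)^{-1}\;\overline{L\big(\mathcal S_{m_0,\mu_0}(g),\bar s+1\big)}$$ for all $s$ with $\operatorname{Re}s>1$ for which $L(\mathcal S_{m_0,\mu_0}(g),s+1)$ converges absolutely. One of $L(g,U,s)$, $L(\mathcal S_{m_0,\mu_0}(g),s)$ continues meromorphically to $\mathbb C$ if and only if the other does, and then the identity holds as an identity of meromorphic functions on $\mathbb C$. If all coefficients $b(m,\mu)$ are real, then both complex conjugations can be omitted: $$L(g,U,s)=2^{-s}(\pi m_0)^{-(s+1)/2}\,\Gamma\Big(\frac{s+1}2\Big)\,L(\chi_{D_0},s+1)^{-1}\,L\big(\mathcal S_{m_0,\mu_0}(g),s+1\big).$$ In particular, let $G\in S_2(\Gamma_0(N))$ be invariant under the Fricke involution, i.e. $G(-1/(N\tau))=N\tau^2G(\tau)$,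 with $L(\mathcal S_{m_0,\mu_0}(g),s)=b(m_0,\mu_0)L(G,s)$ (for example, a newform $g$ and the normalized newform $G$ corresponding to it under the Shimura correspondence). Then $L(g,U,s)$ has a meromorphic continuation to $\mathbb C$ which is holomorphic at $s=0$, and $$L'(g,U,0)=\frac{\sqrt N\operatorname{vol}(K_T)}{\pi}\;\overline{b(m_0,\mu_0)\,L'(G,1)},$$ so that $L'(g,U,0)=\frac{\sqrt N\operatorname{vol}(K_T)}{\pi}\,b(m_0,\mu_0)\,L'(G,1)$ if all $b(m,\mu)$ are real. Here $T=\mathrm{GSpin}(U)$ is the stabilizer of $x$ in $\mathrm{GL}_2$ acting on $V$ by conjugation; $K_T=T(\mathbb A_f)\cap K$, where $K=\prod_pK_p$ and $K_p\subset\mathrm{GL}_2(\mathbb Z_p)$ is the group of the matrices with lower left entry in $N\mathbb Z_p$; and the Haar measure on $T(\mathbb A_f)$ comes from the exact sequence $1\to\mathbb A_f^\times\to T(\mathbb A_f)\to \mathrm{SO}(U)(\mathbb A_f)\to1$ with $\operatorname{vol}(\hat{\mathbb Z}^\times)=1$ and $\operatorname{vol}(\mathrm{SO}(U)(\mathbb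 Q)\backslash\mathrm{SO}(U)(\mathbb A_f))=2$. -/

import Mathlib

open scoped UpperHalfPlane MatrixGroups ModularForm

noncomputable section

namespace RankinShimura

/-- `e(z) = exp(2πiz)`. -/
def e (z : ℂ) : ℂ := Complex.exp (2 * Real.pi * Complex.I * z)

/-! ## Lattices, discriminant groups and the Weil representation

`M` is a lattice in a rational quadratic space `(V, Q)`, not necessarily of full rank; it is
regarded as a lattice in the subspace `ℚ M`.  The bilinear form is
`(x, y) = Q (x + y) - Q x - Q y = QuadraticMap.polar Q x y`. -/

section Lattices

variable {V : Type} [AddCommGroup V] [Module ℚ V]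

/-- The dual lattice `M' = {y ∈ ℚ M : (y, x) ∈ ℤ for all x ∈ M}`. -/
def dualLattice (Q : QuadraticForm ℚ V) (M : AddSubgroup V) : AddSubgroup V where
  carrier := {y | y ∈ Submodule.span ℚ (M : Set V) ∧
    ∀ x ∈ M, ∃ k : ℤ, QuadraticMap.polar Q y x = k}
  zero_mem' := ⟨Submodule.zero_mem _, fun x _ => ⟨0, by simp [QuadraticMap.polar]⟩⟩
  add_mem' := by
    rintro a b ⟨ha, ha'⟩ ⟨hb, hb'⟩
    refine ⟨Submodule.add_mem _ ha hb, fun x hx => ?_⟩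
    obtain ⟨k, hk⟩ := ha' x hx
    obtain ⟨l, hl⟩ := hb' x hx
    exact ⟨k + l, by rw [QuadraticMap.polar_add_left, hk, hl]; push_cast; ring⟩
  neg_mem' := by
    rintro a ⟨ha, ha'⟩
    refine ⟨Submodule.neg_mem _ ha, fun x hx => ?_⟩
    obtain ⟨k, hk⟩ := ha' x hx
    exact ⟨-k, by rw [QuadraticMap.polar_neg_left, hk]; push_cast; ring⟩

/-- The discriminant group `M'/M`. -/
abbrev Disc (Q : QuadraticForm ℚ V) (M : AddSubgroup V) : Type :=
  dualLattice Q M ⧸ M.addSubgroupOf (dualLattice Q M)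

/-- A representative in `M'` of a class in `M'/M`. -/
def Disc.rep {Q : QuadraticForm ℚ V} {M : AddSubgroup V} (μ : Disc Q M) : V :=
  ((Quotient.out μ : dualLattice Q M) : V)

/-- The space `S_M`, realised as the functions on `V` which are supported on `M'` and constant
on the cosets of `M`.  With this realisation the embedding `S_L → S_M` for a sublattice
`M ⊆ L` of finite index is the inclusion. -/
def IsSchwartz (Q : QuadraticForm ℚ V) (M : AddSubgroup V) (φ : V → ℂ) : Prop :=
  (∀ x, x ∉ dualLattice Q M → φ x = 0) ∧ ∀ x, ∀ y ∈ M, φ (x + y) = φ x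

open Classical in
/-- The characteristic function `φ_0` of `M`. -/
def charFun (M : AddSubgroup V) (x : V) : ℂ := if x ∈ M then 1 else 0

/-- `ρ_M(T)`, given by `φ_μ ↦ e(Q(μ)) φ_μ`. -/
def weilT (Q : QuadraticForm ℚ V) (φ : V → ℂ) (x : V) : ℂ := e (Q x : ℂ) * φ x

open Classical in
/-- `ρ_M(S)`, given by `φ_μ ↦ e((b⁻ - b⁺)/8) |M'/M|^{-1/2} ∑_ν e(-(μ,ν)) φ_ν`, where
`sig = b⁺ - b⁻` is the signature of `M`. -/
def weilS (Q : QuadraticForm ℚ V) (M : AddSubgroup V) (sig : ℤ) (φ : V → ℂ) (x : V) : ℂ :=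
  if x ∈ dualLattice Q M then
    e (-(sig : ℂ) / 8) / (Real.sqrt (Nat.card (Disc Q M)) : ℂ) *
      ∑ᶠ μ : Disc Q M, e (-((QuadraticMap.polar Q μ.rep x : ℚ) : ℂ)) * φ μ.rep
  else 0

/-- `WeilWord Q M sig γ A` says that `A` is a product of the operators `ρ_M(S)`, `ρ_M(T)`
belonging to an expression of `γ` as a word in `S`, `T`. -/
inductive WeilWord (Q : QuadraticForm ℚ V) (M : AddSubgroup V) (sig : ℤ) :
    SL(2, ℤ) → ((V → ℂ) → (V → ℂ)) → Prop
  | one : WeilWord Q M sig 1 id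
  | S_mul {γ : SL(2, ℤ)} {A : (V → ℂ) → (V → ℂ)} (h : WeilWord Q M sig γ A) :
      WeilWord Q M sig (ModularGroup.S * γ) (weilS Q M sig ∘ A)
  | T_mul {γ : SL(2, ℤ)} {A : (V → ℂ) → (V → ℂ)} (h : WeilWord Q M sig γ A) :
      WeilWord Q M sig (ModularGroup.T * γ) (weilT Q ∘ A)

/-- Every element of `SL₂(ℤ)` is a word in `S` and `T`. -/
theorem exists_weilWord (Q : QuadraticForm ℚ V) (M : AddSubgroup V) (sig : ℤ) (γ : SL(2, ℤ)) :
    ∃ A, WeilWord Q M sig γ A := by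
  have hS : ∀ γ, (∃ A, WeilWord Q M sig γ A) → ∃ A, WeilWord Q M sig (ModularGroup.S * γ) A :=
    fun γ ⟨A, h⟩ => ⟨_, h.S_mul⟩
  have hT : ∀ γ, (∃ A, WeilWord Q M sig γ A) → ∃ A, WeilWord Q M sig (ModularGroup.T * γ) A :=
    fun γ ⟨A, h⟩ => ⟨_, h.T_mul⟩
  have h : γ ∈ Subgroup.closure {ModularGroup.S, ModularGroup.T} := by
    simp [SpecialLinearGroup.SL2Z_generators]
  induction h using Subgroup.closure_induction_left with
  | one => exact ⟨_, .one⟩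
  | mul_left x hx y _ ih =>
    rcases hx with rfl | rfl
    · exact hS _ ih
    · exact hT _ ih
  | inv_mul_cancel x hx y _ ih =>
    rcases hx with rfl | rfl
    · have : (ModularGroup.S : SL(2, ℤ))⁻¹ * y
          = ModularGroup.S * (ModularGroup.S * (ModularGroup.S * y)) := by
        rw [← mul_assoc, ← mul_assoc]; congr 1; decide
      rw [this]; exact hS _ (hS _ (hS _ ih))
    · have : (ModularGroup.T : SL(2, ℤ))⁻¹ * y
          = ModularGroup.S * (ModularGroup.S * (ModularGroup.S * (ModularGroup.T *
              (ModularGroup.S * (ModularGroup.T * (ModularGroup.S * y)))))) := by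
        simp only [← mul_assoc]; congr 1; decide
      rw [this]; exact hS _ (hS _ (hS _ (hT _ (hS _ (hT _ (hS _ ih))))))

/-- The Weil representation `ρ_M` of `SL₂(ℤ)` on `S_M` for `M` of even signature: the
representation given on the generators `S`, `T` by `weilS`, `weilT`.  (On `S_M`, the operator
does not depend on the word chosen for `γ`.) -/
def weilRep (Q : QuadraticForm ℚ V) (M : AddSubgroup V) (sig : ℤ) (γ : SL(2, ℤ)) :
    (V → ℂ) → (V → ℂ) :=
  Classical.choose (exists_weilWord Q M sig γ)

/-! ## Vector valued cusp forms, theta series and Eisenstein series -/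

/-- `f` belongs to `S_{w/2, ρ_M}`: it is an `S_M`-valued holomorphic function on `ℍ` with
`f(τ+1) = ρ_M(T) f(τ)` and `f(-1/τ) = √τ^w ρ_M(S) f(τ)` (these are the generators of
`Mp₂(ℤ)`), vanishing at the cusp. -/
structure IsCuspForm (Q : QuadraticForm ℚ V) (M : AddSubgroup V) (sig : ℤ) (w : ℕ)
    (f : ℍ → V → ℂ) : Prop where
  schwartz : ∀ τ, IsSchwartz Q M (f τ)
  holo : ∀ x, DifferentiableOn ℂ (fun z : ℂ => f (UpperHalfPlane.ofComplex z) x) {z | 0 < z.im}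
  map_T : ∀ τ : ℍ, f ((1 : ℝ) +ᵥ τ) = weilT Q (f τ)
  map_S : ∀ τ : ℍ, f (ModularGroup.S • τ) =
    fun x => ((τ : ℂ) ^ (1 / 2 : ℂ)) ^ w * weilS Q M sig (f τ) x
  cusp : ∀ x, UpperHalfPlane.IsZeroAtImInfty (fun τ => f τ x)

open Classical in
/-- The Fourier coefficient `b(m, μ)` of `f = ∑_μ ∑_m b(m, μ) q^m φ_μ`, where `μ` is given by a
representative; it is zero unless `m ≡ Q(μ) (mod 1)`. -/
def coeff (Q : QuadraticForm ℚ V) (f : ℍ → V → ℂ) (m : ℚ) (μ : V) : ℂ :=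
  if ∃ k : ℤ, m - Q μ = k then
    ∫ u in (0 : ℝ)..1, f (u +ᵥ UpperHalfPlane.I) μ * e (-(m : ℂ) * (u + Complex.I))
  else 0

open Classical in
/-- The theta function `θ_P(τ) = ∑_{λ ∈ P'} q^{Q(λ)} φ_λ` of a positive definite lattice `P`. -/
def theta (Q : QuadraticForm ℚ V) (P : AddSubgroup V) (τ : ℍ) (x : V) : ℂ :=
  if x ∈ dualLattice Q P then ∑' l : P, e ((Q (x + l) : ℂ) * τ) else 0

/-- The stabiliser `Γ_∞` of the cusp `∞` in `Γ = SL₂(ℤ)`. -/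
def GammaInfty : Subgroup SL(2, ℤ) where
  carrier := {γ | γ 1 0 = 0}
  one_mem' := by simp
  mul_mem' := by
    intro a b ha hb
    simp only [Set.mem_ofPred_eq] at ha hb ⊢
    simp [Matrix.mul_apply, Fin.sum_univ_two, ha, hb]
  inv_mem' := by
    intro a ha
    simp only [Set.mem_ofPred_eq] at ha ⊢
    simp [Matrix.SpecialLinearGroup.SL2_inv_expl, ha]

/-- `Γ_∞ \ Γ`. -/
abbrev GammaInftyCosets : Type := Quotient (QuotientGroup.rightRel GammaInfty)

/-- The summand `[Im(τ)^{s/2} φ_0] |_{1, ρ_M} γ` of the weight one Eisenstein series, for a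
negative definite lattice `M` of rank two. -/
def eisTerm (Q : QuadraticForm ℚ V) (M : AddSubgroup V) (τ : ℍ) (s : ℂ) (γ : SL(2, ℤ))
    (x : V) : ℂ :=
  (((γ 1 0 : ℤ) : ℂ) * τ + ((γ 1 1 : ℤ) : ℂ))⁻¹ * (((γ • τ).im : ℝ) : ℂ) ^ (s / 2) *
    weilRep Q M (-2) γ⁻¹ (charFun M) x

/-- The incoherent Eisenstein series `E_M(τ, s; 1) = ∑_{γ ∈ Γ_∞\Γ} [Im(τ)^{s/2} φ_0] |_{1,ρ_M} γ`
of weight one (convergent for `Re s > 1`) of a negative definite lattice `M` of rank two. -/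
def eisenstein (Q : QuadraticForm ℚ V) (M : AddSubgroup V) (τ : ℍ) (s : ℂ) (x : V) : ℂ :=
  ∑' c : GammaInftyCosets, eisTerm Q M τ s c.out x

/-- The integrand `⟨θ_P(τ) ⊗ E_M(τ, s; 1), \bar g(τ)⟩ v^{3/2}` of the Petersson product, where
`g` is viewed as an `S_{P ⊕ M}`-valued function. -/
def rankinIntegrand (Q : QuadraticForm ℚ V) (P M : AddSubgroup V) (g : ℍ → V → ℂ) (s : ℂ)
    (τ : ℍ) : ℂ :=
  (∑ᶠ p : Disc Q P × Disc Q M, theta Q P τ p.1.rep * eisenstein Q M τ s p.2.rep *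
    (starRingEnd ℂ) (g τ (p.1.rep + p.2.rep))) * ((τ.im ^ (3 / 2 : ℝ) : ℝ) : ℂ)

/-- The Petersson product `(θ_P(τ) ⊗ E_M(τ, s; 1), g(τ))_Pet` in weight `3/2`, for `Re s > 1`.
The integral is with respect to `du dv / v²` over the standard fundamental domain. -/
def rankinL (Q : QuadraticForm ℚ V) (P M : AddSubgroup V) (g : ℍ → V → ℂ) (s : ℂ) : ℂ :=
  ∫ τ in ModularGroup.fd, rankinIntegrand Q P M g s τ

end Lattices

/-! ## The quadratic space of the modular curve `X₀(N)` and its CM data -/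

/-- The space `V` of rational `2 × 2` matrices of trace zero. -/
abbrev V : Type := LinearMap.ker (Matrix.traceLinearMap (Fin 2) ℚ ℚ)

/-- The trace zero matrix `[[a, b], [c, -a]]`. -/
def V.mk (a b c : ℚ) : V :=
  ⟨!![a, b; c, -a], by simp [Matrix.trace, Fin.sum_univ_two]⟩

/-- The quadratic form `Q(x) = N det(x)` on `V`. -/
def Q (N : ℕ) : QuadraticForm ℚ V :=
  QuadraticMap.ofPolar (fun x => (N : ℚ) * (x : Matrix (Fin 2) (Fin 2) ℚ).det)
    (fun a x => by simp [Matrix.det_fin_two]; ring)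
    (fun x y z => by simp [QuadraticMap.polar, Matrix.det_fin_two]; ring)
    (fun a x y => by simp [QuadraticMap.polar, Matrix.det_fin_two]; ring)

/-- The lattice `L` of the matrices `[[b, -a/N], [c, -b]]` with `a, b, c ∈ ℤ`. -/
def L (N : ℕ) : AddSubgroup V where
  carrier := {x | ∃ a b c : ℤ, x = V.mk b (-a / N) c}
  zero_mem' := ⟨0, 0, 0, by ext i j; fin_cases i <;> fin_cases j <;> simp [V.mk]⟩
  add_mem' := by
    rintro _ _ ⟨a, b, c, rfl⟩ ⟨a', b', c', rfl⟩
    refine ⟨a + a', b + b', c + c', ?_⟩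
    ext i j; fin_cases i <;> fin_cases j <;> simp [V.mk] <;> ring
  neg_mem' := by
    rintro _ ⟨a, b, c, rfl⟩
    refine ⟨-a, -b, -c, ?_⟩
    ext i j; fin_cases i <;> fin_cases j <;> simp [V.mk, neg_div]

/-- `μ_r = diag(r/2N, -r/2N)`; the map `r ↦ μ_r` identifies `ℤ/2Nℤ` with `L'/L`. -/
def mu (N : ℕ) (r : ℤ) : V := V.mk (r / (2 * N)) 0 0

/-- The vector `x = [[r/2N, 1/N], [(D - r²)/4N, -r/2N]]`. -/
def xvec (N : ℕ) (D r : ℤ) : V := V.mk (r / (2 * N)) (1 / N) ((D - r ^ 2) / (4 * N))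

/-- `U = V ∩ x^⊥`. -/
def U (N : ℕ) (D r : ℤ) : Submodule ℚ V :=
  LinearMap.ker (QuadraticMap.polarBilin (Q N) (xvec N D r))

/-- `𝒫 = L ∩ V_+` with `V_+ = ℚ x`. -/
def latP (N : ℕ) (D r : ℤ) : AddSubgroup V :=
  L N ⊓ (Submodule.span ℚ {xvec N D r}).toAddSubgroup

/-- `𝒩 = L ∩ U`. -/
def latN (N : ℕ) (D r : ℤ) : AddSubgroup V := L N ⊓ (U N D r).toAddSubgroup

/-- `g ∈ S_{3/2, ρ_L}`; the lattice `L` has signature `(1, 2)`. -/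
def IsCuspFormL (N : ℕ) (g : ℍ → V → ℂ) : Prop := IsCuspForm (Q N) (L N) (-1) 3 g

/-- All Fourier coefficients of `g` are real. -/
def HasRealCoeffs (N : ℕ) (g : ℍ → V → ℂ) : Prop :=
  ∀ (m : ℚ) (μ : V), (starRingEnd ℂ) (coeff (Q N) g m μ) = coeff (Q N) g m μ

/-- `L(g, U, s)` for `Re s > 1`. -/
def LgU (N : ℕ) (D r : ℤ) (g : ℍ → V → ℂ) (s : ℂ) : ℂ :=
  rankinL (Q N) (latP N D r) (latN N D r) g s

/-- `Λ` is a meromorphic continuation of `L(g, U, s)` to the whole complex plane. -/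
def IsContinuationLgU (N : ℕ) (D r : ℤ) (g : ℍ → V → ℂ) (Λ : ℂ → ℂ) : Prop :=
  MeromorphicOn Λ Set.univ ∧ ∀ s : ℂ, 1 < s.re → Λ s = LgU N D r g s

/-! ## Quadratic characters and the Shimura lift -/

/-- Fundamental discriminants (of quadratic fields). -/
def IsFundamentalDiscriminant (D : ℤ) : Prop :=
  (D % 4 = 1 ∧ Squarefree D ∧ D ≠ 1) ∨
    ∃ m : ℤ, D = 4 * m ∧ (m % 4 = 2 ∨ m % 4 = 3) ∧ Squarefree m

/-- The Kronecker symbol `(D/n)` for a natural number `n` (here `(D/0) = 0`, which is the usual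
value for `|D| ≠ 1`). -/
def kronecker (D : ℤ) (n : ℕ) : ℤ :=
  if n = 0 then 0
  else ZMod.χ₈ (D : ZMod 8) ^ n.factorization 2 * jacobiSym D (n / 2 ^ n.factorization 2)

/-- `L(χ_D, s)`, where `χ_D(n) = (D/n)` is the quadratic Dirichlet character modulo `|D|`
of a fundamental discriminant `D`: the continuation of `∑ (D/n) n^{-s}`. -/
def LchiD (D : ℤ) (s : ℂ) : ℂ :=
  if h : D.natAbs = 0 then 0
  else
    haveI : NeZero D.natAbs := ⟨h⟩
    ZMod.LFunction (fun j : ZMod D.natAbs => (kronecker D j.val : ℂ)) s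

/-- The `n`-th Fourier coefficient
`B(n) = ∑_{d ∣ n} (D₀/d) b(m₀ n²/d², μ₀ n/d)` of the Shimura lift `𝒮_{m₀,μ₀}(g)`. -/
def shimuraCoeff (N : ℕ) (D₀ : ℤ) (m₀ : ℚ) (μ₀ : V) (g : ℍ → V → ℂ) (n : ℕ) : ℂ :=
  ∑ d ∈ n.divisors,
    (kronecker D₀ d : ℂ) * coeff (Q N) g (m₀ * (n / d : ℕ) ^ 2) ((n / d : ℕ) • μ₀)

/-- `ℓ` is a meromorphic continuation of the Dirichlet series `∑ a(n) n^{-s}` to the whole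
complex plane. -/
def IsContinuationLSeries (a : ℕ → ℂ) (ℓ : ℂ → ℂ) : Prop :=
  MeromorphicOn ℓ Set.univ ∧ ∃ σ : ℝ, ∀ s : ℂ, σ < s.re → ℓ s = LSeries a s

/-- The factor `2^{-s} (π m₀)^{-(s+1)/2} Γ((s+1)/2) L(χ_{D₀}, s+1)^{-1}`. -/
def archFactor (D₀ : ℤ) (m₀ : ℚ) (s : ℂ) : ℂ :=
  (2 : ℂ) ^ (-s) * (((Real.pi * m₀ : ℝ) : ℂ)) ^ (-(s + 1) / 2) * Complex.Gamma ((s + 1) / 2) *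
    (LchiD D₀ (s + 1))⁻¹

/-! ## Cusp forms of weight two on `Γ₀(N)` -/

/-- `S_2(N)`. -/
abbrev S2 (N : ℕ) : Type :=
  CuspForm ((CongruenceSubgroup.Gamma0 N : Subgroup SL(2, ℤ)) : Subgroup (GL (Fin 2) ℝ)) 2

/-- `G` is invariant under the Fricke involution: `G(-1/(Nτ)) = N τ² G(τ)`. -/
def IsFrickeInvariant (N : ℕ) (G : S2 N) : Prop :=
  ∀ τ τ' : ℍ, (τ' : ℂ) = -1 / (N * τ) → G τ' = N * (τ : ℂ) ^ 2 * G τ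

/-- The Hecke `L`-function `L(G, s)`, an entire function. -/
def heckeL (N : ℕ) [NeZero N] (G : S2 N) (s : ℂ) : ℂ :=
  ModularForm.L (k := 2) two_pos G s

/-! ## The torus `T = GSpin(U)` and the volume of `K_T` -/

/-- The finite adeles `𝔸_f` of `ℚ`. -/
abbrev Af : Type := IsDedekindDomain.FiniteAdeleRing ℤ ℚ

/-- For a ring `R` over `ℚ`: the group `T(R)` of the `h ∈ H(R) = GL₂(R)` acting trivially on
`V_+ = ℚ x`, i.e. with `h x h⁻¹ = x`. -/
def torus (N : ℕ) (D r : ℤ) (R : Type) [CommRing R] [Algebra ℚ R] : Subgroup (GL (Fin 2) R) where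
  carrier := {h | (h : Matrix (Fin 2) (Fin 2) R) *
      (xvec N D r : Matrix (Fin 2) (Fin 2) ℚ).map (algebraMap ℚ R) =
    (xvec N D r : Matrix (Fin 2) (Fin 2) ℚ).map (algebraMap ℚ R) * h}
  one_mem' := by simp
  mul_mem' := by
    intro a b ha hb
    simp only [Set.mem_ofPred_eq] at ha hb ⊢
    rw [Units.val_mul, mul_assoc, hb, ← mul_assoc, ha, mul_assoc]
  inv_mem' := by
    intro a ha
    simp only [Set.mem_ofPred_eq] at ha ⊢
    exact (Commute.units_inv_left (show Commute _ _ from ha)).eq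

variable (N : ℕ) (D r : ℤ)

/-- `T(𝔸_f)`. -/
abbrev TAf : Type := torus N D r Af

instance : MeasurableSpace (TAf N D r) := borel _

instance : MeasurableSpace Afˣ := borel _

/-- The embedding `𝔸_f^× → T(𝔸_f)` as scalar matrices. -/
def scalarHom : Afˣ →* TAf N D r where
  toFun a := ⟨Units.map (Matrix.scalar (Fin 2)).toMonoidHom a, by
    simp only [torus, Subgroup.mem_mk, Submonoid.mem_mk, Subsemigroup.mem_mk, Set.mem_ofPred_eq]
    exact (Matrix.scalar_commute (a : Af) (fun x => Commute.all _ _) _).eq⟩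
  map_one' := by ext; simp
  map_mul' a b := by ext; simp

instance : (scalarHom N D r).range.Normal where
  conj_mem := by
    rintro _ ⟨a, rfl⟩ t
    refine ⟨a, ?_⟩
    have h : t * scalarHom N D r a = scalarHom N D r a * t := by
      apply Subtype.ext; apply Units.ext
      exact (Matrix.scalar_commute (a : Af) (fun x => Commute.all _ _) _).eq.symm
    rw [h, mul_inv_cancel_right]

/-- `SO(U)(𝔸_f)`, as the quotient in the exact sequence
`1 → 𝔸_f^× → T(𝔸_f) → SO(U)(𝔸_f) → 1`. -/
def SOUAf : Type := TAf N D r ⧸ (scalarHom N D r).range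

instance : Group (SOUAf N D r) :=
  inferInstanceAs (Group (TAf N D r ⧸ (scalarHom N D r).range))

instance : TopologicalSpace (SOUAf N D r) :=
  inferInstanceAs (TopologicalSpace (TAf N D r ⧸ (scalarHom N D r).range))

instance : MeasurableSpace (SOUAf N D r) := borel _

/-- The projection `T(𝔸_f) → SO(U)(𝔸_f)`. -/
def toSOU : TAf N D r →* SOUAf N D r := QuotientGroup.mk' (scalarHom N D r).range

/-- The subgroup `SO(U)(ℚ)` of `SO(U)(𝔸_f)`, the image of `T(ℚ)`. -/
def SOUQ : Subgroup (SOUAf N D r) :=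
  Subgroup.map (toSOU N D r)
    (((torus N D r ℚ).map (Matrix.GeneralLinearGroup.map (algebraMap ℚ Af))).subgroupOf
      (torus N D r Af))

/-- `a` is an integral finite adele, i.e. an element of `\hat ℤ`. -/
def IsIntegral (a : Af) : Prop := ∀ v, a v ∈ v.adicCompletionIntegers ℚ

/-- The subgroup `\hat ℤ^×` of `𝔸_f^×`. -/
def ZhatUnits : Set Afˣ := {a | IsIntegral (a : Af) ∧ IsIntegral ((a⁻¹ : Afˣ) : Af)}

/-- `K = ∏_p K_p`, where `K_p` is the group of the matrices in `GL₂(ℤ_p)` whose lower left entry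
lies in `N ℤ_p`. -/
def K : Set (GL (Fin 2) Af) :=
  {h | (∀ i j, IsIntegral (h i j) ∧ IsIntegral (h⁻¹ i j)) ∧
    ∃ c : Af, IsIntegral c ∧ h 1 0 = N * c}

/-- `K_T = K ∩ T(𝔸_f)`. -/
def KT : Set (TAf N D r) := {t | (t : GL (Fin 2) Af) ∈ K N}

open MeasureTheory in
/-- `μT` is the Haar measure on `T(𝔸_f)` obtained from the exact sequence
`1 → 𝔸_f^× → T(𝔸_f) → SO(U)(𝔸_f) → 1`, where the Haar measures `μA` on `𝔸_f^×` and `μS` on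
`SO(U)(𝔸_f)` are normalised by `vol(\hat ℤ^×) = 1` and `vol(SO(U)(ℚ) \ SO(U)(𝔸_f)) = 2`. -/
structure IsTamagawa (μT : Measure (TAf N D r)) (μA : Measure Afˣ)
    (μS : Measure (SOUAf N D r)) : Prop where
  haarT : μT.IsHaarMeasure
  haarA : μA.IsHaarMeasure
  haarS : μS.IsHaarMeasure
  volA : μA ZhatUnits = 1
  volS : ∃ F : Set (SOUAf N D r), IsFundamentalDomain (SOUQ N D r) F μS ∧ μS F = 2
  fubini : ∀ (F : TAf N D r → ENNReal) (Φ : SOUAf N D r → ENNReal), Measurable F →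
    (∀ t, Φ (toSOU N D r t) = ∫⁻ a, F (t * scalarHom N D r a) ∂μA) →
    ∫⁻ t, F t ∂μT = ∫⁻ q, Φ q ∂μS

end RankinShimura

end

open scoped UpperHalfPlane MatrixGroups ModularForm

noncomputable section

namespace RankinShimura

set_option linter.unusedSectionVars false

section

/-! ### The exponential `e` -/

/-! The identity is Rankin's method followed by Möbius inversion; the derivative formula is the
analytic class number formula in adelic form.

Since `L' ⊆ P' + N'`, the operator `ρ_P(S) ⊗ ρ_N(S)` is adjoint on `S_L` to the inverse of `ρ_L(S)`
(`IsSplit.sum_weilS`). With the transformation law of theta (`IsRankOne.theta_S`) this makes `φ ↦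
⟨θ_P ⊗ φ, \bar g⟩ v^{3/2}` equivariant of weight one along every word in `S` and `T`
(`thetaPairing_word`). Each Eisenstein summand therefore contributes the value at `γτ` of one fixed
`T`-invariant function, and the integral over the fundamental domain unfolds to the strip `0 ≤ u <
1` (`rankinL_eq_integral_periodStrip`). There `φ_0` leaves a sum over `P' ∩ L' = ℤx`. Integration
over `u` extracts the conjugate of `b(m₀n², nμ₀)` times `exp(-4πm₀n²v)`, the indices `n` and `-n`
contribute equally, and the Mellin transform at `(s+1)/2` produces the gamma factor and a Dirichlet
series in `n` (`rankinL_eq_LSeries`). The coefficients `B` are the convolution of `χ` with `n ↦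
b(m₀n², nμ₀)`, so passing to the Shimura lift costs the factor `L(χ, s+1)⁻¹` (`LgU_eq`). Absolute
convergence for `Re s > 3/2` is the Hecke bound `b(m, μ) ≪ m^{3/4}`.

For the continuation, the explicit factor is meromorphic without zeros for `Re s > 0`, and the
identity theorem does the rest. A continuation has to agree with the integral on all of `Re s > 1`,
whereas the Dirichlet series is under control only for `Re s > 3/2`; this is why the integral is
shown to be holomorphic on the larger half plane (`differentiableAt_rankinL`).

At the centre, Fricke invariance forces `L(G, 1) = 0`, so the derivative is `archFactor` at `0`,
which equals `1/(√m₀ L(χ, 1))`, times the conjugate of `b(m₀, μ₀) L'(G, 1)`. Write `D₀ = r² + 4NC`.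
Then `T(R)` is the unit group of `R[ω]` with `ω² = NC - rω`, and `ℤ[ω]` is the maximal order of
discriminant `D₀`, with class number `h` and `w` units. Under this identification `K_T` becomes the
unit group of `\hat ℤ[ω]`. The double cosets of `SO(U)(ℚ)` and the image of `K_T` in `SO(U)(𝔸_f)`
form the class group, with stabilisers of order `w/2`, so total volume two gives `h vol(K_T) = w`
(`IsTamagawa.card_mul_measure_KT`). The class number formula (`LchiD_one_eq`) comes from the residue
of the Dedekind zeta function and from `ζ_K = ζ L(χ)`, obtained by counting ideals of prime power
norm (`idealCount_prime_pow`). -/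

theorem e_add (z w : ℂ) : e (z + w) = e z * e w := by
  simp [e, mul_add, Complex.exp_add]

@[simp] theorem e_zero : e 0 = 1 := by simp [e]

theorem e_neg (z : ℂ) : e (-z) = (e z)⁻¹ := by
  simp [e, Complex.exp_neg]

theorem e_ne_zero (z : ℂ) : e z ≠ 0 := Complex.exp_ne_zero _

@[simp] theorem e_intCast (k : ℤ) : e (k : ℂ) = 1 := by
  rw [e, mul_comm]; exact Complex.exp_int_mul_two_pi_mul_I k

theorem conj_e (z : ℂ) : (starRingEnd ℂ) (e z) = e (-(starRingEnd ℂ) z) := by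
  simp only [e, ← Complex.exp_conj, map_mul, Complex.conj_I, Complex.conj_ofReal, map_ofNat]
  congr 1; ring

theorem norm_e (z : ℂ) : ‖e z‖ = Real.exp (-(2 * Real.pi * z.im)) := by
  rw [e, Complex.norm_exp]; congr 1; simp

@[simp] theorem norm_e_ratCast (q : ℚ) : ‖e (q : ℂ)‖ = 1 := by
  rw [norm_e]; simp

theorem conj_e_ratCast (q : ℚ) : (starRingEnd ℂ) (e (q : ℂ)) = e ((-q : ℚ) : ℂ) := by
  rw [conj_e]; simp

theorem e_ratCast_add (p q : ℚ) : e ((p + q : ℚ) : ℂ) = e (p : ℂ) * e (q : ℂ) := by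
  rw [← e_add]; push_cast; rfl

theorem e_ratCast_eq_one_iff (q : ℚ) : e (q : ℂ) = 1 ↔ ∃ k : ℤ, q = k := by
  constructor
  · intro h
    rw [e, Complex.exp_eq_one_iff] at h
    obtain ⟨n, hn⟩ := h
    refine ⟨n, ?_⟩
    have h2 : (2 * Real.pi * Complex.I : ℂ) ≠ 0 := Complex.two_pi_I_ne_zero
    rw [mul_comm] at hn
    have := mul_right_cancel₀ h2 hn
    exact_mod_cast this
  · rintro ⟨k, rfl⟩
    simp

theorem e_ratCast_of_int {q : ℚ} (h : ∃ k : ℤ, q = k) : e (q : ℂ) = 1 :=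
  (e_ratCast_eq_one_iff q).2 h

theorem e_ratCast_congr {p q : ℚ} (h : ∃ k : ℤ, p - q = k) : e (p : ℂ) = e (q : ℂ) := by
  have := e_ratCast_of_int h
  have h2 : p = (p - q) + q := by ring
  rw [h2, e_ratCast_add, this, one_mul]

/-! ### Even lattices -/

section Lattices

variable {V : Type} [AddCommGroup V] [Module ℚ V] {Q : QuadraticForm ℚ V} {M : AddSubgroup V}

theorem polar_comm (Q : QuadraticForm ℚ V) (x y : V) :
    QuadraticMap.polar Q x y = QuadraticMap.polar Q y x := QuadraticMap.polar_comm _ _ _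

theorem map_add_polar (Q : QuadraticForm ℚ V) (x y : V) :
    Q (x + y) = Q x + Q y + QuadraticMap.polar Q x y := by
  simp [QuadraticMap.polar]

/-- `M` is an even lattice which is nondegenerate in the sense that `M'' = M` and `M'/M` is
finite. -/
structure IsEvenLattice (Q : QuadraticForm ℚ V) (M : AddSubgroup V) : Prop where
  int : ∀ x ∈ M, ∃ k : ℤ, Q x = k
  finite_disc : Finite (Disc Q M)
  dual_dual : ∀ x ∈ Submodule.span ℚ (M : Set V),
    (∀ y ∈ dualLattice Q M, ∃ k : ℤ, QuadraticMap.polar Q y x = k) → x ∈ M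

theorem polar_int_of_mem {x y : V} (hx : x ∈ dualLattice Q M) (hy : y ∈ M) :
    ∃ k : ℤ, QuadraticMap.polar Q x y = k := hx.2 y hy

theorem polar_int_of_mem' {x y : V} (hx : x ∈ dualLattice Q M) (hy : y ∈ M) :
    ∃ k : ℤ, QuadraticMap.polar Q y x = k := by
  rw [polar_comm]; exact hx.2 y hy

theorem IsEvenLattice.le_dual (h : IsEvenLattice Q M) : M ≤ dualLattice Q M := by
  intro x hx
  refine ⟨Submodule.subset_span hx, fun y hy => ?_⟩
  obtain ⟨a, ha⟩ := h.int _ hx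
  obtain ⟨b, hb⟩ := h.int _ hy
  obtain ⟨c, hc⟩ := h.int _ (M.add_mem hx hy)
  exact ⟨c - a - b, by simp [QuadraticMap.polar, ha, hb, hc]⟩

theorem IsEvenLattice.Q_add_int (h : IsEvenLattice Q M) {x y : V} (hx : x ∈ dualLattice Q M)
    (hy : y ∈ M) : ∃ k : ℤ, Q (x + y) - Q x = k := by
  obtain ⟨a, ha⟩ := h.int _ hy
  obtain ⟨b, hb⟩ := polar_int_of_mem hx hy
  exact ⟨a + b, by rw [map_add_polar, ha, hb]; push_cast; ring⟩

theorem IsEvenLattice.add_mem_dual_iff (h : IsEvenLattice Q M) {x y : V} (hy : y ∈ M) :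
    x + y ∈ dualLattice Q M ↔ x ∈ dualLattice Q M :=
  (dualLattice Q M).add_mem_cancel_right (h.le_dual hy)

theorem Disc.rep_mem (μ : Disc Q M) : μ.rep ∈ dualLattice Q M := (Quotient.out μ).2

/-- The class in `M'/M` of an element of `M'`. -/
def Disc.cls (x : V) (hx : x ∈ dualLattice Q M) : Disc Q M :=
  QuotientAddGroup.mk (⟨x, hx⟩ : dualLattice Q M)

theorem Disc.cls_rep (μ : Disc Q M) : Disc.cls μ.rep μ.rep_mem = μ :=
  Quotient.out_eq μ

theorem Disc.cls_eq_iff {x y : V} {hx : x ∈ dualLattice Q M} {hy : y ∈ dualLattice Q M} :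
    Disc.cls x hx = Disc.cls y hy ↔ y - x ∈ M := by
  rw [Disc.cls, Disc.cls, QuotientAddGroup.eq, AddSubgroup.mem_addSubgroupOf]
  simp [neg_add_eq_sub]

theorem Disc.cls_add {x y : V} (hx : x ∈ dualLattice Q M) (hy : y ∈ dualLattice Q M) :
    Disc.cls (x + y) ((dualLattice Q M).add_mem hx hy) = Disc.cls x hx + Disc.cls y hy := rfl

theorem Disc.rep_cls_sub_mem (x : V) (hx : x ∈ dualLattice Q M) :
    (Disc.cls x hx).rep - x ∈ M := by
  rw [← Disc.cls_eq_iff (hx := hx) (hy := Disc.rep_mem _), Disc.cls_rep]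

/-- `F` is periodic with respect to `M`. -/
def IsPeriodic (M : AddSubgroup V) (F : V → ℂ) : Prop := ∀ x, ∀ y ∈ M, F (x + y) = F x

theorem IsPeriodic.eq_of_sub_mem {F : V → ℂ} (hF : IsPeriodic M F) {x y : V} (h : x - y ∈ M) :
    F x = F y := by
  have := hF y _ h
  rwa [add_sub_cancel] at this

theorem IsPeriodic.rep_cls {F : V → ℂ} (hF : IsPeriodic M F) {x : V}
    (hx : x ∈ dualLattice Q M) : F (Disc.cls x hx).rep = F x :=
  hF.eq_of_sub_mem (Disc.rep_cls_sub_mem x hx)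

theorem IsPeriodic.rep_add_cls {F : V → ℂ} (hF : IsPeriodic M F) (μ : Disc Q M) {x : V}
    (hx : x ∈ dualLattice Q M) : F (μ + Disc.cls x hx).rep = F (μ.rep + x) := by
  have h : μ + Disc.cls x hx
      = Disc.cls (μ.rep + x) ((dualLattice Q M).add_mem μ.rep_mem hx) := by
    rw [Disc.cls_add μ.rep_mem hx, Disc.cls_rep]
  rw [h, hF.rep_cls]

/-- A lattice with a pair of dual bases is even nondegenerate if the form is integral on it. -/
theorem isEvenLattice_of_dualBasis {n : ℕ} {e f : Fin n → V}
    (hint : ∀ x ∈ M, ∃ k : ℤ, Q x = k) (he : ∀ i, e i ∈ M) (hf : ∀ i, f i ∈ dualLattice Q M)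
    (h₁ : ∀ x ∈ Submodule.span ℚ (M : Set V), x = ∑ i, QuadraticMap.polar Q (f i) x • e i)
    (h₂ : ∀ x ∈ Submodule.span ℚ (M : Set V), x = ∑ i, QuadraticMap.polar Q x (e i) • f i) :
    IsEvenLattice Q M := by
  refine ⟨hint, ?_, fun x hx h => ?_⟩
  · have hfg : Module.Finite ℤ (dualLattice Q M) := by
      classical
      refine ⟨⟨Finset.univ.image (fun i => (⟨f i, hf i⟩ : dualLattice Q M)), ?_⟩⟩
      rw [eq_top_iff]
      rintro ⟨x, hx⟩ -
      have hk : ∀ i, ∃ k : ℤ, QuadraticMap.polar Q x (e i) = k := fun i => hx.2 _ (he i)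
      choose k hk using hk
      have hx' : (⟨x, hx⟩ : dualLattice Q M) = ∑ i, k i • (⟨f i, hf i⟩ : dualLattice Q M) := by
        apply Subtype.ext
        rw [AddSubgroup.val_finsetSum]
        refine (h₂ x hx.1).trans ?_
        refine Finset.sum_congr rfl fun i _ => ?_
        rw [hk i]; simp [Int.cast_smul_eq_zsmul]
      rw [hx']
      refine Submodule.sum_mem _ fun i _ => Submodule.smul_mem _ _ (Submodule.subset_span ?_)
      simp
    have hfg' : Module.Finite ℤ (Disc Q M) :=
      Module.Finite.of_surjective (QuotientAddGroup.mk' _).toIntLinearMap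
        (QuotientAddGroup.mk'_surjective _)
    -- A finitely generated torsion group is finite; here it is torsion because every vector of `ℚ
    -- M` has a nonzero integral multiple in `M`.
    refine Module.finite_of_fg_torsion _ ?_
    intro μ
    have hq : ∀ x ∈ Submodule.span ℚ (M : Set V), ∃ k : ℤ, k ≠ 0 ∧ k • x ∈ M := by
      intro x hx
      induction hx using Submodule.span_induction with
      | mem x h => exact ⟨1, one_ne_zero, by simpa using h⟩
      | zero => exact ⟨1, one_ne_zero, by simp⟩
      | add x y _ _ hx hy =>
        obtain ⟨k, hk, hk'⟩ := hx
        obtain ⟨l, hl, hl'⟩ := hy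
        refine ⟨k * l, mul_ne_zero hk hl, ?_⟩
        rw [smul_add]
        refine M.add_mem ?_ ?_
        · rw [mul_comm, mul_smul]; exact M.zsmul_mem hk' l
        · rw [mul_smul]; exact M.zsmul_mem hl' k
      | smul a x _ hx =>
        obtain ⟨k, hk, hk'⟩ := hx
        refine ⟨a.den * k, mul_ne_zero (by exact_mod_cast a.den_ne_zero) hk, ?_⟩
        have : ((a.den : ℤ) * k) • a • x = a.num • k • x := by
          rw [← Int.cast_smul_eq_zsmul ℚ, ← Int.cast_smul_eq_zsmul ℚ, ← Int.cast_smul_eq_zsmul ℚ,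
            smul_smul, smul_smul]
          congr 1
          push_cast
          have := Rat.mul_den_eq_num a
          linear_combination (k : ℚ) * this
        rw [this]
        exact M.zsmul_mem hk' _
    obtain ⟨k, hk, hk'⟩ := hq μ.rep μ.rep_mem.1
    refine ⟨⟨k, mem_nonZeroDivisors_of_ne_zero hk⟩, ?_⟩
    show k • μ = 0
    rw [← Disc.cls_rep μ]
    show ((k • (⟨μ.rep, μ.rep_mem⟩ : dualLattice Q M) : dualLattice Q M) : Disc Q M) = 0
    rw [QuotientAddGroup.eq_zero_iff, AddSubgroup.mem_addSubgroupOf]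
    simpa using hk'
  · rw [h₁ x hx]
    refine M.sum_mem fun i _ => ?_
    obtain ⟨k, hk⟩ := h _ (hf i)
    rw [hk, Int.cast_smul_eq_zsmul]
    exact M.zsmul_mem (he i) k

end Lattices

end

section

section Lattices

variable {V : Type} [AddCommGroup V] [Module ℚ V] {Q : QuadraticForm ℚ V}
  {M P N L : AddSubgroup V}

open QuadraticMap (polar)

open ComplexConjugate

/-! ### The Weil representation: unitarity -/

theorem charFun_of_mem {x : V} (hx : x ∈ M) : charFun M x = 1 := if_pos hx

theorem charFun_of_notMem {x : V} (hx : x ∉ M) : charFun M x = 0 := if_neg hx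

theorem charFun_periodic {M K : AddSubgroup V} (h : M ≤ K) : IsPeriodic M (charFun K) := by
  intro x y hy
  have := K.add_mem_cancel_right (y := x) (h hy)
  by_cases hx : x ∈ K <;> simp [charFun, this, hx]

theorem IsEvenLattice.charFun_schwartz (h : IsEvenLattice Q M) : IsSchwartz Q M (charFun M) :=
  ⟨fun _ hx => charFun_of_notMem fun h' => hx (h.le_dual h'), charFun_periodic le_rfl⟩

theorem e_polar_periodic {x : V} (hx : x ∈ dualLattice Q M) :
    IsPeriodic M fun y => e ((polar Q x y : ℚ) : ℂ) := by
  intro y z hz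
  simp only
  rw [QuadraticMap.polar_add_right, e_ratCast_add, e_ratCast_of_int (polar_int_of_mem hx hz),
    mul_one]

theorem e_polar_periodic' {x : V} (hx : x ∈ dualLattice Q M) :
    IsPeriodic M fun y => e ((polar Q y x : ℚ) : ℂ) := by
  simpa only [polar_comm Q _ x] using e_polar_periodic hx

theorem IsPeriodic.mul {F G : V → ℂ} (hF : IsPeriodic M F) (hG : IsPeriodic M G) :
    IsPeriodic M fun x => F x * G x := fun x y hy => by simp only [hF x y hy, hG x y hy]

theorem IsPeriodic.conj {F : V → ℂ} (hF : IsPeriodic M F) :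
    IsPeriodic M fun x => conj (F x) := fun x y hy => by simp only [hF x y hy]

theorem IsPeriodic.mono {F : V → ℂ} {K : AddSubgroup V} (hF : IsPeriodic K F) (h : M ≤ K) :
    IsPeriodic M F := fun x y hy => hF x y (h hy)

theorem IsPeriodic.comp_add {F : V → ℂ} (hF : IsPeriodic M F) (w : V) :
    IsPeriodic M fun x => F (x + w) := fun x y hy => by
  simp only [add_right_comm x y w, hF (x + w) y hy]

theorem weilS_of_mem [Fintype (Disc Q M)] (sig : ℤ) (φ : V → ℂ) {x : V}
    (hx : x ∈ dualLattice Q M) :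
    weilS Q M sig φ x = e (-(sig : ℂ) / 8) / (Real.sqrt (Fintype.card (Disc Q M)) : ℂ) *
      ∑ μ : Disc Q M, e ((-polar Q μ.rep x : ℚ) : ℂ) * φ μ.rep := by
  rw [weilS, if_pos hx, finsum_eq_sum_of_fintype, Nat.card_eq_fintype_card]
  simp

theorem weilS_of_notMem (sig : ℤ) (φ : V → ℂ) {x : V} (hx : x ∉ dualLattice Q M) :
    weilS Q M sig φ x = 0 := if_neg hx

theorem IsEvenLattice.weilS_schwartz (h : IsEvenLattice Q M) (sig : ℤ) (φ : V → ℂ) :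
    IsSchwartz Q M (weilS Q M sig φ) := by
  have := h.finite_disc
  have := Fintype.ofFinite (Disc Q M)
  refine ⟨fun x hx => weilS_of_notMem _ _ hx, fun x y hy => ?_⟩
  by_cases hx : x ∈ dualLattice Q M
  · rw [weilS_of_mem _ _ hx, weilS_of_mem _ _ ((h.add_mem_dual_iff hy).2 hx)]
    congr 1
    refine Finset.sum_congr rfl fun μ _ => ?_
    congr 1
    refine e_ratCast_congr ?_
    obtain ⟨k, hk⟩ := polar_int_of_mem μ.rep_mem hy
    exact ⟨-k, by rw [QuadraticMap.polar_add_right, hk]; push_cast; ring⟩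
  · rw [weilS_of_notMem _ _ hx, weilS_of_notMem _ _ (by rwa [h.add_mem_dual_iff hy])]

theorem IsEvenLattice.weilT_schwartz (h : IsEvenLattice Q M) {φ : V → ℂ}
    (hφ : IsSchwartz Q M φ) : IsSchwartz Q M (weilT Q φ) := by
  refine ⟨fun x hx => by rw [weilT, hφ.1 x hx, mul_zero], fun x y hy => ?_⟩
  by_cases hx : x ∈ dualLattice Q M
  · rw [weilT, weilT, hφ.2 x y hy, e_ratCast_congr (h.Q_add_int hx hy)]
  · rw [weilT, weilT, hφ.1 x hx, hφ.2 x y hy, hφ.1 x hx, mul_zero, mul_zero]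

theorem IsPeriodic.sum_shift [Fintype (Disc Q M)] {F : V → ℂ} (hF : IsPeriodic M F) {w : V}
    (hw : w ∈ dualLattice Q M) : ∑ μ : Disc Q M, F (μ.rep + w) = ∑ μ : Disc Q M, F μ.rep :=
  Fintype.sum_equiv (Equiv.addRight (Disc.cls w hw)) _ _ fun μ => (hF.rep_add_cls μ hw).symm

/-- If `w` is not in `M`, then `M'' = M` supplies `y ∈ M'` at which the character is not one;
shifting the sum by `y` multiplies it by that value, so it vanishes. -/
theorem IsEvenLattice.sum_e_polar (h : IsEvenLattice Q M) [Fintype (Disc Q M)] {w : V}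
    (hw : w ∈ dualLattice Q M) :
    ∑ μ : Disc Q M, e ((polar Q w μ.rep : ℚ) : ℂ) = Fintype.card (Disc Q M) * charFun M w := by
  by_cases hwM : w ∈ M
  · rw [charFun_of_mem hwM, mul_one]
    rw [Finset.sum_congr rfl (g := fun _ => 1)]
    · simp
    · intro μ _
      exact e_ratCast_of_int (polar_int_of_mem' μ.rep_mem hwM)
  · rw [charFun_of_notMem hwM, mul_zero]
    have : ∃ y ∈ dualLattice Q M, ¬ ∃ k : ℤ, polar Q y w = k := by
      by_contra! hc
      exact hwM (h.dual_dual w hw.1 fun y hy => hc y hy)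
    obtain ⟨y, hy, hy'⟩ := this
    have hs := (e_polar_periodic hw).sum_shift hy
    simp only [QuadraticMap.polar_add_right, e_ratCast_add, ← Finset.sum_mul] at hs
    rw [← e_ratCast_eq_one_iff, polar_comm] at hy'
    have h0 : (∑ μ : Disc Q M, e ((polar Q w μ.rep : ℚ) : ℂ)) * (e ((polar Q w y : ℚ) : ℂ) - 1) = 0 := by
      rw [mul_sub, hs, mul_one, sub_self]
    exact (mul_eq_zero.1 h0).resolve_right (sub_ne_zero.2 hy')

theorem charFun_rep_sub_rep (μ ν : Disc Q M) [Decidable (μ = ν)] :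
    charFun M (ν.rep - μ.rep) = if μ = ν then 1 else 0 := by
  have : ν.rep - μ.rep ∈ M ↔ μ = ν := by
    rw [← Disc.cls_eq_iff (hx := μ.rep_mem) (hy := ν.rep_mem), Disc.cls_rep, Disc.cls_rep]
  simp [charFun, this]

/-- Unitarity of `ρ_M(S)`: expand the square and sum over the outer variable first, which leaves
only the diagonal. Only values at representatives enter, so `φ` may be arbitrary. -/
theorem IsEvenLattice.sum_norm_sq_weilS (h : IsEvenLattice Q M) [Fintype (Disc Q M)] (sig : ℤ)
    (φ : V → ℂ) :
    ∑ μ : Disc Q M, ‖weilS Q M sig φ μ.rep‖ ^ 2 = ∑ μ : Disc Q M, ‖φ μ.rep‖ ^ 2 := by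
  classical
  have key : ∀ ψ : V → ℂ, ((∑ μ : Disc Q M, ‖ψ μ.rep‖ ^ 2 : ℝ) : ℂ)
      = ∑ μ : Disc Q M, ψ μ.rep * conj (ψ μ.rep) := by
    intro ψ
    push_cast
    exact Finset.sum_congr rfl fun μ _ => (Complex.mul_conj' _).symm
  have hc : (Fintype.card (Disc Q M) : ℂ) ≠ 0 := by
    exact_mod_cast Fintype.card_ne_zero
  have hn : ∀ c z : ℂ, (c * z) * conj (c * z) = (‖c‖ ^ 2 : ℂ) * (z * conj z) := by
    intro c z
    rw [← Complex.mul_conj' c, map_mul]; ring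
  have hcc : ((‖e (-(sig : ℂ) / 8) / (Real.sqrt (Fintype.card (Disc Q M)) : ℂ)‖ : ℂ)) ^ 2
      = (Fintype.card (Disc Q M) : ℂ)⁻¹ := by
    have h1 : ‖e (-(sig : ℂ) / 8)‖ = 1 := by
      have := norm_e_ratCast (-(sig : ℚ) / 8)
      push_cast at this
      exact this
    rw [norm_div, h1, Complex.norm_real, Real.norm_of_nonneg (Real.sqrt_nonneg _), one_div]
    rw [← Complex.ofReal_pow, inv_pow, Real.sq_sqrt (Nat.cast_nonneg _)]
    push_cast; rfl
  apply Complex.ofReal_injective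
  rw [key, key]
  calc ∑ x : Disc Q M, weilS Q M sig φ x.rep * conj (weilS Q M sig φ x.rep)
      = ∑ x : Disc Q M, (Fintype.card (Disc Q M) : ℂ)⁻¹ * ∑ μ : Disc Q M, ∑ ν : Disc Q M,
          φ μ.rep * conj (φ ν.rep) * e ((polar Q (ν.rep - μ.rep) x.rep : ℚ) : ℂ) := by
        refine Finset.sum_congr rfl fun x _ => ?_
        rw [weilS_of_mem _ _ x.rep_mem, hn, hcc, map_sum, Finset.sum_mul_sum]
        congr 1
        refine Finset.sum_congr rfl fun μ _ => Finset.sum_congr rfl fun ν _ => ?_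
        rw [map_mul, conj_e_ratCast, sub_eq_neg_add, QuadraticMap.polar_add_left, e_ratCast_add,
          QuadraticMap.polar_neg_left, neg_neg]
        ring
    _ = (Fintype.card (Disc Q M) : ℂ)⁻¹ * ∑ μ : Disc Q M, ∑ ν : Disc Q M,
          φ μ.rep * conj (φ ν.rep) * (Fintype.card (Disc Q M) * if μ = ν then 1 else 0) := by
        rw [← Finset.mul_sum, Finset.sum_comm]
        congr 1
        refine Finset.sum_congr rfl fun μ _ => ?_
        rw [Finset.sum_comm]
        refine Finset.sum_congr rfl fun ν _ => ?_
        rw [← Finset.mul_sum, h.sum_e_polar ((dualLattice Q M).sub_mem ν.rep_mem μ.rep_mem),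
          charFun_rep_sub_rep]
    _ = ∑ μ : Disc Q M, φ μ.rep * conj (φ μ.rep) := by
        simp only [mul_ite, mul_one, mul_zero, Finset.sum_ite_eq, Finset.mem_univ, if_true]
        rw [← Finset.sum_mul, mul_comm _ (Fintype.card _ : ℂ), ← mul_assoc, inv_mul_cancel₀ hc,
          one_mul]

theorem sum_norm_sq_weilT [Fintype (Disc Q M)] (φ : V → ℂ) :
    ∑ μ : Disc Q M, ‖weilT Q φ μ.rep‖ ^ 2 = ∑ μ : Disc Q M, ‖φ μ.rep‖ ^ 2 := by
  refine Finset.sum_congr rfl fun μ _ => ?_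
  rw [weilT, norm_mul, norm_e_ratCast, one_mul]

theorem WeilWord.schwartz (h : IsEvenLattice Q M) {sig : ℤ} {γ : SL(2, ℤ)}
    {A : (V → ℂ) → (V → ℂ)} (hA : WeilWord Q M sig γ A) {φ : V → ℂ} (hφ : IsSchwartz Q M φ) :
    IsSchwartz Q M (A φ) := by
  induction hA with
  | one => exact hφ
  | S_mul _ _ => exact h.weilS_schwartz sig _
  | T_mul _ ih => exact h.weilT_schwartz ih

theorem WeilWord.sum_norm_sq (h : IsEvenLattice Q M) [Fintype (Disc Q M)] {sig : ℤ}
    {γ : SL(2, ℤ)} {A : (V → ℂ) → (V → ℂ)} (hA : WeilWord Q M sig γ A) (φ : V → ℂ) :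
    ∑ μ : Disc Q M, ‖A φ μ.rep‖ ^ 2 = ∑ μ : Disc Q M, ‖φ μ.rep‖ ^ 2 := by
  induction hA with
  | one => rfl
  | S_mul _ ih => rw [← ih]; exact h.sum_norm_sq_weilS sig _
  | T_mul _ ih => rw [← ih]; exact sum_norm_sq_weilT _

/-- The only property of `weilRep` that is used. Everything is proved for an arbitrary word
representing `γ`, so independence of the word is never needed. -/
theorem weilRep_word (Q : QuadraticForm ℚ V) (M : AddSubgroup V) (sig : ℤ) (γ : SL(2, ℤ)) :
    WeilWord Q M sig γ (weilRep Q M sig γ) :=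
  Classical.choose_spec (exists_weilWord Q M sig γ)

/-- The matrix coefficients of the Weil representation at `φ_0` have absolute value at most
one. -/
theorem IsEvenLattice.norm_weilRep_charFun_le (h : IsEvenLattice Q M) (sig : ℤ) (γ : SL(2, ℤ))
    (x : V) : ‖weilRep Q M sig γ (charFun M) x‖ ≤ 1 := by
  classical
  have := h.finite_disc
  have := Fintype.ofFinite (Disc Q M)
  have hw := weilRep_word Q M sig γ
  have hs := hw.schwartz h h.charFun_schwartz
  by_cases hx : x ∈ dualLattice Q M
  · have h1 : ∑ μ : Disc Q M, ‖charFun M μ.rep‖ ^ 2 = 1 := by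
      rw [Finset.sum_eq_single (Disc.cls 0 (zero_mem _))]
      · rw [IsPeriodic.rep_cls (charFun_periodic le_rfl), charFun_of_mem M.zero_mem]; simp
      · intro μ _ hμ
        rw [charFun_of_notMem]
        · simp
        · intro hm
          apply hμ
          rw [← Disc.cls_rep μ, Disc.cls_eq_iff]
          simpa using M.neg_mem hm
      · simp
    -- `φ_0` has norm one and words act unitarily, so each coordinate of the image has absolute
    -- value at most one.
    have h2 := hw.sum_norm_sq h (charFun M)
    rw [h1] at h2
    have h3 : ‖weilRep Q M sig γ (charFun M) (Disc.cls x hx).rep‖ ^ 2 ≤ 1 := by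
      rw [← h2]
      exact Finset.single_le_sum
        (f := fun μ : Disc Q M => ‖weilRep Q M sig γ (charFun M) μ.rep‖ ^ 2)
        (fun _ _ => by positivity) (Finset.mem_univ _)
    rw [IsPeriodic.rep_cls hs.2] at h3
    exact (sq_le_one_iff₀ (norm_nonneg _)).1 h3
  · rw [hs.1 x hx]; simp

end Lattices

end

section

section Lattices

variable {V : Type} [AddCommGroup V] [Module ℚ V] {Q : QuadraticForm ℚ V}
  {M P N L : AddSubgroup V}

open QuadraticMap (polar)

open ComplexConjugate

/-! ### Orthogonal sublattices and the compatibility of Weil representations -/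

/-- `P` and `N` are orthogonal sublattices of `L` with `L' ⊆ P' + N'`. -/
structure IsSplit (Q : QuadraticForm ℚ V) (P N L : AddSubgroup V) : Prop where
  evenP : IsEvenLattice Q P
  evenN : IsEvenLattice Q N
  evenL : IsEvenLattice Q L
  leP : P ≤ L
  leN : N ≤ L
  orth : ∀ p ∈ Submodule.span ℚ (P : Set V), ∀ n ∈ Submodule.span ℚ (N : Set V),
    polar Q p n = 0
  decomp : ∀ x ∈ dualLattice Q L, ∃ p ∈ dualLattice Q P, ∃ n ∈ dualLattice Q N, x = p + n

/-- The element of `P' + N'` belonging to a pair of classes. -/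
def repSum (a : Disc Q P × Disc Q N) : V := a.1.rep + a.2.rep

theorem IsPeriodic.sum_repSum_shift [Fintype (Disc Q P)] [Fintype (Disc Q N)] {F : V → ℂ}
    (hP : IsPeriodic P F) (hN : IsPeriodic N F) {p n : V} (hp : p ∈ dualLattice Q P)
    (hn : n ∈ dualLattice Q N) :
    ∑ a : Disc Q P × Disc Q N, F (repSum a + (p + n)) =
      ∑ a : Disc Q P × Disc Q N, F (repSum a) := by
  refine Fintype.sum_equiv (Equiv.addRight (Disc.cls p hp, Disc.cls n hn)) _ _ fun a => ?_
  simp only [repSum, Equiv.coe_addRight, Prod.fst_add, Prod.snd_add]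
  rw [add_comm (a.1 + _).rep, (hN.comp_add _).rep_add_cls a.2 hn, add_comm (a.2.rep + n),
    (hP.comp_add _).rep_add_cls a.1 hp]
  congr 1; abel

namespace IsSplit

variable (h : IsSplit Q P N L)
include h

theorem mem_span_L {p n : V} (hp : p ∈ dualLattice Q P) (hn : n ∈ dualLattice Q N) :
    p + n ∈ Submodule.span ℚ (L : Set V) :=
  Submodule.add_mem _ (Submodule.span_mono h.leP hp.1) (Submodule.span_mono h.leN hn.1)

theorem polar_add_add {p n p' n' : V} (hp : p ∈ dualLattice Q P) (hn : n ∈ dualLattice Q N)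
    (hp' : p' ∈ dualLattice Q P) (hn' : n' ∈ dualLattice Q N) :
    polar Q (p + n) (p' + n') = polar Q p p' + polar Q n n' := by
  rw [QuadraticMap.polar_add_left, QuadraticMap.polar_add_right, QuadraticMap.polar_add_right,
    h.orth p hp.1 n' hn'.1, polar_comm Q n p', h.orth p' hp'.1 n hn.1]
  ring

theorem polar_int_P {p n x : V} (hp : p ∈ dualLattice Q P) (hn : n ∈ dualLattice Q N)
    (hx : x ∈ P) : ∃ k : ℤ, polar Q (p + n) x = k := by
  obtain ⟨k, hk⟩ := polar_int_of_mem hp hx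
  refine ⟨k, ?_⟩
  rw [QuadraticMap.polar_add_left, hk, polar_comm Q n x,
    h.orth x (Submodule.subset_span hx) n hn.1, add_zero]

theorem polar_int_N {p n x : V} (hp : p ∈ dualLattice Q P) (hn : n ∈ dualLattice Q N)
    (hx : x ∈ N) : ∃ k : ℤ, polar Q (p + n) x = k := by
  obtain ⟨k, hk⟩ := polar_int_of_mem hn hx
  refine ⟨k, ?_⟩
  rw [QuadraticMap.polar_add_left, hk, h.orth p hp.1 x (Submodule.subset_span hx), zero_add]

theorem e_polar_periodic_P {p n : V} (hp : p ∈ dualLattice Q P) (hn : n ∈ dualLattice Q N) :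
    IsPeriodic P fun z => e ((polar Q (p + n) z : ℚ) : ℂ) := fun z y hy => by
  simp only [QuadraticMap.polar_add_right, e_ratCast_add,
    e_ratCast_of_int (h.polar_int_P hp hn hy), mul_one]

theorem e_polar_periodic_N {p n : V} (hp : p ∈ dualLattice Q P) (hn : n ∈ dualLattice Q N) :
    IsPeriodic N fun z => e ((polar Q (p + n) z : ℚ) : ℂ) := fun z y hy => by
  simp only [QuadraticMap.polar_add_right, e_ratCast_add,
    e_ratCast_of_int (h.polar_int_N hp hn hy), mul_one]

theorem charFun_dual_periodic : IsPeriodic L (charFun (dualLattice Q L)) :=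
  charFun_periodic h.evenL.le_dual

variable [Fintype (Disc Q P)] [Fintype (Disc Q N)]

/-- The vanishing of a sum which is multiplied by `c ≠ 1` under a shift by an element of
`L'`. -/
theorem sum_eq_zero_of_shift {F : V → ℂ} (hP : IsPeriodic P F) (hN : IsPeriodic N F) {y : V}
    (hy : y ∈ dualLattice Q L) {c : ℂ} (hc : c ≠ 1) (hF : ∀ x, F (x + y) = F x * c) :
    ∑ a : Disc Q P × Disc Q N, F (repSum a) = 0 := by
  obtain ⟨p, hp, n, hn, rfl⟩ := h.decomp y hy
  have hs := hP.sum_repSum_shift hN hp hn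
  simp only [hF, ← Finset.sum_mul] at hs
  have h0 : (∑ a : Disc Q P × Disc Q N, F (repSum a)) * (c - 1) = 0 := by
    rw [mul_sub, hs, mul_one, sub_self]
  exact (mul_eq_zero.1 h0).resolve_right (sub_ne_zero.2 hc)

/-- Orthogonality of characters on `L'/(P ⊕ N)`: by `L'' = L` the character attached to `p + n` is
trivial exactly when `p + n ∈ L`; otherwise a shift by an element of `L'` kills the sum. -/
theorem sum_dual_mul_e {p n : V} (hp : p ∈ dualLattice Q P) (hn : n ∈ dualLattice Q N) :
    ∑ a : Disc Q P × Disc Q N, charFun (dualLattice Q L) (repSum a) *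
        e ((polar Q (p + n) (repSum a) : ℚ) : ℂ) =
      charFun L (p + n) * ∑ a : Disc Q P × Disc Q N, charFun (dualLattice Q L) (repSum a) := by
  by_cases hw : p + n ∈ L
  · rw [charFun_of_mem hw, one_mul]
    refine Finset.sum_congr rfl fun a _ => ?_
    by_cases ha : repSum a ∈ dualLattice Q L
    · rw [e_ratCast_of_int (polar_int_of_mem' ha hw), mul_one]
    · rw [charFun_of_notMem ha, zero_mul]
  · rw [charFun_of_notMem hw, zero_mul]
    have : ∃ y ∈ dualLattice Q L, ¬ ∃ k : ℤ, polar Q y (p + n) = k := by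
      by_contra! hc
      exact hw (h.evenL.dual_dual _ (h.mem_span_L hp hn) fun y hy => hc y hy)
    obtain ⟨y, hy, hy'⟩ := this
    rw [← e_ratCast_eq_one_iff, polar_comm] at hy'
    refine h.sum_eq_zero_of_shift
      (F := fun z => charFun (dualLattice Q L) z * e ((polar Q (p + n) z : ℚ) : ℂ))
      ((h.charFun_dual_periodic.mono h.leP).mul (h.e_polar_periodic_P hp hn))
      ((h.charFun_dual_periodic.mono h.leN).mul (h.e_polar_periodic_N hp hn)) hy hy' fun x => ?_
    simp only [QuadraticMap.polar_add_right, e_ratCast_add]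
    rw [charFun_periodic le_rfl x y hy, mul_assoc]

theorem sum_lattice_mul_e {p n : V} (hp : p ∈ dualLattice Q P) (hn : n ∈ dualLattice Q N) :
    ∑ a : Disc Q P × Disc Q N, charFun L (repSum a) *
        e ((polar Q (p + n) (repSum a) : ℚ) : ℂ) =
      charFun (dualLattice Q L) (p + n) * ∑ a : Disc Q P × Disc Q N, charFun L (repSum a) := by
  by_cases hw : p + n ∈ dualLattice Q L
  · rw [charFun_of_mem hw, one_mul]
    refine Finset.sum_congr rfl fun a _ => ?_
    by_cases ha : repSum a ∈ L
    · rw [e_ratCast_of_int (polar_int_of_mem hw ha), mul_one]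
    · rw [charFun_of_notMem ha, zero_mul]
  · rw [charFun_of_notMem hw, zero_mul]
    have : ∃ y ∈ L, ¬ ∃ k : ℤ, polar Q (p + n) y = k := by
      by_contra! hc
      exact hw ⟨h.mem_span_L hp hn, fun y hy => hc y hy⟩
    obtain ⟨y, hy, hy'⟩ := this
    rw [← e_ratCast_eq_one_iff] at hy'
    refine h.sum_eq_zero_of_shift
      (F := fun z => charFun L z * e ((polar Q (p + n) z : ℚ) : ℂ))
      ((charFun_periodic h.leP).mul (h.e_polar_periodic_P hp hn))
      ((charFun_periodic h.leN).mul (h.e_polar_periodic_N hp hn)) (h.evenL.le_dual hy) hy'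
      fun x => ?_
    simp only [QuadraticMap.polar_add_right, e_ratCast_add]
    rw [charFun_periodic le_rfl x y hy, mul_assoc]

theorem sum_charFun_shift {x : V} (hx : x ∈ dualLattice Q L) :
    ∑ a : Disc Q P × Disc Q N, charFun L (repSum a - x) =
      ∑ a : Disc Q P × Disc Q N, charFun L (repSum a) := by
  obtain ⟨p, hp, n, hn, hpn⟩ := h.decomp (-x) ((dualLattice Q L).neg_mem hx)
  simp only [sub_eq_add_neg, hpn]
  exact (charFun_periodic h.leP).sum_repSum_shift (charFun_periodic h.leN) hp hn

/-- Each class of `L'/L` is met by the same number of pairs, namely `[L : P ⊕ N]`; the independence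
of the class is `sum_charFun_shift`. -/
theorem sum_eq_mul_sum_disc [Fintype (Disc Q L)] {F : V → ℂ} (hF : IsSchwartz Q L F) :
    ∑ a : Disc Q P × Disc Q N, F (repSum a) =
      (∑ a : Disc Q P × Disc Q N, charFun L (repSum a)) * ∑ μ : Disc Q L, F μ.rep := by
  classical
  have key : ∀ x, F x = ∑ μ : Disc Q L, charFun L (x - μ.rep) * F μ.rep := by
    intro x
    by_cases hx : x ∈ dualLattice Q L
    · rw [Finset.sum_eq_single (Disc.cls x hx)]
      · rw [IsPeriodic.rep_cls hF.2, charFun_of_mem, one_mul]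
        rw [← neg_sub]
        exact L.neg_mem (Disc.rep_cls_sub_mem x hx)
      · intro μ _ hμ
        rw [charFun_of_notMem, zero_mul]
        intro hm
        apply hμ
        rw [← Disc.cls_rep μ, Disc.cls_eq_iff]
        exact hm
      · simp
    · rw [hF.1 x hx, Finset.sum_eq_zero]
      intro μ _
      rw [charFun_of_notMem, zero_mul]
      intro hm
      apply hx
      have := (dualLattice Q L).add_mem (h.evenL.le_dual hm) μ.rep_mem
      rwa [sub_add_cancel] at this
  rw [Finset.sum_congr rfl fun a _ => key (repSum a), Finset.sum_comm, Finset.mul_sum]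
  refine Finset.sum_congr rfl fun μ _ => ?_
  rw [← Finset.sum_mul, h.sum_charFun_shift μ.rep_mem]

theorem sum_e_polar_repSum (a : Disc Q P × Disc Q N) [Decidable (a = 0)] :
    ∑ b : Disc Q P × Disc Q N, e ((polar Q (repSum a) (repSum b) : ℚ) : ℂ) =
      if a = 0 then (Fintype.card (Disc Q P) : ℂ) * Fintype.card (Disc Q N) else 0 := by
  classical
  have h1 : ∀ b : Disc Q P × Disc Q N, e ((polar Q (repSum a) (repSum b) : ℚ) : ℂ)
      = e ((polar Q a.1.rep b.1.rep : ℚ) : ℂ) * e ((polar Q a.2.rep b.2.rep : ℚ) : ℂ) := by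
    intro b
    rw [repSum, repSum, h.polar_add_add a.1.rep_mem a.2.rep_mem b.1.rep_mem b.2.rep_mem,
      e_ratCast_add]
  rw [Finset.sum_congr rfl fun b _ => h1 b, Fintype.sum_prod_type]
  simp only
  rw [← Finset.sum_mul_sum, h.evenP.sum_e_polar a.1.rep_mem, h.evenN.sum_e_polar a.2.rep_mem]
  have h0 : ∀ {M : AddSubgroup V} (μ : Disc Q M), charFun M μ.rep = if μ = 0 then 1 else 0 := by
    intro M μ
    have : μ.rep ∈ M ↔ μ = 0 := by
      have h2 : (0 : Disc Q M) = Disc.cls 0 (zero_mem _) := rfl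
      rw [h2, eq_comm, ← Disc.cls_rep μ, Disc.cls_eq_iff, sub_zero, Disc.cls_rep]
    by_cases hμ : μ = 0
    · rw [if_pos hμ, charFun_of_mem (this.2 hμ)]
    · rw [if_neg hμ, charFun_of_notMem (mt this.1 hμ)]
  rw [h0, h0]
  rcases a with ⟨p, n⟩
  by_cases hp : p = 0 <;> by_cases hn : n = 0 <;> simp [hp, hn, Prod.ext_iff]

/-- In terms of indices, `|P'/P| |N'/N| = [L : P ⊕ N] [L' : P ⊕ N]`. Both sides evaluate the double
sum over `a`, `b` of `charFun L (repSum a) e((repSum a, repSum b))`: summing over `b` first leaves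
`a = 0`, summing over `a` first leaves the `b` in `L'`. -/
theorem card_mul_card :
    (Fintype.card (Disc Q P) : ℂ) * Fintype.card (Disc Q N) =
      (∑ a : Disc Q P × Disc Q N, charFun L (repSum a)) *
        ∑ a : Disc Q P × Disc Q N, charFun (dualLattice Q L) (repSum a) := by
  classical
  have hl : ∑ b : Disc Q P × Disc Q N, ∑ a : Disc Q P × Disc Q N, charFun L (repSum a) *
        e ((polar Q (repSum b) (repSum a) : ℚ) : ℂ) =
      (∑ a : Disc Q P × Disc Q N, charFun L (repSum a)) *
        ∑ a : Disc Q P × Disc Q N, charFun (dualLattice Q L) (repSum a) := by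
    rw [Finset.mul_sum]
    refine Finset.sum_congr rfl fun b _ => ?_
    rw [mul_comm]
    exact h.sum_lattice_mul_e b.1.rep_mem b.2.rep_mem
  rw [← hl, Finset.sum_comm]
  simp only [← Finset.mul_sum]
  rw [Finset.sum_congr rfl fun a _ => by
    rw [Finset.sum_congr rfl fun b _ => by rw [polar_comm Q (repSum b)],
      h.sum_e_polar_repSum a]]
  rw [Finset.sum_eq_single 0]
  · rw [if_pos rfl, charFun_of_mem, one_mul]
    have h2 : ∀ {M : AddSubgroup V}, (0 : Disc Q M).rep ∈ M := by
      intro M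
      have := Disc.rep_cls_sub_mem (Q := Q) (M := M) 0 (zero_mem _)
      rwa [sub_zero] at this
    exact L.add_mem (h.leP h2) (h.leN h2)
  · intro a _ ha
    rw [if_neg ha, mul_zero]
  · simp

/-- On `S_L ⊆ S_P ⊗ S_N`, the operator `ρ_P(S) ⊗ ρ_N(S)` is adjoint to the inverse of
`ρ_L(S)`. -/
theorem sum_weilS [Fintype (Disc Q L)] {sP sN sL : ℤ} (hsig : sP + sN = sL) (a b : V → ℂ)
    {g : V → ℂ} (hg : IsSchwartz Q L g) :
    ∑ x : Disc Q P × Disc Q N, weilS Q P sP a x.1.rep * weilS Q N sN b x.2.rep *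
        conj (weilS Q L sL g (repSum x)) =
      ∑ x : Disc Q P × Disc Q N, a x.1.rep * b x.2.rep * conj (g (repSum x)) := by
  classical
  -- `κ` and `κ'` are the indices of `P ⊕ N` in `L` and in `L'`.
  set κ := ∑ x : Disc Q P × Disc Q N, charFun L (repSum x) with hκ
  set κ' := ∑ x : Disc Q P × Disc Q N, charFun (dualLattice Q L) (repSum x) with hκ'
  have hcards := h.card_mul_card
  rw [← hκ, ← hκ'] at hcards
  have hPN : (Fintype.card (Disc Q P) : ℂ) * Fintype.card (Disc Q N) ≠ 0 := by
    exact_mod_cast mul_ne_zero Fintype.card_ne_zero Fintype.card_ne_zero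
  have hκ0 : κ ≠ 0 := by rintro h0; rw [h0, zero_mul] at hcards; exact hPN hcards
  have hκ0' : κ' ≠ 0 := by rintro h0; rw [h0, mul_zero] at hcards; exact hPN hcards
  have hL : κ' = κ * Fintype.card (Disc Q L) := by
    have h1 : IsSchwartz Q L (charFun (dualLattice Q L)) :=
      ⟨fun x hx => charFun_of_notMem hx, h.charFun_dual_periodic⟩
    rw [hκ', h.sum_eq_mul_sum_disc h1]
    congr 1
    rw [Finset.sum_congr rfl fun μ _ => charFun_of_mem μ.rep_mem]
    simp
  set C : ℂ := (e (-(sP : ℂ) / 8) / (Real.sqrt (Fintype.card (Disc Q P)) : ℂ)) *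
    (e (-(sN : ℂ) / 8) / (Real.sqrt (Fintype.card (Disc Q N)) : ℂ)) *
    conj (e (-(sL : ℂ) / 8) / (Real.sqrt (Fintype.card (Disc Q L)) : ℂ)) with hC
  -- The eighth roots of unity cancel because the signatures add up, and `κ'^2 = |P'/P| |N'/N|
  -- |L'/L|`. That `κ'` is the positive square root follows from its being a cardinality.
  have hCκ : C * κ' = 1 := by
    have h1 : C = ((Real.sqrt (Fintype.card (Disc Q P) * Fintype.card (Disc Q N) *
        Fintype.card (Disc Q L)) : ℝ) : ℂ)⁻¹ := by
      rw [hC, Real.sqrt_mul (by positivity), Real.sqrt_mul (by positivity), map_div₀,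
        Complex.conj_ofReal]
      have h2 : conj (e (-(sL : ℂ) / 8)) = (e (-(sP : ℂ) / 8) * e (-(sN : ℂ) / 8))⁻¹ := by
        rw [conj_e, ← e_add, ← e_neg, ← hsig]
        have h8 : conj (8 : ℂ) = 8 := Complex.conj_ofNat 8
        congr 1
        simp only [map_div₀, map_neg, map_intCast, h8]
        push_cast
        ring
      rw [h2]
      have := e_ne_zero (-(sP : ℂ) / 8)
      have := e_ne_zero (-(sN : ℂ) / 8)
      push_cast
      generalize e (-(sP : ℂ) / 8) = u at *
      generalize e (-(sN : ℂ) / 8) = v at *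
      field_simp
    have h3 : (κ' ^ 2 : ℂ) = ((Fintype.card (Disc Q P) * Fintype.card (Disc Q N) *
        Fintype.card (Disc Q L) : ℝ) : ℂ) := by
      push_cast
      rw [hcards, sq]
      conv_lhs => rw [hL]
      rw [hL]; ring
    have h4 : κ' = (({x : Disc Q P × Disc Q N |
        repSum x ∈ dualLattice Q L} : Finset _).card : ℕ) := by
      rw [hκ', Finset.card_eq_sum_ones, Finset.sum_filter]
      push_cast
      exact Finset.sum_congr rfl fun x _ => by
        by_cases hx : repSum x ∈ dualLattice Q L <;> simp [charFun, hx]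
    rw [h1, inv_mul_eq_one₀]
    · have h5 := h3
      rw [h4] at h5 ⊢
      rw [← Complex.ofReal_natCast, Complex.ofReal_inj,
        Real.sqrt_eq_iff_eq_sq (by positivity) (by positivity)]
      exact_mod_cast h5.symm
    · rw [Ne, Complex.ofReal_eq_zero, Real.sqrt_eq_zero (by positivity)]
      have := Fintype.card_pos (α := Disc Q P)
      have := Fintype.card_pos (α := Disc Q N)
      have := Fintype.card_pos (α := Disc Q L)
      positivity
  -- The sum over `L'/L` inside `ρ_L(S) g` is lifted to pairs at the cost of `κ⁻¹`, so that all
  -- transforms run over one index set; the factor `charFun L'` records that `weilS` vanishes off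
  -- `L'`.
  have hterm : ∀ x : Disc Q P × Disc Q N,
      weilS Q P sP a x.1.rep * weilS Q N sN b x.2.rep * conj (weilS Q L sL g (repSum x)) =
      C * κ⁻¹ * ∑ y : Disc Q P × Disc Q N, ∑ w : Disc Q P × Disc Q N,
        a y.1.rep * b y.2.rep * conj (g (repSum w)) *
          (charFun (dualLattice Q L) (repSum x) *
            e ((polar Q (repSum w - repSum y) (repSum x) : ℚ) : ℂ)) := by
    intro x
    by_cases hx : repSum x ∈ dualLattice Q L
    · have h1 : ∑ μ : Disc Q L, conj (g μ.rep) * e ((polar Q μ.rep (repSum x) : ℚ) : ℂ) =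
          κ⁻¹ * ∑ w : Disc Q P × Disc Q N, conj (g (repSum w)) *
            e ((polar Q (repSum w) (repSum x) : ℚ) : ℂ) := by
        have h2 : IsSchwartz Q L fun z => conj (g z) * e ((polar Q z (repSum x) : ℚ) : ℂ) :=
          ⟨fun z hz => by simp only [hg.1 z hz, map_zero, zero_mul],
            (IsPeriodic.conj hg.2).mul (e_polar_periodic' hx)⟩
        have h3 := h.sum_eq_mul_sum_disc h2
        rw [h3, inv_mul_cancel_left₀ hκ0]
      rw [weilS_of_mem _ _ x.1.rep_mem, weilS_of_mem _ _ x.2.rep_mem, weilS_of_mem _ _ hx,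
        map_mul, map_sum]
      have h4 : ∑ μ : Disc Q L, conj (e ((-polar Q μ.rep (repSum x) : ℚ) : ℂ) * g μ.rep) =
          κ⁻¹ * ∑ w : Disc Q P × Disc Q N, conj (g (repSum w)) *
            e ((polar Q (repSum w) (repSum x) : ℚ) : ℂ) := by
        rw [← h1]
        refine Finset.sum_congr rfl fun μ _ => ?_
        rw [map_mul, conj_e_ratCast, neg_neg, mul_comm]
      have h5 : (∑ μ : Disc Q P, e ((-polar Q μ.rep x.1.rep : ℚ) : ℂ) * a μ.rep) *
          (∑ μ : Disc Q N, e ((-polar Q μ.rep x.2.rep : ℚ) : ℂ) * b μ.rep) =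
          ∑ y : Disc Q P × Disc Q N, a y.1.rep * b y.2.rep *
            e ((-polar Q (repSum y) (repSum x) : ℚ) : ℂ) := by
        rw [Finset.sum_mul_sum, Fintype.sum_prod_type]
        refine Finset.sum_congr rfl fun μ _ => Finset.sum_congr rfl fun ν _ => ?_
        rw [repSum, repSum, h.polar_add_add μ.rep_mem ν.rep_mem x.1.rep_mem x.2.rep_mem, neg_add,
          e_ratCast_add]
        ring
      rw [h4]
      rw [show ∀ c₁ c₂ c₃ s₁ s₂ s₃ : ℂ, c₁ * s₁ * (c₂ * s₂) * (c₃ * (κ⁻¹ * s₃)) =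
        (c₁ * c₂ * c₃) * κ⁻¹ * ((s₁ * s₂) * s₃) by intros; ring, h5, ← hC, Finset.sum_mul_sum]
      congr 1
      refine Finset.sum_congr rfl fun y _ => Finset.sum_congr rfl fun w _ => ?_
      rw [charFun_of_mem hx, one_mul, sub_eq_neg_add, QuadraticMap.polar_add_left,
        QuadraticMap.polar_neg_left, e_ratCast_add]
      ring
    · rw [weilS_of_notMem _ _ hx, charFun_of_notMem hx]
      simp
  rw [Finset.sum_congr rfl fun x _ => hterm x, ← Finset.mul_sum, Finset.sum_comm]
  -- Summing over `x` yields `κ'` and forces `repSum w - repSum y ∈ L`; there `g` takes the same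
  -- value at both, and `κ` of the `w` qualify.
  have hin : ∀ y : Disc Q P × Disc Q N, ∑ x : Disc Q P × Disc Q N, ∑ w : Disc Q P × Disc Q N,
        a y.1.rep * b y.2.rep * conj (g (repSum w)) *
          (charFun (dualLattice Q L) (repSum x) *
            e ((polar Q (repSum w - repSum y) (repSum x) : ℚ) : ℂ)) =
      κ' * κ * (a y.1.rep * b y.2.rep * conj (g (repSum y))) := by
    intro y
    rw [Finset.sum_comm]
    have h1 : ∀ w : Disc Q P × Disc Q N, ∑ x : Disc Q P × Disc Q N,
        a y.1.rep * b y.2.rep * conj (g (repSum w)) *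
          (charFun (dualLattice Q L) (repSum x) *
            e ((polar Q (repSum w - repSum y) (repSum x) : ℚ) : ℂ)) =
        κ' * (a y.1.rep * b y.2.rep * conj (g (repSum y))) * charFun L (repSum w - repSum y) := by
      intro w
      have h2 : repSum w - repSum y = (w.1.rep - y.1.rep) + (w.2.rep - y.2.rep) := by
        simp only [repSum]; abel
      rw [← Finset.mul_sum, h2, h.sum_dual_mul_e
        ((dualLattice Q P).sub_mem w.1.rep_mem y.1.rep_mem)
        ((dualLattice Q N).sub_mem w.2.rep_mem y.2.rep_mem), ← h2, ← hκ']
      by_cases hm : repSum w - repSum y ∈ L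
      · rw [IsPeriodic.eq_of_sub_mem (M := L) hg.2 hm]
        ring
      · rw [charFun_of_notMem hm]; ring
    rw [Finset.sum_congr rfl fun w _ => h1 w, ← Finset.mul_sum]
    have h3 : ∑ w : Disc Q P × Disc Q N, charFun L (repSum w - repSum y) = κ := by
      have := (charFun_periodic h.leP).sum_repSum_shift (charFun_periodic h.leN)
        ((dualLattice Q P).neg_mem y.1.rep_mem) ((dualLattice Q N).neg_mem y.2.rep_mem)
      rw [hκ, ← this]
      refine Finset.sum_congr rfl fun w _ => ?_
      congr 1
      simp only [repSum]; abel
    rw [h3]; ring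
  rw [Finset.sum_congr rfl fun y _ => hin y, ← Finset.mul_sum]
  rw [show ∀ s : ℂ, C * κ⁻¹ * (κ' * κ * s) = (C * κ') * (κ⁻¹ * κ) * s by intros; ring, hCκ,
    inv_mul_cancel₀ hκ0]
  ring


end IsSplit

end Lattices

end

section

section Lattices

variable {V : Type} [AddCommGroup V] [Module ℚ V] {Q : QuadraticForm ℚ V}
  {M P N L : AddSubgroup V}

open QuadraticMap (polar)

open ComplexConjugate

/-! ### Theta functions of lattices of rank one -/

/-- The decomposition of `M'` into cosets of `M`. -/
def dualEquivDiscProd (h : IsEvenLattice Q M) : dualLattice Q M ≃ Disc Q M × M where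
  toFun x := (Disc.cls x.1 x.2, ⟨x.1 - (Disc.cls x.1 x.2).rep, by
    rw [← neg_sub]; exact M.neg_mem (Disc.rep_cls_sub_mem x.1 x.2)⟩)
  invFun a := ⟨a.1.rep + a.2, (dualLattice Q M).add_mem a.1.rep_mem (h.le_dual a.2.2)⟩
  left_inv x := Subtype.ext (add_sub_cancel _ _)
  right_inv a := by
    have h1 : Disc.cls (a.1.rep + a.2) ((dualLattice Q M).add_mem a.1.rep_mem (h.le_dual a.2.2))
        = a.1 := by
      conv_rhs => rw [← Disc.cls_rep a.1]
      rw [Disc.cls_eq_iff, sub_add_cancel_left]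
      exact M.neg_mem a.2.2
    refine Prod.ext h1 (Subtype.ext ?_)
    simp only [h1]
    exact add_sub_cancel_left _ _

theorem sum_disc_mul_tsum (h : IsEvenLattice Q M) [Fintype (Disc Q M)] {F G : V → ℂ}
    (hG : IsPeriodic M G)
    (hFG : Summable fun x : dualLattice Q M => G x * F x) :
    ∑ μ : Disc Q M, G μ.rep * ∑' l : M, F (μ.rep + l) = ∑' x : dualLattice Q M, G x * F x := by
  have hs : Summable fun a : Disc Q M × M => G (a.1.rep + a.2) * F (a.1.rep + a.2) :=
    ((dualEquivDiscProd h).symm.summable_iff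
      (f := fun x : dualLattice Q M => G x * F x)).2 hFG
  have h1 : ∑' x : dualLattice Q M, G x * F x =
      ∑' a : Disc Q M × M, G (a.1.rep + a.2) * F (a.1.rep + a.2) :=
    ((dualEquivDiscProd h).symm.tsum_eq (fun x : dualLattice Q M => G x * F x)).symm
  rw [h1, Summable.tsum_prod hs, tsum_fintype]
  refine Finset.sum_congr rfl fun μ _ => ?_
  rw [← tsum_mul_left]
  refine tsum_congr fun l => ?_
  rw [hG μ.rep l l.2]

theorem zsmul_left_inj_of_ne_zero {y : V} (hy : y ≠ 0) {m n : ℤ} (h : m • y = n • y) :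
    m = n := by
  rw [← Int.cast_smul_eq_zsmul ℚ, ← Int.cast_smul_eq_zsmul ℚ n] at h
  exact_mod_cast smul_left_injective ℚ hy h

/-- `P` is generated by `K y`, its dual by `y`, and `(y, y) = 1 / K`. -/
structure IsRankOne (Q : QuadraticForm ℚ V) (P : AddSubgroup V) (y : V) (K : ℕ) : Prop where
  pos : 0 < K
  mem_iff : ∀ x, x ∈ P ↔ ∃ n : ℤ, x = (n * K) • y
  mem_dual_iff : ∀ x, x ∈ dualLattice Q P ↔ ∃ n : ℤ, x = n • y
  Q_gen : Q y = 1 / (2 * K)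
  even : IsEvenLattice Q P

theorem Q_zsmul (Q : QuadraticForm ℚ V) (n : ℤ) (y : V) : Q (n • y) = n ^ 2 * Q y := by
  rw [← Int.cast_smul_eq_zsmul ℚ, QuadraticMap.map_smul]
  simp [sq]

theorem polar_zsmul_zsmul (Q : QuadraticForm ℚ V) (m n : ℤ) (y : V) :
    polar Q (m • y) (n • y) = m * n * (2 * Q y) := by
  rw [← Int.cast_smul_eq_zsmul ℚ m, ← Int.cast_smul_eq_zsmul ℚ n, QuadraticMap.polar_smul_left,
    QuadraticMap.polar_smul_right, QuadraticMap.polar_self]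
  simp [mul_assoc]

namespace IsRankOne

variable {y : V} {K : ℕ} (h : IsRankOne Q P y K)
include h

theorem ne_zero : (K : ℚ) ≠ 0 := by exact_mod_cast h.pos.ne'

theorem ne_zero' : (K : ℂ) ≠ 0 := by exact_mod_cast h.pos.ne'

theorem gen_ne_zero : y ≠ 0 := by
  rintro rfl
  have := h.Q_gen
  rw [QuadraticMap.map_zero] at this
  have h2 := h.ne_zero
  field_simp at this
  norm_num at this

/-- `P' ≅ ℤ`. -/
def dualEquiv : ℤ ≃ dualLattice Q P :=
  Equiv.ofBijective (fun n => ⟨n • y, (h.mem_dual_iff _).2 ⟨n, rfl⟩⟩) (by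
    constructor
    · intro m n hmn
      have := congrArg Subtype.val hmn
      exact zsmul_left_inj_of_ne_zero h.gen_ne_zero this
    · rintro ⟨x, hx⟩
      obtain ⟨n, rfl⟩ := (h.mem_dual_iff x).1 hx
      exact ⟨n, rfl⟩)

/-- `P ≅ ℤ`. -/
def latEquiv : ℤ ≃ P :=
  Equiv.ofBijective (fun n => ⟨(n * K) • y, (h.mem_iff _).2 ⟨n, rfl⟩⟩) (by
    constructor
    · intro m n hmn
      have := congrArg Subtype.val hmn
      have := zsmul_left_inj_of_ne_zero h.gen_ne_zero this
      exact mul_right_cancel₀ (by exact_mod_cast h.pos.ne') this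
    · rintro ⟨x, hx⟩
      obtain ⟨n, rfl⟩ := (h.mem_iff x).1 hx
      exact ⟨n, rfl⟩)

theorem card_disc : Nat.card (Disc Q P) = K := by
  have h1 : Nat.card (Disc Q P) = (P.addSubgroupOf (dualLattice Q P)).index := rfl
  let f : ℤ →+ dualLattice Q P :=
    { toFun := h.dualEquiv
      map_zero' := Subtype.ext (zero_smul ℤ y)
      map_add' := fun m n => Subtype.ext (add_smul m n y) }
  rw [h1, ← AddSubgroup.index_comap_of_surjective _ (f := f) h.dualEquiv.surjective]
  have h2 : (P.addSubgroupOf (dualLattice Q P)).comap f = AddSubgroup.zmultiples (K : ℤ) := by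
    ext n
    rw [AddSubgroup.mem_comap, AddSubgroup.mem_addSubgroupOf, Int.mem_zmultiples_iff]
    show n • y ∈ P ↔ _
    rw [h.mem_iff]
    constructor
    · rintro ⟨m, hm⟩
      exact ⟨m, (zsmul_left_inj_of_ne_zero h.gen_ne_zero hm).trans (mul_comm _ _)⟩
    · rintro ⟨m, rfl⟩
      exact ⟨m, by rw [mul_comm]⟩
  rw [h2, Int.index_zmultiples]; simp

theorem Q_zsmul_gen (n : ℤ) : Q (n • y) = n ^ 2 / (2 * K) := by
  rw [Q_zsmul, h.Q_gen]; ring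

theorem polar_zsmul_gen (m n : ℤ) : polar Q (m • y) (n • y) = m * n / K := by
  rw [polar_zsmul_zsmul, h.Q_gen]
  have := h.ne_zero
  field_simp

/-- Since `Q(ny) = n²/(2K)`, the theta series of `P` is Jacobi's at `τ/K`; the variable `z` carries
the characters of `P'/P`. -/
theorem jacobi_term (n : ℤ) (z τ : ℂ) :
    e (n * z) * e (((Q (n • y) : ℚ) : ℂ) * τ) = jacobiTheta₂_term n z (τ / K) := by
  rw [← e_add, h.Q_zsmul_gen, e, jacobiTheta₂_term]
  have := h.ne_zero'
  congr 1
  push_cast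
  field_simp

theorem summable_dual (τ : ℍ) :
    Summable fun x : dualLattice Q P => e (((Q (x : V) : ℚ) : ℂ) * τ) := by
  rw [← h.dualEquiv.summable_iff]
  have : 0 < ((τ : ℂ) / K).im := by
    rw [Complex.div_natCast_im]; exact div_pos τ.im_pos (by exact_mod_cast h.pos)
  refine ((summable_jacobiTheta₂_term_iff 0 _).2 this).congr fun n => ?_
  rw [← h.jacobi_term]
  simp; rfl

theorem summable_mul_dual (τ : ℍ) {G : V → ℂ} {C : ℝ} (hG : ∀ x, ‖G x‖ ≤ C) :
    Summable fun x : dualLattice Q P => G x * e (((Q (x : V) : ℚ) : ℂ) * τ) := by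
  refine .of_norm_bounded ((h.summable_dual τ).norm.mul_left C) fun x => ?_
  rw [norm_mul]
  exact mul_le_mul_of_nonneg_right (hG _) (norm_nonneg _)

/-- Unfolding a sum over `P'/P` against the theta function. -/
theorem sum_mul_theta [Fintype (Disc Q P)] (τ : ℍ) {G : V → ℂ} {C : ℝ}
    (hGP : IsPeriodic P G) (hG : ∀ x, ‖G x‖ ≤ C) :
    ∑ μ : Disc Q P, G μ.rep * theta Q P τ μ.rep =
      ∑' n : ℤ, G (n • y) * e (((Q (n • y) : ℚ) : ℂ) * τ) := by
  have h1 := sum_disc_mul_tsum h.even (F := fun x => e (((Q x : ℚ) : ℂ) * τ)) hGP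
    (h.summable_mul_dual τ hG)
  rw [← h.dualEquiv.tsum_eq] at h1
  rw [← show _ = ∑' n : ℤ, G (n • y) * e (((Q (n • y) : ℚ) : ℂ) * τ) from h1]
  exact Finset.sum_congr rfl fun μ _ => by rw [theta, if_pos μ.rep_mem]

theorem theta_T (τ : ℍ) (x : V) : theta Q P ((1 : ℝ) +ᵥ τ) x = weilT Q (theta Q P τ) x := by
  rw [weilT, theta, theta]
  split_ifs with hx
  · rw [← tsum_mul_left]
    refine tsum_congr fun l => ?_
    rw [UpperHalfPlane.coe_vadd, Complex.ofReal_one, mul_add, mul_one, e_add,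
      e_ratCast_congr (h.even.Q_add_int hx l.2)]
  · simp

omit h in
-- No branch is crossed: `arg τ ≥ 0` and `arg (-i) = -π/2`, so the logarithms add. The root of unity
-- that appears is the one in `ρ_P(S)` for signature one.
theorem neg_I_mul_cpow_half (τ : ℍ) :
    (-Complex.I * τ) ^ (1 / 2 : ℂ) = e (-1 / 8) * (τ : ℂ) ^ (1 / 2 : ℂ) := by
  have hτ : (τ : ℂ) ≠ 0 := τ.ne_zero
  have harg : Complex.arg (-Complex.I) = -(Real.pi / 2) := Complex.arg_neg_I
  have hpos : 0 ≤ Complex.arg τ := Complex.arg_nonneg_iff.2 τ.im_pos.le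
  have hlog : Complex.log (-Complex.I * τ) = Complex.log (-Complex.I) + Complex.log τ := by
    rw [Complex.log_mul_eq_add_log_iff (neg_ne_zero.2 Complex.I_ne_zero) hτ, harg]
    have := Complex.arg_le_pi (τ : ℂ)
    have := Real.pi_pos
    constructor <;> linarith
  rw [Complex.cpow_def_of_ne_zero (mul_ne_zero (neg_ne_zero.2 Complex.I_ne_zero) hτ),
    Complex.cpow_def_of_ne_zero hτ, hlog, add_mul, Complex.exp_add, e, Complex.log_neg_I]
  congr 2
  ring

/-- Poisson summation, as the functional equation of `jacobiTheta₂` at `(-a/K, τ/K)`. Its factor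
`(-iτ/K)^{1/2}` cancels against `√τ` and the constant of `ρ_P(S)`, because `|P'/P| = K`. -/
theorem theta_S (τ : ℍ) {x : V} (hx : x ∈ dualLattice Q P) :
    theta Q P (ModularGroup.S • τ) x =
      (τ : ℂ) ^ (1 / 2 : ℂ) * weilS Q P 1 (theta Q P τ) x := by
  have := h.even.finite_disc
  have := Fintype.ofFinite (Disc Q P)
  have hK := h.ne_zero'
  have hτ : (τ : ℂ) ≠ 0 := τ.ne_zero
  rw [weilS_of_mem _ _ hx]
  have h1 : IsPeriodic P fun z => e ((-polar Q z x : ℚ) : ℂ) := by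
    have := IsPeriodic.conj (e_polar_periodic' hx)
    simpa only [conj_e_ratCast] using this
  rw [h.sum_mul_theta τ h1 (C := 1) fun z => (norm_e_ratCast _).le]
  obtain ⟨a, rfl⟩ := (h.mem_dual_iff x).1 hx
  have h2 : ∑' n : ℤ, e ((-polar Q (n • y) (a • y) : ℚ) : ℂ) * e (((Q (n • y) : ℚ) : ℂ) * τ)
      = jacobiTheta₂ (-a / K) (τ / K) := by
    refine tsum_congr fun n => ?_
    rw [← h.jacobi_term, h.polar_zsmul_gen]
    congr 2
    push_cast; ring
  -- Expanding the square of `a + nK` separates the Gaussian factor from a Jacobi theta series at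
  -- `-K/τ`.
  have h3 : theta Q P (ModularGroup.S • τ) (a • y) =
      e (-a ^ 2 / (2 * K * τ)) * jacobiTheta₂ (-a / τ) (-K / τ) := by
    rw [theta, if_pos hx, ← h.latEquiv.tsum_eq, jacobiTheta₂, ← tsum_mul_left]
    refine tsum_congr fun n => ?_
    have h4 : a • y + (h.latEquiv n : V) = (a + n * K : ℤ) • y := by
      rw [add_smul]; rfl
    rw [h4, h.Q_zsmul_gen, UpperHalfPlane.modular_S_smul, e, e, jacobiTheta₂_term,
      ← Complex.exp_add]
    congr 1
    push_cast
    field_simp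
    ring
  rw [h2, h3, jacobiTheta₂_functional_equation (-a / K) (τ / K)]
  have h5 : (-Complex.I * (τ / K)) ^ (1 / 2 : ℂ) =
      e (-1 / 8) * (τ : ℂ) ^ (1 / 2 : ℂ) / (Real.sqrt K : ℂ) := by
    have h6 : -Complex.I * ((τ : ℂ) / K) = ((K⁻¹ : ℝ) : ℂ) * (-Complex.I * τ) := by
      push_cast; field_simp
    have hpos : (0 : ℝ) < (K : ℝ)⁻¹ := by have := h.pos; positivity
    have hne : -Complex.I * (τ : ℂ) ≠ 0 := mul_ne_zero (neg_ne_zero.2 Complex.I_ne_zero) hτ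
    have h7 : (((K⁻¹ : ℝ) : ℂ) * (-Complex.I * τ)) ^ (1 / 2 : ℂ) =
        (((K : ℝ)⁻¹ : ℝ) : ℂ) ^ (1 / 2 : ℂ) * (-Complex.I * τ) ^ (1 / 2 : ℂ) := by
      rw [Complex.cpow_def_of_ne_zero (mul_ne_zero (by exact_mod_cast hpos.ne') hne),
        Complex.cpow_def_of_ne_zero (by exact_mod_cast hpos.ne'),
        Complex.cpow_def_of_ne_zero hne, Complex.log_ofReal_mul hpos hne, add_mul,
        Complex.exp_add, Complex.ofReal_log hpos.le]
    have h8 : (((K : ℝ)⁻¹ : ℝ) : ℂ) ^ (1 / 2 : ℂ) = ((Real.sqrt K : ℝ) : ℂ)⁻¹ := by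
      rw [show (1 / 2 : ℂ) = ((1 / 2 : ℝ) : ℂ) by push_cast; rfl,
        ← Complex.ofReal_cpow hpos.le, ← Real.sqrt_eq_rpow, Real.sqrt_inv]
      push_cast; rfl
    rw [h6, h7, h8, neg_I_mul_cpow_half]
    field_simp
  have h9 : (-(a : ℂ) / K) / (τ / K) = -a / τ := by field_simp
  have h10 : -1 / ((τ : ℂ) / K) = -K / τ := by field_simp
  have h11 : Complex.exp (-Real.pi * Complex.I * (-(a : ℂ) / K) ^ 2 / (τ / K)) =
      e (-a ^ 2 / (2 * K * τ)) := by
    rw [e]; congr 1; field_simp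
  have h12 : (Fintype.card (Disc Q P) : ℝ) = K := by
    rw [← Nat.card_eq_fintype_card, h.card_disc]
  have h13 : e (-1 / 8) ≠ 0 := e_ne_zero _
  have h14 : (τ : ℂ) ^ (1 / 2 : ℂ) ≠ 0 := by
    rw [Ne, Complex.cpow_eq_zero_iff]; tauto
  have h15 : ((Real.sqrt K : ℝ) : ℂ) ≠ 0 := by
    rw [Ne, Complex.ofReal_eq_zero, Real.sqrt_eq_zero (by positivity)]
    exact_mod_cast h.pos.ne'
  have h16 : e (-((1 : ℤ) : ℂ) / 8) = e (-1 / 8) := by simp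
  rw [h5, h9, h10, h11, h12, h16]
  generalize e (-1 / 8) = u at *
  field_simp

end IsRankOne

end Lattices

end

section

section Lattices

variable {V : Type} [AddCommGroup V] [Module ℚ V] {Q : QuadraticForm ℚ V}
  {M P N L : AddSubgroup V}

open QuadraticMap (polar)

open ComplexConjugate

/-! ### The pairing of theta functions with cusp forms -/

/-- The pairing `⟨θ_P(τ) ⊗ φ, \bar g(τ)⟩ v^{3/2}` for `φ ∈ S_N`. -/
def thetaPairing (Q : QuadraticForm ℚ V) (P N : AddSubgroup V) (g : ℍ → V → ℂ) (φ : V → ℂ)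
    (τ : ℍ) : ℂ :=
  (∑ᶠ p : Disc Q P × Disc Q N, theta Q P τ p.1.rep * φ p.2.rep *
    conj (g τ (p.1.rep + p.2.rep))) * ((τ.im ^ (3 / 2 : ℝ) : ℝ) : ℂ)

theorem rankinIntegrand_eq_thetaPairing (g : ℍ → V → ℂ) (s : ℂ) (τ : ℍ) :
    rankinIntegrand Q P N g s τ = thetaPairing Q P N g (eisenstein Q N τ s) τ := rfl

theorem IsSchwartz.bounded (h : IsEvenLattice Q M) {φ : V → ℂ} (hφ : IsSchwartz Q M φ) :
    ∃ C : ℝ, ∀ x, ‖φ x‖ ≤ C := by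
  have := h.finite_disc
  have := Fintype.ofFinite (Disc Q M)
  refine ⟨∑ μ : Disc Q M, ‖φ μ.rep‖, fun x => ?_⟩
  by_cases hx : x ∈ dualLattice Q M
  · rw [← IsPeriodic.rep_cls hφ.2 hx]
    exact Finset.single_le_sum (f := fun μ : Disc Q M => ‖φ μ.rep‖)
      (fun _ _ => norm_nonneg _) (Finset.mem_univ _)
  · rw [hφ.1 x hx, norm_zero]
    exact Finset.sum_nonneg fun _ _ => norm_nonneg _

/-- The factor of automorphy `cτ + d`. -/
def autFactor (γ : SL(2, ℤ)) (τ : ℍ) : ℂ := ((γ 1 0 : ℤ) : ℂ) * τ + ((γ 1 1 : ℤ) : ℂ)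

theorem autFactor_eq_denom (γ : SL(2, ℤ)) (τ : ℍ) : autFactor γ τ = UpperHalfPlane.denom γ τ := by
  simp [autFactor, UpperHalfPlane.denom]

theorem autFactor_ne_zero (γ : SL(2, ℤ)) (τ : ℍ) : autFactor γ τ ≠ 0 := by
  rw [autFactor_eq_denom]; exact UpperHalfPlane.denom_ne_zero _ _

theorem im_smul_eq (γ : SL(2, ℤ)) (τ : ℍ) : (γ • τ).im = τ.im / ‖autFactor γ τ‖ ^ 2 := by
  rw [ModularGroup.im_smul_eq_div_normSq, autFactor_eq_denom, Complex.normSq_eq_norm_sq]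

theorem autFactor_mul (γ δ : SL(2, ℤ)) (τ : ℍ) :
    autFactor (γ * δ) τ = autFactor γ (δ • τ) * autFactor δ τ := by
  have h1 := autFactor_ne_zero δ τ
  have h2 : ((δ • τ : ℍ) : ℂ) =
      (((δ 0 0 : ℤ) : ℂ) * τ + ((δ 0 1 : ℤ) : ℂ)) / autFactor δ τ := by
    rw [UpperHalfPlane.coe_specialLinearGroup_apply]
    simp [autFactor]
  rw [autFactor, autFactor, h2, Matrix.SpecialLinearGroup.coe_mul, Matrix.mul_apply,
    Matrix.mul_apply, Fin.sum_univ_two, Fin.sum_univ_two]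
  field_simp
  rw [autFactor]
  push_cast
  ring

theorem autFactor_S (τ : ℍ) : autFactor ModularGroup.S τ = τ := by
  simp [autFactor, ModularGroup.S]

theorem autFactor_T (τ : ℍ) : autFactor ModularGroup.T τ = 1 := by
  simp [autFactor, ModularGroup.T]

theorem autFactor_one (τ : ℍ) : autFactor 1 τ = 1 := by
  simp [autFactor]

theorem cpow_half_sq (z : ℂ) : (z ^ (1 / 2 : ℂ)) ^ 2 = z := by
  rw [← Complex.cpow_nat_mul]; norm_num

theorem norm_cpow_half_sq (z : ℂ) : ‖z ^ (1 / 2 : ℂ)‖ ^ 2 = ‖z‖ := by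
  rw [← norm_pow, cpow_half_sq]

/-! ### Modularity of the pairing -/

section Invariance

variable {y : V} {K : ℕ} (h : IsSplit Q P N L) (hr : IsRankOne Q P y K) {g : ℍ → V → ℂ}
  (hg : IsCuspForm Q L (-1) 3 g)

include h hr hg

/-- By orthogonality `Q(p + n) = Q(p) + Q(n)`, so the phases of theta and of `φ` cancel that of the
conjugate of `g`. -/
theorem thetaPairing_T (φ : V → ℂ) (τ : ℍ) :
    thetaPairing Q P N g (weilT Q φ) (ModularGroup.T • τ) = thetaPairing Q P N g φ τ := by
  rw [UpperHalfPlane.modular_T_smul, thetaPairing, thetaPairing, UpperHalfPlane.vadd_im]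
  congr 1
  refine finsum_congr fun p => ?_
  rw [hr.theta_T, hg.map_T]
  simp only [weilT]
  rw [map_mul, conj_e_ratCast, map_add_polar, h.orth _ p.1.rep_mem.1 _ p.2.rep_mem.1, add_zero,
    neg_add, e_ratCast_add]
  have h1 : e ((Q p.1.rep : ℚ) : ℂ) * e ((-Q p.1.rep : ℚ) : ℂ) = 1 := by
    rw [← e_ratCast_add]; simp
  have h2 : e ((Q p.2.rep : ℚ) : ℂ) * e ((-Q p.2.rep : ℚ) : ℂ) = 1 := by
    rw [← e_ratCast_add]; simp
  linear_combination (theta Q P τ p.1.rep * φ p.2.rep * conj (g τ (p.1.rep + p.2.rep))) *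
    (e ((Q p.2.rep : ℚ) : ℂ) * e ((-Q p.2.rep : ℚ) : ℂ) * h1 + h2)

/-- The factor `τ^{1/2}` from theta, the conjugate of `(τ^{1/2})^3` from `g`, and `|τ|^{-3}` from
`v^{3/2}` multiply to `\bar τ/|τ|² = τ⁻¹`; the finite sums are matched by `sum_weilS`. -/
theorem thetaPairing_S (φ : V → ℂ) (τ : ℍ) :
    thetaPairing Q P N g (weilS Q N (-2) φ) (ModularGroup.S • τ) =
      (τ : ℂ)⁻¹ * thetaPairing Q P N g φ τ := by
  have := h.evenP.finite_disc
  have := h.evenN.finite_disc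
  have := h.evenL.finite_disc
  have := Fintype.ofFinite (Disc Q P)
  have := Fintype.ofFinite (Disc Q N)
  have := Fintype.ofFinite (Disc Q L)
  have hτ : (τ : ℂ) ≠ 0 := τ.ne_zero
  have hτn : 0 < ‖(τ : ℂ)‖ := norm_pos_iff.2 hτ
  rw [thetaPairing, thetaPairing, finsum_eq_sum_of_fintype, finsum_eq_sum_of_fintype]
  have h1 := h.sum_weilS (sP := 1) (sN := -2) (sL := -1) (by norm_num) (theta Q P τ) φ
    (hg.schwartz τ)
  have h2 : ∀ p : Disc Q P × Disc Q N, theta Q P (ModularGroup.S • τ) p.1.rep *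
      weilS Q N (-2) φ p.2.rep * conj (g (ModularGroup.S • τ) (p.1.rep + p.2.rep)) =
      ((τ : ℂ) ^ (1 / 2 : ℂ) * conj (((τ : ℂ) ^ (1 / 2 : ℂ)) ^ 3)) *
        (weilS Q P 1 (theta Q P τ) p.1.rep * weilS Q N (-2) φ p.2.rep *
          conj (weilS Q L (-1) (g τ) (repSum p))) := by
    intro p
    rw [hr.theta_S τ p.1.rep_mem, hg.map_S]
    simp only [map_mul, repSum]
    ring
  rw [Finset.sum_congr rfl fun p _ => h2 p, ← Finset.mul_sum, h1, im_smul_eq, autFactor_S]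
  set w := (τ : ℂ) ^ (1 / 2 : ℂ) with hw
  have h3 : w * conj (w ^ 3) = ‖(τ : ℂ)‖ * conj (τ : ℂ) := by
    rw [← norm_cpow_half_sq, ← hw, map_pow, Complex.ofReal_pow, ← Complex.mul_conj' w]
    conv_rhs => rw [← cpow_half_sq (τ : ℂ), ← hw]
    rw [map_pow]
    ring
  have h4 : (τ.im / ‖(τ : ℂ)‖ ^ 2) ^ (3 / 2 : ℝ) = τ.im ^ (3 / 2 : ℝ) / ‖(τ : ℂ)‖ ^ 3 := by
    rw [Real.div_rpow τ.im_pos.le (by positivity), ← Real.rpow_natCast, ← Real.rpow_mul hτn.le,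
      ← Real.rpow_natCast]
    norm_num
  have h5 : (τ : ℂ)⁻¹ = conj (τ : ℂ) / (‖(τ : ℂ)‖ : ℂ) ^ 2 := by
    rw [← Complex.mul_conj' (τ : ℂ)]
    have : conj (τ : ℂ) ≠ 0 := by simpa using hτ
    field_simp
  rw [h3, h4, h5]
  have h6 : (‖(τ : ℂ)‖ : ℂ) ≠ 0 := by exact_mod_cast hτn.ne'
  push_cast
  simp only [repSum]
  field_simp

/-- This is what makes the integral unfold. The induction combines the cases of the two generators
through the cocycle rule for `cτ + d`. -/
theorem thetaPairing_word {γ : SL(2, ℤ)} {A : (V → ℂ) → (V → ℂ)} (hA : WeilWord Q N (-2) γ A)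
    (φ : V → ℂ) (τ : ℍ) :
    thetaPairing Q P N g (A φ) (γ • τ) = (autFactor γ τ)⁻¹ * thetaPairing Q P N g φ τ := by
  induction hA with
  | one => simp [autFactor_one]
  | S_mul _ ih =>
    rw [Function.comp_apply, mul_smul, thetaPairing_S h hr hg, ih, autFactor_mul, autFactor_S,
      mul_inv]
    ring
  | T_mul _ ih =>
    rw [Function.comp_apply, mul_smul, thetaPairing_T h hr hg, ih, autFactor_mul, autFactor_T,
      one_mul]

omit h hr hg in
theorem thetaPairing_const_mul (c : ℂ) (φ : V → ℂ) (τ : ℍ) :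
    thetaPairing Q P N g (fun x => c * φ x) τ = c * thetaPairing Q P N g φ τ := by
  rw [thetaPairing, thetaPairing, ← mul_assoc, mul_finsum]
  congr 1
  exact finsum_congr fun p => by ring

/-- The pairing with a summand of the Eisenstein series. -/
theorem thetaPairing_eisTerm (γ : SL(2, ℤ)) (s : ℂ) (τ : ℍ) :
    thetaPairing Q P N g (eisTerm Q N τ s γ) τ =
      (((γ • τ).im : ℝ) : ℂ) ^ (s / 2) * thetaPairing Q P N g (charFun N) (γ • τ) := by
  -- The Eisenstein summand involves `ρ(γ⁻¹)`, so equivariance is applied to a word for `γ⁻¹` at the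
  -- point `γτ`.
  have h1 := thetaPairing_word h hr hg (weilRep_word Q N (-2) γ⁻¹) (charFun N) (γ • τ)
  rw [inv_smul_smul] at h1
  have h2 : autFactor γ⁻¹ (γ • τ) * autFactor γ τ = 1 := by
    rw [← autFactor_mul, inv_mul_cancel, autFactor_one]
  have h3 : eisTerm Q N τ s γ = fun x => ((autFactor γ τ)⁻¹ * (((γ • τ).im : ℝ) : ℂ) ^ (s / 2)) *
      weilRep Q N (-2) γ⁻¹ (charFun N) x := rfl
  rw [h3, thetaPairing_const_mul, h1]
  have h4 := autFactor_ne_zero γ τ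
  rw [eq_inv_of_mul_eq_one_left h2, inv_inv]
  field_simp

/-- `φ_0` picks out the trivial class of `N'/N`, and the sum over `P'/P` against theta unfolds to
one over `P' = ℤy`. -/
theorem thetaPairing_charFun (τ : ℍ) :
    thetaPairing Q P N g (charFun N) τ =
      (∑' n : ℤ, e (((Q (n • y) : ℚ) : ℂ) * τ) * conj (g τ (n • y))) *
        ((τ.im ^ (3 / 2 : ℝ) : ℝ) : ℂ) := by
  classical
  have := h.evenP.finite_disc
  have := h.evenN.finite_disc
  have := Fintype.ofFinite (Disc Q P)
  have := Fintype.ofFinite (Disc Q N)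
  rw [thetaPairing, finsum_eq_sum_of_fintype, Fintype.sum_prod_type]
  congr 1
  obtain ⟨C, hC⟩ := (hg.schwartz τ).bounded h.evenL
  have h1 := hr.sum_mul_theta τ (G := fun x => conj (g τ x)) (C := C)
    ((IsPeriodic.conj (hg.schwartz τ).2).mono h.leP) (fun x => by simpa using hC x)
  rw [tsum_congr fun n => mul_comm (e _) _, ← h1]
  refine Finset.sum_congr rfl fun p _ => ?_
  rw [Finset.sum_eq_single (0 : Disc Q N)]
  · have h2 : (0 : Disc Q N).rep ∈ N := by
      have := Disc.rep_cls_sub_mem (Q := Q) (M := N) 0 (zero_mem _)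
      rwa [sub_zero] at this
    simp only
    rw [charFun_of_mem h2, (hg.schwartz τ).2 _ _ (h.leN h2)]
    ring
  · intro n _ hn
    rw [charFun_of_notMem, mul_zero, zero_mul]
    intro hm
    apply hn
    rw [← Disc.cls_rep n, show (0 : Disc Q N) = Disc.cls 0 (zero_mem _) from rfl,
      Disc.cls_eq_iff, zero_sub]
    exact N.neg_mem hm
  · simp

end Invariance

/-- Fourier inversion on `M'/M`: the double sum collapses to the class of `-x`. -/
theorem IsEvenLattice.weilS_weilS (h : IsEvenLattice Q M) (sig : ℤ) {φ : V → ℂ}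
    (hφ : IsSchwartz Q M φ) (x : V) :
    weilS Q M sig (weilS Q M sig φ) x = e (-(sig : ℂ) / 8) ^ 2 * φ (-x) := by
  classical
  have := h.finite_disc
  have := Fintype.ofFinite (Disc Q M)
  by_cases hx : x ∈ dualLattice Q M
  · have hx' := (dualLattice Q M).neg_mem hx
    have h1 : ∀ μ : Disc Q M, e ((-polar Q μ.rep x : ℚ) : ℂ) * weilS Q M sig φ μ.rep =
        e (-(sig : ℂ) / 8) / (Real.sqrt (Fintype.card (Disc Q M)) : ℂ) *
          ∑ ν : Disc Q M, φ ν.rep * e ((polar Q (-x - ν.rep) μ.rep : ℚ) : ℂ) := by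
      intro μ
      rw [weilS_of_mem _ _ μ.rep_mem, mul_left_comm, Finset.mul_sum]
      congr 1
      refine Finset.sum_congr rfl fun ν _ => ?_
      rw [sub_eq_add_neg, QuadraticMap.polar_add_left, QuadraticMap.polar_neg_left,
        QuadraticMap.polar_neg_left, e_ratCast_add, polar_comm Q x]
      ring
    rw [weilS_of_mem _ _ hx, Finset.sum_congr rfl fun μ _ => h1 μ, ← Finset.mul_sum,
      Finset.sum_comm]
    have h2 : ∀ ν : Disc Q M, ∑ μ : Disc Q M, φ ν.rep * e ((polar Q (-x - ν.rep) μ.rep : ℚ) : ℂ) =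
        if Disc.cls (-x) hx' = ν then Fintype.card (Disc Q M) * φ (-x) else 0 := by
      intro ν
      rw [← Finset.mul_sum, h.sum_e_polar ((dualLattice Q M).sub_mem hx' ν.rep_mem)]
      have h3 : -x - ν.rep ∈ M ↔ Disc.cls (-x) hx' = ν := by
        rw [eq_comm, ← Disc.cls_eq_iff (hx := ν.rep_mem) (hy := hx'), Disc.cls_rep]
      split_ifs with h4
      · rw [charFun_of_mem (h3.2 h4), IsPeriodic.eq_of_sub_mem hφ.2 (h3.2 h4)]
        ring
      · rw [charFun_of_notMem (mt h3.1 h4)]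
        ring
    rw [Finset.sum_congr rfl fun ν _ => h2 ν, Finset.sum_ite_eq, if_pos (Finset.mem_univ _)]
    have h5 : ((Real.sqrt (Fintype.card (Disc Q M)) : ℝ) : ℂ) ^ 2 = Fintype.card (Disc Q M) := by
      rw [← Complex.ofReal_pow, Real.sq_sqrt (Nat.cast_nonneg _)]; simp
    have h6 : (Fintype.card (Disc Q M) : ℂ) ≠ 0 := by exact_mod_cast Fintype.card_ne_zero
    have h7 : ((Real.sqrt (Fintype.card (Disc Q M)) : ℝ) : ℂ) ≠ 0 := by
      intro h8; rw [h8] at h5; apply h6; rw [← h5]; simp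
    rw [← h5]
    field_simp
  · have hx' : -x ∉ dualLattice Q M := by rwa [neg_mem_iff]
    rw [weilS_of_notMem _ _ hx, hφ.1 _ hx', mul_zero]

/-- The product squares to `-1`. Both arguments lie in `(0, π)`, hence so does half their sum; the
positive imaginary part selects `i`. -/
theorem cpow_half_mul_cpow_half_S (τ : ℍ) :
    ((ModularGroup.S • τ : ℍ) : ℂ) ^ (1 / 2 : ℂ) * (τ : ℂ) ^ (1 / 2 : ℂ) = Complex.I := by
  set τ' := ModularGroup.S • τ with hτ'
  have h1 : (τ' : ℂ) * τ = -1 := by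
    rw [hτ', UpperHalfPlane.modular_S_smul]
    have := τ.ne_zero
    simp only
    field_simp
  set w := (τ' : ℂ) ^ (1 / 2 : ℂ) * (τ : ℂ) ^ (1 / 2 : ℂ) with hw
  have h2 : w ^ 2 = -1 := by rw [hw, mul_pow, cpow_half_sq, cpow_half_sq, h1]
  have h3 : 0 < w.im := by
    rw [hw, Complex.cpow_def_of_ne_zero τ'.ne_zero, Complex.cpow_def_of_ne_zero τ.ne_zero,
      ← Complex.exp_add, Complex.exp_im]
    refine mul_pos (Real.exp_pos _) ?_
    have hpos : ∀ z : ℍ, 0 < Complex.arg z ∧ Complex.arg z < Real.pi := by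
      intro z
      refine ⟨(Complex.arg_nonneg_iff.2 z.im_pos.le).lt_of_ne fun h => ?_,
        (Complex.arg_le_pi _).lt_of_ne fun h => ?_⟩
      · exact z.im_ne_zero (Complex.arg_eq_zero_iff.1 h.symm).2
      · exact z.im_ne_zero (Complex.arg_eq_pi_iff.1 h).2
    have e1 : (Complex.log τ' * (1 / 2) + Complex.log τ * (1 / 2)).im
        = (Complex.arg τ' + Complex.arg τ) / 2 := by
      rw [← add_mul, show (1 / 2 : ℂ) = ((1 / 2 : ℝ) : ℂ) by push_cast; rfl,
        Complex.im_mul_ofReal, Complex.add_im, Complex.log_im, Complex.log_im]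
      ring
    rw [e1]
    refine Real.sin_pos_of_pos_of_lt_pi ?_ ?_ <;> linarith [(hpos τ).1, (hpos τ).2, (hpos τ').1,
      (hpos τ').2]
  have h4 : (w - Complex.I) * (w + Complex.I) = 0 := by
    linear_combination h2 - Complex.I_sq
  rcases mul_eq_zero.1 h4 with h5 | h5
  · exact sub_eq_zero.1 h5
  · rw [eq_neg_of_add_eq_zero_left h5] at h3
    simp at h3
    linarith

theorem weilS_const_mul (sig : ℤ) (c : ℂ) (φ : V → ℂ) :
    weilS Q M sig (fun x => c * φ x) = fun x => c * weilS Q M sig φ x := by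
  funext x
  rw [weilS, weilS]
  split_ifs
  · rw [mul_left_comm, mul_finsum (r := c)]
    congr 1
    exact congrArg _ (funext fun μ => by ring)
  · simp

/-- The symmetry of cusp forms under `x ↦ -x`. -/
theorem IsCuspForm.neg (h : IsEvenLattice Q M) {g : ℍ → V → ℂ} (hg : IsCuspForm Q M (-1) 3 g)
    (τ : ℍ) (x : V) : g τ (-x) = g τ x := by
  have h1 : ModularGroup.S • ModularGroup.S • τ = τ := by
    rw [← mul_smul]
    have : ModularGroup.S * ModularGroup.S = (-1 : SL(2, ℤ)) := by decide
    rw [this, ModularGroup.SL_neg_smul, one_smul]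
  have h2 := congrFun (hg.map_S (ModularGroup.S • τ)) x
  rw [h1, hg.map_S τ, weilS_const_mul] at h2
  simp only [h.weilS_weilS _ (hg.schwartz τ)] at h2
  have h3 := cpow_half_mul_cpow_half_S τ
  have h4 : e (-((-1 : ℤ) : ℂ) / 8) ^ 2 = Complex.I := by
    rw [sq, ← e_add, e]
    refine Eq.trans ?_ Complex.exp_pi_div_two_mul_I
    congr 1
    push_cast; ring
  rw [h4] at h2
  rw [h2]
  -- Weight `3/2` contributes `i³` and signature `-1` contributes `e(1/8)² = i`; their product is
  -- one, so `g` is even rather than odd.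
  rw [← mul_assoc, ← mul_pow, h3, ← mul_assoc, ← pow_succ]
  simp

end Lattices

end

section

/-! ### The lattices of the modular curve -/

open QuadraticMap (polar)

theorem V.exists_mk (x : V) : ∃ a b c, x = V.mk a b c := by
  refine ⟨x.1 0 0, x.1 0 1, x.1 1 0, ?_⟩
  have h : x.1.trace = 0 := x.2
  rw [Matrix.trace_fin_two] at h
  ext i j
  fin_cases i <;> fin_cases j <;> simp [V.mk]
  linarith

theorem V.mk_inj {a b c a' b' c' : ℚ} : V.mk a b c = V.mk a' b' c' ↔ a = a' ∧ b = b' ∧ c = c' := by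
  constructor
  · intro h
    have h1 := congrArg Subtype.val h
    have h2 := fun i j => congrFun (congrFun h1 i) j
    exact ⟨by simpa [V.mk] using h2 0 0, by simpa [V.mk] using h2 0 1, by simpa [V.mk] using h2 1 0⟩
  · rintro ⟨rfl, rfl, rfl⟩; rfl

theorem V.mk_add (a b c a' b' c' : ℚ) :
    V.mk a b c + V.mk a' b' c' = V.mk (a + a') (b + b') (c + c') := by
  ext i j
  fin_cases i <;> fin_cases j <;> simp [V.mk]
  ring

theorem V.smul_mk (t a b c : ℚ) : t • V.mk a b c = V.mk (t * a) (t * b) (t * c) := by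
  ext i j
  fin_cases i <;> fin_cases j <;> simp [V.mk]

theorem V.sub_mk (a b c a' b' c' : ℚ) :
    V.mk a b c - V.mk a' b' c' = V.mk (a - a') (b - b') (c - c') := by
  rw [sub_eq_iff_eq_add, V.mk_add]; simp

variable (N : ℕ)

theorem Q_mk (a b c : ℚ) : Q N (V.mk a b c) = N * (-a ^ 2 - b * c) := by
  simp [Q, V.mk, Matrix.det_fin_two, QuadraticMap.ofPolar]
  left; ring

theorem polar_mk (a b c a' b' c' : ℚ) :
    polar (Q N) (V.mk a b c) (V.mk a' b' c') = -N * (2 * a * a' + b * c' + c * b') := by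
  rw [polar, V.mk_add, Q_mk, Q_mk, Q_mk]; ring

variable [NeZero N]

theorem natCast_ne_zero_rat : (N : ℚ) ≠ 0 := by exact_mod_cast NeZero.ne N

theorem isEvenLattice_L : IsEvenLattice (Q N) (L N) := by
  have hN := natCast_ne_zero_rat N
  have he : ∀ i, (![V.mk 1 0 0, V.mk 0 (-1 / N) 0, V.mk 0 0 1] : Fin 3 → V) i ∈ L N := by
    intro i
    fin_cases i
    · exact ⟨0, 1, 0, by simp⟩
    · exact ⟨1, 0, 0, by simp⟩
    · exact ⟨0, 0, 1, by simp⟩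
  have hspan : ∀ x : V, x ∈ Submodule.span ℚ (L N : Set V) := by
    intro x
    obtain ⟨a, b, c, rfl⟩ := x.exists_mk
    have : V.mk a b c = a • V.mk 1 0 0 + (-N * b) • V.mk 0 (-1 / N) 0 + c • V.mk 0 0 1 := by
      simp only [V.smul_mk, V.mk_add, V.mk_inj]
      refine ⟨by ring, by field_simp; ring, by ring⟩
    rw [this]
    refine Submodule.add_mem _ (Submodule.add_mem _ ?_ ?_) ?_ <;>
      refine Submodule.smul_mem _ _ (Submodule.subset_span ?_)
    exacts [he 0, he 1, he 2]
  refine isEvenLattice_of_dualBasis (n := 3)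
    (e := ![V.mk 1 0 0, V.mk 0 (-1 / N) 0, V.mk 0 0 1])
    (f := ![V.mk (-1 / (2 * N)) 0 0, V.mk 0 0 1, V.mk 0 (-1 / N) 0]) ?_ he ?_ ?_ ?_
  · rintro _ ⟨a, b, c, rfl⟩
    refine ⟨a * c - N * b ^ 2, ?_⟩
    rw [Q_mk]; push_cast; field_simp; ring
  · intro i
    refine ⟨hspan _, ?_⟩
    rintro _ ⟨a, b, c, rfl⟩
    fin_cases i
    · exact ⟨b, by simp [polar_mk]; field_simp⟩
    · exact ⟨a, by simp [polar_mk]; field_simp⟩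
    · exact ⟨c, by simp [polar_mk]; field_simp⟩
  · intro x _
    obtain ⟨a, b, c, rfl⟩ := x.exists_mk
    simp only [Fin.sum_univ_three, Matrix.cons_val_zero, Matrix.cons_val_one, Matrix.cons_val,
      polar_mk, V.smul_mk, V.mk_add, V.mk_inj]
    refine ⟨by field_simp; ring, by field_simp; ring, by field_simp; ring⟩
  · intro x _
    obtain ⟨a, b, c, rfl⟩ := x.exists_mk
    simp only [Fin.sum_univ_three, Matrix.cons_val_zero, Matrix.cons_val_one, Matrix.cons_val,
      polar_mk, V.smul_mk, V.mk_add, V.mk_inj]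
    refine ⟨by field_simp; ring, by field_simp; ring, by field_simp; ring⟩

theorem span_L (x : V) : x ∈ Submodule.span ℚ (L N : Set V) := by
  have hN := natCast_ne_zero_rat N
  obtain ⟨a, b, c, rfl⟩ := x.exists_mk
  have : V.mk a b c = a • V.mk 1 0 0 + (-N * b) • V.mk 0 (-1 / N) 0 + c • V.mk 0 0 1 := by
    simp only [V.smul_mk, V.mk_add, V.mk_inj]
    refine ⟨by ring, by field_simp; ring, by ring⟩
  rw [this]
  refine Submodule.add_mem _ (Submodule.add_mem _ ?_ ?_) ?_ <;>
    refine Submodule.smul_mem _ _ (Submodule.subset_span ?_)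
  exacts [⟨0, 1, 0, by simp⟩, ⟨1, 0, 0, by simp⟩, ⟨0, 0, 1, by simp⟩]

theorem mem_dual_L_iff (a b c : ℚ) : V.mk a b c ∈ dualLattice (Q N) (L N) ↔
    (∃ k : ℤ, 2 * N * a = k) ∧ (∃ k : ℤ, N * b = k) ∧ ∃ k : ℤ, c = k := by
  have hN := natCast_ne_zero_rat N
  constructor
  · rintro ⟨-, h⟩
    obtain ⟨k₁, h₁⟩ := h (V.mk 1 0 0) ⟨0, 1, 0, by simp⟩
    obtain ⟨k₂, h₂⟩ := h (V.mk 0 (-1 / N) 0) ⟨1, 0, 0, by simp⟩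
    obtain ⟨k₃, h₃⟩ := h (V.mk 0 0 1) ⟨0, 0, 1, by simp⟩
    rw [polar_mk] at h₁ h₂ h₃
    refine ⟨⟨-k₁, ?_⟩, ⟨-k₃, ?_⟩, ⟨k₂, ?_⟩⟩
    · push_cast; rw [← h₁]; ring
    · push_cast; rw [← h₃]; ring
    · rw [← h₂]; field_simp; ring
  · rintro ⟨⟨k₁, h₁⟩, ⟨k₂, h₂⟩, ⟨k₃, h₃⟩⟩
    refine ⟨span_L N _, ?_⟩
    rintro _ ⟨a', b', c', rfl⟩
    refine ⟨-k₁ * b' - k₂ * c' + k₃ * a', ?_⟩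
    rw [polar_mk]; push_cast; rw [← h₁, ← h₂, ← h₃]; field_simp; ring

/-- The data of a CM point: `D < 0` and `D = r² + 4NC`. -/
structure IsCMDatum (N : ℕ) (D r C : ℤ) : Prop where
  neg : D < 0
  eq : D = r ^ 2 + 4 * N * C

namespace IsCMDatum

variable {N} {D r C : ℤ} (h : IsCMDatum N D r C)
include h

theorem eq_rat : (D : ℚ) = r ^ 2 + 4 * N * C := by exact_mod_cast h.eq

theorem ne_zero_rat : (D : ℚ) ≠ 0 := by exact_mod_cast h.neg.ne

theorem xvec_eq : xvec N D r = V.mk (r / (2 * N)) (1 / N) C := by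
  have hN := natCast_ne_zero_rat N
  rw [xvec, V.mk_inj, h.eq_rat]
  refine ⟨rfl, rfl, ?_⟩
  field_simp; ring

theorem polar_xvec (a b c : ℚ) :
    polar (Q N) (xvec N D r) (V.mk a b c) = -(r * a + c + N * C * b) := by
  have hN := natCast_ne_zero_rat N
  rw [h.xvec_eq, polar_mk]; field_simp

theorem Q_xvec : Q N (xvec N D r) = -D / (4 * N) := by
  have hN := natCast_ne_zero_rat N
  rw [h.xvec_eq, Q_mk, h.eq_rat]; field_simp; ring

theorem Q_xvec_pos : 0 < Q N (xvec N D r) := by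
  have h1 : (0 : ℚ) < -D := by have := h.neg; exact_mod_cast neg_pos.2 this
  have h2 : (0 : ℚ) < N := by exact_mod_cast NeZero.pos N
  rw [h.Q_xvec]; positivity

/-- Upper right entries of `L'` lie in `(1/N)ℤ` and that of `x` is `1/N`, which forces `q` to be
integral: `x` is primitive in `L'`. -/
theorem smul_xvec_mem_dual_iff (q : ℚ) :
    q • xvec N D r ∈ dualLattice (Q N) (L N) ↔ ∃ k : ℤ, q = k := by
  have hN := natCast_ne_zero_rat N
  rw [h.xvec_eq, V.smul_mk, mem_dual_L_iff]
  constructor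
  · rintro ⟨-, ⟨k, hk⟩, -⟩
    exact ⟨k, by rw [← hk]; field_simp⟩
  · rintro ⟨k, rfl⟩
    exact ⟨⟨k * r, by push_cast; field_simp⟩, ⟨k, by field_simp⟩, ⟨k * C, by push_cast; ring⟩⟩

theorem xvec_sub_mu_mem : xvec N D r - mu N r ∈ L N := by
  rw [h.xvec_eq, mu, V.sub_mk]
  exact ⟨-1, 0, C, by rw [V.mk_inj]; simp⟩

/-- A basis of `U`; it is also a basis of `𝒩`. -/
theorem mem_U_iff (x : V) : x ∈ U N D r ↔
    ∃ α β : ℚ, x = α • V.mk 1 0 (-r) + β • V.mk 0 (-1 / N) C := by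
  have hN := natCast_ne_zero_rat N
  obtain ⟨a, b, c, rfl⟩ := x.exists_mk
  have : V.mk a b c ∈ U N D r ↔ polar (Q N) (xvec N D r) (V.mk a b c) = 0 := Iff.rfl
  rw [this, h.polar_xvec]
  simp only [V.smul_mk, V.mk_add, V.mk_inj]
  constructor
  · intro h1
    refine ⟨a, -N * b, by ring, by field_simp; ring, by linear_combination -h1⟩
  · rintro ⟨α, β, rfl, rfl, rfl⟩
    field_simp; ring

theorem mem_latN_iff (x : V) : x ∈ latN N D r ↔
    ∃ α β : ℤ, x = (α : ℚ) • V.mk 1 0 (-r) + (β : ℚ) • V.mk 0 (-1 / N) C := by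
  have hN := natCast_ne_zero_rat N
  rw [latN, AddSubgroup.mem_inf, Submodule.mem_toAddSubgroup, h.mem_U_iff]
  constructor
  · rintro ⟨⟨a, b, c, rfl⟩, α, β, h1⟩
    refine ⟨b, a, ?_⟩
    simp only [V.smul_mk, V.mk_add, V.mk_inj] at h1 ⊢
    obtain ⟨h1, h2, h3⟩ := h1
    have h4 : (a : ℚ) = β := by field_simp at h2; linarith
    refine ⟨by ring, by ring, ?_⟩
    rw [h3, h4, show (b : ℚ) = α by linarith]
  · rintro ⟨α, β, rfl⟩
    refine ⟨⟨β, α, -α * r + β * C, ?_⟩, α, β, rfl⟩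
    simp only [V.smul_mk, V.mk_add, V.mk_inj]
    push_cast
    refine ⟨by ring, by ring, by ring⟩

theorem span_latN (x : V) : x ∈ Submodule.span ℚ (latN N D r : Set V) ↔ x ∈ U N D r := by
  constructor
  · intro hx
    exact Submodule.span_le.2 (fun y hy => hy.2) hx
  · intro hx
    obtain ⟨α, β, rfl⟩ := (h.mem_U_iff x).1 hx
    refine Submodule.add_mem _ ?_ ?_ <;> refine Submodule.smul_mem _ _ (Submodule.subset_span ?_)
    · exact (h.mem_latN_iff _).2 ⟨1, 0, by simp⟩
    · exact (h.mem_latN_iff _).2 ⟨0, 1, by simp⟩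

theorem isEvenLattice_latN : IsEvenLattice (Q N) (latN N D r) := by
  have hN := natCast_ne_zero_rat N
  have hD := h.ne_zero_rat
  have hDe := h.eq_rat
  -- The coefficients of the dual basis are the rows of the inverse of the Gram matrix `[[-2N, -r],
  -- [-r, 2C]]`, whose determinant is `-D`.
  refine isEvenLattice_of_dualBasis (n := 2)
    (e := ![V.mk 1 0 (-r), V.mk 0 (-1 / N) C])
    (f := ![(-2 * C / D : ℚ) • V.mk 1 0 (-r) + (-r / D : ℚ) • V.mk 0 (-1 / N) C,
      (-r / D : ℚ) • V.mk 1 0 (-r) + (2 * N / D : ℚ) • V.mk 0 (-1 / N) C]) ?_ ?_ ?_ ?_ ?_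
  · intro x hx
    exact (isEvenLattice_L N).int x hx.1
  · intro i
    fin_cases i
    · exact (h.mem_latN_iff _).2 ⟨1, 0, by simp⟩
    · exact (h.mem_latN_iff _).2 ⟨0, 1, by simp⟩
  · intro i
    constructor
    · rw [h.span_latN, h.mem_U_iff]
      fin_cases i
      · exact ⟨_, _, rfl⟩
      · exact ⟨_, _, rfl⟩
    · intro x hx
      obtain ⟨α, β, rfl⟩ := (h.mem_latN_iff _).1 hx
      fin_cases i
      · refine ⟨α, ?_⟩
        simp only [V.smul_mk, V.mk_add, Matrix.cons_val_zero, Fin.zero_eta, polar_mk]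
        field_simp
        rw [hDe]; ring
      · refine ⟨β, ?_⟩
        simp only [V.smul_mk, V.mk_add, Matrix.cons_val_one, Fin.mk_one, polar_mk, Matrix.cons_val]
        field_simp
        rw [hDe]; ring
  · intro x hx
    rw [h.span_latN, h.mem_U_iff] at hx
    obtain ⟨α, β, rfl⟩ := hx
    simp only [Fin.sum_univ_two, Matrix.cons_val_zero, Matrix.cons_val_one,
      polar_mk, V.smul_mk, V.mk_add, V.mk_inj]
    refine ⟨?_, ?_, ?_⟩ <;> field_simp <;> rw [hDe] <;> ring
  · intro x hx
    rw [h.span_latN, h.mem_U_iff] at hx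
    obtain ⟨α, β, rfl⟩ := hx
    simp only [Fin.sum_univ_two, Matrix.cons_val_zero, Matrix.cons_val_one,
      polar_mk, V.smul_mk, V.mk_add, V.mk_inj]
    refine ⟨?_, ?_, ?_⟩ <;> field_simp <;> rw [hDe] <;> ring

/-- For `qx ∈ L` the entry `1/N` forces `q ∈ ℤ`, and the diagonal entry forces `2N ∣ qr`; the least
positive such `q` is `2N/gcd(2N, r)`. -/
theorem mem_latP_iff (x : V) : x ∈ latP N D r ↔
    ∃ n : ℤ, x = ((n * (2 * N / Int.gcd (2 * N) r : ℤ) : ℤ) : ℚ) • xvec N D r := by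
  have hN := natCast_ne_zero_rat N
  have hN' : (N : ℤ) ≠ 0 := by exact_mod_cast NeZero.ne N
  have hg : (Int.gcd (2 * N) r : ℤ) ≠ 0 := by
    rw [Int.natCast_ne_zero, Ne, Int.gcd_eq_zero_iff]
    rintro ⟨h1, -⟩
    exact hN' (by linarith)
  obtain ⟨u, hu⟩ : (Int.gcd (2 * N) r : ℤ) ∣ 2 * N := Int.gcd_dvd_left ..
  obtain ⟨v, hv⟩ : (Int.gcd (2 * N) r : ℤ) ∣ r := Int.gcd_dvd_right ..
  have hu' : (2 * N / Int.gcd (2 * N) r : ℤ) = u := Int.ediv_eq_of_eq_mul_right hg hu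
  have hcop : IsCoprime u v := by
    rw [Int.isCoprime_iff_gcd_eq_one]
    have h1 : (2 * N / Int.gcd (2 * N) r : ℤ).gcd (r / Int.gcd (2 * N) r) = 1 :=
      Int.gcd_ediv_gcd_ediv_gcd (Int.gcd_pos_iff.2 (Or.inl (by
        intro h1; exact hN' (by linarith))))
    rwa [hu', Int.ediv_eq_of_eq_mul_right hg hv] at h1
  set G := (Int.gcd (2 * N) r : ℤ) with hG
  have hGq : (G : ℚ) ≠ 0 := by exact_mod_cast hg
  have huq : (2 * N : ℚ) = G * u := by exact_mod_cast hu
  have hvq : (r : ℚ) = G * v := by exact_mod_cast hv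
  have hu0 : (u : ℚ) ≠ 0 := by
    rintro h0; rw [h0, mul_zero] at huq; exact hN (by linarith)
  rw [hu', latP, AddSubgroup.mem_inf, Submodule.mem_toAddSubgroup, Submodule.mem_span_singleton]
  have hcoord : (r / (2 * N) : ℚ) = v / u := by
    rw [huq, hvq]; field_simp
  constructor
  · rintro ⟨⟨a, b, c, h1⟩, q, h2⟩
    rw [← h2, h.xvec_eq, V.smul_mk, V.mk_inj, hcoord] at h1
    obtain ⟨h3, h4, -⟩ := h1
    have h5 : q = ((-a : ℤ) : ℚ) := by push_cast; field_simp at h4; linarith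
    have h6 : -a * v = b * u := by
      rw [h5] at h3
      field_simp at h3
      rw [mul_comm b]
      exact_mod_cast h3
    obtain ⟨n, hn⟩ : u ∣ -a := hcop.dvd_of_dvd_mul_right ⟨b, by rw [h6]; ring⟩
    exact ⟨n, by rw [← h2, h5, hn, mul_comm]⟩
  · rintro ⟨n, rfl⟩
    refine ⟨⟨-(n * u), n * v, n * u * C, ?_⟩, _, rfl⟩
    rw [h.xvec_eq, V.smul_mk, V.mk_inj, hcoord]
    push_cast
    refine ⟨by field_simp, by ring, by ring⟩

omit h in
theorem level_div_gcd_pos : 0 < (2 * N / Int.gcd (2 * N) r : ℤ) := by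
  have hN' : 0 < (2 * N : ℤ) := by have := NeZero.pos N; positivity
  refine Int.ediv_pos_of_pos_of_dvd hN' (by positivity) (Int.gcd_dvd_left ..)

/-- The lattice `𝒫` has rank one; the intersection of its dual with `L'` is generated by `x`. -/
theorem exists_isRankOne : ∃ (y : V) (K : ℕ) (k : ℤ), IsRankOne (Q N) (latP N D r) y K ∧
    k ≠ 0 ∧ k • y = xvec N D r ∧ ∀ n : ℤ, n • y ∈ dualLattice (Q N) (L N) ↔ k ∣ n := by
  have hN := natCast_ne_zero_rat N
  have hx0 := h.Q_xvec_pos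
  set x := xvec N D r with hx
  set t : ℤ := (2 * N / Int.gcd (2 * N) r : ℤ) with ht
  have htpos : 0 < t := level_div_gcd_pos
  have htq : (0 : ℚ) < t := by exact_mod_cast htpos
  have hmem := h.mem_latP_iff
  rw [← ht, ← hx] at hmem
  have hxL : x ∈ dualLattice (Q N) (L N) := by
    have := (h.smul_xvec_mem_dual_iff 1).2 ⟨1, by simp⟩
    rwa [one_smul] at this
  have htx : (t : ℚ) • x ∈ latP N D r := (hmem _).2 ⟨1, by simp⟩
  -- As `tx` generates `P` and `k = (x, tx)`, the dual of `P` is generated by `y = x/k`; then `(y,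
  -- y) = 1/(kt)`, which gives `K = kt`.
  obtain ⟨k, hk⟩ := polar_int_of_mem hxL htx.1
  rw [QuadraticMap.polar_smul_right, QuadraticMap.polar_self, smul_eq_mul, two_smul] at hk
  have hkpos : (0 : ℚ) < k := by rw [← hk]; positivity
  have hkpos' : 0 < k := by exact_mod_cast hkpos
  have hK : ((k * t).toNat : ℤ) = k * t := Int.toNat_of_nonneg (by positivity)
  have hKq : (((k * t).toNat : ℕ) : ℚ) = k * t := by exact_mod_cast hK
  have hspan : ∀ v, v ∈ Submodule.span ℚ (latP N D r : Set V) ↔ ∃ q : ℚ, v = q • x := by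
    intro v
    constructor
    · intro hv
      have h1 : v ∈ Submodule.span ℚ {x} := Submodule.span_le.2 (fun y hy => hy.2) hv
      obtain ⟨q, hq⟩ := Submodule.mem_span_singleton.1 h1
      exact ⟨q, hq.symm⟩
    · rintro ⟨q, rfl⟩
      have h1 : q • x = (q / t) • ((t : ℚ) • x) := by
        rw [smul_smul]; congr 1; field_simp
      rw [h1]
      exact Submodule.smul_mem _ _ (Submodule.subset_span htx)
  have hdual : ∀ v, v ∈ dualLattice (Q N) (latP N D r) ↔ ∃ n : ℤ, v = n • ((k : ℚ)⁻¹ • x) := by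
    intro v
    constructor
    · rintro ⟨h1, h2⟩
      obtain ⟨q, rfl⟩ := (hspan v).1 h1
      obtain ⟨n, hn⟩ := h2 _ htx
      rw [QuadraticMap.polar_smul_left, QuadraticMap.polar_smul_right, QuadraticMap.polar_self,
        smul_eq_mul, smul_eq_mul, two_smul, hk] at hn
      refine ⟨n, ?_⟩
      rw [← Int.cast_smul_eq_zsmul ℚ, smul_smul, ← hn]
      congr 1; field_simp
    · rintro ⟨n, rfl⟩
      rw [← Int.cast_smul_eq_zsmul ℚ, smul_smul]
      refine ⟨(hspan _).2 ⟨_, rfl⟩, fun w hw => ?_⟩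
      obtain ⟨m, rfl⟩ := (hmem w).1 hw
      refine ⟨n * m, ?_⟩
      rw [QuadraticMap.polar_smul_left, QuadraticMap.polar_smul_right, QuadraticMap.polar_self,
        smul_eq_mul, smul_eq_mul, two_smul]
      push_cast
      have : (m * t : ℚ) * (Q N x + Q N x) = m * k := by rw [← hk]; ring
      rw [this]; field_simp
  have hkQ : 2 * t * Q N x = k := by rw [← hk]; ring
  refine ⟨(k : ℚ)⁻¹ • x, (k * t).toNat, k, ⟨?_, ?_, hdual, ?_, ?_⟩, hkpos'.ne', ?_, ?_⟩
  · have : 0 < k * t := by positivity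
    omega
  · intro v
    rw [hmem]
    refine exists_congr fun n => ?_
    rw [← Int.cast_smul_eq_zsmul ℚ, smul_smul, hK]
    push_cast
    rw [show (n * (k * t) : ℚ) * (k : ℚ)⁻¹ = n * t by field_simp]
  · rw [QuadraticMap.map_smul, hKq, smul_eq_mul]
    field_simp
    linarith
  · refine isEvenLattice_of_dualBasis (n := 1) (e := ![(t : ℚ) • x]) (f := ![(k : ℚ)⁻¹ • x])
      (fun v hv => (isEvenLattice_L N).int v hv.1) ?_ ?_ ?_ ?_
    · intro i; fin_cases i; exact htx
    · intro i; fin_cases i; exact (hdual _).2 ⟨1, by simp⟩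
    · intro v hv
      obtain ⟨q, rfl⟩ := (hspan v).1 hv
      simp only [Fin.sum_univ_one, Matrix.cons_val_zero, QuadraticMap.polar_smul_left,
        QuadraticMap.polar_smul_right, QuadraticMap.polar_self, smul_smul, smul_eq_mul, two_smul]
      congr 1; field_simp; rw [← hkQ]; ring
    · intro v hv
      obtain ⟨q, rfl⟩ := (hspan v).1 hv
      simp only [Fin.sum_univ_one, Matrix.cons_val_zero, QuadraticMap.polar_smul_left,
        QuadraticMap.polar_smul_right, QuadraticMap.polar_self, smul_smul, smul_eq_mul, two_smul]
      congr 1; field_simp; rw [← hkQ]; ring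
  · rw [← Int.cast_smul_eq_zsmul ℚ, smul_smul, mul_inv_cancel₀ hkpos.ne', one_smul]
  · intro n
    rw [← Int.cast_smul_eq_zsmul ℚ, smul_smul, h.smul_xvec_mem_dual_iff]
    constructor
    · rintro ⟨m, hm⟩
      refine ⟨m, ?_⟩
      field_simp at hm
      exact_mod_cast hm
    · rintro ⟨m, rfl⟩
      refine ⟨m, ?_⟩
      push_cast; field_simp

/-- Orthogonal projection to `ℚx` and to `U` splits a vector of `L'`. Each component pairs
integrally with its lattice, because the whole vector does and the other component is orthogonal to
it. -/
theorem isSplit : IsSplit (Q N) (latP N D r) (latN N D r) (L N) := by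
  have hx0 := h.Q_xvec_pos
  obtain ⟨y, K, k, hr, -⟩ := h.exists_isRankOne
  have horth : ∀ p ∈ Submodule.span ℚ (latP N D r : Set V),
      ∀ n ∈ Submodule.span ℚ (latN N D r : Set V), polar (Q N) p n = 0 := by
    intro p hp n hn
    have h1 : p ∈ Submodule.span ℚ {xvec N D r} := Submodule.span_le.2 (fun y hy => hy.2) hp
    obtain ⟨q, rfl⟩ := Submodule.mem_span_singleton.1 h1
    rw [h.span_latN] at hn
    have h2 : polar (Q N) (xvec N D r) n = 0 := hn
    rw [QuadraticMap.polar_smul_left, h2, smul_zero]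
  refine ⟨hr.even, h.isEvenLattice_latN, isEvenLattice_L N, inf_le_left, inf_le_left, horth, ?_⟩
  intro v hv
  set x := xvec N D r with hx
  set c : ℚ := polar (Q N) v x / (2 * Q N x) with hc
  have hspanP : x ∈ Submodule.span ℚ (latP N D r : Set V) := by
    have h1 : ((2 * N / Int.gcd (2 * N) r : ℤ) : ℚ) • x ∈ latP N D r :=
      (h.mem_latP_iff _).2 ⟨1, by simp [hx]⟩
    have h2 : ((2 * N / Int.gcd (2 * N) r : ℤ) : ℚ) ≠ 0 := by
      exact_mod_cast level_div_gcd_pos.ne'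
    have h3 := Submodule.smul_mem _ (((2 * N / Int.gcd (2 * N) r : ℤ) : ℚ)⁻¹)
      (Submodule.subset_span (R := ℚ) h1)
    rwa [smul_smul, inv_mul_cancel₀ h2, one_smul] at h3
  have hU : v - c • x ∈ U N D r := by
    have : polar (Q N) x (v - c • x) = 0 := by
      rw [sub_eq_add_neg, QuadraticMap.polar_add_right, QuadraticMap.polar_neg_right,
        QuadraticMap.polar_smul_right, QuadraticMap.polar_self, hc, polar_comm (Q N) x v,
        smul_eq_mul, two_smul]
      field_simp; ring
    exact this
  have hUs := (h.span_latN _).2 hU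
  refine ⟨c • x, ⟨Submodule.smul_mem _ _ hspanP, fun l hl => ?_⟩, v - c • x,
    ⟨hUs, fun l hl => ?_⟩, by abel⟩
  · obtain ⟨m, hm⟩ := polar_int_of_mem hv hl.1
    refine ⟨m, ?_⟩
    have h1 := horth l (Submodule.subset_span hl) _ hUs
    rw [polar_comm, sub_eq_add_neg, QuadraticMap.polar_add_left, QuadraticMap.polar_neg_left,
      hm] at h1
    linarith
  · obtain ⟨m, hm⟩ := polar_int_of_mem hv hl.1
    refine ⟨m, ?_⟩
    rw [sub_eq_add_neg, QuadraticMap.polar_add_left, QuadraticMap.polar_neg_left,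
      horth _ (Submodule.smul_mem _ _ hspanP) l (Submodule.subset_span hl), hm]
    ring

end IsCMDatum

end

section

section Lattices

variable {V : Type} [AddCommGroup V] [Module ℚ V] {Q : QuadraticForm ℚ V} {M : AddSubgroup V}

open QuadraticMap (polar)

open UpperHalfPlane (ofComplex)

/-! ### Estimates for cusp forms -/

namespace IsCuspForm

variable {sig : ℤ} {w : ℕ} {g : ℍ → V → ℂ} (hg : IsCuspForm Q M sig w g)

include hg

theorem mdifferentiable (x : V) :
    MDifferentiable (modelWithCornersSelf ℂ ℂ) (modelWithCornersSelf ℂ ℂ) fun τ => g τ x :=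
  UpperHalfPlane.mdifferentiable_iff.2 (hg.holo x)

theorem continuous (x : V) : Continuous fun τ => g τ x := (hg.mdifferentiable x).continuous

theorem vadd_one (τ : ℍ) (x : V) : g ((1 : ℝ) +ᵥ τ) x = e ((Q x : ℚ) : ℂ) * g τ x := by
  rw [hg.map_T]; rfl

theorem vadd_nat (n : ℕ) (τ : ℍ) (x : V) :
    g ((n : ℝ) +ᵥ τ) x = e ((n * Q x : ℚ) : ℂ) * g τ x := by
  induction n with
  | zero => simp
  | succ n ih =>
    have h1 : ((n + 1 : ℕ) : ℝ) +ᵥ τ = (1 : ℝ) +ᵥ ((n : ℝ) +ᵥ τ) := by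
      rw [vadd_vadd]; congr 1; push_cast; ring
    rw [h1, hg.vadd_one, ih, ← mul_assoc, ← e_ratCast_add]
    congr 3; push_cast; ring

theorem vadd_den (τ : ℍ) (x : V) : g (((Q x).den : ℝ) +ᵥ τ) x = g τ x := by
  rw [hg.vadd_nat, e_ratCast_of_int, one_mul]
  exact ⟨(Q x).num, by rw [mul_comm]; exact Rat.mul_den_eq_num _⟩

omit hg in
theorem ofComplex_add_real (t : ℝ) {z : ℂ} (hz : 0 < z.im) :
    ofComplex (z + t) = t +ᵥ ofComplex z := by
  have h1 : 0 < (z + t).im := by simpa using hz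
  rw [UpperHalfPlane.ofComplex_apply_of_im_pos h1, UpperHalfPlane.ofComplex_apply_of_im_pos hz]
  ext
  simp [add_comm]

theorem periodic (x : V) : Function.Periodic ((fun τ => g τ x) ∘ ofComplex) ((Q x).den : ℝ) := by
  intro z
  simp only [Function.comp_apply]
  by_cases hz : 0 < z.im
  · rw [ofComplex_add_real _ hz, hg.vadd_den]
  · rw [UpperHalfPlane.ofComplex_apply_of_im_nonpos (w := z) (not_lt.1 hz),
      UpperHalfPlane.ofComplex_apply_of_im_nonpos (w := z + _) (by simpa using hz)]

/-- Exponential decay at the cusp. -/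
theorem exists_exp_bound (x : V) : ∃ C c : ℝ, 0 < c ∧ ∀ τ : ℍ, 1 / 2 ≤ τ.im →
    ‖g τ x‖ ≤ C * Real.exp (-c * τ.im) := by
  have hden : (0 : ℝ) < (Q x).den := by exact_mod_cast (Q x).den_pos
  have h1 := (hg.cusp x).exp_decay_atImInfty hden (hg.periodic x) (hg.mdifferentiable x)
    (hg.cusp x).isBoundedAtImInfty
  obtain ⟨C₁, hC₁⟩ := h1.bound
  obtain ⟨A, hA⟩ := UpperHalfPlane.atImInfty_mem _ |>.1 hC₁
  set c : ℝ := 2 * Real.pi / (Q x).den with hc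
  have hcpos : 0 < c := by positivity
  -- Below the height where the decay of the `q`-expansion sets in, periodicity reduces everything
  -- to a compact rectangle, where continuity suffices.
  have hcomp : IsCompact ((fun p : ℝ × ℝ => g (ofComplex (p.1 + p.2 * Complex.I)) x) ''
      (Set.Icc 0 ((Q x).den : ℝ) ×ˢ Set.Icc (1 / 2) (max A 1))) := by
    refine (isCompact_Icc.prod isCompact_Icc).image_of_continuousOn ?_
    have h2 : ContinuousOn (fun z : ℂ => g (ofComplex z) x) {z | 0 < z.im} :=
      (hg.holo x).continuousOn
    refine h2.comp (by fun_prop) ?_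
    rintro ⟨u, v⟩ ⟨-, hv⟩
    simp only [Set.mem_ofPred_eq]
    simp
    linarith [hv.1]
  obtain ⟨C₂, hC₂⟩ := hcomp.isBounded.exists_norm_le
  have hC₂' : ∀ u ∈ Set.Icc 0 ((Q x).den : ℝ), ∀ v ∈ Set.Icc (1 / 2) (max A 1),
      ‖g (ofComplex (u + v * Complex.I)) x‖ ≤ C₂ := fun u hu v hv =>
    hC₂ _ ⟨(u, v), ⟨hu, hv⟩, rfl⟩
  refine ⟨max C₁ (C₂ * Real.exp (c * max A 1)), c, hcpos, fun τ hτ => ?_⟩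
  by_cases hτA : A ≤ τ.im
  · have h3 := hA τ hτA
    simp only [Set.mem_ofPred_eq] at h3
    rw [Real.norm_of_nonneg (Real.exp_pos _).le] at h3
    have h4 : -2 * Real.pi * τ.im / (Q x).den = -c * τ.im := by rw [hc]; ring
    rw [h4] at h3
    exact h3.trans (mul_le_mul_of_nonneg_right (le_max_left _ _) (Real.exp_pos _).le)
  · have hper : ∀ n : ℤ, g τ x = g (ofComplex ((τ : ℂ) - (n * (Q x).den : ℝ))) x := by
      intro n
      have h5 := (hg.periodic x).sub_zsmul_eq n (x := (τ : ℂ))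
      simp only [Function.comp_apply, UpperHalfPlane.ofComplex_apply] at h5
      rw [← h5]
      congr 3
      simp
    set n : ℤ := ⌊τ.re / (Q x).den⌋
    have hn1 := Int.floor_le (τ.re / (Q x).den)
    have hn2 := (Int.lt_floor_add_one (τ.re / (Q x).den)).le
    rw [le_div_iff₀ hden] at hn1
    rw [div_le_iff₀ hden] at hn2
    have h6 : (τ : ℂ) - (n * (Q x).den : ℝ) = ((τ.re - n * (Q x).den : ℝ) : ℂ) +
        (τ.im : ℂ) * Complex.I := by
      apply Complex.ext <;> simp
    have h7 : ‖g τ x‖ ≤ C₂ := by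
      rw [hper n, h6]
      refine hC₂' _ ⟨by linarith, by linarith⟩ _ ⟨hτ, ?_⟩
      exact (not_le.1 hτA).le.trans (le_max_left _ _)
    have hC₂0 : 0 ≤ C₂ := (norm_nonneg _).trans h7
    have h8 : C₂ ≤ C₂ * Real.exp (c * max A 1) * Real.exp (-c * τ.im) := by
      rw [mul_assoc, ← Real.exp_add]
      refine le_mul_of_one_le_right hC₂0 (Real.one_le_exp ?_)
      have : τ.im ≤ max A 1 := (not_le.1 hτA).le.trans (le_max_left _ _)
      nlinarith
    exact (h7.trans h8).trans
      (mul_le_mul_of_nonneg_right (le_max_right _ _) (Real.exp_pos _).le)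

/-- The invariant height of a cusp form. -/
theorem sum_norm_sq_smul (h : IsEvenLattice Q M) [Fintype (Disc Q M)] (γ : SL(2, ℤ)) (τ : ℍ) :
    (γ • τ).im ^ ((w : ℝ) / 2) * ∑ μ : Disc Q M, ‖g (γ • τ) μ.rep‖ ^ 2 =
      τ.im ^ ((w : ℝ) / 2) * ∑ μ : Disc Q M, ‖g τ μ.rep‖ ^ 2 := by
  obtain ⟨A, hA⟩ := exists_weilWord Q M sig γ
  induction hA with
  | one => simp
  | @S_mul γ A _ ih =>
    rw [mul_smul, ← ih]
    set τ' := γ • τ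
    have hτ' : 0 < ‖(τ' : ℂ)‖ := norm_pos_iff.2 τ'.ne_zero
    have h1 : ∀ μ : Disc Q M, ‖g (ModularGroup.S • τ') μ.rep‖ ^ 2 =
        ‖(τ' : ℂ)‖ ^ w * ‖weilS Q M sig (g τ') μ.rep‖ ^ 2 := by
      intro μ
      rw [hg.map_S, norm_mul, mul_pow, norm_pow, ← pow_mul, mul_comm w, pow_mul,
        norm_cpow_half_sq]
    rw [Finset.sum_congr rfl fun μ _ => h1 μ, ← Finset.mul_sum, h.sum_norm_sq_weilS, im_smul_eq,
      autFactor_S, Real.div_rpow τ'.im_pos.le (by positivity)]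
    have h2 : (‖(τ' : ℂ)‖ ^ 2) ^ ((w : ℝ) / 2) = ‖(τ' : ℂ)‖ ^ w := by
      rw [← Real.rpow_natCast, ← Real.rpow_mul hτ'.le, ← Real.rpow_natCast]
      congr 1; push_cast; ring
    rw [h2]
    field_simp
  | @T_mul γ A _ ih =>
    rw [mul_smul, ← ih, UpperHalfPlane.modular_T_smul, UpperHalfPlane.vadd_im, hg.map_T,
      sum_norm_sq_weilT]

/-- The Hecke bound for `g`. -/
theorem exists_hecke_bound (h : IsEvenLattice Q M) :
    ∃ C : ℝ, 0 ≤ C ∧ ∀ (τ : ℍ) (x : V), ‖g τ x‖ ≤ C * τ.im ^ (-(w : ℝ) / 4) := by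
  have := h.finite_disc
  have := Fintype.ofFinite (Disc Q M)
  have h1 : ∃ B : ℝ, ∀ τ : ℍ, 1 / 2 ≤ τ.im →
      τ.im ^ ((w : ℝ) / 2) * ∑ μ : Disc Q M, ‖g τ μ.rep‖ ^ 2 ≤ B := by
    choose C c hc hC using fun μ : Disc Q M => hg.exists_exp_bound μ.rep
    have h2 : ∀ μ : Disc Q M, ∃ B : ℝ, ∀ t : ℝ, 1 / 2 ≤ t →
        t ^ ((w : ℝ) / 2) * (C μ * Real.exp (-(c μ) * t)) ^ 2 ≤ B := by
      intro μ
      have h3 : Filter.Tendsto (fun t : ℝ => t ^ ((w : ℝ) / 2) * Real.exp (-(2 * c μ) * t))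
          Filter.atTop (nhds 0) :=
        tendsto_rpow_mul_exp_neg_mul_atTop_nhds_zero _ _ (by have := hc μ; positivity)
      obtain ⟨A, hA⟩ := Filter.eventually_atTop.1 (h3.eventually (ge_mem_nhds one_pos))
      have h4 : ContinuousOn (fun t : ℝ => t ^ ((w : ℝ) / 2) * Real.exp (-(2 * c μ) * t))
          (Set.Icc (1 / 2) A) := by
        refine ContinuousOn.mul ?_ (by fun_prop)
        refine ContinuousOn.rpow_const (by fun_prop) fun t ht => Or.inl ?_
        have := ht.1; linarith
      obtain ⟨B, hB⟩ := (isCompact_Icc.image_of_continuousOn h4).isBounded.exists_norm_le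
      refine ⟨max B 1 * C μ ^ 2, fun t ht => ?_⟩
      have h5 : t ^ ((w : ℝ) / 2) * (C μ * Real.exp (-(c μ) * t)) ^ 2 =
          t ^ ((w : ℝ) / 2) * Real.exp (-(2 * c μ) * t) * C μ ^ 2 := by
        rw [mul_pow, ← Real.exp_nat_mul]
        push_cast
        ring_nf
      rw [h5]
      refine mul_le_mul_of_nonneg_right ?_ (sq_nonneg _)
      by_cases htA : A ≤ t
      · exact (hA t htA).trans (le_max_right _ _)
      · exact (le_abs_self _).trans ((hB _ ⟨t, ⟨ht, (not_le.1 htA).le⟩, rfl⟩).trans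
          (le_max_left _ _))
    choose B hB using h2
    refine ⟨∑ μ, B μ, fun τ hτ => ?_⟩
    rw [Finset.mul_sum]
    refine Finset.sum_le_sum fun μ _ => le_trans ?_ (hB μ τ.im hτ)
    refine mul_le_mul_of_nonneg_left ?_ (Real.rpow_nonneg τ.im_pos.le _)
    exact pow_le_pow_left₀ (norm_nonneg _) (hC μ τ hτ) 2
  obtain ⟨B, hB⟩ := h1
  refine ⟨Real.sqrt B, Real.sqrt_nonneg _, fun τ x => ?_⟩
  by_cases hx : x ∈ dualLattice Q M
  swap
  · rw [(hg.schwartz τ).1 x hx, norm_zero]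
    exact mul_nonneg (Real.sqrt_nonneg _) (Real.rpow_nonneg τ.im_pos.le _)
  obtain ⟨γ, hγ⟩ := ModularGroup.exists_smul_mem_fd τ
  have him : 1 / 2 ≤ (γ • τ).im := by
    have := ModularGroup.three_le_four_mul_im_sq_of_mem_fd hγ
    have := (γ • τ).im_pos
    nlinarith
  have h2 := hB _ him
  rw [hg.sum_norm_sq_smul h] at h2
  have h3 : ‖g τ x‖ ^ 2 ≤ ∑ μ : Disc Q M, ‖g τ μ.rep‖ ^ 2 := by
    rw [← IsPeriodic.rep_cls (hg.schwartz τ).2 hx]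
    exact Finset.single_le_sum (f := fun μ : Disc Q M => ‖g τ μ.rep‖ ^ 2)
      (fun _ _ => by positivity) (Finset.mem_univ _)
  have hv : 0 < τ.im ^ ((w : ℝ) / 2) := Real.rpow_pos_of_pos τ.im_pos _
  have h4 : ‖g τ x‖ ^ 2 ≤ B * τ.im ^ (-(w : ℝ) / 2) := by
    rw [neg_div, Real.rpow_neg τ.im_pos.le, ← div_eq_mul_inv, le_div_iff₀ hv, mul_comm]
    exact (mul_le_mul_of_nonneg_left h3 hv.le).trans h2
  have h5 : Real.sqrt (B * τ.im ^ (-(w : ℝ) / 2)) = Real.sqrt B * τ.im ^ (-(w : ℝ) / 4) := by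
    rw [Real.sqrt_mul' _ (Real.rpow_nonneg τ.im_pos.le _), Real.sqrt_eq_rpow (τ.im ^ _),
      ← Real.rpow_mul τ.im_pos.le]
    congr 2; ring
  rw [← h5]
  exact Real.le_sqrt_of_sq_le h4

/-- The Fourier coefficients can be computed at any height. -/
theorem coeff_eq_integral {m : ℚ} {x : V} (hm : ∃ k : ℤ, m - Q x = k) {v : ℝ} (hv : 0 < v) :
    ∫ u in (0 : ℝ)..1, g (ofComplex (u + v * Complex.I)) x * e (-m * (u + v * Complex.I)) =
      coeff Q g m x := by
  set f : ℂ → ℂ := fun z => g (ofComplex z) x * e (-m * z) with hf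
  have hdiff : DifferentiableOn ℂ f {z | 0 < z.im} := by
    refine (hg.holo x).mul ?_
    have : Differentiable ℂ fun z : ℂ => e (-m * z) := by unfold e; fun_prop
    exact this.differentiableOn
  have hper : ∀ z : ℂ, 0 < z.im → f (z + 1) = f z := by
    intro z hz
    have h1 := ofComplex_add_real 1 hz
    rw [Complex.ofReal_one] at h1
    simp only [hf]
    rw [h1, hg.vadd_one, mul_add, e_add, mul_one, ← Rat.cast_neg]
    have h2 : e ((Q x : ℚ) : ℂ) * e ((-m : ℚ) : ℂ) = 1 := by
      rw [← e_ratCast_add]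
      obtain ⟨k, hk⟩ := hm
      exact e_ratCast_of_int ⟨-k, by push_cast; linarith⟩
    linear_combination (g (ofComplex z) x * e (((-m : ℚ) : ℂ) * z)) * h2
  have hI : coeff Q g m x = ∫ u in (0 : ℝ)..1, f (u + (1 : ℝ) * Complex.I) := by
    rw [coeff, if_pos hm]
    refine intervalIntegral.integral_congr fun u _ => ?_
    simp only [hf, Complex.ofReal_one, one_mul]
    congr 2
    ext
    rw [UpperHalfPlane.coe_vadd, UpperHalfPlane.ofComplex_apply_of_im_pos (by simp)]
    simp
  -- Cauchy's theorem on the rectangle between the heights `v` and `1`; the vertical sides cancel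
  -- because `f` has period one.
  have hrect := Complex.integral_boundary_rect_eq_zero_of_differentiableOn f
    (v * Complex.I) (1 + Complex.I) (hdiff.mono (by
      intro z hz
      rw [Complex.mem_reProdIm] at hz
      have h3 := hz.2
      simp only [Complex.mul_im, Complex.ofReal_re, Complex.I_im, mul_one, Complex.ofReal_im,
        Complex.I_re, mul_zero, add_zero, Complex.add_im, Complex.one_im, zero_add] at h3
      have h4 : min v 1 ≤ z.im := h3.1
      exact (lt_min hv one_pos).trans_le h4))
  simp only [Complex.mul_re, Complex.ofReal_re, Complex.I_re, mul_zero, Complex.ofReal_im,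
    Complex.I_im, mul_one, Complex.add_re, Complex.one_re, add_zero, Complex.mul_im,
    Complex.add_im, Complex.one_im, zero_add, Complex.ofReal_zero, Complex.ofReal_one,
    sub_self] at hrect
  have h5 : ∫ y in v..1, f (1 + y * Complex.I) = ∫ y in v..1, f (y * Complex.I) := by
    refine intervalIntegral.integral_congr fun y hy => ?_
    rw [add_comm, hper]
    have : min v 1 ≤ y := hy.1
    simpa using (lt_min hv one_pos).trans_le this
  rw [h5, add_sub_cancel_right, sub_eq_zero] at hrect
  rw [hI, Complex.ofReal_one]
  exact hrect

theorem norm_coeff_le_of_bound {m : ℚ} {x : V} (hm : ∃ k : ℤ, m - Q x = k) {v : ℝ} (hv : 0 < v)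
    {B : ℝ} (hB : ∀ τ : ℍ, τ.im = v → ‖g τ x‖ ≤ B) :
    ‖coeff Q g m x‖ ≤ B * Real.exp (2 * Real.pi * m * v) := by
  rw [← hg.coeff_eq_integral hm hv]
  have := intervalIntegral.norm_integral_le_of_norm_le_const (a := (0 : ℝ)) (b := 1)
    (f := fun u : ℝ => g (ofComplex (u + v * Complex.I)) x * e (-m * (u + v * Complex.I)))
    (C := B * Real.exp (2 * Real.pi * m * v)) ?_
  · simpa using this
  · intro u _
    have him : ((u : ℂ) + v * Complex.I).im = v := by simp
    rw [norm_mul, norm_e]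
    have h1 : -(2 * Real.pi * (-(m : ℂ) * (u + v * Complex.I)).im) = 2 * Real.pi * m * v := by
      simp; ring
    rw [h1]
    refine mul_le_mul_of_nonneg_right (hB _ ?_) (Real.exp_pos _).le
    rw [UpperHalfPlane.ofComplex_apply_of_im_pos (by rw [him]; exact hv)]
    exact him

/-- The Hecke bound for the Fourier coefficients. -/
theorem exists_coeff_bound (h : IsEvenLattice Q M) : ∃ C : ℝ, 0 ≤ C ∧
    ∀ (x : V) (m : ℚ), 0 < m → ‖coeff Q g m x‖ ≤ C * (m : ℝ) ^ ((w : ℝ) / 4) := by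
  obtain ⟨C, hC0, hC⟩ := hg.exists_hecke_bound h
  refine ⟨C * Real.exp (2 * Real.pi), by positivity, fun x m hm => ?_⟩
  have hm' : (0 : ℝ) < m := by exact_mod_cast hm
  by_cases hk : ∃ k : ℤ, m - Q x = k
  -- At height `1/m` the factor `exp(2πmv)` is a constant.
  · have h1 := hg.norm_coeff_le_of_bound hk (v := (m : ℝ)⁻¹) (inv_pos.2 hm')
      (B := C * (m : ℝ) ^ ((w : ℝ) / 4)) (fun τ hτ => by
        refine (hC τ x).trans (le_of_eq ?_)
        rw [hτ, Real.inv_rpow hm'.le, ← Real.rpow_neg hm'.le, neg_div, neg_neg])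
    rw [mul_assoc _ (m : ℝ), mul_inv_cancel₀ hm'.ne', mul_one] at h1
    linarith [h1]
  · rw [coeff, if_neg hk, norm_zero]
    positivity

theorem coeff_congr (h : IsEvenLattice Q M) (m : ℚ) {x y : V} (hx : x ∈ dualLattice Q M)
    (hxy : y - x ∈ M) : coeff Q g m y = coeff Q g m x := by
  have h1 : ∀ τ, g τ y = g τ x := fun τ => IsPeriodic.eq_of_sub_mem (hg.schwartz τ).2 hxy
  have h2 : ∃ k : ℤ, Q y = Q x + k := by
    obtain ⟨k, hk⟩ := h.Q_add_int hx hxy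
    exact ⟨k, by rw [← hk, add_sub_cancel x y]; ring⟩
  obtain ⟨k, hk⟩ := h2
  have h3 : (∃ j : ℤ, m - Q y = j) ↔ ∃ j : ℤ, m - Q x = j := by
    rw [hk]
    constructor
    · rintro ⟨j, hj⟩; exact ⟨j + k, by push_cast; linarith⟩
    · rintro ⟨j, hj⟩; exact ⟨j - k, by push_cast; linarith⟩
  unfold coeff
  simp only [h1]
  by_cases hj : ∃ j : ℤ, m - Q x = j
  · rw [if_pos hj, if_pos (h3.2 hj)]
  · rw [if_neg hj, if_neg (mt h3.1 hj)]

omit hg in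
theorem coeff_neg (hneg : ∀ τ x, g τ (-x) = g τ x) (m : ℚ) (x : V) :
    coeff Q g m (-x) = coeff Q g m x := by
  unfold coeff
  simp only [hneg]
  have h3 : (∃ j : ℤ, m - Q (-x) = j) ↔ ∃ j : ℤ, m - Q x = j := by rw [QuadraticMap.map_neg]
  by_cases hj : ∃ j : ℤ, m - Q x = j
  · rw [if_pos hj, if_pos (h3.2 hj)]
  · rw [if_neg hj, if_neg (mt h3.1 hj)]

/-- For `m = 0` the factor `exp(2πmv)` is one, so the coefficient is bounded by `g` at arbitrarily
large height. This disposes of the term `n = 0` of the theta sum. -/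
theorem coeff_zero_zero : coeff Q g 0 0 = 0 := by
  have h0 : ∃ k : ℤ, (0 : ℚ) - Q 0 = k := ⟨0, by simp⟩
  rw [← norm_le_zero_iff]
  refine le_of_forall_pos_le_add fun ε hε => ?_
  obtain ⟨A, hA⟩ := UpperHalfPlane.isZeroAtImInfty_iff.1 (hg.cusp 0) ε hε
  have h1 := hg.norm_coeff_le_of_bound h0 (v := max A 1) (lt_max_of_lt_right one_pos) (B := ε)
    (fun τ hτ => hA τ (by rw [hτ]; exact le_max_left _ _))
  simpa using h1

end IsCuspForm

end Lattices

end

section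

/-! ### Unfolding over the modular group -/

open MeasureTheory UpperHalfPlane ModularGroup Pointwise

instance : SMulInvariantMeasure SL(2, ℤ) ℍ volume :=
  ⟨fun γ _ hs => measure_preimage_smul_of_nullMeasurableSet hs.nullMeasurableSet (γ : GL (Fin 2) ℝ)⟩

instance : MeasurableConstSMul SL(2, ℤ) ℍ :=
  ⟨fun γ => measurable_const_smul (γ : GL (Fin 2) ℝ)⟩

/-- A fundamental domain for the translations by integers. -/
def periodStrip : Set ℍ := {z | 0 ≤ z.re ∧ z.re < 1}

theorem measurableSet_periodStrip : MeasurableSet periodStrip := by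
  have h : Measurable fun z : ℍ => z.re := UpperHalfPlane.continuous_re.measurable
  exact (measurableSet_le measurable_const h).inter (measurableSet_lt h measurable_const)

theorem isFundamentalDomain_periodStrip :
    IsFundamentalDomain (Subgroup.zpowers (T : SL(2, ℤ))) periodStrip volume := by
  refine IsFundamentalDomain.mk' measurableSet_periodStrip.nullMeasurableSet fun z => ?_
  refine ⟨⟨T ^ (-⌊z.re⌋), _, rfl⟩, ?_, ?_⟩
  · change T ^ (-⌊z.re⌋) • z ∈ periodStrip
    simp only [periodStrip, Set.mem_ofPred_eq, re_T_zpow_smul]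
    push_cast
    constructor
    · linarith [Int.floor_le z.re]
    · linarith [Int.lt_floor_add_one z.re]
  · rintro ⟨_, n, rfl⟩ hn
    change T ^ n • z ∈ periodStrip at hn
    simp only [periodStrip, Set.mem_ofPred_eq, re_T_zpow_smul] at hn
    have : n = -⌊z.re⌋ := by
      rw [eq_neg_iff_add_eq_zero, add_comm, ← Int.floor_add_intCast, Int.floor_eq_zero_iff]
      exact hn
    subst this
    rfl

theorem volume_fd_diff_fdo : volume (fd \ fdo) = 0 := by
  rw [volume_eq_lintegral]
  refine setLIntegral_measure_zero _ _ (measure_mono_null (t := frontier (Metric.ball (0 : ℂ) 1) ∪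
    (frontier {z : ℂ | z.re < 1 / 2} ∪ frontier {z : ℂ | z.re < -(1 / 2)})) ?_ ?_)
  · rintro _ ⟨z, ⟨⟨h1, h2⟩, h3⟩, rfl⟩
    rw [frontier_ball _ one_ne_zero, Complex.frontier_setOfPred_re_lt, Complex.frontier_setOfPred_re_lt]
    by_cases h4 : Complex.normSq (z : ℂ) = 1
    · left
      rw [Complex.normSq_eq_norm_sq, pow_eq_one_iff_of_nonneg (norm_nonneg _) two_ne_zero] at h4
      simpa using h4
    · right
      have h5 : |z.re| = 1 / 2 := by
        by_contra h6
        exact h3 ⟨lt_of_le_of_ne h1 (Ne.symm h4), lt_of_le_of_ne h2 h6⟩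
      rcases eq_or_eq_neg_of_abs_eq h5 with h6 | h6
      · left; simpa using h6
      · right; simpa using h6
  · refine measure_union_null ((convex_ball _ _).addHaar_frontier _)
      (measure_union_null ?_ ?_)
    · exact (convex_halfSpace_re_lt _).addHaar_frontier _
    · exact (convex_halfSpace_re_lt _).addHaar_frontier _

theorem measurableSet_fd : MeasurableSet fd := isClosed_fd.measurableSet

theorem mk_eq_mk_iff_mem {γ δ : SL(2, ℤ)} :
    (Quotient.mk (QuotientGroup.rightRel GammaInfty) γ) =
      Quotient.mk (QuotientGroup.rightRel GammaInfty) δ ↔ δ * γ⁻¹ ∈ GammaInfty := by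
  rw [Quotient.eq, QuotientGroup.rightRel_apply]

theorem T_zpow_mem (n : ℤ) : T ^ n ∈ GammaInfty := by
  change (T ^ n : SL(2, ℤ)) 1 0 = 0
  rw [coe_T_zpow]; simp

theorem neg_mem_GammaInfty {γ : SL(2, ℤ)} (h : γ ∈ GammaInfty) : -γ ∈ GammaInfty := by
  change (-γ : SL(2, ℤ)) 1 0 = 0
  have h : γ 1 0 = 0 := h
  simp [h]

instance : Countable SL(2, ℤ) := by
  have : Countable (Matrix (Fin 2) (Fin 2) ℤ) := inferInstanceAs (Countable (Fin 2 → Fin 2 → ℤ))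
  exact Subtype.countable

instance : Countable GammaInftyCosets := Quotient.countable

/-- Representatives of the cosets, up to translations. -/
theorem exists_smul_eq_T_zpow_smul (γ : SL(2, ℤ)) :
    ∃ n : ℤ, ∀ z : ℍ, (Quotient.mk (QuotientGroup.rightRel GammaInfty) γ).out • z =
      T ^ n • γ • z := by
  set δ := (Quotient.mk (QuotientGroup.rightRel GammaInfty) γ).out
  have h : δ * γ⁻¹ ∈ GammaInfty := mk_eq_mk_iff_mem.1 (Quotient.out_eq _).symm
  obtain ⟨n, hn⟩ := exists_eq_T_zpow_of_c_eq_zero (g := δ * γ⁻¹) h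
  refine ⟨n, fun z => ?_⟩
  rw [← hn, mul_smul, inv_smul_smul]

/-- The points where two translates of `fd` can meet form a null set. -/
theorem aedisjoint_smul_fd {γ δ : SL(2, ℤ)} (h1 : γ ≠ δ) (h2 : γ ≠ -δ) :
    AEDisjoint volume (γ • fd) (δ • fd) := by
  refine measure_mono_null (t := γ • (fd \ fdo)) ?_ ?_
  · rintro z ⟨⟨w, hw, rfl⟩, ⟨w', hw', h3⟩⟩
    refine ⟨w, ⟨hw, fun hw0 => ?_⟩, rfl⟩
    have h4 : (δ⁻¹ * γ) • w ∈ fd := by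
      have : δ • w' = γ • w := h3
      rw [mul_smul, ← this, inv_smul_smul]
      exact hw'
    rcases eq_one_or_neg_one_of_mem_fdo_mem_fd hw0 h4 with h5 | h5
    · exact h1 (inv_mul_eq_one.1 h5).symm
    · rw [inv_mul_eq_iff_eq_mul, mul_neg, mul_one] at h5
      exact h2 h5
  · rw [measure_smul, volume_fd_diff_fdo]

/-- Every point is moved into `fd` by some matrix, whose inverse agrees on `ℍ` with a coset
representative up to a power of `T`. Overlaps are null by `aedisjoint_smul_fd`; as `-1 ∈
GammaInfty`, matrices equal up to sign lie in the same coset. -/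
theorem isFundamentalDomain_iUnion :
    IsFundamentalDomain (Subgroup.zpowers (T : SL(2, ℤ)))
      (⋃ c : GammaInftyCosets, c.out • fd) volume where
  nullMeasurableSet := NullMeasurableSet.iUnion fun c =>
    (measurableSet_fd.const_smul _).nullMeasurableSet
  ae_covers := by
    refine Filter.Eventually.of_forall fun z => ?_
    obtain ⟨γ, hγ⟩ := exists_smul_mem_fd z
    obtain ⟨n, hn⟩ := exists_smul_eq_T_zpow_smul γ⁻¹
    refine ⟨⟨T ^ n, _, rfl⟩, Set.mem_iUnion.2 ⟨Quotient.mk _ γ⁻¹, γ • z, hγ, ?_⟩⟩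
    change (Quotient.mk (QuotientGroup.rightRel GammaInfty) γ⁻¹).out • γ • z = T ^ n • z
    rw [hn, inv_smul_smul]
  aedisjoint := by
    rintro ⟨_, m, rfl⟩ ⟨_, n, rfl⟩ hmn
    change AEDisjoint volume ((T ^ m : SL(2, ℤ)) • _) ((T ^ n : SL(2, ℤ)) • _)
    have hmn' : m ≠ n := by rintro rfl; exact hmn rfl
    rw [Set.smul_set_iUnion, Set.smul_set_iUnion]
    rw [AEDisjoint.iUnion_left_iff]
    intro c
    rw [AEDisjoint.iUnion_right_iff]
    intro c'
    rw [smul_smul, smul_smul]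
    have key : ∀ δ ∈ GammaInfty, T ^ m * c.out = δ * c'.out → c = c' := by
      intro δ hδ h
      rw [← Quotient.out_eq c, ← Quotient.out_eq c', mk_eq_mk_iff_mem]
      have : c'.out * c.out⁻¹ = δ⁻¹ * T ^ m := by
        rw [eq_comm, inv_mul_eq_iff_eq_mul, ← mul_assoc, eq_mul_inv_iff_mul_eq, h]
      rw [this]
      exact GammaInfty.mul_mem (GammaInfty.inv_mem hδ) (T_zpow_mem m)
    have entry : ∀ k : ℤ, (T ^ k : SL(2, ℤ)) 0 1 = k ∧ (T ^ k : SL(2, ℤ)) 0 0 = 1 := by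
      intro k; rw [coe_T_zpow]; simp
    refine aedisjoint_smul_fd (fun h => ?_) (fun h => ?_)
    · obtain rfl := key _ (T_zpow_mem n) h
      rw [mul_left_inj] at h
      exact hmn' (by rw [← (entry m).1, h, (entry n).1])
    -- `T^m = -T^n` is impossible, since the upper left entries are `1` and `-1`.
    · rw [← neg_mul] at h
      obtain rfl := key _ (neg_mem_GammaInfty (T_zpow_mem n)) h
      rw [mul_left_inj] at h
      have h5 := congrArg (fun γ : SL(2, ℤ) => γ 0 0) h
      simp only [Matrix.SpecialLinearGroup.coe_neg, Matrix.neg_apply, (entry m).2,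
        (entry n).2] at h5
      omega

theorem aedisjoint_out_smul_fd :
    Pairwise (Function.onFun (AEDisjoint volume) fun c : GammaInftyCosets => c.out • fd) := by
  intro c c' hc
  refine aedisjoint_smul_fd (fun h => ?_) (fun h => ?_)
  · exact hc (by rw [← Quotient.out_eq c, ← Quotient.out_eq c', h])
  · refine hc ?_
    rw [← Quotient.out_eq c, ← Quotient.out_eq c', mk_eq_mk_iff_mem, h]
    have : c'.out * (-c'.out)⁻¹ = -1 := by
      rw [mul_inv_eq_iff_eq_mul, neg_mul_neg, one_mul]
    rw [this]
    exact neg_mem_GammaInfty GammaInfty.one_mem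

theorem smul_eq_of_T_smul_eq {β : Type*} {F : ℍ → β} (hF : ∀ z, F (T • z) = F z)
    (γ : Subgroup.zpowers (T : SL(2, ℤ))) (z : ℍ) : F (γ • z) = F z := by
  obtain ⟨_, n, rfl⟩ := γ
  change F ((T ^ n : SL(2, ℤ)) • z) = F z
  induction n using Int.induction_on generalizing z with
  | zero => simp
  | succ n ih => rw [zpow_add_one, mul_smul, ih, hF]
  | pred n ih => rw [zpow_sub_one, mul_smul, ih, ← hF (T⁻¹ • z), smul_inv_smul]

/-- Unfolding of integrals of nonnegative functions. -/
theorem tsum_lintegral_fd {F : ℍ → ENNReal} (hF : ∀ z, F (T • z) = F z) :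
    ∑' c : GammaInftyCosets, ∫⁻ z in fd, F (c.out • z) = ∫⁻ z in periodStrip, F z := by
  have hF' := smul_eq_of_T_smul_eq hF
  rw [isFundamentalDomain_periodStrip.setLIntegral_eq isFundamentalDomain_iUnion F hF',
    lintegral_iUnion₀ (fun c => (measurableSet_fd.const_smul _).nullMeasurableSet)
      aedisjoint_out_smul_fd]
  refine tsum_congr fun c => ?_
  rw [← Set.image_smul, (measurePreserving_smul c.out volume).setLIntegral_comp_emb
    (measurableEmbedding_const_smul c.out)]

/-- Unfolding of integrals. -/
theorem hasSum_integral_fd {F : ℍ → ℂ} (hF : ∀ z, F (T • z) = F z)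
    (hint : IntegrableOn F periodStrip) :
    HasSum (fun c : GammaInftyCosets => ∫ z in fd, F (c.out • z)) (∫ z in periodStrip, F z) := by
  have hF' := smul_eq_of_T_smul_eq hF
  rw [isFundamentalDomain_periodStrip.integrableOn_iff isFundamentalDomain_iUnion hF'] at hint
  rw [isFundamentalDomain_periodStrip.setIntegral_eq isFundamentalDomain_iUnion hF']
  have := hasSum_integral_iUnion_ae (fun c => (measurableSet_fd.const_smul _).nullMeasurableSet)
      aedisjoint_out_smul_fd hint
  refine this.congr_fun fun c => ?_
  rw [← Set.image_smul, (measurePreserving_smul c.out volume).setIntegral_image_emb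
    (measurableEmbedding_const_smul c.out)]

end

section

section Lattices

variable {V : Type} [AddCommGroup V] [Module ℚ V] {Q : QuadraticForm ℚ V}
  {M P N L : AddSubgroup V}

open MeasureTheory UpperHalfPlane ComplexConjugate

/-! ### Absolute convergence of the Rankin integral -/

theorem measurable_tsum_of_summable {ι α : Type*} [Countable ι] [MeasurableSpace α]
    {f : ι → α → ℂ} (hf : ∀ i, Measurable (f i)) (hs : ∀ a, Summable fun i => f i a) :
    Measurable fun a => ∑' i, f i a := by
  refine measurable_of_tendsto_metrizable' (Filter.atTop : Filter (Finset ι))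
    (f := fun s a => ∑ i ∈ s, f i a) (fun s => Finset.measurable_sum s fun i _ => hf i) ?_
  rw [tendsto_pi_nhds]
  exact fun a => (hs a).hasSum

/-- `fd` lies in a strip of width one above height `1/2`, on which `v⁻²` is integrable. -/
theorem volume_fd_lt_top : volume ModularGroup.fd < ⊤ := by
  rw [volume_eq_lintegral]
  have hsub : ((↑) : ℍ → ℂ) '' ModularGroup.fd ⊆
      Set.Icc (-(1 / 2) : ℝ) (1 / 2) ×ℂ Set.Ioi (1 / 2 : ℝ) := by
    rintro _ ⟨z, hz, rfl⟩
    rw [Complex.mem_reProdIm]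
    refine ⟨abs_le.1 hz.2, ?_⟩
    have := ModularGroup.three_le_four_mul_im_sq_of_mem_fd hz
    have h2 := z.im_pos
    change 1 / 2 < z.im
    nlinarith
  refine (lintegral_mono_set hsub).trans_lt ?_
  have h1 : IntegrableOn (fun v : ℝ => v ^ (-2 : ℝ)) (Set.Ioi (1 / 2)) :=
    integrableOn_Ioi_rpow_of_lt (by norm_num) (by norm_num)
  have h2 : IntegrableOn (fun p : ℝ × ℝ => (1 : ℝ) * p.2 ^ (-2 : ℝ))
      (Set.Icc (-(1 / 2) : ℝ) (1 / 2) ×ˢ Set.Ioi (1 / 2 : ℝ)) := by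
    rw [IntegrableOn, Measure.volume_eq_prod, ← Measure.prod_restrict]
    exact Integrable.mul_prod (f := fun _ : ℝ => (1 : ℝ))
      (integrable_const 1) h1
  have h3 := (hasFiniteIntegral_iff_enorm.1 h2.2)
  rw [← Complex.volume_preserving_equiv_real_prod.symm.setLIntegral_comp_preimage_emb
    Complex.measurableEquivRealProd.symm.measurableEmbedding]
  refine lt_of_le_of_lt (le_of_eq ?_) h3
  have : Complex.measurableEquivRealProd.symm ⁻¹' (Set.Icc (-(1 / 2) : ℝ) (1 / 2) ×ℂ
      Set.Ioi (1 / 2 : ℝ)) = Set.Icc (-(1 / 2) : ℝ) (1 / 2) ×ˢ Set.Ioi (1 / 2 : ℝ) := by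
    ext p; simp [Complex.mem_reProdIm, Complex.measurableEquivRealProd_symm_apply]
  rw [this]
  refine setLIntegral_congr_fun (measurableSet_Icc.prod measurableSet_Ioi) ?_
  rintro ⟨u, v⟩ ⟨-, hv⟩
  have hv' : (0 : ℝ) < v := lt_trans (by norm_num) hv
  simp only [Complex.measurableEquivRealProd_symm_apply, one_mul]
  rw [Real.rpow_neg hv'.le, enorm_inv (by positivity)]
  have h4 : ‖v ^ (2 : ℝ)‖ₑ = ((‖v‖₊ ^ 2 : NNReal) : ENNReal) := by
    rw [Real.rpow_ofNat, enorm_eq_nnnorm, nnnorm_pow]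
  have h5 : ‖v‖₊ ^ 2 ≠ 0 := by simpa using hv'.ne'
  rw [h4, ← ENNReal.coe_inv h5, one_div, inv_pow]

theorem exists_rpow_mul_exp_le (k : ℝ) (hk : 0 ≤ k) {a : ℝ} (ha : 0 < a) :
    ∃ D : ℝ, 0 ≤ D ∧ ∀ t : ℝ, 1 / 2 ≤ t → t ^ k * Real.exp (-a * t) ≤ D := by
  set n := ⌈k⌉₊
  refine ⟨2 ^ n * (n.factorial / a ^ n), by positivity, fun t ht => ?_⟩
  have ht0 : 0 < t := by linarith
  have h1 : t ^ k ≤ 2 ^ n * t ^ n := by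
    calc t ^ k ≤ (2 * t) ^ k := Real.rpow_le_rpow ht0.le (by linarith) hk
      _ ≤ (2 * t) ^ (n : ℝ) := Real.rpow_le_rpow_of_exponent_le (by linarith) (Nat.le_ceil k)
      _ = 2 ^ n * t ^ n := by rw [Real.rpow_natCast, mul_pow]
  have h2 := Real.pow_div_factorial_le_exp (a * t) (by positivity) n
  rw [neg_mul, Real.exp_neg, ← div_eq_mul_inv, div_le_iff₀ (Real.exp_pos _)]
  refine h1.trans ?_
  rw [mul_assoc]
  refine mul_le_mul_of_nonneg_left ?_ (by positivity)
  rw [mul_pow, div_le_iff₀ (by positivity)] at h2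
  rw [div_mul_eq_mul_div, le_div_iff₀ (by positivity)]
  linarith

/-- As `Q ≥ 0` on `P'`, every term is largest at height `1/2`; the sum over all of `P'` at `i/2`
dominates the sum over any coset. -/
theorem IsRankOne.exists_theta_bound {y : V} {K : ℕ} (hr : IsRankOne Q P y K) :
    ∃ B : ℝ, 0 ≤ B ∧ ∀ τ : ℍ, 1 / 2 ≤ τ.im → ∀ x, ‖theta Q P τ x‖ ≤ B := by
  have hτ₀ : 0 < (Complex.I / 2).im := by simp
  set τ₀ : ℍ := ⟨Complex.I / 2, hτ₀⟩ with hτ₀'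
  have hs := (hr.summable_dual τ₀).norm
  refine ⟨∑' x : dualLattice Q P, ‖e (((Q (x : V) : ℚ) : ℂ) * τ₀)‖,
    tsum_nonneg fun _ => norm_nonneg _, fun τ hτ x => ?_⟩
  rw [theta]
  split_ifs with hx
  swap
  · rw [norm_zero]; exact tsum_nonneg fun _ => norm_nonneg _
  let φ : P → dualLattice Q P :=
    fun l => ⟨x + l, (dualLattice Q P).add_mem hx (hr.even.le_dual l.2)⟩
  have hφ : Function.Injective φ := fun a b hab => by
    have := congrArg Subtype.val hab
    exact Subtype.ext (add_left_cancel this)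
  have hle : ∀ l : P, ‖e (((Q (x + l) : ℚ) : ℂ) * τ)‖ ≤
      ‖e (((Q (φ l : V) : ℚ) : ℂ) * τ₀)‖ := by
    intro l
    have hQ : 0 ≤ Q (x + l) := by
      obtain ⟨n, hn⟩ := (hr.mem_dual_iff _).1 (φ l).2
      have : x + l = n • y := hn
      rw [this, hr.Q_zsmul_gen]
      positivity
    have hQ' : (0 : ℝ) ≤ (Q (x + l) : ℚ) := by exact_mod_cast hQ
    rw [norm_e, norm_e, Real.exp_le_exp]
    have e1 : ((((Q (x + l) : ℚ) : ℂ)) * (τ : ℂ)).im = (Q (x + l) : ℚ) * τ.im := by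
      simp
    have e2 : ((((Q (φ l : V) : ℚ) : ℂ)) * (τ₀ : ℂ)).im = (Q (x + l) : ℚ) * (1 / 2) := by
      simp [hτ₀', φ]
    rw [e1, e2]
    have := mul_le_mul_of_nonneg_left hτ hQ'
    nlinarith [Real.pi_pos]
  have hs' := hs.comp_injective hφ
  refine (norm_tsum_le_tsum_norm (.of_nonneg_of_le (fun _ => norm_nonneg _) hle hs')).trans ?_
  refine (Summable.tsum_le_tsum hle (.of_nonneg_of_le (fun _ => norm_nonneg _) hle hs') hs').trans ?_
  exact tsum_comp_le_tsum_of_inj hs (fun _ => norm_nonneg _) hφ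

theorem IsRankOne.measurable_theta {y : V} {K : ℕ} (hr : IsRankOne Q P y K) (x : V) :
    Measurable fun τ : ℍ => theta Q P τ x := by
  by_cases hx : x ∈ dualLattice Q P
  swap
  · simp only [theta, hx, if_false]; exact measurable_const
  simp only [theta, hx, if_true]
  have : Countable P := hr.latEquiv.symm.injective.countable
  refine measurable_tsum_of_summable (f := fun (l : P) (τ : ℍ) => e (((Q (x + l) : ℚ) : ℂ) * τ))
    (fun l => ?_) fun τ => ?_
  · have : Continuous fun τ : ℍ => e (((Q (x + l) : ℚ) : ℂ) * τ) := by
      have h1 : Continuous fun τ : ℍ => (τ : ℂ) := UpperHalfPlane.continuous_coe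
      exact Complex.continuous_exp.comp (continuous_const.mul (continuous_const.mul h1))
    exact this.measurable
  · let φ : P → dualLattice Q P :=
      fun l => ⟨x + l, (dualLattice Q P).add_mem hx (hr.even.le_dual l.2)⟩
    have hφ : Function.Injective φ := fun a b hab => by
      have := congrArg Subtype.val hab
      exact Subtype.ext (add_left_cancel this)
    have h1 := (hr.summable_dual τ).comp_injective hφ
    simpa only [Function.comp_def, φ] using h1

/-! ### Eisenstein series -/

theorem norm_im_cpow (τ : ℍ) (s : ℂ) : ‖((τ.im : ℝ) : ℂ) ^ (s / 2)‖ = τ.im ^ (s.re / 2) := by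
  rw [Complex.norm_cpow_eq_rpow_re_of_pos τ.im_pos]
  simp

/-- Matrix coefficients of the Weil representation are at most one in absolute value, so the scalar
Eisenstein series with exponent `Re s + 1` is a majorant; it converges when this exceeds two. -/
theorem IsEvenLattice.norm_eisTerm_le (h : IsEvenLattice Q M) (τ : ℍ) (s : ℂ) (γ : SL(2, ℤ))
    (x : V) : ‖eisTerm Q M τ s γ x‖ ≤ τ.im ^ (s.re / 2) * ‖autFactor γ τ‖ ^ (-(s.re + 1)) := by
  have h1 : eisTerm Q M τ s γ x = (autFactor γ τ)⁻¹ * (((γ • τ).im : ℝ) : ℂ) ^ (s / 2) *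
      weilRep Q M (-2) γ⁻¹ (charFun M) x := rfl
  have h0 : 0 < ‖autFactor γ τ‖ := norm_pos_iff.2 (autFactor_ne_zero γ τ)
  rw [h1, norm_mul, norm_mul, norm_im_cpow, norm_inv, im_smul_eq,
    Real.div_rpow τ.im_pos.le (by positivity), ← Real.rpow_natCast, ← Real.rpow_mul h0.le]
  have h2 : ‖autFactor γ τ‖⁻¹ * (τ.im ^ (s.re / 2) / ‖autFactor γ τ‖ ^ (((2 : ℕ) : ℝ) * (s.re / 2)))
      = τ.im ^ (s.re / 2) * ‖autFactor γ τ‖ ^ (-(s.re + 1)) := by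
    rw [neg_add, Real.rpow_add h0, Real.rpow_neg_one, Real.rpow_neg h0.le, div_eq_mul_inv]
    have : ((2 : ℕ) : ℝ) * (s.re / 2) = s.re := by push_cast; ring
    rw [this]; ring
  rw [h2]
  exact mul_le_of_le_one_right (by positivity) (h.norm_weilRep_charFun_le _ _ _)

/-- The lower row of the representative of a coset. -/
def lowerRow (c : GammaInftyCosets) : Fin 2 → ℤ := c.out 1

theorem lowerRow_injective : Function.Injective lowerRow := by
  intro c c' hc
  have h0 : c.out 1 0 = c'.out 1 0 := congrFun hc 0
  have h1 : c.out 1 1 = c'.out 1 1 := congrFun hc 1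
  rw [← Quotient.out_eq c, ← Quotient.out_eq c', mk_eq_mk_iff_mem]
  change (c'.out * c.out⁻¹ : SL(2, ℤ)) 1 0 = 0
  rw [Matrix.SpecialLinearGroup.coe_mul, Matrix.mul_apply, Fin.sum_univ_two,
    Matrix.SpecialLinearGroup.SL2_inv_expl]
  simp only [Matrix.cons_val', Matrix.cons_val_zero, Matrix.cons_val_one,
    Matrix.cons_val_fin_one]
  rw [h0, h1]; ring

theorem summable_lowerRow {k : ℝ} (hk : 2 < k) :
    Summable fun c : GammaInftyCosets => ‖lowerRow c‖ ^ (-k) :=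
  (EisensteinSeries.summable_one_div_norm_rpow hk).comp_injective lowerRow_injective

theorem norm_autFactor_rpow_le {σ : ℝ} (hσ : 0 ≤ σ) (τ : ℍ) (c : GammaInftyCosets) :
    ‖autFactor c.out τ‖ ^ (-σ) ≤ EisensteinSeries.r τ ^ (-σ) * ‖lowerRow c‖ ^ (-σ) :=
  EisensteinSeries.summand_bound τ hσ (lowerRow c)

theorem IsEvenLattice.summable_eisTerm (h : IsEvenLattice Q M) (τ : ℍ) {s : ℂ} (hs : 1 < s.re)
    (x : V) : Summable fun c : GammaInftyCosets => eisTerm Q M τ s c.out x := by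
  refine .of_norm_bounded (((summable_lowerRow (k := s.re + 1) (by linarith)).mul_left
    (EisensteinSeries.r τ ^ (-(s.re + 1)))).mul_left (τ.im ^ (s.re / 2))) fun c => ?_
  refine (h.norm_eisTerm_le τ s c.out x).trans ?_
  exact mul_le_mul_of_nonneg_left (norm_autFactor_rpow_le (by linarith) τ c)
    (Real.rpow_nonneg τ.im_pos.le _)

end Lattices

end

section

section Lattices

variable {V : Type} [AddCommGroup V] [Module ℚ V] {Q : QuadraticForm ℚ V}
  {M P N L : AddSubgroup V}

open MeasureTheory UpperHalfPlane ComplexConjugate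

/-! ### The unfolded Rankin integral -/

/-- The function `Im(τ)^{s/2} ⟨θ_P(τ) ⊗ φ_0, \bar g(τ)⟩ v^{3/2}`. -/
def unfoldedIntegrand (Q : QuadraticForm ℚ V) (P N : AddSubgroup V) (g : ℍ → V → ℂ) (s : ℂ)
    (τ : ℍ) : ℂ :=
  ((τ.im : ℝ) : ℂ) ^ (s / 2) * thetaPairing Q P N g (charFun N) τ

variable {y : V} {K : ℕ} (h : IsSplit Q P N L) (hr : IsRankOne Q P y K) {g : ℍ → V → ℂ}
  (hg : IsCuspForm Q L (-1) 3 g)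

include h hr hg

/-- The exponential decay of `g` beats any power of `v`, while theta stays bounded. The bound is
linear in the sup norm of `φ`, which allows Eisenstein summands to be inserted for `φ`. -/
theorem exists_thetaPairing_bound {k : ℝ} (hk : 0 ≤ k) :
    ∃ D : ℝ, 0 ≤ D ∧ ∀ τ : ℍ, 1 / 2 ≤ τ.im → ∀ (φ : V → ℂ) (C : ℝ), (∀ x, ‖φ x‖ ≤ C) →
      τ.im ^ k * ‖thetaPairing Q P N g φ τ‖ ≤ D * C := by
  have := h.evenP.finite_disc
  have := h.evenN.finite_disc
  have := Fintype.ofFinite (Disc Q P)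
  have := Fintype.ofFinite (Disc Q N)
  obtain ⟨B, hB0, hB⟩ := hr.exists_theta_bound
  have hgx : ∀ x, ∃ D : ℝ, 0 ≤ D ∧ ∀ τ : ℍ, 1 / 2 ≤ τ.im → τ.im ^ (k + 3 / 2) * ‖g τ x‖ ≤ D := by
    intro x
    obtain ⟨C, c, hc, hC⟩ := hg.exists_exp_bound x
    obtain ⟨D, hD0, hD⟩ := exists_rpow_mul_exp_le (k + 3 / 2) (by linarith) hc
    refine ⟨D * |C|, by positivity, fun τ hτ => ?_⟩
    have h1 := hC τ hτ
    have h2 : ‖g τ x‖ ≤ |C| * Real.exp (-c * τ.im) :=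
      h1.trans (mul_le_mul_of_nonneg_right (le_abs_self C) (Real.exp_pos _).le)
    calc τ.im ^ (k + 3 / 2) * ‖g τ x‖ ≤ τ.im ^ (k + 3 / 2) * (|C| * Real.exp (-c * τ.im)) :=
          mul_le_mul_of_nonneg_left h2 (Real.rpow_nonneg τ.im_pos.le _)
      _ = τ.im ^ (k + 3 / 2) * Real.exp (-c * τ.im) * |C| := by ring
      _ ≤ D * |C| := mul_le_mul_of_nonneg_right (hD _ hτ) (abs_nonneg _)
  choose D hD0 hD using hgx
  refine ⟨∑ p : Disc Q P × Disc Q N, B * D (p.1.rep + p.2.rep),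
    Finset.sum_nonneg fun p _ => mul_nonneg hB0 (hD0 _), fun τ hτ φ C hC => ?_⟩
  have hC0 : 0 ≤ C := (norm_nonneg _).trans (hC 0)
  rw [thetaPairing, finsum_eq_sum_of_fintype, norm_mul, Complex.norm_real,
    Real.norm_of_nonneg (Real.rpow_nonneg τ.im_pos.le _), mul_comm (‖_‖), ← mul_assoc,
    ← Real.rpow_add τ.im_pos, Finset.sum_mul]
  refine (mul_le_mul_of_nonneg_left (norm_sum_le _ _) (Real.rpow_nonneg τ.im_pos.le _)).trans ?_
  rw [Finset.mul_sum]
  refine Finset.sum_le_sum fun p _ => ?_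
  rw [norm_mul, norm_mul, RCLike.norm_conj]
  calc τ.im ^ (k + 3 / 2) * (‖theta Q P τ p.1.rep‖ * ‖φ p.2.rep‖ * ‖g τ (p.1.rep + p.2.rep)‖)
      = ‖theta Q P τ p.1.rep‖ * (τ.im ^ (k + 3 / 2) * ‖g τ (p.1.rep + p.2.rep)‖) *
          ‖φ p.2.rep‖ := by ring
    _ ≤ B * D (p.1.rep + p.2.rep) * C := by
        refine mul_le_mul (mul_le_mul (hB τ hτ _) (hD _ τ hτ) ?_ hB0) (hC _) (norm_nonneg _)
          (mul_nonneg hB0 (hD0 _))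
        exact mul_nonneg (Real.rpow_nonneg τ.im_pos.le _) (norm_nonneg _)

theorem measurable_thetaPairing {φ : ℍ → V → ℂ} (hφ : ∀ x, Measurable fun τ => φ τ x) :
    Measurable fun τ => thetaPairing Q P N g (φ τ) τ := by
  have := h.evenP.finite_disc
  have := h.evenN.finite_disc
  have := Fintype.ofFinite (Disc Q P)
  have := Fintype.ofFinite (Disc Q N)
  simp only [thetaPairing, finsum_eq_sum_of_fintype]
  refine Measurable.mul (Finset.measurable_sum _ fun p _ => ?_) ?_
  · exact ((hr.measurable_theta _).mul (hφ _)).mul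
      (Complex.continuous_conj.measurable.comp (hg.continuous _).measurable)
  · exact Complex.measurable_ofReal.comp (UpperHalfPlane.continuous_im.measurable.pow_const _)

theorem measurable_unfoldedIntegrand (s : ℂ) : Measurable (unfoldedIntegrand Q P N g s) := by
  refine Measurable.mul ?_ (measurable_thetaPairing h hr hg fun x => measurable_const)
  exact (Complex.measurable_ofReal.comp UpperHalfPlane.continuous_im.measurable).pow_const _

omit hr in
theorem unfoldedIntegrand_T (hr : IsRankOne Q P y K) (s : ℂ) (τ : ℍ) :
    unfoldedIntegrand Q P N g s (ModularGroup.T • τ) = unfoldedIntegrand Q P N g s τ := by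
  have h1 := thetaPairing_T h hr hg (charFun N) τ
  have h2 : weilT Q (charFun N) = charFun N := by
    ext x
    rw [weilT, charFun]
    split_ifs with hx
    · rw [e_ratCast_of_int (h.evenN.int _ hx), one_mul]
    · simp
  rw [h2] at h1
  rw [unfoldedIntegrand, unfoldedIntegrand, h1, ModularGroup.im_T_smul]

/-- The pairing is a finite sum, so it commutes with the Eisenstein series; `thetaPairing_eisTerm`
turns each summand into a translate of one function. -/
theorem hasSum_unfoldedIntegrand {s : ℂ} (hs : 1 < s.re) (τ : ℍ) :
    HasSum (fun c : GammaInftyCosets => unfoldedIntegrand Q P N g s (c.out • τ))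
      (rankinIntegrand Q P N g s τ) := by
  have := h.evenP.finite_disc
  have := h.evenN.finite_disc
  have := Fintype.ofFinite (Disc Q P)
  have := Fintype.ofFinite (Disc Q N)
  rw [rankinIntegrand_eq_thetaPairing]
  have h1 : HasSum (fun c : GammaInftyCosets => thetaPairing Q P N g (eisTerm Q N τ s c.out) τ)
      (thetaPairing Q P N g (eisenstein Q N τ s) τ) := by
    simp only [thetaPairing, finsum_eq_sum_of_fintype]
    refine HasSum.mul_right _ (hasSum_sum fun p _ => ?_)
    exact ((h.evenN.summable_eisTerm τ hs _).hasSum.mul_left _).mul_right _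
  exact h1.congr_fun fun c => (thetaPairing_eisTerm h hr hg c.out s τ).symm

/-- A majorant uniform on `fd` and summable over the cosets; with the finite volume of `fd` it
justifies every interchange in the unfolding. -/
theorem exists_unfoldedIntegrand_bound {s : ℂ} (hs : 1 < s.re) :
    ∃ D : ℝ, 0 ≤ D ∧ ∀ τ ∈ ModularGroup.fd, ∀ c : GammaInftyCosets,
      ‖unfoldedIntegrand Q P N g s (c.out • τ)‖ ≤ D * ‖lowerRow c‖ ^ (-(s.re + 1)) := by
  obtain ⟨D, hD0, hD⟩ := exists_thetaPairing_bound h hr hg (k := s.re / 2) (by linarith)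
  refine ⟨D * EisensteinSeries.r ⟨⟨1 / 2, 1 / 2⟩, by norm_num⟩ ^ (-(s.re + 1)),
    mul_nonneg hD0 (Real.rpow_nonneg (EisensteinSeries.r_pos _).le _), fun τ hτ c => ?_⟩
  have him : 1 / 2 ≤ τ.im := by
    have := ModularGroup.three_le_four_mul_im_sq_of_mem_fd hτ
    have h2 := τ.im_pos
    nlinarith
  have h1 : unfoldedIntegrand Q P N g s (c.out • τ) = _ :=
    (thetaPairing_eisTerm h hr hg c.out s τ).symm
  rw [h1]
  -- Divided by `v^{Re s/2}`, the Eisenstein summand is bounded by a power of `|cτ + d|` alone; the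
  -- removed power of `v` is absorbed by the choice `k = Re s/2`.
  have h2 := hD τ him (fun x => ((τ.im ^ (s.re / 2) : ℝ) : ℂ)⁻¹ * eisTerm Q N τ s c.out x)
    (‖autFactor c.out τ‖ ^ (-(s.re + 1))) (fun x => by
      have hpos : 0 < τ.im ^ (s.re / 2) := Real.rpow_pos_of_pos τ.im_pos _
      rw [norm_mul, norm_inv, Complex.norm_real, Real.norm_of_nonneg hpos.le,
        inv_mul_le_iff₀ hpos]
      exact h.evenN.norm_eisTerm_le τ s c.out x)
  have hpos : 0 < τ.im ^ (s.re / 2) := Real.rpow_pos_of_pos τ.im_pos _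
  rw [thetaPairing_const_mul, norm_mul, norm_inv, Complex.norm_real, Real.norm_of_nonneg hpos.le,
    mul_inv_cancel_left₀ hpos.ne'] at h2
  refine h2.trans ?_
  rw [mul_assoc]
  refine mul_le_mul_of_nonneg_left ?_ hD0
  exact EisensteinSeries.summand_bound_of_mem_verticalStrip (k := s.re + 1) (by linarith)
    (lowerRow c) (by norm_num) ⟨hτ.2, him⟩

theorem integrableOn_unfoldedIntegrand_comp {s : ℂ} (hs : 1 < s.re) (c : GammaInftyCosets) :
    IntegrableOn (fun τ => unfoldedIntegrand Q P N g s (c.out • τ)) ModularGroup.fd := by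
  obtain ⟨D, hD0, hD⟩ := exists_unfoldedIntegrand_bound h hr hg hs
  refine Measure.integrableOn_of_bounded volume_fd_lt_top.ne
    ((measurable_unfoldedIntegrand h hr hg s).comp
      (measurable_const_smul c.out)).aestronglyMeasurable (M := D * ‖lowerRow c‖ ^ (-(s.re + 1))) ?_
  exact (ae_restrict_iff' measurableSet_fd).2 (.of_forall fun τ hτ => hD τ hτ c)

theorem integrableOn_rankinIntegrand {s : ℂ} (hs : 1 < s.re) :
    IntegrableOn (rankinIntegrand Q P N g s) ModularGroup.fd := by
  obtain ⟨D, hD0, hD⟩ := exists_unfoldedIntegrand_bound h hr hg hs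
  have hsum := hasSum_unfoldedIntegrand h hr hg hs
  have hm : Measurable (rankinIntegrand Q P N g s) := by
    have h1 : rankinIntegrand Q P N g s = fun τ => ∑' c : GammaInftyCosets,
        unfoldedIntegrand Q P N g s (c.out • τ) := funext fun τ => (hsum τ).tsum_eq.symm
    rw [h1]
    exact measurable_tsum_of_summable (fun c => (measurable_unfoldedIntegrand h hr hg s).comp
      (measurable_const_smul c.out)) fun τ => (hsum τ).summable
  have hrow := (summable_lowerRow (k := s.re + 1) (by linarith)).mul_left D
  refine Measure.integrableOn_of_bounded volume_fd_lt_top.ne hm.aestronglyMeasurable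
    (M := ∑' c, D * ‖lowerRow c‖ ^ (-(s.re + 1))) ?_
  refine (ae_restrict_iff' measurableSet_fd).2 (.of_forall fun τ hτ => ?_)
  rw [← (hsum τ).tsum_eq]
  exact tsum_of_norm_bounded hrow.hasSum (hD τ hτ)

/-- Unfolding of nonnegative functions, applied to the norm, turns the integral over the strip into
a sum of integrals over `fd`, to which the majorant applies. -/
theorem integrableOn_unfoldedIntegrand {s : ℂ} (hs : 1 < s.re) :
    IntegrableOn (unfoldedIntegrand Q P N g s) periodStrip := by
  obtain ⟨D, hD0, hD⟩ := exists_unfoldedIntegrand_bound h hr hg hs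
  refine ⟨(measurable_unfoldedIntegrand h hr hg s).aestronglyMeasurable, ?_⟩
  rw [hasFiniteIntegral_iff_enorm, ← tsum_lintegral_fd (F := fun τ =>
    ‖unfoldedIntegrand Q P N g s τ‖ₑ) (fun z => by rw [unfoldedIntegrand_T h hg hr])]
  have hrow := (summable_lowerRow (k := s.re + 1) (by linarith)).mul_left D
  have h1 : ∀ c : GammaInftyCosets,
      ∫⁻ z in ModularGroup.fd, ‖unfoldedIntegrand Q P N g s (c.out • z)‖ₑ ≤
        ENNReal.ofReal (D * ‖lowerRow c‖ ^ (-(s.re + 1))) * volume ModularGroup.fd := by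
    intro c
    rw [← setLIntegral_const]
    refine setLIntegral_mono measurable_const fun z hz => ?_
    rw [← ofReal_norm]
    exact ENNReal.ofReal_le_ofReal (hD z hz c)
  refine (ENNReal.tsum_le_tsum h1).trans_lt ?_
  rw [ENNReal.tsum_mul_right]
  exact ENNReal.mul_lt_top hrow.tsum_ofReal_lt_top volume_fd_lt_top

/-- Both sides are the sum over cosets of the integrals of the translates over `fd`: up to powers of
`T` the strip is tiled by translates of `fd`, and on `fd` the sum may be taken under the integral.
-/
theorem rankinL_eq_integral_periodStrip {s : ℂ} (hs : 1 < s.re) :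
    rankinL Q P N g s = ∫ τ in periodStrip, unfoldedIntegrand Q P N g s τ := by
  obtain ⟨D, hD0, hD⟩ := exists_unfoldedIntegrand_bound h hr hg hs
  have h1 := hasSum_integral_fd (F := unfoldedIntegrand Q P N g s)
    (unfoldedIntegrand_T h hg hr s) (integrableOn_unfoldedIntegrand h hr hg hs)
  have hrow := (summable_lowerRow (k := s.re + 1) (by linarith)).mul_left D
  have h2 := hasSum_integral_of_summable_integral_norm (μ := volume.restrict ModularGroup.fd)
    (F := fun (c : GammaInftyCosets) τ => unfoldedIntegrand Q P N g s (c.out • τ))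
    (fun c => integrableOn_unfoldedIntegrand_comp h hr hg hs c) (by
      refine .of_nonneg_of_le (fun c => integral_nonneg fun _ => norm_nonneg _) (fun c => ?_)
        (hrow.mul_right (volume.real ModularGroup.fd))
      refine (le_abs_self _).trans ?_
      rw [← Real.norm_eq_abs]
      refine norm_setIntegral_le_of_norm_le_const volume_fd_lt_top fun τ hτ => ?_
      rw [norm_norm]
      exact hD τ hτ c)
  rw [h1.unique h2, rankinL]
  exact integral_congr_ae (.of_forall fun τ =>
    (hasSum_unfoldedIntegrand h hr hg hs τ).tsum_eq.symm)

end Lattices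

end

section

open MeasureTheory UpperHalfPlane

/-! ### The invariant measure in coordinates -/

/-- The real and imaginary part. -/
def reIm (z : ℍ) : ℝ × ℝ := (z.re, z.im)

theorem measurableEmbedding_reIm : MeasurableEmbedding reIm :=
  Complex.measurableEquivRealProd.measurableEmbedding.comp measurableEmbedding_coe

theorem measurePreserving_reIm : MeasurePreserving reIm ((volume : Measure ℂ).comap (↑))
    ((volume : Measure (ℝ × ℝ)).restrict (Set.range reIm)) := by
  have h1 : MeasurePreserving UpperHalfPlane.coe (volume.comap UpperHalfPlane.coe)
      (volume.restrict (.range UpperHalfPlane.coe)) :=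
    ⟨measurable_coe, by rw [measurableEmbedding_coe.map_comap]⟩
  have h2 := Complex.volume_preserving_equiv_real_prod.restrict_image_emb
    Complex.measurableEquivRealProd.measurableEmbedding (Set.range UpperHalfPlane.coe)
  rw [← Set.range_comp] at h2
  exact h2.comp h1

theorem image_reIm_periodStrip : reIm '' periodStrip = Set.Ico 0 1 ×ˢ Set.Ioi 0 := by
  ext ⟨u, v⟩
  simp only [Set.mem_image, reIm, Prod.mk.injEq, Set.mem_prod, Set.mem_Ioi, periodStrip,
    Set.mem_ofPred_eq, Set.mem_Ico]
  constructor
  · rintro ⟨z, hz, rfl, rfl⟩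
    exact ⟨hz, z.im_pos⟩
  · rintro ⟨hu, hv⟩
    exact ⟨⟨⟨u, v⟩, hv⟩, hu, rfl, rfl⟩

theorem restrict_periodStrip : (volume : Measure ℍ).restrict periodStrip =
    ((volume.comap UpperHalfPlane.coe).restrict periodStrip).withDensity fun z ↦
      ↑((1 / NNReal.mk z.im z.im_pos.le : NNReal) ^ 2) := by
  rw [volume_def, restrict_withDensity measurableSet_periodStrip]

theorem measurable_density :
    Measurable fun z : ℍ => (1 / NNReal.mk z.im z.im_pos.le : NNReal) ^ 2 := by
  refine (Measurable.div measurable_const ?_).pow_const 2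
  exact UpperHalfPlane.continuous_im.measurable.subtype_mk

variable (F : ℍ → ℂ)

theorem density_smul (z : ℍ) : (1 / NNReal.mk z.im z.im_pos.le : NNReal) ^ 2 • F z =
    ((reIm z).2 ^ 2)⁻¹ • F (ofComplex ((reIm z).1 + (reIm z).2 * Complex.I)) := by
  have h1 : (((reIm z).1 : ℂ) + (reIm z).2 * Complex.I) = z := by
    apply Complex.ext <;> simp [reIm]
  rw [h1, ofComplex_apply, NNReal.smul_def]
  simp [reIm]

theorem integrableOn_periodStrip_iff : IntegrableOn F periodStrip ↔
    IntegrableOn (fun p : ℝ × ℝ => (p.2 ^ 2)⁻¹ • F (ofComplex (p.1 + p.2 * Complex.I)))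
      (Set.Ico 0 1 ×ˢ Set.Ioi 0) := by
  rw [IntegrableOn, restrict_periodStrip,
    integrable_withDensity_iff_integrable_smul measurable_density,
    ← image_reIm_periodStrip, ← Set.inter_eq_self_of_subset_left (Set.image_subset_range reIm _),
    IntegrableOn, ← Measure.restrict_restrict']
  · simp only [density_smul]
    exact (measurePreserving_reIm.integrableOn_image measurableEmbedding_reIm
      (f := fun p : ℝ × ℝ => (p.2 ^ 2)⁻¹ • F (ofComplex (p.1 + p.2 * Complex.I)))).symm
  · exact measurableEmbedding_reIm.measurableSet_range

theorem integral_periodStrip : ∫ z in periodStrip, F z =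
    ∫ p in Set.Ico (0 : ℝ) 1 ×ˢ Set.Ioi (0 : ℝ),
      (p.2 ^ 2)⁻¹ • F (ofComplex (p.1 + p.2 * Complex.I)) := by
  rw [restrict_periodStrip, integral_withDensity_eq_integral_smul measurable_density,
    ← image_reIm_periodStrip, ← Set.inter_eq_self_of_subset_left (Set.image_subset_range reIm _),
    ← Measure.restrict_restrict' measurableEmbedding_reIm.measurableSet_range,
    measurePreserving_reIm.setIntegral_image_emb measurableEmbedding_reIm]
  simp only [density_smul]

/-- Integration over the strip in coordinates. -/
theorem integrableOn_integral_and_integral_periodStrip (hF : IntegrableOn F periodStrip) :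
    IntegrableOn (fun v : ℝ => (v ^ 2)⁻¹ • ∫ u in (0 : ℝ)..1,
      F (ofComplex (u + v * Complex.I))) (Set.Ioi 0) ∧
    ∫ z in periodStrip, F z = ∫ v in Set.Ioi (0 : ℝ), (v ^ 2)⁻¹ • ∫ u in (0 : ℝ)..1,
      F (ofComplex (u + v * Complex.I)) := by
  rw [integrableOn_periodStrip_iff, IntegrableOn, Measure.volume_eq_prod,
    ← Measure.prod_restrict] at hF
  have h1 : ∀ v : ℝ, (v ^ 2)⁻¹ • ∫ u in (0 : ℝ)..1, F (ofComplex (u + v * Complex.I)) =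
      ∫ u in Set.Ico (0 : ℝ) 1, (v ^ 2)⁻¹ • F (ofComplex (u + v * Complex.I)) := by
    intro v
    rw [integral_smul, intervalIntegral.integral_of_le zero_le_one, integral_Ico_eq_integral_Ioc]
  simp only [h1]
  refine ⟨hF.integral_prod_right, ?_⟩
  rw [integral_periodStrip, Measure.volume_eq_prod, ← Measure.prod_restrict,
    integral_prod_symm _ hF]

end

section

open MeasureTheory

/-! ### Mellin transforms -/

/-- Differentiation under the integral: `|log t|` costs a power `t^{±δ}`, and the resulting powers
of `t` are dominated by those at `a` and `b`. Convergence at two real points is enough, so no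
asymptotics of `f` are required. -/
theorem differentiableAt_mellin_of_mellinConvergent {f : ℝ → ℂ} {a b : ℝ} {s : ℂ}
    (hf : MellinConvergent f a) (hf' : MellinConvergent f b) (ha : a < s.re) (hb : s.re < b) :
    DifferentiableAt ℂ (mellin f) s := by
  -- One `δ` leaves room for `z` to move around `s`, the other pays for the logarithm.
  obtain ⟨δ, hδ, hδa, hδb⟩ : ∃ δ : ℝ, 0 < δ ∧ a ≤ s.re - 2 * δ ∧ s.re + 2 * δ ≤ b := by
    refine ⟨min (s.re - a) (b - s.re) / 2, ?_, ?_, ?_⟩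
    · have : 0 < min (s.re - a) (b - s.re) := lt_min (by linarith) (by linarith)
      linarith
    · have := min_le_left (s.re - a) (b - s.re); linarith
    · have := min_le_right (s.re - a) (b - s.re); linarith
  have norm_cpow : ∀ (t : ℝ) (_ : 0 < t) (z : ℂ), ‖(t : ℂ) ^ (z - 1)‖ = t ^ (z.re - 1) := by
    intro t ht z
    rw [Complex.norm_cpow_eq_rpow_re_of_pos ht]; simp
  have hmeas_cpow : ∀ z : ℂ, AEStronglyMeasurable (fun t : ℝ => (t : ℂ) ^ (z - 1))
      (volume.restrict (Set.Ioi 0)) := fun z =>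
    (Complex.measurable_ofReal.pow_const _).aestronglyMeasurable
  -- Measurability of `f` is recovered from that of `t^{a-1} f` on multiplying by `t^{1-a}`.
  have hfmeas : AEStronglyMeasurable f (volume.restrict (Set.Ioi 0)) := by
    have h1 := (hmeas_cpow (2 - a)).mul hf.aestronglyMeasurable
    refine h1.congr ((ae_restrict_mem measurableSet_Ioi).mono fun t ht => ?_)
    have ht' : (t : ℂ) ≠ 0 := by exact_mod_cast (ne_of_gt ht)
    change (t : ℂ) ^ (2 - (a : ℂ) - 1) * ((t : ℂ) ^ ((a : ℂ) - 1) * f t) = f t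
    rw [← mul_assoc, ← Complex.cpow_add _ _ ht']
    ring_nf
    rw [Complex.cpow_zero, one_mul]
  have hbound : ∀ z : ℂ, |z.re - s.re| ≤ δ → ∀ t : ℝ, 0 < t →
      ‖(t : ℂ) ^ (z - 1) * Real.log t‖ ≤ (t ^ (a - 1) + t ^ (b - 1)) * δ⁻¹ := by
    intro z hz t ht
    have hz' := abs_le.1 hz
    rw [norm_mul, norm_cpow t ht, Complex.norm_real, Real.norm_eq_abs]
    have p1 : 0 < t ^ (a - 1) := Real.rpow_pos_of_pos ht _
    have p2 : 0 < t ^ (b - 1) := Real.rpow_pos_of_pos ht _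
    rcases le_total t 1 with h1 | h1
    · have h2 := (Real.abs_log_mul_self_rpow_lt t δ ht h1 hδ).le
      rw [abs_mul, abs_of_pos (Real.rpow_pos_of_pos ht _)] at h2
      have h3 : t ^ (z.re - 1) = t ^ (z.re - 1 - δ) * t ^ δ := by
        rw [← Real.rpow_add ht]; congr 1; ring
      have h4 : t ^ (z.re - 1 - δ) ≤ t ^ (a - 1) :=
        Real.rpow_le_rpow_of_exponent_ge ht h1 (by linarith)
      rw [h3, mul_assoc, mul_comm (t ^ δ)]
      refine mul_le_mul (h4.trans (by linarith)) (by simpa using h2) (by positivity) (by positivity)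
    · have h2 : |Real.log t| ≤ t ^ δ * δ⁻¹ := by
        rw [abs_of_nonneg (Real.log_nonneg h1), ← div_eq_mul_inv]
        exact Real.log_le_rpow_div ht.le hδ
      have h3 : t ^ (z.re - 1) * t ^ δ ≤ t ^ (b - 1) := by
        rw [← Real.rpow_add ht]
        exact Real.rpow_le_rpow_of_exponent_le h1 (by linarith)
      calc t ^ (z.re - 1) * |Real.log t| ≤ t ^ (z.re - 1) * (t ^ δ * δ⁻¹) :=
            mul_le_mul_of_nonneg_left h2 (Real.rpow_nonneg ht.le _)
        _ = t ^ (z.re - 1) * t ^ δ * δ⁻¹ := by ring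
        _ ≤ (t ^ (a - 1) + t ^ (b - 1)) * δ⁻¹ :=
            mul_le_mul_of_nonneg_right (h3.trans (by linarith)) (by positivity)
  have hconv : ∀ c : ℝ, MellinConvergent f c →
      IntegrableOn (fun t => t ^ (c - 1) * ‖f t‖) (Set.Ioi 0) := by
    intro c hc
    refine IntegrableOn.congr_fun hc.norm (fun t ht => ?_) measurableSet_Ioi
    simp only [norm_smul, norm_cpow t ht, Complex.ofReal_re]
  have hsconv : IntegrableOn (fun t : ℝ => (t : ℂ) ^ (s - 1) • f t) (Set.Ioi 0) := by
    refine Integrable.mono' ((hconv a hf).add (hconv b hf')) ((hmeas_cpow s).smul hfmeas)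
      ((ae_restrict_mem measurableSet_Ioi).mono fun t ht => ?_)
    simp only [norm_smul, norm_cpow t ht, Pi.add_apply, ← add_mul]
    refine mul_le_mul_of_nonneg_right ?_ (norm_nonneg _)
    have p1 : 0 < t ^ (a - 1) := Real.rpow_pos_of_pos ht _
    have p2 : 0 < t ^ (b - 1) := Real.rpow_pos_of_pos ht _
    rcases le_total t 1 with h1 | h1
    · exact (Real.rpow_le_rpow_of_exponent_ge ht h1 (y := s.re - 1) (z := a - 1) (by linarith)).trans
        (by linarith)
    · exact (Real.rpow_le_rpow_of_exponent_le h1 (y := s.re - 1) (z := b - 1) (by linarith)).trans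
        (by linarith)
  have key := hasDerivAt_integral_of_dominated_loc_of_deriv_le (𝕜 := ℂ)
    (μ := volume.restrict (Set.Ioi 0)) (F := fun (z : ℂ) (t : ℝ) => (t : ℂ) ^ (z - 1) • f t)
    (F' := fun (z : ℂ) (t : ℝ) => ((t : ℂ) ^ (z - 1) * Real.log t) • f t) (x₀ := s)
    (bound := fun t => ((t ^ (a - 1) + t ^ (b - 1)) * δ⁻¹) * ‖f t‖)
    (Metric.ball_mem_nhds s hδ) (.of_forall fun z => (hmeas_cpow z).smul hfmeas) hsconv
    (((hmeas_cpow s).mul (Complex.measurable_ofReal.comp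
      Real.measurable_log).aestronglyMeasurable).smul hfmeas)
    ((ae_restrict_mem measurableSet_Ioi).mono fun t ht z hz => by
      rw [norm_smul]
      refine mul_le_mul_of_nonneg_right (hbound z ?_ t ht) (norm_nonneg _)
      rw [mem_ball_iff_norm] at hz
      rw [← Complex.sub_re]
      exact (Complex.abs_re_le_norm _).trans hz.le)
    (by
      have := ((hconv a hf).add (hconv b hf')).const_mul δ⁻¹
      refine this.congr (.of_forall fun t => ?_)
      simp only [Pi.add_apply]; ring)
    ((ae_restrict_mem measurableSet_Ioi).mono fun t ht z _ => by
      have ht' : (t : ℂ) ≠ 0 := by exact_mod_cast (ne_of_gt ht)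
      have u1 : HasDerivAt (fun z : ℂ => (t : ℂ) ^ (z - 1)) (t ^ (z - 1) * Real.log t) z := by
        convert ((hasDerivAt_id' z).sub_const 1).const_cpow (Or.inl ht') using 1
        rw [Complex.ofReal_log (le_of_lt ht)]
        ring
      exact u1.smul_const (f t))
  exact key.2.differentiableAt

end

section

section Lattices

variable {V : Type} [AddCommGroup V] [Module ℚ V] {Q : QuadraticForm ℚ V}
  {M P N L : AddSubgroup V}

open MeasureTheory ComplexConjugate

open UpperHalfPlane (ofComplex)

/-! ### The Rankin integral as a Mellin transform -/

/-- The zeroth Fourier coefficient of `∑_n q^{Q(nx)} \bar g_{nx}`. -/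
def thetaMean (Q : QuadraticForm ℚ V) (g : ℍ → V → ℂ) (x : V) (v : ℝ) : ℂ :=
  ∫ u in (0 : ℝ)..1, ∑' n : ℤ, e (((Q (n • x) : ℚ) : ℂ) * ofComplex (u + v * Complex.I)) *
    conj (g (ofComplex (u + v * Complex.I)) (n • x))

theorem im_ofComplex {u v : ℝ} (hv : 0 < v) : (ofComplex (u + v * Complex.I)).im = v := by
  have him : 0 < ((u : ℂ) + v * Complex.I).im := by simpa
  rw [UpperHalfPlane.ofComplex_apply_of_im_pos him]
  change ((u : ℂ) + v * Complex.I).im = v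
  simp

theorem coe_ofComplex {u v : ℝ} (hv : 0 < v) :
    ((ofComplex (u + v * Complex.I) : ℍ) : ℂ) = u + v * Complex.I := by
  have him : 0 < ((u : ℂ) + v * Complex.I).im := by simpa
  rw [UpperHalfPlane.ofComplex_apply_of_im_pos him]

variable {y x : V} {K : ℕ} {k : ℤ} (h : IsSplit Q P N L) (hr : IsRankOne Q P y K)
  {g : ℍ → V → ℂ} (hg : IsCuspForm Q L (-1) 3 g)

/-- Conjugating the coefficient integral turns `e(-Qτ)` into `e(Q\bar τ)`; its ratio to `e(Qτ)` is
accounted for by `e(2iQv) = exp(-4πQv)`. -/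
theorem integral_mul_conj_eq {sig : ℤ} {w : ℕ} (hg : IsCuspForm Q L sig w g) (x : V) {v : ℝ}
    (hv : 0 < v) :
    ∫ u in (0 : ℝ)..1, e (((Q x : ℚ) : ℂ) * ofComplex (u + v * Complex.I)) *
      conj (g (ofComplex (u + v * Complex.I)) x) =
    conj (coeff Q g (Q x) x) * Real.exp (-(4 * Real.pi * Q x) * v) := by
  have h1 := hg.coeff_eq_integral (m := Q x) (x := x) ⟨0, by simp⟩ hv
  have h2 : ∀ f : ℝ → ℂ, conj (∫ u in (0 : ℝ)..1, f u) = ∫ u in (0 : ℝ)..1, conj (f u) := by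
    intro f
    rw [intervalIntegral.integral_of_le zero_le_one, intervalIntegral.integral_of_le zero_le_one,
      integral_conj]
  rw [← h1, h2, ← intervalIntegral.integral_mul_const]
  refine intervalIntegral.integral_congr fun u _ => ?_
  rw [coe_ofComplex hv, map_mul, mul_comm (e _), mul_assoc]
  congr 1
  rw [conj_e, e, e, Complex.ofReal_exp, ← Complex.exp_add]
  congr 1
  simp only [map_mul, map_neg, map_add, Complex.conj_I, Complex.conj_ofReal, map_ratCast]
  push_cast
  linear_combination (2 * (Real.pi : ℂ) * (Q x : ℚ) * v * 2) * Complex.I_mul_I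

include h hr hg

omit hg in
theorem summable_norm_e_zsmul (hk : k ≠ 0) (hkx : k • y = x) (τ : ℍ) :
    Summable fun n : ℤ => ‖e (((Q (n • x) : ℚ) : ℂ) * τ)‖ := by
  have h1 := (hr.summable_dual τ).norm.comp_injective (i := fun n : ℤ => hr.dualEquiv (n * k))
    (fun a b hab => mul_right_cancel₀ hk (hr.dualEquiv.injective hab))
  refine h1.congr fun n => ?_
  have : ((hr.dualEquiv (n * k) : dualLattice Q P) : V) = n • x := by
    rw [← hkx, smul_smul]; rfl
  simp only [Function.comp_apply, this]

/-- Dominated convergence: on a horizontal line the absolute values of the theta terms do not depend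
on `u`, and `g` is controlled by the Hecke bound. -/
theorem hasSum_thetaMean (hk : k ≠ 0) (hkx : k • y = x) {v : ℝ} (hv : 0 < v) :
    HasSum (fun n : ℤ => conj (coeff Q g (Q (n • x)) (n • x)) *
      Real.exp (-(4 * Real.pi * Q (n • x)) * v)) (thetaMean Q g x v) := by
  obtain ⟨C, hC0, hC⟩ := hg.exists_hecke_bound h.evenL
  have hsum : Summable fun n : ℤ => ‖e (((Q (n • x) : ℚ) : ℂ) * ofComplex (0 + v * Complex.I))‖ :=
    summable_norm_e_zsmul h hr hk hkx _
  have hnorm : ∀ (n : ℤ) (u : ℝ), ‖e (((Q (n • x) : ℚ) : ℂ) * ofComplex (u + v * Complex.I))‖ =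
      ‖e (((Q (n • x) : ℚ) : ℂ) * ofComplex (0 + v * Complex.I))‖ := by
    intro n u
    have h0 := coe_ofComplex (u := 0) hv
    rw [Complex.ofReal_zero] at h0
    rw [norm_e, norm_e, coe_ofComplex hv, h0]
    simp
  have hb : ∀ (n : ℤ) (u : ℝ), ‖e (((Q (n • x) : ℚ) : ℂ) * ofComplex (u + v * Complex.I)) *
      conj (g (ofComplex (u + v * Complex.I)) (n • x))‖ ≤
      ‖e (((Q (n • x) : ℚ) : ℂ) * ofComplex (0 + v * Complex.I))‖ *
        (C * v ^ (-((3 : ℕ) : ℝ) / 4)) := by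
    intro n u
    rw [norm_mul, hnorm, RCLike.norm_conj]
    refine mul_le_mul_of_nonneg_left ?_ (norm_nonneg _)
    have := hC (ofComplex (u + v * Complex.I)) (n • x)
    rwa [im_ofComplex hv] at this
  have hcont : Continuous fun u : ℝ => ofComplex (u + v * Complex.I) := by
    rw [UpperHalfPlane.isOpenEmbedding_coe.isInducing.continuous_iff]
    have : (fun u : ℝ => ((ofComplex (u + v * Complex.I) : ℍ) : ℂ)) =
        fun u : ℝ => u + v * Complex.I := funext fun u => coe_ofComplex hv
    rw [Function.comp_def, this]
    fun_prop
  have key := intervalIntegral.hasSum_integral_of_dominated_convergence (a := 0) (b := 1)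
    (μ := volume)
    (F := fun (n : ℤ) (u : ℝ) => e (((Q (n • x) : ℚ) : ℂ) * ofComplex (u + v * Complex.I)) *
      conj (g (ofComplex (u + v * Complex.I)) (n • x)))
    (f := fun u => ∑' n : ℤ, e (((Q (n • x) : ℚ) : ℂ) * ofComplex (u + v * Complex.I)) *
      conj (g (ofComplex (u + v * Complex.I)) (n • x)))
    (fun n _ => ‖e (((Q (n • x) : ℚ) : ℂ) * ofComplex (0 + v * Complex.I))‖ *
        (C * v ^ (-((3 : ℕ) : ℝ) / 4)))
    (fun n => by
      refine Continuous.aestronglyMeasurable (Continuous.mul ?_ ?_)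
      · have h2 : Continuous fun τ : ℍ => (τ : ℂ) := UpperHalfPlane.continuous_coe
        exact Complex.continuous_exp.comp (continuous_const.mul
          (continuous_const.mul (h2.comp hcont)))
      · exact Complex.continuous_conj.comp ((hg.continuous _).comp hcont))
    (fun n => .of_forall fun u _ => hb n u)
    (.of_forall fun u _ => hsum.mul_right _)
    (by simp)
    (.of_forall fun u _ => (Summable.of_norm_bounded (hsum.mul_right _) fun n => hb n u).hasSum)
  exact key.congr_fun fun n => (integral_mul_conj_eq hg (n • x) hv).symm

/-- As `g` is even, `n` and `-n` contribute equally. Folding counts `n = 0` twice, which is harmless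
because that coefficient vanishes. -/
theorem hasSum_thetaMean_nat (hk : k ≠ 0) (hkx : k • y = x) {v : ℝ} (hv : 0 < v) :
    HasSum (fun n : ℕ => (2 * conj (coeff Q g (Q (n • x)) (n • x))) *
      Real.exp (-(4 * Real.pi * Q x * n ^ 2) * v)) (thetaMean Q g x v) := by
  have h1 := (hasSum_thetaMean h hr hg hk hkx hv).nat_add_neg
  have h0 : coeff Q g (Q ((0 : ℤ) • x)) ((0 : ℤ) • x) = 0 := by
    rw [zero_smul, QuadraticMap.map_zero]; exact hg.coeff_zero_zero
  rw [h0, map_zero, zero_mul, add_zero] at h1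
  refine h1.congr_fun fun n => ?_
  have hc : coeff Q g (Q (-(n : ℤ) • x)) (-(n : ℤ) • x) = coeff Q g (Q ((n : ℤ) • x)) ((n : ℤ) • x) := by
    rw [neg_smul, QuadraticMap.map_neg]
    exact IsCuspForm.coeff_neg (fun τ x => hg.neg h.evenL τ x) _ _
  have hQ : ∀ n : ℤ, ((Q (n • x) : ℚ) : ℝ) = Q x * n ^ 2 := by
    intro n; rw [Q_zsmul]; push_cast; ring
  rw [hc, hQ, hQ, ← natCast_zsmul]
  push_cast
  ring_nf

/-- `g` vanishes off `L'`, and `ny ∈ L'` only if `k ∣ n`; so the sum over `P' = ℤy` is really one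
over `ℤx`. -/
theorem unfoldedIntegrand_eq (hk : k ≠ 0) (hkx : k • y = x)
    (hdiv : ∀ n : ℤ, n • y ∈ dualLattice Q L ↔ k ∣ n) (s : ℂ) (τ : ℍ) :
    unfoldedIntegrand Q P N g s τ = ((τ.im : ℝ) : ℂ) ^ (s / 2 + 3 / 2) *
      ∑' n : ℤ, e (((Q (n • x) : ℚ) : ℂ) * τ) * conj (g τ (n • x)) := by
  have h1 : ∑' n : ℤ, e (((Q (n • y) : ℚ) : ℂ) * τ) * conj (g τ (n • y)) =
      ∑' n : ℤ, e (((Q (n • x) : ℚ) : ℂ) * τ) * conj (g τ (n • x)) := by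
    have hinj : Function.Injective fun n : ℤ => n * k := fun a b hab => mul_right_cancel₀ hk hab
    rw [← hinj.tsum_eq]
    · refine tsum_congr fun n => ?_
      rw [mul_smul, hkx]
    · intro n hn
      by_contra hn'
      refine hn ?_
      have : n • y ∉ dualLattice Q L := by
        rw [hdiv]
        rintro ⟨m, rfl⟩
        exact hn' ⟨m, mul_comm _ _⟩
      simp only [(hg.schwartz τ).1 _ this, map_zero, mul_zero]
  have him : ((τ.im : ℝ) : ℂ) ≠ 0 := by exact_mod_cast τ.im_pos.ne'
  rw [unfoldedIntegrand, thetaPairing_charFun h hr hg, h1, Complex.cpow_add _ _ him,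
    Complex.ofReal_cpow τ.im_pos.le]
  push_cast
  ring

/-- The exponent of `v` is `s/2` from the Eisenstein series plus `3/2` from the weight minus `2`
from the measure, that is `(s+1)/2 - 1`. -/
theorem mellin_thetaMean (hk : k ≠ 0) (hkx : k • y = x)
    (hdiv : ∀ n : ℤ, n • y ∈ dualLattice Q L ↔ k ∣ n) {s : ℂ} (hs : 1 < s.re) :
    MellinConvergent (thetaMean Q g x) ((s + 1) / 2) ∧
    rankinL Q P N g s = mellin (thetaMean Q g x) ((s + 1) / 2) := by
  obtain ⟨h1, h2⟩ := integrableOn_integral_and_integral_periodStrip _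
    (integrableOn_unfoldedIntegrand h hr hg hs)
  have h3 : ∀ v ∈ Set.Ioi (0 : ℝ), (v ^ 2)⁻¹ • ∫ u in (0 : ℝ)..1,
      unfoldedIntegrand Q P N g s (ofComplex (u + v * Complex.I)) =
      (v : ℂ) ^ ((s + 1) / 2 - 1) • thetaMean Q g x v := by
    intro v hv
    have hv0 : (0 : ℝ) < v := hv
    have hv' : (v : ℂ) ≠ 0 := by exact_mod_cast hv0.ne'
    simp only [unfoldedIntegrand_eq h hr hg hk hkx hdiv, im_ofComplex hv0]
    rw [intervalIntegral.integral_const_mul, ← thetaMean, Complex.real_smul, smul_eq_mul,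
      ← mul_assoc]
    congr 1
    have : (s + 1) / 2 - 1 = (s / 2 + 3 / 2) - (2 : ℕ) := by push_cast; ring
    rw [this, Complex.cpow_sub _ _ hv', Complex.cpow_natCast]
    push_cast
    ring
  rw [rankinL_eq_integral_periodStrip h hr hg hs, h2]
  exact ⟨h1.congr_fun h3 measurableSet_Ioi, setIntegral_congr_fun measurableSet_Ioi h3⟩

/-- The Mellin integral converges throughout `Re s > 1`. This gives holomorphy also for `Re s ≤
3/2`, where absolute convergence of the Dirichlet series is not available from the Hecke bound. -/
theorem differentiableAt_rankinL (hk : k ≠ 0) (hkx : k • y = x)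
    (hdiv : ∀ n : ℤ, n • y ∈ dualLattice Q L ↔ k ∣ n) {s : ℂ} (hs : 1 < s.re) :
    DifferentiableAt ℂ (rankinL Q P N g) s := by
  have hm := fun {s : ℂ} => mellin_thetaMean h hr hg hk hkx hdiv (s := s)
  have h1 : (rankinL Q P N g) =ᶠ[nhds s] fun s => mellin (thetaMean Q g x) ((s + 1) / 2) :=
    (isOpen_lt continuous_const Complex.continuous_re).mem_nhds hs |> Filter.mem_of_superset <|
      fun s hs => (hm hs).2
  refine DifferentiableAt.congr_of_eventuallyEq ?_ h1
  have h2 : DifferentiableAt ℂ (mellin (thetaMean Q g x)) ((s + 1) / 2) := by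
    refine differentiableAt_mellin_of_mellinConvergent (a := ((1 + s.re) / 2 + 1) / 2)
      (b := (s.re + 1 + 1) / 2) ?_ ?_ ?_ ?_
    · have := (hm (s := (((1 + s.re) / 2 : ℝ) : ℂ)) (by simp; linarith)).1
      convert this using 1
      push_cast; ring
    · have := (hm (s := ((s.re + 1 : ℝ) : ℂ)) (by simp; linarith)).1
      convert this using 1
      push_cast; ring
    · simp; linarith
    · simp; linarith
  exact DifferentiableAt.comp (g := mellin (thetaMean Q g x)) s h2 (by fun_prop)

/-- Termwise, `2 exp(-4πQ(x)n²v)` has Mellin transform `2 Γ(w) (4πQ(x)n²)^{-w}` at `w = (s+1)/2`,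
and `2 · 4^{-w} = 2^{-s}`. Absolute convergence of the Dirichlet series permits the interchange. -/
theorem rankinL_eq_LSeries (hk : k ≠ 0) (hkx : k • y = x)
    (hdiv : ∀ n : ℤ, n • y ∈ dualLattice Q L ↔ k ∣ n) (hx : 0 < Q x) {s : ℂ} (hs : 1 < s.re)
    (hsum : LSeriesSummable (fun n => coeff Q g (Q (n • x)) (n • x)) (s + 1)) :
    rankinL Q P N g s = 2 ^ (-s) * ((Real.pi * Q x : ℝ) : ℂ) ^ (-(s + 1) / 2) *
      Complex.Gamma ((s + 1) / 2) *
      LSeries (fun n => conj (coeff Q g (Q (n • x)) (n • x))) (s + 1) := by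
  set w := (s + 1) / 2 with hw
  set c : ℕ → ℂ := fun n => conj (coeff Q g (Q (n • x)) (n • x)) with hc
  set κ : ℂ := 2 ^ (-s) * ((Real.pi * Q x : ℝ) : ℂ) ^ (-(s + 1) / 2) with hκ
  have hx' : (0 : ℝ) < Q x := by exact_mod_cast hx
  have hpi : 0 < Real.pi * Q x := mul_pos Real.pi_pos hx'
  have hc0 : c 0 = 0 := by
    have : coeff Q g (Q ((0 : ℕ) • x)) ((0 : ℕ) • x) = 0 := by
      rw [zero_smul, QuadraticMap.map_zero]; exact hg.coeff_zero_zero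
    simp only [hc, this, map_zero]
  have hterm : ∀ n : ℕ, 2 * c n / ((4 * Real.pi * Q x * n ^ 2 : ℝ) : ℂ) ^ w =
      κ * LSeries.term c (s + 1) n := by
    intro n
    rcases eq_or_ne n 0 with rfl | hn
    · simp [hc0]
    have hn' : (0 : ℝ) < n := by exact_mod_cast Nat.pos_of_ne_zero hn
    have e1 : ((4 * Real.pi * Q x * n ^ 2 : ℝ) : ℂ) =
        (((2 * 2 : ℝ) * (n * n : ℝ) : ℝ) : ℂ) * ((Real.pi * Q x : ℝ) : ℂ) := by push_cast; ring
    have sq_cpow : ∀ a : ℝ, 0 < a → ((a * a : ℝ) : ℂ) ^ w = (a : ℂ) ^ (s + 1) := by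
      intro a ha
      have ha' : (a : ℂ) ≠ 0 := by exact_mod_cast ha.ne'
      rw [Complex.ofReal_mul, Complex.mul_cpow_ofReal_nonneg ha.le ha.le, ← Complex.cpow_add _ _ ha']
      congr 1; rw [hw]; ring
    have h2 : ((2 : ℝ) : ℂ) ^ (s + 1) = 2 / 2 ^ (-s) := by
      rw [Complex.cpow_neg, div_inv_eq_mul, Complex.cpow_add _ _ (by norm_num), Complex.cpow_one]
      push_cast; ring
    have h3 : (2 : ℂ) ^ (-s) ≠ 0 := by simp [Complex.cpow_eq_zero_iff]
    have h5 : ((Real.pi * Q x : ℝ) : ℂ) ^ (-w) = (((Real.pi * Q x : ℝ) : ℂ) ^ w)⁻¹ :=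
      Complex.cpow_neg _ _
    have h6 : ((Real.pi * Q x : ℝ) : ℂ) ^ w ≠ 0 := by
      have : ((Real.pi * Q x : ℝ) : ℂ) ≠ 0 := by exact_mod_cast hpi.ne'
      simp only [ne_eq, Complex.cpow_eq_zero_iff, this, false_and, not_false_eq_true]
    rw [e1, Complex.mul_cpow_ofReal_nonneg (by positivity) hpi.le,
      Complex.ofReal_mul (2 * 2), Complex.mul_cpow_ofReal_nonneg (by norm_num) (by positivity),
      sq_cpow 2 two_pos, sq_cpow n hn', h2, LSeries.term_of_ne_zero hn, hκ, neg_div, ← hw, h5]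
    simp only [Complex.ofReal_natCast]
    field_simp
  have hsum' : Summable (LSeries.term c (s + 1)) := by
    have h1 : ∀ n, ‖LSeries.term c (s + 1) n‖ =
        ‖LSeries.term (fun n => coeff Q g (Q (n • x)) (n • x)) (s + 1) n‖ := by
      intro n
      simp only [LSeries.norm_term_eq, hc, RCLike.norm_conj]
    exact .of_norm ((summable_congr h1).2 hsum.norm)
  have hp : ∀ n : ℕ, 2 * c n = 0 ∨ 0 < 4 * Real.pi * Q x * (n : ℝ) ^ 2 := by
    intro n
    rcases eq_or_ne n 0 with rfl | hn
    · left; simp [hc0]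
    · right
      have hn' : (0 : ℝ) < n := by exact_mod_cast Nat.pos_of_ne_zero hn
      have := Real.pi_pos
      positivity
  have hwre : 0 < w.re := by
    have : w.re = (s.re + 1) / 2 := by simp [hw]
    rw [this]; linarith
  have key := hasSum_mellin (a := fun n => 2 * c n) (p := fun n : ℕ => 4 * Real.pi * Q x * n ^ 2)
    (F := thetaMean Q g x) hp hwre (fun t ht => hasSum_thetaMean_nat h hr hg hk hkx ht) (by
      refine ((hsum'.mul_left κ).norm).congr fun n => ?_
      rw [← hterm, norm_div]
      rcases hp n with h0 | h0
      · rw [h0]; simp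
      · rw [Complex.norm_cpow_eq_rpow_re_of_pos h0])
  have key2 : HasSum (fun n => Complex.Gamma w * (κ * LSeries.term c (s + 1) n))
      (mellin (thetaMean Q g x) w) :=
    key.congr_fun fun n => by rw [← hterm]; ring
  rw [(mellin_thetaMean h hr hg hk hkx hdiv hs).2, ← key2.tsum_eq, tsum_mul_left, tsum_mul_left,
    LSeries]
  ring

end Lattices

end

section

/-! ### The Kronecker symbol as a Dirichlet character -/

theorem kronecker_zero (D : ℤ) : kronecker D 0 = 0 := if_pos rfl

theorem kronecker_one (D : ℤ) : kronecker D 1 = 1 := by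
  simp [kronecker]

theorem ordCompl_ne_zero {n : ℕ} (hn : n ≠ 0) : n / 2 ^ n.factorization 2 ≠ 0 :=
  (Nat.ordCompl_pos 2 hn).ne'

theorem odd_ordCompl {n : ℕ} (hn : n ≠ 0) : Odd (n / 2 ^ n.factorization 2) := by
  rw [← Nat.not_even_iff_odd, even_iff_two_dvd]
  exact Nat.not_dvd_ordCompl Nat.prime_two hn

theorem kronecker_mul (D : ℤ) (m n : ℕ) : kronecker D (m * n) = kronecker D m * kronecker D n := by
  rcases eq_or_ne m 0 with rfl | hm
  · simp [kronecker_zero]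
  rcases eq_or_ne n 0 with rfl | hn
  · simp [kronecker_zero]
  rw [kronecker, kronecker, kronecker, if_neg hm, if_neg hn, if_neg (mul_ne_zero hm hn),
    Nat.ordCompl_mul, jacobiSym.mul_right' _ (ordCompl_ne_zero hm) (ordCompl_ne_zero hn),
    Nat.factorization_mul hm hn, Finsupp.add_apply, pow_add]
  ring

theorem kronecker_of_odd (D : ℤ) {n : ℕ} (hn : Odd n) : kronecker D n = jacobiSym D n := by
  have h0 : n ≠ 0 := by rintro rfl; exact (by decide : ¬ Odd 0) hn
  have h1 : n.factorization 2 = 0 :=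
    Nat.factorization_eq_zero_of_not_dvd (by rwa [← even_iff_two_dvd, Nat.not_even_iff_odd])
  rw [kronecker, if_neg h0, h1]
  simp

theorem kronecker_two (D : ℤ) : kronecker D 2 = ZMod.χ₈ (D : ZMod 8) := by
  have h1 : Nat.factorization 2 2 = 1 := Nat.prime_two.factorization_self
  rw [kronecker, if_neg two_ne_zero, h1]
  simp

/-- For an odd discriminant the Kronecker symbol is a Jacobi symbol. -/
theorem kronecker_eq_jacobiSym {D : ℤ} (hD : D < 0) (hD4 : D % 4 = 1) (n : ℕ) :
    kronecker D n = jacobiSym n D.natAbs := by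
  set d := D.natAbs with hd
  have hDd : D = -(d : ℤ) := by omega
  have hd4 : d % 4 = 3 := by omega
  have hdodd : Odd d := Nat.odd_iff.2 (by omega)
  rcases eq_or_ne n 0 with rfl | hn
  · rw [kronecker_zero, Nat.cast_zero, jacobiSym.zero_left (by omega)]
  set m := n / 2 ^ n.factorization 2 with hm
  have hmodd : Odd m := odd_ordCompl hn
  have h1 : jacobiSym D m = jacobiSym m d := by
    rw [hDd, jacobiSym.neg _ hmodd]
    rcases Nat.odd_mod_four_iff.1 (Nat.odd_iff.1 hmodd) with h | h
    · rw [ZMod.χ₄_nat_one_mod_four h, one_mul,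
        jacobiSym.quadratic_reciprocity_one_mod_four' hdodd h]
    · rw [ZMod.χ₄_nat_three_mod_four h, jacobiSym.quadratic_reciprocity_three_mod_four hd4 h]
      ring
  have h2 : ZMod.χ₈ (D : ZMod 8) = jacobiSym 2 d := by
    rw [jacobiSym.at_two hdodd, hDd, Int.cast_neg, Int.cast_natCast]
    generalize (d : ZMod 8) = a
    revert a; decide
  have h3 : (n : ℤ) = 2 ^ n.factorization 2 * m := by
    exact_mod_cast (Nat.ordProj_mul_ordCompl_eq_self n 2).symm
  rw [kronecker, if_neg hn, ← hm, h1, h2, h3, jacobiSym.mul_left, jacobiSym.pow_left]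

theorem kronecker_of_four_dvd {m : ℤ} {n : ℕ} (hn : Odd n) :
    kronecker (4 * m) n = jacobiSym m n := by
  have h1 : (4 : ℤ) = 2 ^ 2 := by norm_num
  rw [kronecker_of_odd _ hn, jacobiSym.mul_left, h1, jacobiSym.sq_one', one_mul]
  rw [Int.gcd_eq_natAbs]
  simpa using hn.coprime_two_left

theorem kronecker_of_four_dvd_of_even {m : ℤ} {n : ℕ} (hn : Even n) :
    kronecker (4 * m) n = 0 := by
  obtain ⟨k, rfl⟩ := even_iff_two_dvd.1 hn
  have : ∀ a : ZMod 8, ZMod.χ₈ (4 * a) = 0 := by decide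
  rw [kronecker_mul, kronecker_two]
  push_cast
  rw [this, zero_mul]

/-- Quadratic reciprocity: for odd `D` through `kronecker_eq_jacobiSym`, for `D = 4m` through the
periodicity of `n ↦ (m/n)` modulo `4|m|` on odd `n`. -/
theorem kronecker_mod {D : ℤ} (hD : D < 0) (hD4 : D % 4 = 0 ∨ D % 4 = 1) (n : ℕ) :
    kronecker D (n % D.natAbs) = kronecker D n := by
  rcases hD4 with h | h
  · obtain ⟨m, rfl⟩ := Int.dvd_of_emod_eq_zero h
    have hdvd : 2 ∣ (4 * m).natAbs := by rw [Int.natAbs_mul]; exact ⟨2 * m.natAbs, by simp; ring⟩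
    have hpar : Even (n % (4 * m).natAbs) ↔ Even n := by
      rw [even_iff_two_dvd, even_iff_two_dvd, Nat.dvd_mod_iff hdvd]
    rcases Nat.even_or_odd n with hn | hn
    · rw [kronecker_of_four_dvd_of_even hn, kronecker_of_four_dvd_of_even (hpar.2 hn)]
    · have hn' : Odd (n % (4 * m).natAbs) := by
        rw [← Nat.not_even_iff_odd, hpar, Nat.not_even_iff_odd]; exact hn
      rw [kronecker_of_four_dvd hn, kronecker_of_four_dvd hn', jacobiSym.mod_right m hn,
        Int.natAbs_mul]
      rfl
  · rw [kronecker_eq_jacobiSym hD h, kronecker_eq_jacobiSym hD h, jacobiSym.mod_left' (b := D.natAbs)]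
    push_cast
    exact Int.emod_emod_of_dvd _ dvd_rfl

theorem kronecker_eq_zero {D : ℤ} (hD : D < 0) (hD4 : D % 4 = 0 ∨ D % 4 = 1) {n : ℕ}
    (hn : ¬ n.Coprime D.natAbs) : kronecker D n = 0 := by
  have hd : D.natAbs ≠ 0 := by omega
  rcases hD4 with h | h
  · obtain ⟨m, rfl⟩ := Int.dvd_of_emod_eq_zero h
    rcases Nat.even_or_odd n with hn' | hn'
    · exact kronecker_of_four_dvd_of_even hn'
    · rw [kronecker_of_four_dvd hn', jacobiSym.eq_zero_iff]
      refine ⟨by rintro rfl; exact (by decide : ¬ Odd 0) hn', fun h2 => hn ?_⟩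
      rw [Int.natAbs_mul]
      refine Nat.Coprime.mul_right ?_ ?_
      · exact (hn'.coprime_two_right.pow_right 2)
      · rw [Int.gcd_eq_natAbs] at h2
        exact Nat.Coprime.symm (by simpa using h2)
  · rw [kronecker_eq_jacobiSym hD h, jacobiSym.eq_zero_iff]
    exact ⟨hd, fun h2 => hn (by
      rwa [Int.gcd_eq_natAbs, Int.natAbs_natCast, Int.natAbs_natCast] at h2)⟩

/-- The character is odd because `D < 0`. This is how it is seen to be nontrivial, without `D` being
fundamental. -/
theorem kronecker_natAbs_sub_one {D : ℤ} (hD : D < 0) (hD4 : D % 4 = 0 ∨ D % 4 = 1) :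
    kronecker D (D.natAbs - 1) = -1 := by
  rcases hD4 with h | h
  · obtain ⟨m, rfl⟩ := Int.dvd_of_emod_eq_zero h
    set k := m.natAbs with hk
    have hm : m = -(k : ℤ) := by omega
    have hn : (4 * m).natAbs - 1 = 4 * k - 1 := by omega
    have hodd : Odd (4 * k - 1) := Nat.odd_iff.2 (by omega)
    have h3 : (4 * k - 1) % 4 = 3 := by omega
    rw [hn, kronecker_of_four_dvd hodd, hm, jacobiSym.neg _ hodd, ZMod.χ₄_nat_three_mod_four h3]
    have h4 : jacobiSym (4 * k : ℤ) (4 * k - 1) = jacobiSym 1 (4 * k - 1) := by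
      refine jacobiSym.mod_left' ((Int.ModEq.symm ((Int.modEq_iff_dvd).2 ⟨1, ?_⟩)))
      rw [Nat.cast_sub (by omega)]
      push_cast; ring
    have h5 : jacobiSym (4 * k : ℤ) (4 * k - 1) = jacobiSym k (4 * k - 1) := by
      rw [← kronecker_of_odd _ hodd, kronecker_of_four_dvd hodd]
    rw [← h5, h4, jacobiSym.one_left]; rfl
  · set d := D.natAbs with hd
    have hdodd : Odd d := Nat.odd_iff.2 (by omega)
    have h3 : d % 4 = 3 := by omega
    rw [kronecker_eq_jacobiSym hD h, ← hd]
    have h4 : jacobiSym ((d - 1 : ℕ) : ℤ) d = jacobiSym (-1) d := by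
      refine jacobiSym.mod_left' ((Int.ModEq.symm ((Int.modEq_iff_dvd).2 ⟨1, ?_⟩)))
      rw [Nat.cast_sub (by omega)]
      push_cast; ring
    rw [h4, jacobiSym.at_neg_one hdodd, ZMod.χ₄_nat_three_mod_four h3]

/-- The quadratic character `(D/·)` of a negative discriminant. -/
def chiD (D : ℤ) (hD : D < 0) (hD4 : D % 4 = 0 ∨ D % 4 = 1) : DirichletCharacter ℂ D.natAbs where
  toFun j := (kronecker D j.val : ℂ)
  map_one' := by
    have h1 := kronecker_mod hD hD4 1
    rw [ZMod.val_one_eq_one_mod, h1, kronecker_one, Int.cast_one]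
  map_mul' a b := by
    rw [ZMod.val_mul, kronecker_mod hD hD4, kronecker_mul, Int.cast_mul]
  map_nonunit' a ha := by
    have : NeZero D.natAbs := ⟨by omega⟩
    rw [kronecker_eq_zero hD hD4, Int.cast_zero]
    intro h
    refine ha ?_
    rw [← ZMod.natCast_zmod_val a]
    exact (ZMod.isUnit_iff_coprime _ _).2 h

section

variable {D : ℤ} (hD : D < 0) (hD4 : D % 4 = 0 ∨ D % 4 = 1)
include hD hD4

theorem chiD_natCast (n : ℕ) : chiD D hD hD4 n = kronecker D n := by
  change (kronecker D (n : ZMod D.natAbs).val : ℂ) = _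
  rw [ZMod.val_natCast, kronecker_mod hD hD4]

theorem chiD_ne_one : chiD D hD hD4 ≠ 1 := by
  intro h
  have h1 := chiD_natCast hD hD4 (D.natAbs - 1)
  rw [kronecker_natAbs_sub_one hD hD4, h] at h1
  by_cases hu : IsUnit ((D.natAbs - 1 : ℕ) : ZMod D.natAbs)
  · rw [MulChar.one_apply hu] at h1
    norm_num at h1
  · rw [MulChar.map_nonunit _ hu] at h1
    norm_num at h1

theorem LchiD_eq_LFunction (s : ℂ) :
    haveI : NeZero D.natAbs := ⟨by omega⟩
    LchiD D s = (chiD D hD hD4).LFunction s := by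
  rw [LchiD, dif_neg (by omega)]
  rfl

theorem differentiable_LchiD : Differentiable ℂ (LchiD D) := by
  have : NeZero D.natAbs := ⟨by omega⟩
  have h1 : LchiD D = (chiD D hD hD4).LFunction := funext (LchiD_eq_LFunction hD hD4)
  rw [h1]
  exact DirichletCharacter.differentiable_LFunction (chiD_ne_one hD hD4)

theorem LchiD_ne_zero {s : ℂ} (hs : 1 ≤ s.re) : LchiD D s ≠ 0 := by
  have : NeZero D.natAbs := ⟨by omega⟩
  rw [LchiD_eq_LFunction hD hD4]
  exact DirichletCharacter.LFunction_ne_zero_of_one_le_re _ (Or.inl (chiD_ne_one hD hD4)) hs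

theorem LchiD_eq_LSeries {s : ℂ} (hs : 1 < s.re) :
    LchiD D s = LSeries (fun n => chiD D hD hD4 n) s := by
  have : NeZero D.natAbs := ⟨by omega⟩
  rw [LchiD_eq_LFunction hD hD4]
  exact DirichletCharacter.LFunction_eq_LSeries _ hs

theorem conj_chiD (n : ℕ) : (starRingEnd ℂ) (chiD D hD hD4 n) = chiD D hD hD4 n := by
  rw [chiD_natCast, map_intCast]

end

end

section

open ComplexConjugate Filter Topology

/-! ### Conjugation of Dirichlet series and meromorphic functions -/

theorem conj_natCast_cpow (n : ℕ) (s : ℂ) : conj ((n : ℂ) ^ s) = (n : ℂ) ^ conj s := by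
  have h : (n : ℂ).arg ≠ Real.pi := by rw [Complex.natCast_arg]; exact Real.pi_pos.ne
  have := Complex.cpow_conj (n : ℂ) s h
  rw [this, Complex.conj_natCast]

theorem conj_LSeries (a : ℕ → ℂ) (s : ℂ) :
    conj (LSeries a s) = LSeries (fun n => conj (a n)) (conj s) := by
  rw [LSeries, Complex.conj_tsum]
  refine tsum_congr fun n => ?_
  rcases eq_or_ne n 0 with rfl | hn
  · simp
  · rw [LSeries.term_of_ne_zero hn, LSeries.term_of_ne_zero hn, map_div₀, conj_natCast_cpow]

theorem analyticAt_conj_conj {f : ℂ → ℂ} {z : ℂ} (hf : AnalyticAt ℂ f (conj z)) :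
    AnalyticAt ℂ (fun w => conj (f (conj w))) z := by
  rw [Complex.analyticAt_iff_eventually_differentiableAt] at hf ⊢
  filter_upwards [(Complex.continuous_conj.tendsto z).eventually hf] with w hw
  have := hw.conj_conj
  rwa [Complex.conj_conj] at this

theorem meromorphicAt_conj_conj {f : ℂ → ℂ} {z : ℂ} (hf : MeromorphicAt f (conj z)) :
    MeromorphicAt (fun w => conj (f (conj w))) z := by
  obtain ⟨n, hn⟩ := hf
  refine ⟨n, (analyticAt_conj_conj hn).congr (.of_forall fun w => ?_)⟩
  simp

theorem MeromorphicOn.comp_affine {f : ℂ → ℂ} (hf : MeromorphicOn f Set.univ) {h : ℂ → ℂ}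
    (hh : ∀ z, AnalyticAt ℂ h z) : MeromorphicOn (fun z => f (h z)) Set.univ := fun z _ =>
  (hf (h z) trivial).comp_analyticAt (hh z)

/-- The identity theorem for meromorphic functions. -/
theorem eventuallyEq_nhdsNE_of_isPreconnected {f g : ℂ → ℂ} {U : Set ℂ} (hU : IsPreconnected U)
    (hf : MeromorphicOn f U) (hg : MeromorphicOn g U) {z w : ℂ} (hz : z ∈ U) (hw : w ∈ U)
    (h : f =ᶠ[𝓝[≠] z] g) : f =ᶠ[𝓝[≠] w] g := by
  by_contra hne
  have h1 : meromorphicOrderAt (f - g) w ≠ ⊤ := by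
    rw [ne_eq, meromorphicOrderAt_eq_top_iff]
    exact fun h2 => hne (h2.mono fun z hz => sub_eq_zero.1 hz)
  have h2 := (hf.sub hg).meromorphicOrderAt_ne_top_of_isPreconnected hU hw hz h1
  rw [ne_eq, meromorphicOrderAt_eq_top_iff] at h2
  exact h2 (h.mono fun z hz => sub_eq_zero.2 hz)

theorem eventuallyEq_codiscrete {f g : ℂ → ℂ} (hf : MeromorphicOn f Set.univ)
    (hg : MeromorphicOn g Set.univ) {σ : ℝ} (h : ∀ s : ℂ, σ < s.re → f s = g s) :
    f =ᶠ[codiscrete ℂ] g := by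
  have h1 : ∀ z, f =ᶠ[𝓝[≠] z] g := by
    intro z
    refine eventuallyEq_nhdsNE_of_isPreconnected isPreconnected_univ hf hg
      (z := ((σ + 1 : ℝ) : ℂ)) trivial trivial ?_
    have : {s : ℂ | σ < s.re} ∈ 𝓝 (((σ + 1 : ℝ) : ℂ)) :=
      (isOpen_lt continuous_const Complex.continuous_re).mem_nhds (by simp)
    exact nhdsWithin_le_nhds (Filter.mem_of_superset this h)
  refine mem_codiscreteWithin_iff_forall_mem_nhdsNE.2 fun z _ => ?_
  rw [Set.compl_univ, Set.union_empty]
  exact h1 z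

theorem eventuallyEq_nhds_of_codiscrete {f g : ℂ → ℂ} (h : f =ᶠ[codiscrete ℂ] g) {z : ℂ}
    (hf : AnalyticAt ℂ f z) (hg : AnalyticAt ℂ g z) : f =ᶠ[𝓝 z] g := by
  have h1 : f =ᶠ[𝓝[≠] z] g := by
    have := mem_codiscreteWithin_iff_forall_mem_nhdsNE.1 h z trivial
    rwa [Set.compl_univ, Set.union_empty] at this
  exact (hf.frequently_eq_iff_eventually_eq hg).1 (Filter.Eventually.frequently h1)

/-- A function which is holomorphic on a half plane and coincides far to the right with a
meromorphic function on the plane continues to the plane. -/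
theorem meromorphicOn_ite {f F : ℂ → ℂ} {a σ : ℝ} (hf : ∀ s : ℂ, a < s.re → DifferentiableAt ℂ f s)
    (hF : MeromorphicOn F Set.univ) (h : ∀ s : ℂ, σ < s.re → f s = F s) :
    MeromorphicOn (fun s => if a < s.re then f s else F s) Set.univ := by
  have hopen : IsOpen {s : ℂ | a < s.re} := isOpen_lt continuous_const Complex.continuous_re
  have hfan : ∀ s : ℂ, a < s.re → AnalyticAt ℂ f s := fun s hs =>
    Complex.analyticAt_iff_eventually_differentiableAt.2
      (Filter.mem_of_superset (hopen.mem_nhds hs) hf)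
  have hloc : ∀ s : ℂ, a < s.re → f =ᶠ[𝓝[≠] s] F := by
    intro s hs
    refine eventuallyEq_nhdsNE_of_isPreconnected (U := {s : ℂ | a < s.re})
      (convex_halfSpace_re_gt a).isPreconnected (fun s hs => (hfan s hs).meromorphicAt)
      (fun s _ => hF s trivial) (z := ((max a σ + 1 : ℝ) : ℂ)) ?_ hs ?_
    · simp only [Set.mem_ofPred_eq, Complex.ofReal_re]
      linarith [le_max_left a σ]
    · have : {s : ℂ | σ < s.re} ∈ 𝓝 (((max a σ + 1 : ℝ) : ℂ)) :=
        (isOpen_lt continuous_const Complex.continuous_re).mem_nhds (by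
          simp only [Set.mem_ofPred_eq, Complex.ofReal_re]
          linarith [le_max_right a σ])
      exact nhdsWithin_le_nhds (Filter.mem_of_superset this h)
  intro s _
  refine (hF s trivial).congr ?_
  -- A meromorphic `F` may take arbitrary values at isolated points; away from these, local
  -- agreement is equality of values.
  have h1 : ∀ᶠ w in 𝓝[≠] s, AnalyticAt ℂ F w := (hF s trivial).eventually_analyticAt
  filter_upwards [h1] with w hw
  split_ifs with hw'
  · have h2 : f =ᶠ[𝓝 w] F := ((hfan w hw').frequently_eq_iff_eventually_eq hw).1
      (hloc w hw').frequently
    exact h2.eq_of_nhds.symm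
  · rfl

end

section

open ComplexConjugate Filter Topology MeasureTheory

/-! ### The Shimura lift -/

/-- The coefficients `b(m₀ n², n μ₀)`. -/
def sqCoeff (N : ℕ) (m₀ : ℚ) (μ₀ : V) (g : ℍ → V → ℂ) (n : ℕ) : ℂ :=
  coeff (Q N) g (m₀ * (n : ℚ) ^ 2) (n • μ₀)

theorem shimuraCoeff_eq_convolution (N : ℕ) {D : ℤ} (hD : D < 0) (hD4 : D % 4 = 0 ∨ D % 4 = 1)
    (m₀ : ℚ) (μ₀ : V) (g : ℍ → V → ℂ) :
    shimuraCoeff N D m₀ μ₀ g =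
      LSeries.convolution (fun n => chiD D hD hD4 n) (sqCoeff N m₀ μ₀ g) := by
  ext n
  rw [LSeries.convolution_def]
  simp only [chiD_natCast]
  rw [Nat.sum_divisorsAntidiagonal (f := fun d k => (kronecker D d : ℂ) * sqCoeff N m₀ μ₀ g k)]
  rfl

open LSeries.notation ArithmeticFunction in
-- By complete multiplicativity `χμ` is the convolution inverse of `χ`. The index `n = 0` is
-- excluded since convolutions vanish there.
theorem sqCoeff_eq_convolution (N : ℕ) {D : ℤ} (hD : D < 0) (hD4 : D % 4 = 0 ∨ D % 4 = 1)
    (m₀ : ℚ) (μ₀ : V) (g : ℍ → V → ℂ) {n : ℕ} (hn : n ≠ 0) :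
    LSeries.convolution (fun n => chiD D hD hD4 n * ((ArithmeticFunction.moebius n : ℤ) : ℂ))
      (shimuraCoeff N D m₀ μ₀ g) n = sqCoeff N m₀ μ₀ g n := by
  set χ := chiD D hD hD4
  set a : ℕ → ℂ := fun n => χ n
  set b : ℕ → ℂ := fun n => χ n * ((ArithmeticFunction.moebius n : ℤ) : ℂ)
  have h1 : LSeries.convolution a b = LSeries.delta := DirichletCharacter.convolution_mul_moebius χ
  have h2 : toArithmeticFunction a * toArithmeticFunction b = 1 := by
    ext n
    have := congrFun h1 n
    rw [LSeries.convolution] at this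
    rw [this, ← ArithmeticFunction.one_eq_delta]
  rw [shimuraCoeff_eq_convolution N hD hD4, LSeries.convolution, LSeries.convolution,
    ArithmeticFunction.toArithmeticFunction_eq_self, ← mul_assoc, mul_comm (toArithmeticFunction b),
    h2, one_mul]
  simp [toArithmeticFunction, hn]

/-- Absolute convergence is transported back from the lift by convolving with `χμ`, whose series
converges for `Re s > 1`. -/
theorem LSeriesSummable_sqCoeff_of_shimuraCoeff (N : ℕ) {D : ℤ} (hD : D < 0)
    (hD4 : D % 4 = 0 ∨ D % 4 = 1) (m₀ : ℚ) (μ₀ : V) (g : ℍ → V → ℂ) {s : ℂ} (hs : 1 < s.re)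
    (hsum : LSeriesSummable (shimuraCoeff N D m₀ μ₀ g) s) :
    LSeriesSummable (sqCoeff N m₀ μ₀ g) s := by
  have h1 : LSeriesSummable
      (fun n => chiD D hD hD4 n * ((ArithmeticFunction.moebius n : ℤ) : ℂ)) s :=
    DirichletCharacter.LSeriesSummable_mul _
      (ArithmeticFunction.LSeriesSummable_moebius_iff.2 hs)
  refine (LSeriesSummable_congr s fun {n} hn => ?_).1 (h1.convolution hsum)
  exact sqCoeff_eq_convolution N hD hD4 m₀ μ₀ g hn

theorem LSeries_shimuraCoeff (N : ℕ) {D : ℤ} (hD : D < 0)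
    (hD4 : D % 4 = 0 ∨ D % 4 = 1) (m₀ : ℚ) (μ₀ : V) (g : ℍ → V → ℂ) {s : ℂ} (hs : 1 < s.re)
    (hsum : LSeriesSummable (sqCoeff N m₀ μ₀ g) s) :
    LSeries (shimuraCoeff N D m₀ μ₀ g) s = LchiD D s * LSeries (sqCoeff N m₀ μ₀ g) s := by
  rw [shimuraCoeff_eq_convolution N hD hD4, LchiD_eq_LSeries hD hD4 hs]
  have : NeZero D.natAbs := ⟨by omega⟩
  exact LSeries_convolution' (DirichletCharacter.LSeriesSummable_of_one_lt_re _ hs) hsum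

theorem HasRealCoeffs.conj_shimuraCoeff {N : ℕ} {g : ℍ → V → ℂ} (hg : HasRealCoeffs N g) (D : ℤ)
    (m₀ : ℚ) (μ₀ : V) (n : ℕ) :
    conj (shimuraCoeff N D m₀ μ₀ g n) = shimuraCoeff N D m₀ μ₀ g n := by
  rw [shimuraCoeff, map_sum]
  exact Finset.sum_congr rfl fun d _ => by rw [map_mul, map_intCast, hg]

theorem HasRealCoeffs.conj_LSeries {N : ℕ} {g : ℍ → V → ℂ} (hg : HasRealCoeffs N g) (D : ℤ)
    (m₀ : ℚ) (μ₀ : V) (s : ℂ) :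
    conj (LSeries (shimuraCoeff N D m₀ μ₀ g) (conj s + 1)) =
      LSeries (shimuraCoeff N D m₀ μ₀ g) (s + 1) := by
  rw [RankinShimura.conj_LSeries, map_add, Complex.conj_conj, map_one]
  simp only [hg.conj_shimuraCoeff]

/-! ### Comparison of the Rankin integral with the Shimura lift -/

section

variable {N : ℕ} [NeZero N] {D r C : ℤ} {m₀ : ℚ} {g : ℍ → V → ℂ}

theorem IsCMDatum.mod_four (h : IsCMDatum N D r C) : D % 4 = 0 ∨ D % 4 = 1 := by
  have h1 : r ^ 2 % 4 = 0 ∨ r ^ 2 % 4 = 1 := by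
    rcases Int.emod_two_eq_zero_or_one r with h | h
    · left
      obtain ⟨k, rfl⟩ := Int.dvd_of_emod_eq_zero h
      ring_nf; omega
    · right
      obtain ⟨k, rfl⟩ : ∃ k, r = 2 * k + 1 := ⟨r / 2, by omega⟩
      ring_nf; omega
  have h2 : D = r ^ 2 + 4 * (N * C) := by rw [h.eq]; ring
  omega

variable (h : IsCMDatum N D r C) (hm : Q N (xvec N D r) = m₀) (hg : IsCuspFormL N g)

include h in
theorem archFactor_ne_zero (hm0 : 0 < m₀) {s : ℂ} (hs : 0 < s.re) : archFactor D m₀ s ≠ 0 := by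
  have hpi : ((Real.pi * m₀ : ℝ) : ℂ) ≠ 0 := by
    have : (0 : ℝ) < Real.pi * m₀ := mul_pos Real.pi_pos (by exact_mod_cast hm0)
    exact_mod_cast this.ne'
  refine mul_ne_zero (mul_ne_zero (mul_ne_zero ?_ ?_) ?_) (inv_ne_zero ?_)
  · simp [Complex.cpow_eq_zero_iff]
  · rw [ne_eq, Complex.cpow_eq_zero_iff]; tauto
  · refine Complex.Gamma_ne_zero_of_re_pos ?_
    simp; linarith
  · refine LchiD_ne_zero h.neg h.mod_four ?_
    simp; linarith

theorem _root_.Complex.meromorphicOn_Gamma : MeromorphicOn Complex.Gamma Set.univ := by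
  have h1 : MeromorphicOn (fun s => (Complex.Gamma s)⁻¹) Set.univ := fun s _ =>
    (Complex.differentiable_one_div_Gamma.analyticAt s).meromorphicAt
  have h2 : (fun s => (Complex.Gamma s)⁻¹)⁻¹ = Complex.Gamma := by ext; simp
  have h3 := h1.inv
  rwa [h2] at h3

include h in
theorem meromorphicOn_archFactor (hm0 : 0 < m₀) : MeromorphicOn (archFactor D m₀) Set.univ := by
  have hpi : ((Real.pi * m₀ : ℝ) : ℂ) ≠ 0 := by
    have : (0 : ℝ) < Real.pi * m₀ := mul_pos Real.pi_pos (by exact_mod_cast hm0)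
    exact_mod_cast this.ne'
  intro s _
  refine MeromorphicAt.mul (MeromorphicAt.mul (MeromorphicAt.mul ?_ ?_) ?_) (MeromorphicAt.inv ?_)
  · have : Differentiable ℂ fun s : ℂ => (2 : ℂ) ^ (-s) := fun s =>
      (differentiableAt_id.neg).const_cpow (Or.inl two_ne_zero)
    exact (this.analyticAt s).meromorphicAt
  · have : Differentiable ℂ fun s : ℂ => ((Real.pi * m₀ : ℝ) : ℂ) ^ (-(s + 1) / 2) := fun s =>
      DifferentiableAt.const_cpow (by fun_prop) (Or.inl hpi)
    exact (this.analyticAt s).meromorphicAt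
  · have h1 : AnalyticAt ℂ (fun s : ℂ => (s + 1) / 2) s := by fun_prop
    exact (Complex.meromorphicOn_Gamma _ trivial).comp_analyticAt h1
  · have h1 : AnalyticAt ℂ (fun s : ℂ => s + 1) s := by fun_prop
    exact (((differentiable_LchiD h.neg h.mod_four).analyticAt _).comp h1).meromorphicAt

include h in
theorem analyticAt_archFactor_zero (hm0 : 0 < m₀) : AnalyticAt ℂ (archFactor D m₀) 0 := by
  have hpi : ((Real.pi * m₀ : ℝ) : ℂ) ≠ 0 := by
    have : (0 : ℝ) < Real.pi * m₀ := mul_pos Real.pi_pos (by exact_mod_cast hm0)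
    exact_mod_cast this.ne'
  have hev : ∀ᶠ s : ℂ in 𝓝 0, -1 / 2 < s.re :=
    (isOpen_lt continuous_const Complex.continuous_re).mem_nhds (by simp; norm_num)
  refine AnalyticAt.mul ?_ (AnalyticAt.inv ?_ ?_)
  · rw [Complex.analyticAt_iff_eventually_differentiableAt]
    filter_upwards [hev] with s hs
    refine DifferentiableAt.mul (DifferentiableAt.mul ?_ ?_) ?_
    · exact (differentiableAt_id.neg).const_cpow (Or.inl two_ne_zero)
    · exact DifferentiableAt.const_cpow (by fun_prop) (Or.inl hpi)
    · refine DifferentiableAt.comp (g := Complex.Gamma) s ?_ (by fun_prop)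
      refine Complex.differentiableAt_Gamma _ fun m hm => ?_
      have h1 := congrArg Complex.re hm
      simp at h1
      have : (0 : ℝ) ≤ m := m.cast_nonneg
      linarith
  · have h1 : AnalyticAt ℂ (fun s : ℂ => s + 1) 0 := by fun_prop
    exact ((differentiable_LchiD h.neg h.mod_four).analyticAt _).comp h1
  · exact LchiD_ne_zero h.neg h.mod_four (by simp)

include h hg in
omit hm in
theorem mu_mem_dual : mu N r ∈ dualLattice (Q N) (L N) := by
  have hN := natCast_ne_zero_rat N
  rw [mu, mem_dual_L_iff]
  exact ⟨⟨r, by field_simp⟩, ⟨0, by simp⟩, ⟨0, by simp⟩⟩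

include h hm hg

theorem coeff_zsmul_xvec (n : ℕ) :
    coeff (Q N) g (Q N (n • xvec N D r)) (n • xvec N D r) = sqCoeff N m₀ (mu N r) g n := by
  have h1 : n • xvec N D r - n • mu N r ∈ L N := by
    rw [← nsmul_sub]; exact (L N).nsmul_mem h.xvec_sub_mu_mem n
  have h2 : Q N (n • xvec N D r) = m₀ * (n : ℚ) ^ 2 := by
    rw [← natCast_zsmul, Q_zsmul, hm]; push_cast; ring
  rw [h2, sqCoeff]
  exact hg.coeff_congr (isEvenLattice_L N) _
    ((dualLattice (Q N) (L N)).nsmul_mem (mu_mem_dual h hg) n) h1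

/-- The Hecke bound gives `b(m₀n², nμ₀) ≪ n^{3/2}`. -/
theorem LSeriesSummable_sqCoeff (hm0 : 0 < m₀) {s : ℂ} (hs : 5 / 2 < s.re) :
    LSeriesSummable (sqCoeff N m₀ (mu N r) g) s := by
  obtain ⟨B, hB0, hB⟩ := hg.exists_coeff_bound (isEvenLattice_L N)
  refine LSeriesSummable_of_le_const_mul_rpow hs ⟨B * (m₀ : ℝ) ^ (((3 : ℕ) : ℝ) / 4), fun n hn => ?_⟩
  have hn' : (0 : ℝ) < n := by exact_mod_cast Nat.pos_of_ne_zero hn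
  have hnq : (0 : ℚ) < n := by exact_mod_cast Nat.pos_of_ne_zero hn
  refine (hB _ _ (by positivity)).trans (le_of_eq ?_)
  have hm0' : (0 : ℝ) < m₀ := by exact_mod_cast hm0
  push_cast
  rw [Real.mul_rpow hm0'.le (by positivity), ← Real.rpow_natCast, ← Real.rpow_mul hn'.le]
  norm_num
  ring

theorem LSeriesSummable_shimuraCoeff (hm0 : 0 < m₀) {s : ℂ} (hs : 5 / 2 < s.re) :
    LSeriesSummable (shimuraCoeff N D m₀ (mu N r) g) s := by
  rw [shimuraCoeff_eq_convolution N h.neg h.mod_four]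
  have : NeZero D.natAbs := ⟨by have := h.neg; omega⟩
  exact (DirichletCharacter.LSeriesSummable_of_one_lt_re _ (by linarith)).convolution
    (LSeriesSummable_sqCoeff h hm hg hm0 hs)

/-- The series of the lift at `conj s + 1` factors into `L(χ, ·)` and the series of the `b(m₀n²,
nμ₀)`. Conjugation fixes the real character and turns the second factor into the series of the
Rankin integral. -/
theorem LgU_eq (hm0 : 0 < m₀) {s : ℂ} (hs : 1 < s.re)
    (hsum : LSeriesSummable (shimuraCoeff N D m₀ (mu N r) g) (s + 1)) :
    LgU N D r g s = archFactor D m₀ s *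
      conj (LSeries (shimuraCoeff N D m₀ (mu N r) g) (conj s + 1)) := by
  obtain ⟨y, K, k, hr, hk, hkx, hdiv⟩ := h.exists_isRankOne
  have hs1 : 1 < (s + 1).re := by simp; linarith
  have hs2 : 1 < (conj s + 1).re := by simp; linarith
  have hsum1 := LSeriesSummable_sqCoeff_of_shimuraCoeff N h.neg h.mod_four m₀ (mu N r) g hs1 hsum
  have hc : (fun n : ℕ => coeff (Q N) g (Q N (n • xvec N D r)) (n • xvec N D r)) =
      sqCoeff N m₀ (mu N r) g := funext fun n => coeff_zsmul_xvec h hm hg n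
  have h1 := rankinL_eq_LSeries h.isSplit hr hg hk hkx hdiv (by rw [hm]; exact hm0) hs
    (by rw [hc]; exact hsum1)
  have hc' : (fun n : ℕ => conj (coeff (Q N) g (Q N (n • xvec N D r)) (n • xvec N D r))) =
      fun n => conj (sqCoeff N m₀ (mu N r) g n) :=
    funext fun n => by rw [coeff_zsmul_xvec h hm hg n]
  have h2 : conj (LSeries (shimuraCoeff N D m₀ (mu N r) g) (conj s + 1)) =
      LchiD D (s + 1) * LSeries (fun n => conj (sqCoeff N m₀ (mu N r) g n)) (s + 1) := by
    rw [LSeries_shimuraCoeff N h.neg h.mod_four _ _ _ hs2 (hsum1.of_re_le_re (by simp)), map_mul,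
      conj_LSeries, LchiD_eq_LSeries h.neg h.mod_four hs2, conj_LSeries,
      LchiD_eq_LSeries h.neg h.mod_four hs1]
    simp only [conj_chiD, map_add, Complex.conj_conj, map_one]
  have h3 : LchiD D (s + 1) ≠ 0 := LchiD_ne_zero h.neg h.mod_four hs1.le
  rw [LgU, h1, h2, archFactor, hc', hm]
  field_simp

/-! ### Meromorphic continuation -/

omit h hm hg in
theorem meromorphicOn_archFactor_mul_conj (h : IsCMDatum N D r C) (hm0 : 0 < m₀) {ℓ : ℂ → ℂ}
    (hℓ : MeromorphicOn ℓ Set.univ) :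
    MeromorphicOn (fun s => archFactor D m₀ s * conj (ℓ (conj s + 1))) Set.univ := by
  refine (meromorphicOn_archFactor h hm0).mul fun s _ => ?_
  have h1 : MeromorphicOn (fun s => ℓ (s + 1)) Set.univ :=
    MeromorphicOn.comp_affine hℓ (h := fun s => s + 1) fun z => by fun_prop
  exact meromorphicAt_conj_conj (f := fun s => ℓ (s + 1)) (h1 _ trivial)

/-- A continuation must equal the integral on all of `Re s > 1`, also where the identity is not yet
known; hence the definition by cases, glued by holomorphy of the integral. -/
theorem isContinuationLgU_ite (hm0 : 0 < m₀) {ℓ : ℂ → ℂ}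
    (hℓ : IsContinuationLSeries (shimuraCoeff N D m₀ (mu N r) g) ℓ) :
    IsContinuationLgU N D r g (fun s => if 1 < s.re then LgU N D r g s else
      archFactor D m₀ s * conj (ℓ (conj s + 1))) := by
  obtain ⟨hℓ, σ, hσ⟩ := hℓ
  refine ⟨?_, fun s hs => if_pos hs⟩
  obtain ⟨y, K, k, hr, hk, hkx, hdiv⟩ := h.exists_isRankOne
  refine meromorphicOn_ite (σ := max (3 / 2) σ)
    (fun s hs => differentiableAt_rankinL h.isSplit hr hg hk hkx hdiv hs)
    (meromorphicOn_archFactor_mul_conj h hm0 hℓ) fun s hs => ?_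
  have h1 : 3 / 2 < s.re := (le_max_left _ _).trans_lt hs
  have h2 : σ < s.re := (le_max_right _ _).trans_lt hs
  rw [hσ _ (by simp; linarith)]
  exact LgU_eq h hm hg hm0 (by linarith)
    (LSeriesSummable_shimuraCoeff h hm hg hm0 (by simp; linarith))

theorem exists_continuationLgU_iff (hm0 : 0 < m₀) :
    (∃ Λ, IsContinuationLgU N D r g Λ) ↔
      ∃ ℓ, IsContinuationLSeries (shimuraCoeff N D m₀ (mu N r) g) ℓ := by
  constructor
  · rintro ⟨Λ, hΛ, hΛ'⟩
    -- The identity solved for the Dirichlet series; `archFactor` has no zeros for `Re s > 0`.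
    refine ⟨fun z => conj (Λ (conj z - 1) * (archFactor D m₀ (conj z - 1))⁻¹), ?_, 5 / 2,
      fun z hz => ?_⟩
    · intro z _
      have h1 : MeromorphicOn (fun s => Λ (s - 1) * (archFactor D m₀ (s - 1))⁻¹) Set.univ :=
        (MeromorphicOn.comp_affine hΛ (h := fun s => s - 1) fun z => by fun_prop).mul
          (MeromorphicOn.comp_affine (meromorphicOn_archFactor h hm0)
            (h := fun s => s - 1) fun z => by fun_prop).inv
      exact meromorphicAt_conj_conj (f := fun s => Λ (s - 1) * (archFactor D m₀ (s - 1))⁻¹)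
        (h1 _ trivial)
    · have hs : 1 < (conj z - 1).re := by simp; linarith
      have h0 : archFactor D m₀ (conj z - 1) ≠ 0 := archFactor_ne_zero h hm0 (by linarith)
      simp only
      rw [hΛ' _ hs, LgU_eq h hm hg hm0 hs
        (LSeriesSummable_shimuraCoeff h hm hg hm0 (by simp; linarith)), mul_comm,
        inv_mul_cancel_left₀ h0, Complex.conj_conj]
      simp
  · rintro ⟨ℓ, hℓ⟩
    exact ⟨_, isContinuationLgU_ite h hm hg hm0 hℓ⟩

theorem continuation_eq (hm0 : 0 < m₀) {Λ ℓ : ℂ → ℂ} (hΛ : IsContinuationLgU N D r g Λ)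
    (hℓ : IsContinuationLSeries (shimuraCoeff N D m₀ (mu N r) g) ℓ) :
    Λ =ᶠ[codiscrete ℂ] (fun s => archFactor D m₀ s * conj (ℓ (conj s + 1))) := by
  obtain ⟨hℓ, σ, hσ⟩ := hℓ
  refine eventuallyEq_codiscrete (σ := max (3 / 2) σ) hΛ.1
    (meromorphicOn_archFactor_mul_conj h hm0 hℓ) fun s hs => ?_
  have h1 : 3 / 2 < s.re := (le_max_left _ _).trans_lt hs
  have h2 : σ < s.re := (le_max_right _ _).trans_lt hs
  rw [hσ _ (by simp; linarith), hΛ.2 s (by linarith)]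
  exact LgU_eq h hm hg hm0 (by linarith)
    (LSeriesSummable_shimuraCoeff h hm hg hm0 (by simp; linarith))

theorem continuation_eq_of_real (hm0 : 0 < m₀) {Λ ℓ : ℂ → ℂ} (hΛ : IsContinuationLgU N D r g Λ)
    (hℓ : IsContinuationLSeries (shimuraCoeff N D m₀ (mu N r) g) ℓ) (hreal : HasRealCoeffs N g) :
    Λ =ᶠ[codiscrete ℂ] fun s => archFactor D m₀ s * ℓ (s + 1) := by
  obtain ⟨hℓ, σ, hσ⟩ := hℓ
  refine eventuallyEq_codiscrete (σ := max (3 / 2) σ) hΛ.1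
    ((meromorphicOn_archFactor h hm0).mul
      (MeromorphicOn.comp_affine hℓ (h := fun s => s + 1) fun z => by fun_prop)) fun s hs => ?_
  have h1 : 3 / 2 < s.re := (le_max_left _ _).trans_lt hs
  have h2 : σ < s.re := (le_max_right _ _).trans_lt hs
  rw [hσ _ (by simp; linarith), hΛ.2 s (by linarith), ← hreal.conj_LSeries]
  exact LgU_eq h hm hg hm0 (by linarith)
    (LSeriesSummable_shimuraCoeff h hm hg hm0 (by simp; linarith))

end

end

section

open ComplexConjugate Filter Topology MeasureTheory

/-! ### The central derivative -/

section Fricke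

variable {N : ℕ} [NeZero N] {G : S2 N}

open UpperHalfPlane in
-- On the imaginary axis `τ² = -t²`, which is the source of the minus sign.
theorem IsFrickeInvariant.apply_I_mul (hG : IsFrickeInvariant N G) {t : ℝ} (ht : 0 < t) :
    G (ofComplex (Complex.I * ((N * t : ℝ)⁻¹ : ℝ))) =
      -N * (t : ℂ) ^ (2 : ℂ) * G (ofComplex (Complex.I * t)) := by
  have hN : (0 : ℝ) < N := by exact_mod_cast Nat.pos_of_ne_zero (NeZero.ne N)
  have h1 : 0 < (Complex.I * t).im := by simpa using ht
  have h2 : 0 < (Complex.I * ((N * t : ℝ)⁻¹ : ℝ)).im := by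
    have : 0 < (N * t)⁻¹ := by positivity
    rw [Complex.I_mul_im, Complex.ofReal_re]; exact this
  rw [ofComplex_apply_of_im_pos h1, ofComplex_apply_of_im_pos h2, hG ⟨_, h1⟩ ⟨_, h2⟩]
  · have h3 : (t : ℂ) ^ (2 : ℂ) = (t : ℂ) ^ 2 := by
      rw [← Complex.cpow_natCast]; norm_num
    rw [h3]
    change _ * (Complex.I * (t : ℂ)) ^ 2 * _ = _
    rw [mul_pow, Complex.I_sq]; ring
  · change Complex.I * _ = -1 / ((N : ℂ) * (Complex.I * t))
    have ht' : (t : ℂ) ≠ 0 := by exact_mod_cast ht.ne'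
    have hN' : (N : ℂ) ≠ 0 := by exact_mod_cast hN.ne'
    push_cast
    field_simp
    simp

/-- The substitution `t ↦ 1/(Nt)` shows that the Mellin integral at the centre equals its own
negative. -/
theorem IsFrickeInvariant.heckeL_one (hG : IsFrickeInvariant N G) : heckeL N G 1 = 0 := by
  have hN : (0 : ℝ) < N := by exact_mod_cast Nat.pos_of_ne_zero (NeZero.ne N)
  set φ : ℝ → ℂ := fun t => G (UpperHalfPlane.ofComplex (Complex.I * t)) with hφ
  have h1 : mellin (fun t : ℝ => φ ((N * t)⁻¹)) (-1) = N * mellin φ 1 := by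
    rw [mellin_comp_mul_left (fun t => φ t⁻¹) (-1) hN, mellin_comp_inv, neg_neg]
    simp
  have h2 : mellin (fun t : ℝ => φ ((N * t)⁻¹)) (-1) = -N * mellin φ 1 := by
    have h3 : mellin (fun t : ℝ => φ ((N * t)⁻¹)) (-1) =
        mellin (fun t : ℝ => (-N : ℂ) • ((t : ℂ) ^ (2 : ℂ) • φ t)) (-1) := by
      refine setIntegral_congr_fun measurableSet_Ioi fun t ht => ?_
      have := hG.apply_I_mul ht
      simp only [hφ, this, smul_eq_mul]
      ring
    rw [h3, mellin_const_smul, mellin_cpow_smul, smul_eq_mul]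
    norm_num
  have hN' : (N : ℂ) ≠ 0 := by exact_mod_cast hN.ne'
  have h4 : mellin φ 1 = 0 := by
    have : (2 * N : ℂ) * mellin φ 1 = 0 := by linear_combination h2 - h1
    simpa [hN'] using this
  rw [heckeL, ModularForm.L, CuspForm.Λ_eq_mellin, h4, zero_mul]

theorem differentiable_heckeL : Differentiable ℂ (heckeL N G) :=
  CuspForm.differentiable_L two_pos G

end Fricke

section

variable {N : ℕ} [NeZero N] {D r C : ℤ} {m₀ : ℚ} {g : ℍ → V → ℂ} {G : S2 N} {b : ℂ}

theorem isContinuationLSeries_heckeL {a : ℕ → ℂ}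
    (hL : ∃ σ : ℝ, ∀ s : ℂ, σ < s.re → LSeries a s = b * heckeL N G s) :
    IsContinuationLSeries a (fun s => b * heckeL N G s) :=
  ⟨fun s _ => ((differentiable_heckeL.const_mul b).analyticAt s).meromorphicAt,
    hL.imp fun _ h s hs => (h s hs).symm⟩

theorem hasDerivAt_archFactor_mul (h : IsCMDatum N D r C) (hm0 : 0 < m₀) {f : ℂ → ℂ}
    (hf0 : f 0 = 0) {f' : ℂ} (hf : HasDerivAt f f' 0) :
    HasDerivAt (fun s => archFactor D m₀ s * f s) (archFactor D m₀ 0 * f') 0 := by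
  have h1 := (analyticAt_archFactor_zero h hm0).differentiableAt.hasDerivAt.mul hf
  rw [hf0, mul_zero, zero_add] at h1
  exact h1

theorem hasDerivAt_heckeL_add_one (b : ℂ) :
    HasDerivAt (fun s => b * heckeL N G (s + 1)) (b * deriv (heckeL N G) 1) 0 := by
  have h1 : HasDerivAt (heckeL N G) (deriv (heckeL N G) 1) ((0 : ℂ) + 1) := by
    rw [zero_add]; exact (differentiable_heckeL 1).hasDerivAt
  exact (h1.comp_add_const 0 1).const_mul b

variable (h : IsCMDatum N D r C) (hm : Q N (xvec N D r) = m₀) (hg : IsCuspFormL N g)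
  (hm0 : 0 < m₀) (hG : IsFrickeInvariant N G)
  (hL : ∃ σ : ℝ, ∀ s : ℂ, σ < s.re →
    LSeries (shimuraCoeff N D m₀ (mu N r) g) s = b * heckeL N G s)

include h in
theorem analyticAt_archFactor_mul_conj (hm0 : 0 < m₀) :
    AnalyticAt ℂ (fun s => archFactor D m₀ s * conj (b * heckeL N G (conj s + 1))) 0 := by
  refine (analyticAt_archFactor_zero h hm0).mul
    (analyticAt_conj_conj (f := fun s => b * heckeL N G (s + 1)) ?_)
  have : Differentiable ℂ fun s => b * heckeL N G (s + 1) :=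
    (differentiable_heckeL.comp (differentiable_id.add_const 1)).const_mul b
  exact this.analyticAt _

include h hm hg hm0 hL

theorem exists_analyticAt_continuationLgU :
    ∃ Λ, IsContinuationLgU N D r g Λ ∧ AnalyticAt ℂ Λ 0 := by
  refine ⟨_, isContinuationLgU_ite h hm hg hm0 (isContinuationLSeries_heckeL hL), ?_⟩
  refine (analyticAt_archFactor_mul_conj (b := b) (G := G) h hm0).congr ?_
  filter_upwards [(isOpen_lt Complex.continuous_re continuous_const).mem_nhds
    (show (0 : ℂ).re < 1 by simp)] with s hs
  rw [if_neg (not_lt.2 (le_of_lt hs))]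

include hG

/-- Both `Λ` and the explicit product are analytic at `0`, so they agree near it. Since `L(G, 1) =
0`, the product rule leaves a single term. -/
theorem deriv_continuationLgU {Λ : ℂ → ℂ} (hΛ : IsContinuationLgU N D r g Λ)
    (hΛ0 : AnalyticAt ℂ Λ 0) :
    deriv Λ 0 = archFactor D m₀ 0 * conj (b * deriv (heckeL N G) 1) := by
  have h1 := eventuallyEq_nhds_of_codiscrete
    (continuation_eq h hm hg hm0 hΛ (isContinuationLSeries_heckeL hL)) hΛ0
    (analyticAt_archFactor_mul_conj h hm0)
  rw [h1.deriv_eq]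
  have h2 : HasDerivAt (fun s => conj (b * heckeL N G (conj s + 1)))
      (conj (b * deriv (heckeL N G) 1)) 0 := by
    have := (hasDerivAt_heckeL_add_one (N := N) (G := G) b).conj_conj
    rw [map_zero] at this
    exact this
  exact (hasDerivAt_archFactor_mul h hm0 (by simp [hG.heckeL_one]) h2).deriv

theorem deriv_continuationLgU_of_real {Λ : ℂ → ℂ} (hΛ : IsContinuationLgU N D r g Λ)
    (hΛ0 : AnalyticAt ℂ Λ 0) (hreal : HasRealCoeffs N g) :
    deriv Λ 0 = archFactor D m₀ 0 * (b * deriv (heckeL N G) 1) := by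
  have hd : Differentiable ℂ fun s => b * heckeL N G (s + 1) :=
    (differentiable_heckeL.comp (differentiable_id.add_const 1)).const_mul b
  have h1 := eventuallyEq_nhds_of_codiscrete
    (continuation_eq_of_real h hm hg hm0 hΛ (isContinuationLSeries_heckeL hL) hreal) hΛ0
    ((analyticAt_archFactor_zero h hm0).mul (hd.analyticAt 0))
  rw [h1.deriv_eq]
  exact (hasDerivAt_archFactor_mul h hm0 (by simp [hG.heckeL_one])
    (hasDerivAt_heckeL_add_one b)).deriv

end

theorem archFactor_zero (D : ℤ) {m₀ : ℚ} (hm0 : 0 < m₀) :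
    archFactor D m₀ 0 = ((Real.sqrt m₀)⁻¹ : ℝ) * (LchiD D 1)⁻¹ := by
  have hm0' : (0 : ℝ) < m₀ := by exact_mod_cast hm0
  rw [archFactor, zero_add, neg_zero, Complex.cpow_zero, one_mul, Complex.Gamma_one_half_eq]
  have h1 : ((Real.pi * m₀ : ℝ) : ℂ) ^ (-1 / 2 : ℂ) =
      (((Real.sqrt Real.pi)⁻¹ * (Real.sqrt m₀)⁻¹ : ℝ) : ℂ) := by
    have : (-1 / 2 : ℂ) = ((-(1 / 2) : ℝ) : ℂ) := by push_cast; ring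
    rw [this, ← Complex.ofReal_cpow (by positivity), Real.rpow_neg (by positivity),
      ← Real.sqrt_eq_rpow, Real.sqrt_mul Real.pi_pos.le, mul_inv]
  have h2 : (Real.pi : ℂ) ^ (1 / 2 : ℂ) = (Real.sqrt Real.pi : ℝ) := by
    have : (1 / 2 : ℂ) = ((1 / 2 : ℝ) : ℂ) := by push_cast; ring
    rw [this, ← Complex.ofReal_cpow Real.pi_pos.le, ← Real.sqrt_eq_rpow]
  have h3 : ((Real.sqrt Real.pi : ℝ) : ℂ) ≠ 0 := by
    exact_mod_cast (Real.sqrt_pos.2 Real.pi_pos).ne'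
  rw [h1, h2]
  push_cast
  field_simp

end

section

open Filter Topology NumberField

/-! ### Invariants of imaginary quadratic fields -/

section

variable {K : Type*} [Field K] [NumberField K] {a b : ℤ} (e : 𝓞 K ≃+* QuadraticAlgebra ℤ a b)

/-- The trace form of `ℤ[ω]`, `ω² = a + b ω`. -/
theorem discr_quadraticAlgebra (a b : ℤ) :
    Algebra.discr ℤ (QuadraticAlgebra.basis a b) = b ^ 2 + 4 * a := by
  have h0 : QuadraticAlgebra.basis a b 0 = ⟨1, 0⟩ := by
    rw [← (QuadraticAlgebra.basis a b).repr.injective.eq_iff]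
    ext i; fin_cases i <;> simp
  have h1 : QuadraticAlgebra.basis a b 1 = ⟨0, 1⟩ := by
    rw [← (QuadraticAlgebra.basis a b).repr.injective.eq_iff]
    ext i; fin_cases i <;> simp
  have ht (z : QuadraticAlgebra ℤ a b) : Algebra.trace ℤ _ z = 2 * z.re + b * z.im := by
    rw [Algebra.trace_eq_matrix_trace (QuadraticAlgebra.basis a b), Matrix.trace_fin_two,
      Algebra.leftMulMatrix_eq_repr_mul, Algebra.leftMulMatrix_eq_repr_mul,
      QuadraticAlgebra.basis_repr_apply, QuadraticAlgebra.basis_repr_apply]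
    rw [h0, h1]
    simp
    ring
  rw [Algebra.discr_def, Matrix.det_fin_two]
  simp only [Algebra.traceMatrix_apply, Algebra.traceForm_apply, ht, h0, h1]
  simp
  ring

include e

theorem discr_eq_of_ringEquiv : discr K = b ^ 2 + 4 * a := by
  let f : QuadraticAlgebra ℤ a b ≃ₐ[ℤ] 𝓞 K := AlgEquiv.ofRingEquiv (f := e.symm) fun x => by simp
  rw [← discr_eq_discr K ((QuadraticAlgebra.basis a b).map f.toLinearEquiv),
    ← discr_quadraticAlgebra, Algebra.discr_eq_discr_of_algEquiv _ f]
  rfl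

theorem finrank_eq_two_of_ringEquiv : Module.finrank ℚ K = 2 := by
  let f : QuadraticAlgebra ℤ a b ≃ₐ[ℤ] 𝓞 K := AlgEquiv.ofRingEquiv (f := e.symm) fun x => by simp
  rw [← RingOfIntegers.rank, ← f.toLinearEquiv.finrank_eq, QuadraticAlgebra.finrank_eq_two]

/-- A real embedding would send `2ω - b` to a real number with negative square. -/
theorem isTotallyComplex_of_ringEquiv (hD : b ^ 2 + 4 * a < 0) : IsTotallyComplex K := by
  refine ⟨fun w => ?_⟩
  rw [← InfinitePlace.not_isReal_iff_isComplex]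
  intro hw
  set φ := InfinitePlace.embedding_of_isReal hw
  set x : ℝ := φ (e.symm QuadraticAlgebra.omega : 𝓞 K)
  have h1 : (QuadraticAlgebra.omega : QuadraticAlgebra ℤ a b) * QuadraticAlgebra.omega =
      (a : QuadraticAlgebra ℤ a b) + (b : QuadraticAlgebra ℤ a b) * QuadraticAlgebra.omega := by
    ext <;> simp
  have h2 : x * x = a + b * x := by
    have := congrArg (fun z => φ ((e.symm z : 𝓞 K) : K)) h1
    simpa [x] using this
  have h3 : (2 * x - b) ^ 2 = ((b ^ 2 + 4 * a : ℤ) : ℝ) := by push_cast; linear_combination 4 * h2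
  have h4 : ((b ^ 2 + 4 * a : ℤ) : ℝ) < 0 := by exact_mod_cast hD
  nlinarith [sq_nonneg (2 * x - b)]

theorem nrComplexPlaces_eq_one (hD : b ^ 2 + 4 * a < 0) :
    InfinitePlace.nrComplexPlaces K = 1 := by
  have := isTotallyComplex_of_ringEquiv e hD
  have h1 := IsTotallyComplex.finrank (K := K)
  rw [finrank_eq_two_of_ringEquiv e] at h1
  omega

theorem card_infinitePlace_eq_one (hD : b ^ 2 + 4 * a < 0) :
    Fintype.card (InfinitePlace K) = 1 := by
  have := isTotallyComplex_of_ringEquiv e hD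
  rw [InfinitePlace.card_eq_nrRealPlaces_add_nrComplexPlaces,
    IsTotallyComplex.nrRealPlaces_eq_zero, nrComplexPlaces_eq_one e hD]

/-- There is only one infinite place, so the regulator is an empty determinant. -/
theorem regulator_eq_one (hD : b ^ 2 + 4 * a < 0) : Units.regulator K = 1 := by
  have h1 : Subsingleton (InfinitePlace K) :=
    Fintype.card_le_one_iff_subsingleton.1 (card_infinitePlace_eq_one e hD).le
  rw [Units.regulator_eq_det']
  have : IsEmpty {w : InfinitePlace K // w ≠ Units.dirichletUnitTheorem.w₀} :=
    ⟨fun w => w.2 (Subsingleton.elim _ _)⟩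
  have h2 (n : Type _) (_ : Fintype n) (_ : DecidableEq n) (_ : IsEmpty n) (A : Matrix n n ℝ) :
      |A.det| = 1 := by rw [Matrix.det_isEmpty, abs_one]
  exact h2 _ _ _ this _

theorem torsionOrder_eq_card_units (hD : b ^ 2 + 4 * a < 0) :
    Units.torsionOrder K = Nat.card (QuadraticAlgebra ℤ a b)ˣ := by
  have h0 : Units.rank K = 0 := by
    rw [Units.rank, card_infinitePlace_eq_one e hD]
  have h1 : Units.torsion K = ⊤ := by
    have h2 := Units.closure_fundSystem_sup_torsion_eq_top (K := K)
    have : IsEmpty (Fin (Units.rank K)) := by rw [h0]; infer_instance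
    rwa [Set.range_eq_empty, Subgroup.closure_empty, bot_sup_eq] at h2
  rw [Units.torsionOrder, h1, ← Nat.card_congr (Units.mapEquiv e.toMulEquiv).toEquiv]
  exact Nat.card_congr Subgroup.topEquiv.toEquiv

theorem dedekindZeta_residue_eq (hD : b ^ 2 + 4 * a < 0) :
    dedekindZeta_residue K = 2 * Real.pi * classNumber K /
      (Nat.card (QuadraticAlgebra ℤ a b)ˣ * Real.sqrt (-(b ^ 2 + 4 * a : ℤ))) := by
  have := isTotallyComplex_of_ringEquiv e hD
  rw [dedekindZeta_residue_def, IsTotallyComplex.nrRealPlaces_eq_zero, nrComplexPlaces_eq_one e hD,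
    regulator_eq_one e hD, torsionOrder_eq_card_units e hD, discr_eq_of_ringEquiv e]
  have h1 : |((b ^ 2 + 4 * a : ℤ) : ℝ)| = (-(b ^ 2 + 4 * a : ℤ) : ℝ) :=
    abs_of_neg (by exact_mod_cast hD)
  rw [h1]
  simp

end

end

section

open Filter Topology NumberField

/-! ### Counting ideals of quadratic orders -/

section

variable (R : Type*) [CommRing R] [IsDedekindDomain R] [Module.Free ℤ R] [Module.Finite ℤ R]
  [CharZero R]

/-- The number of ideals of norm `n`. -/
def idealCount (n : ℕ) : ℕ := Nat.card {I : Ideal R // Ideal.absNorm I = n}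

variable {R}

/-- `I` contains its norm `mn`. Expanding the product and using that `m` and `n` are comaximal
leaves `I`. -/
theorem Ideal.sup_natCast_mul_sup_natCast {m n : ℕ} (hmn : m.Coprime n) {I : Ideal R}
    (hI : Ideal.absNorm I = m * n) :
    (I ⊔ Ideal.span {(m : R)}) * (I ⊔ Ideal.span {(n : R)}) = I := by
  have hcop : Ideal.span {(m : R)} ⊔ Ideal.span {(n : R)} = ⊤ := by
    rw [← Ideal.isCoprime_iff_sup_eq, Ideal.isCoprime_span_singleton_iff]
    exact_mod_cast (Nat.isCoprime_iff_coprime.2 hmn).intCast (R := R)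
  have hmem : Ideal.span {(m : R)} * Ideal.span {(n : R)} ≤ I := by
    rw [Ideal.span_singleton_mul_span_singleton, Ideal.span_singleton_le_iff_mem, ← Nat.cast_mul,
      ← hI]
    exact Ideal.absNorm_mem I
  have h : (I ⊔ Ideal.span {(m : R)}) * (I ⊔ Ideal.span {(n : R)}) =
      I * (I ⊔ (Ideal.span {(m : R)} ⊔ Ideal.span {(n : R)})) ⊔
        Ideal.span {(m : R)} * Ideal.span {(n : R)} := by
    simp only [← Ideal.add_eq_sup]; ring
  rw [h, hcop, sup_top_eq, Ideal.mul_top, sup_eq_left.2 hmem]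

theorem Ideal.absNorm_sup_natCast_dvd (m : ℕ) (I : Ideal R) :
    Ideal.absNorm (I ⊔ Ideal.span {(m : R)}) ∣ m ^ Module.finrank ℤ R := by
  rw [← Ideal.absNorm_span_natCast]
  exact Ideal.absNorm_dvd_absNorm_of_le le_sup_right

/-- Multiplication of ideals of norms `m` and `n` is a bijection with inverse `I ↦ (I + (m), I +
(n))`; the norms of these factors divide powers of `m` and of `n`, so coprimality determines them.
-/
theorem idealCount_mul {m n : ℕ} (hmn : m.Coprime n) :
    idealCount R (m * n) = idealCount R m * idealCount R n := by
  rw [idealCount, idealCount, idealCount, ← Nat.card_prod]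
  refine (Nat.card_congr (Equiv.ofBijective (fun P => ⟨P.1.1 * P.2.1,
    by rw [map_mul, P.1.2, P.2.2]⟩) ⟨?_, ?_⟩)).symm
  · have key {m n : ℕ} (hmn : m.Coprime n) {J J' : Ideal R} (h : Ideal.absNorm J = m)
        (h' : Ideal.absNorm J' = n) : J * J' ⊔ Ideal.span {(m : R)} = J := by
      have h1 : J' ⊔ Ideal.span {(m : R)} = ⊤ := by
        have hcop : Ideal.span {(n : R)} ⊔ Ideal.span {(m : R)} = ⊤ := by
          rw [← Ideal.isCoprime_iff_sup_eq, Ideal.isCoprime_span_singleton_iff]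
          exact_mod_cast (Nat.isCoprime_iff_coprime.2 hmn.symm).intCast (R := R)
        refine top_le_iff.1 (hcop ▸ sup_le_sup_right ?_ _)
        rw [Ideal.span_singleton_le_iff_mem, ← h']
        exact Ideal.absNorm_mem J'
      have h2 : Ideal.span {(m : R)} ≤ J := by
        rw [Ideal.span_singleton_le_iff_mem, ← h]
        exact Ideal.absNorm_mem J
      refine le_antisymm (sup_le Ideal.mul_le_left h2) ?_
      calc J = J * (J' ⊔ Ideal.span {(m : R)}) := by rw [h1, Ideal.mul_top]
        _ = J * J' ⊔ J * Ideal.span {(m : R)} := Ideal.mul_sup _ _ _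
        _ ≤ _ := sup_le_sup_left Ideal.mul_le_right _
    intro ⟨⟨J₁, h₁⟩, ⟨J₁', h₁'⟩⟩ ⟨⟨J₂, h₂⟩, ⟨J₂', h₂'⟩⟩ h
    have h : J₁ * J₁' = J₂ * J₂' := congrArg Subtype.val h
    have e1 : J₁ = J₂ := by rw [← key hmn h₁ h₁', ← key hmn h₂ h₂', h]
    have e2 : J₁' = J₂' := by
      rw [← key hmn.symm h₁' h₁, ← key hmn.symm h₂' h₂, mul_comm, h, mul_comm]
    simp only [e1, e2]
  · rintro ⟨I, hI⟩
    have h := Ideal.sup_natCast_mul_sup_natCast hmn hI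
    have hdm := Ideal.absNorm_sup_natCast_dvd m I
    have hdn := Ideal.absNorm_sup_natCast_dvd n I
    have hN := congrArg Ideal.absNorm h
    rw [map_mul, hI] at hN
    have hm : Ideal.absNorm (I ⊔ Ideal.span {(m : R)}) = m := by
      apply Nat.dvd_antisymm
      · exact Nat.Coprime.dvd_of_dvd_mul_right (Nat.Coprime.coprime_dvd_left hdm (hmn.pow_left _))
          (Dvd.intro _ hN)
      · exact Nat.Coprime.dvd_of_dvd_mul_right (Nat.Coprime.coprime_dvd_right hdn (hmn.pow_right _))
          (hN ▸ Dvd.intro _ rfl)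
    have hn : Ideal.absNorm (I ⊔ Ideal.span {(n : R)}) = n := by
      apply Nat.dvd_antisymm
      · exact Nat.Coprime.dvd_of_dvd_mul_left
          (Nat.Coprime.coprime_dvd_left hdn (hmn.symm.pow_left _)) (Dvd.intro_left _ hN)
      · exact Nat.Coprime.dvd_of_dvd_mul_left
          (Nat.Coprime.coprime_dvd_right hdm (hmn.symm.pow_right _)) (hN ▸ Dvd.intro_left _ rfl)
    exact ⟨⟨⟨_, hm⟩, ⟨_, hn⟩⟩, Subtype.ext h⟩

theorem idealCount_one : idealCount R 1 = 1 := by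
  rw [idealCount, Nat.card_eq_one_iff_unique]
  refine ⟨⟨fun I J => Subtype.ext ?_⟩, ⟨⟨⊤, Ideal.absNorm_top⟩⟩⟩
  rw [Ideal.absNorm_eq_one_iff.1 I.2, Ideal.absNorm_eq_one_iff.1 J.2]

variable {p : ℕ} (hp : p.Prime)
include hp

theorem Ideal.isMaximal_of_absNorm_eq_prime {P : Ideal R} (hP : Ideal.absNorm P = p) :
    P.IsMaximal := by
  have h := Ideal.isPrime_of_irreducible_absNorm (hP ▸ hp : Irreducible (Ideal.absNorm P))
  refine h.isMaximal fun h0 => ?_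
  rw [h0, Ideal.absNorm_bot] at hP
  exact hp.ne_zero hP.symm

theorem Ideal.exists_factor {I : Ideal R} (hI : p ∣ Ideal.absNorm I) :
    ∃ M J : Ideal R, M.IsMaximal ∧ Ideal.span {(p : R)} ≤ M ∧ I = M * J := by
  obtain ⟨M, hM, hMp, J, rfl⟩ := Ideal.exists_isMaximal_dvd_of_dvd_absNorm' hp I hI
  refine ⟨M, J, hM, ?_, rfl⟩
  rw [Ideal.span_singleton_le_iff_mem]
  have : (p : ℤ) ∈ M.under ℤ := by rw [hMp]; exact Ideal.mem_span_singleton_self _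
  simpa [Ideal.mem_under] using this

/-- Induction on `k`: a maximal factor of `I` above `p` contains `P₁P₂`, hence is `P₁` or `P₂`, and
can be split off. -/
theorem Ideal.eq_pow_mul_pow_of_absNorm {P₁ P₂ : Ideal R} (h : P₁ * P₂ = Ideal.span {(p : R)})
    (h₁ : Ideal.absNorm P₁ = p) (h₂ : Ideal.absNorm P₂ = p) (k : ℕ) (I : Ideal R)
    (hI : Ideal.absNorm I = p ^ k) : ∃ i ≤ k, I = P₁ ^ i * P₂ ^ (k - i) := by
  induction k generalizing I with
  | zero =>
    refine ⟨0, le_rfl, ?_⟩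
    rw [pow_zero] at hI
    simpa using Ideal.absNorm_eq_one_iff.1 hI
  | succ k ih =>
    obtain ⟨M, J, hM, hMp, rfl⟩ := Ideal.exists_factor hp (hI ▸ dvd_pow_self p k.succ_ne_zero)
    have hJ (hMn : Ideal.absNorm M = p) : Ideal.absNorm J = p ^ k := by
      rw [map_mul, hMn, pow_succ'] at hI
      exact Nat.eq_of_mul_eq_mul_left hp.pos hI
    rw [← h, hM.isPrime.mul_le] at hMp
    rcases hMp with hMp | hMp
    · have e := (Ideal.isMaximal_of_absNorm_eq_prime hp h₁).eq_of_le hM.ne_top hMp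
      obtain ⟨i, hi, e'⟩ := ih J (hJ (e ▸ h₁))
      exact ⟨i + 1, by omega, by rw [← e, e', pow_succ', mul_assoc, Nat.add_sub_add_right]⟩
    · have e := (Ideal.isMaximal_of_absNorm_eq_prime hp h₂).eq_of_le hM.ne_top hMp
      obtain ⟨i, hi, e'⟩ := ih J (hJ (e ▸ h₂))
      exact ⟨i, by omega, by rw [← e, e', Nat.succ_sub hi, pow_succ']; ring⟩

theorem Ideal.pow_mul_pow_ne {P₁ P₂ : Ideal R} (h₁ : Ideal.absNorm P₁ = p)
    (h₂ : Ideal.absNorm P₂ = p) (hne : P₁ ≠ P₂) {k i j : ℕ} (hij : i < j) (hj : j ≤ k) :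
    P₁ ^ i * P₂ ^ (k - i) ≠ P₁ ^ j * P₂ ^ (k - j) := by
  intro h
  have hm1 := Ideal.isMaximal_of_absNorm_eq_prime hp h₁
  have hm2 := Ideal.isMaximal_of_absNorm_eq_prime hp h₂
  have h0 : P₁ ^ i ≠ 0 := by
    intro h0
    have := congrArg Ideal.absNorm h0
    rw [map_pow, h₁, map_zero] at this
    exact (pow_ne_zero _ hp.ne_zero) this
  obtain ⟨d, rfl⟩ : ∃ d, j = i + (d + 1) := ⟨j - i - 1, by omega⟩
  rw [pow_add, mul_assoc] at h
  have h3 := mul_left_cancel₀ h0 h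
  have h4 : P₂ ^ (k - i) ≤ P₁ := by
    rw [h3, pow_succ', mul_assoc]
    exact Ideal.mul_le_left
  exact hne ((hm2.eq_of_le hm1.ne_top (hm1.isPrime.le_of_pow_le h4)).symm)

theorem idealCount_prime_pow_of_split {P₁ P₂ : Ideal R} (h : P₁ * P₂ = Ideal.span {(p : R)})
    (h₁ : Ideal.absNorm P₁ = p) (h₂ : Ideal.absNorm P₂ = p) (hne : P₁ ≠ P₂) (k : ℕ) :
    idealCount R (p ^ k) = k + 1 := by
  rw [idealCount, ← Nat.card_fin (k + 1)]
  refine (Nat.card_congr (Equiv.ofBijective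
    (fun i : Fin (k + 1) => ⟨P₁ ^ (i : ℕ) * P₂ ^ (k - i), by
      rw [map_mul, map_pow, map_pow, h₁, h₂, ← pow_add]
      congr 1; omega⟩) ⟨?_, ?_⟩)).symm
  · intro i j hij
    have hij : P₁ ^ (i : ℕ) * P₂ ^ (k - i) = P₁ ^ (j : ℕ) * P₂ ^ (k - j) := congrArg Subtype.val hij
    rcases lt_trichotomy i j with hlt | heq | hlt
    · exact absurd hij (Ideal.pow_mul_pow_ne hp h₁ h₂ hne hlt (by omega))
    · exact heq
    · exact absurd hij.symm (Ideal.pow_mul_pow_ne hp h₁ h₂ hne hlt (by omega))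
  · rintro ⟨I, hI⟩
    obtain ⟨i, hi, rfl⟩ := Ideal.eq_pow_mul_pow_of_absNorm hp h h₁ h₂ k I hI
    exact ⟨⟨i, by omega⟩, rfl⟩

theorem idealCount_prime_pow_of_ramified {P : Ideal R} (h : P * P = Ideal.span {(p : R)})
    (h₁ : Ideal.absNorm P = p) (k : ℕ) : idealCount R (p ^ k) = 1 := by
  rw [idealCount, Nat.card_eq_one_iff_unique]
  have key (I : Ideal R) (hI : Ideal.absNorm I = p ^ k) : I = P ^ k := by
    obtain ⟨i, hi, rfl⟩ := Ideal.eq_pow_mul_pow_of_absNorm hp h h₁ h₁ k I hI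
    rw [← pow_add]; congr 1; omega
  exact ⟨⟨fun I J => Subtype.ext (by rw [key I I.2, key J J.2])⟩, ⟨⟨P ^ k, by rw [map_pow, h₁]⟩⟩⟩

/-- An ideal whose norm is divisible by `p` is divisible by `(p)`, of norm `p²`; dividing by `(p)`
lowers the exponent by two. -/
theorem idealCount_prime_pow_of_inert (h : (Ideal.span {(p : R)}).IsMaximal)
    (h2 : Module.finrank ℤ R = 2) (k : ℕ) :
    idealCount R (p ^ k) = if Even k then 1 else 0 := by
  have hN : Ideal.absNorm (Ideal.span {(p : R)}) = p ^ 2 := by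
    rw [Ideal.absNorm_span_natCast, h2]
  induction k using Nat.twoStepInduction with
  | zero => simpa using idealCount_one
  | one =>
    rw [if_neg (by decide), idealCount, Nat.card_eq_zero]
    left
    refine ⟨fun ⟨I, hI⟩ => ?_⟩
    obtain ⟨M, J, hM, hMp, rfl⟩ := Ideal.exists_factor hp (hI ▸ dvd_pow_self p one_ne_zero)
    have e := h.eq_of_le hM.ne_top hMp
    rw [map_mul, ← e, hN, pow_two, pow_one, mul_assoc] at hI
    have := Nat.eq_of_mul_eq_mul_left hp.pos (hI.trans (mul_one p).symm)
    exact hp.one_lt.ne' (Nat.eq_one_of_mul_eq_one_right this)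
  | more k ih _ =>
    rw [show (if Even (k + 2) then 1 else 0) = if Even k then 1 else 0 by
      simp [Nat.even_add], ← ih, idealCount, idealCount]
    refine (Nat.card_congr (Equiv.ofBijective
      (fun J => ⟨Ideal.span {(p : R)} * J.1, by rw [map_mul, hN, J.2, ← pow_add, add_comm]⟩)
      ⟨?_, ?_⟩)).symm
    · intro I J hIJ
      have hp0 : Ideal.span {(p : R)} ≠ 0 := by
        simpa using hp.ne_zero
      exact Subtype.ext (mul_left_cancel₀ hp0 (congrArg Subtype.val hIJ))
    · rintro ⟨I, hI⟩
      obtain ⟨M, J, hM, hMp, rfl⟩ := Ideal.exists_factor hp (hI ▸ dvd_pow_self p (by omega))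
      have e := h.eq_of_le hM.ne_top hMp
      refine ⟨⟨J, ?_⟩, Subtype.ext (congrArg (· * J) e)⟩
      rw [map_mul, ← e, hN, add_comm, pow_add] at hI
      exact Nat.eq_of_mul_eq_mul_left (pow_pos hp.pos 2) hI

end

end

section

open Filter Topology NumberField

/-! ### Splitting of primes in quadratic orders -/

/-- The roots of `X² - b X - a` modulo `p`. -/
abbrev QuadRoots (a b : ℤ) (p : ℕ) : Type := {u : ZMod p // u * u = a • (1 : ZMod p) + b • u}

/-- Both sides depend only on `a` and `b` modulo eight, which leaves a finite check. -/
theorem card_quadRoots_two (a b : ℤ) :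
    (Nat.card (QuadRoots a b 2) : ℤ) = 1 + kronecker (b ^ 2 + 4 * a) 2 := by
  have key : ∀ A B : ZMod 8, (Fintype.card {u : ZMod 2 // u * u =
      ZMod.castHom (show 2 ∣ 8 by norm_num) (ZMod 2) A +
        ZMod.castHom (show 2 ∣ 8 by norm_num) (ZMod 2) B * u} : ℤ) =
      1 + ZMod.χ₈ (B ^ 2 + 4 * A) := by decide
  have h := key a b
  simp only [map_intCast] at h
  rw [kronecker_two, Nat.card_eq_fintype_card]
  push_cast
  rw [← h]
  congr 1
  exact Fintype.card_congr (Equiv.subtypeEquivRight fun u => by simp)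

/-- Completing the square, `u ↦ 2u - b` identifies the roots with the square roots of the
discriminant. -/
theorem card_quadRoots_of_odd (a b : ℤ) {p : ℕ} (hp : p.Prime) (hp2 : p ≠ 2) :
    (Nat.card (QuadRoots a b p) : ℤ) = 1 + kronecker (b ^ 2 + 4 * a) p := by
  have : Fact p.Prime := ⟨hp⟩
  have h2 : (2 : ZMod p) ≠ 0 := by
    have := ZMod.prime_ne_zero p 2 hp2
    exact_mod_cast this
  rw [kronecker_of_odd _ (hp.odd_of_ne_two hp2), ← jacobiSym.legendreSym.to_jacobiSym, add_comm,
    ← legendreSym.card_sqrts p hp2, Set.toFinset_card, ← Nat.card_eq_fintype_card]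
  congr 1
  refine Nat.card_congr ⟨fun u => ⟨2 * u.1 - b, ?_⟩, fun x => ⟨(x.1 + b) / 2, ?_⟩, fun u => ?_,
    fun x => ?_⟩
  · have h := u.2
    simp only [zsmul_eq_mul, mul_one] at h
    rw [Set.mem_ofPred_eq]
    push_cast
    linear_combination 4 * h
  · have h : x.1 ^ 2 = _ := x.2
    push_cast at h
    simp only [zsmul_eq_mul, mul_one]
    field_simp
    linear_combination h
  · ext; simp only; field_simp; ring
  · ext; simp only; field_simp; ring

theorem card_quadRoots (a b : ℤ) {p : ℕ} (hp : p.Prime) :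
    (Nat.card (QuadRoots a b p) : ℤ) = 1 + kronecker (b ^ 2 + 4 * a) p := by
  by_cases hp2 : p = 2
  · subst hp2; exact card_quadRoots_two a b
  · exact card_quadRoots_of_odd a b hp hp2

section

variable {R : Type*} [CommRing R] [IsDedekindDomain R] [Module.Free ℤ R] [Module.Finite ℤ R]
  [CharZero R] {a b : ℤ} (e : R ≃+* QuadraticAlgebra ℤ a b) {p : ℕ} (hp : p.Prime)

include hp in
/-- The ideals of norm `p` are the kernels of the homomorphisms to `ℤ/p`. -/
theorem idealCount_prime : idealCount R p = Nat.card (R →+* ZMod p) := by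
  have : Fact p.Prime := ⟨hp⟩
  refine (Nat.card_congr (Equiv.ofBijective
    (fun f : R →+* ZMod p => (⟨RingHom.ker f, ?_⟩ : {I : Ideal R // Ideal.absNorm I = p}))
      ⟨?_, ?_⟩)).symm
  · have h1 := RingHom.quotientKerEquivOfSurjective (ZMod.ringHom_surjective f)
    rw [Ideal.absNorm_apply, Submodule.cardQuot_apply, Nat.card_congr h1.toEquiv, Nat.card_zmod]
  · intro f g hfg
    exact ZMod.ringHom_eq_of_ker_eq f g (congrArg Subtype.val hfg)
  · rintro ⟨I, hI⟩
    have hc : Nat.card (R ⧸ I) = p := by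
      rw [← hI, Ideal.absNorm_apply, Submodule.cardQuot_apply]
    have : Finite (R ⧸ I) := Nat.finite_of_card_ne_zero (by rw [hc]; exact hp.ne_zero)
    have := Fintype.ofFinite (R ⧸ I)
    let f := ZMod.ringEquivOfPrime (R ⧸ I) hp (by rw [← Nat.card_eq_fintype_card, hc])
    refine ⟨(f.symm : R ⧸ I →+* ZMod p).comp (Ideal.Quotient.mk I), Subtype.ext ?_⟩
    ext x
    simp [RingHom.mem_ker, Ideal.Quotient.eq_zero_iff_mem]

include e in
theorem card_ringHom : Nat.card (R →+* ZMod p) = Nat.card (QuadRoots a b p) := by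
  rw [Nat.card_congr (QuadraticAlgebra.lift (R := ℤ) (a := a) (b := b) (A := ZMod p)),
    ← Nat.card_congr (RingHom.equivIntAlgHom _ _)]
  exact Nat.card_congr ⟨fun f => f.comp e.symm, fun f => f.comp e,
    fun f => by ext; simp, fun f => by ext; simp⟩

include hp e in
-- The number `1 + κ` of ideals of norm `p` decides the case: two (split, `κ = 1`), one (ramified,
-- `κ = 0`) or none (inert, `κ = -1`). In each, the geometric sum is the count for `p^k`.
theorem idealCount_prime_pow (h2 : Module.finrank ℤ R = 2) (k : ℕ) :
    (idealCount R (p ^ k) : ℤ) =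
      ∑ i ∈ Finset.range (k + 1), kronecker (b ^ 2 + 4 * a) p ^ i := by
  have hcard : (idealCount R p : ℤ) = 1 + kronecker (b ^ 2 + 4 * a) p := by
    rw [idealCount_prime hp, card_ringHom e, card_quadRoots a b hp]
  set κ := kronecker (b ^ 2 + 4 * a) p
  have hN : Ideal.absNorm (Ideal.span {(p : R)}) = p ^ 2 := by
    rw [Ideal.absNorm_span_natCast, h2]
  have hcof {P : Ideal R} (hP : Ideal.absNorm P = p) :
      ∃ J : Ideal R, P * J = Ideal.span {(p : R)} ∧ Ideal.absNorm J = p := by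
    have hdvd : P ∣ Ideal.span {(p : R)} := by
      rw [Ideal.dvd_iff_le, Ideal.span_singleton_le_iff_mem, ← hP]
      exact Ideal.absNorm_mem P
    obtain ⟨J, hJ⟩ := hdvd
    refine ⟨J, hJ.symm, ?_⟩
    rw [hJ, map_mul, hP, pow_two] at hN
    exact Nat.eq_of_mul_eq_mul_left hp.pos hN
  by_cases h0 : ∃ P₁ : Ideal R, Ideal.absNorm P₁ = p
  · obtain ⟨P₁, h₁⟩ := h0
    obtain ⟨J, hJ, hJn⟩ := hcof h₁
    by_cases h1 : ∃ P₂ : Ideal R, Ideal.absNorm P₂ = p ∧ P₁ ≠ P₂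
    · obtain ⟨P₂, h₂, hne⟩ := h1
      have hm1 := Ideal.isMaximal_of_absNorm_eq_prime hp h₁
      have hm2 := Ideal.isMaximal_of_absNorm_eq_prime hp h₂
      have hmJ := Ideal.isMaximal_of_absNorm_eq_prime hp hJn
      have hle : P₁ * J ≤ P₂ := by
        rw [hJ, Ideal.span_singleton_le_iff_mem, ← h₂]
        exact Ideal.absNorm_mem P₂
      have hJ2 : J = P₂ := by
        rcases hm2.isPrime.mul_le.1 hle with h | h
        · exact absurd (hm1.eq_of_le hm2.ne_top h) hne
        · exact hmJ.eq_of_le hm2.ne_top h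
      rw [hJ2] at hJ
      have h3 := idealCount_prime_pow_of_split hp hJ h₁ h₂ hne 1
      rw [pow_one] at h3
      rw [h3] at hcard
      have hκ : κ = 1 := by push_cast at hcard; linarith
      rw [idealCount_prime_pow_of_split hp hJ h₁ h₂ hne k, hκ]
      simp
    · have h1' : ∀ P₂ : Ideal R, Ideal.absNorm P₂ = p → P₁ = P₂ := by
        intro P₂ h
        by_contra hne
        exact h1 ⟨P₂, h, hne⟩
      rw [← h1' J hJn] at hJ
      have h3 := idealCount_prime_pow_of_ramified hp hJ h₁ 1
      rw [pow_one] at h3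
      rw [h3] at hcard
      have hκ : κ = 0 := by push_cast at hcard; linarith
      rw [idealCount_prime_pow_of_ramified hp hJ h₁ k, hκ]
      simp [Finset.sum_range_succ']
  · have h3 : idealCount R p = 0 := by
      rw [idealCount, Nat.card_eq_zero]
      exact Or.inl ⟨fun I => h0 ⟨I.1, I.2⟩⟩
    rw [h3] at hcard
    have hκ : κ = -1 := by push_cast at hcard; linarith
    have hmax : (Ideal.span {(p : R)}).IsMaximal := by
      obtain ⟨M, J, hM, -, hMJ⟩ := Ideal.exists_factor hp (I := Ideal.span {(p : R)})
        (hN ▸ dvd_pow_self p two_ne_zero)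
      have h4 := hN
      rw [hMJ, map_mul] at h4
      obtain ⟨i, hi, h5⟩ := (Nat.dvd_prime_pow hp).1 (Dvd.intro _ h4)
      have hi0 : i ≠ 0 := by
        rintro rfl
        rw [pow_zero] at h5
        exact hM.ne_top (Ideal.absNorm_eq_one_iff.1 h5)
      have hi1 : i ≠ 1 := by
        rintro rfl
        exact h0 ⟨M, by rw [h5, pow_one]⟩
      have hi2 : i = 2 := by omega
      rw [h5, hi2] at h4
      have h6 : Ideal.absNorm J = 1 :=
        Nat.eq_of_mul_eq_mul_left (pow_pos hp.pos 2) (h4.trans (mul_one _).symm)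
      rw [hMJ, Ideal.absNorm_eq_one_iff.1 h6, Ideal.mul_top]
      exact hM
    rw [idealCount_prime_pow_of_inert hp hmax h2 k, hκ, neg_one_geom_sum]
    simp only [Nat.even_add_one]
    split_ifs <;> simp_all

variable (R) in
/-- `n ↦ #{ideals of norm n}` as an arithmetic function. -/
def idealCountFun : ArithmeticFunction ℂ := ⟨fun n => if n = 0 then 0 else idealCount R n, by simp⟩

include e in
-- Both functions are multiplicative and agree at prime powers; this is the factorisation of the
-- Dedekind zeta function on the level of coefficients.
theorem idealCountFun_eq_zetaMul (h2 : Module.finrank ℤ R = 2) (hD : b ^ 2 + 4 * a < 0)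
    (hD4 : (b ^ 2 + 4 * a) % 4 = 0 ∨ (b ^ 2 + 4 * a) % 4 = 1) :
    idealCountFun R = (chiD _ hD hD4).zetaMul := by
  have hm : (idealCountFun R).IsMultiplicative := by
    refine ArithmeticFunction.IsMultiplicative.iff_ne_zero.2 ⟨?_, fun {m n} hm hn hmn => ?_⟩
    · simp [idealCountFun, idealCount_one]
    · simp [idealCountFun, hm, hn, idealCount_mul hmn]
  rw [ArithmeticFunction.IsMultiplicative.eq_iff_eq_on_prime_powers _ hm _
    (DirichletCharacter.isMultiplicative_zetaMul _)]
  intro p k hp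
  have h1 := idealCount_prime_pow e hp h2 k
  have h3 : idealCountFun R (p ^ k) = ((idealCount R (p ^ k) : ℤ) : ℂ) := by
    simp [idealCountFun, hp.ne_zero]
  rw [h3, h1, DirichletCharacter.zetaMul, ArithmeticFunction.coe_zeta_mul_apply,
    Nat.sum_divisors_prime_pow hp]
  push_cast
  refine Finset.sum_congr rfl fun i _ => ?_
  simp [toArithmeticFunction, hp.ne_zero, ← chiD_natCast hD hD4]

end

section

variable {K : Type*} [Field K] [NumberField K] {a b : ℤ} (e : 𝓞 K ≃+* QuadraticAlgebra ℤ a b)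

include e

theorem dedekindZeta_eq_mul (hD : b ^ 2 + 4 * a < 0)
    (hD4 : (b ^ 2 + 4 * a) % 4 = 0 ∨ (b ^ 2 + 4 * a) % 4 = 1) {s : ℂ} (hs : 1 < s.re) :
    dedekindZeta K s = riemannZeta s * LchiD (b ^ 2 + 4 * a) s := by
  have : NeZero (b ^ 2 + 4 * a).natAbs := ⟨by omega⟩
  have h2 : Module.finrank ℤ (𝓞 K) = 2 := by
    rw [RingOfIntegers.rank, finrank_eq_two_of_ringEquiv e]
  have h1 : dedekindZeta K s = LSeries (idealCountFun (𝓞 K)) s := by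
    refine LSeries_congr (fun {n} hn => ?_) s
    simp [idealCountFun, hn, idealCount]
  rw [h1, idealCountFun_eq_zetaMul e h2 hD hD4, LchiD_eq_LSeries hD hD4 hs,
    ← ArithmeticFunction.LSeries_zeta_eq_riemannZeta hs, DirichletCharacter.zetaMul]
  have h3 : LSeriesSummable (fun n => chiD _ hD hD4 n) s :=
    DirichletCharacter.LSeriesSummable_of_one_lt_re _ hs
  have h4 {n : ℕ} (hn : n ≠ 0) :
      (toArithmeticFunction fun n => chiD _ hD hD4 n) n = chiD _ hD hD4 n := by
    simp [toArithmeticFunction, hn]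
  have h5 : LSeriesSummable (fun n => (ArithmeticFunction.zeta : ArithmeticFunction ℂ) n) s := by
    simpa only [ArithmeticFunction.natCoe_apply] using
      ArithmeticFunction.LSeriesSummable_zeta_iff.2 hs
  rw [ArithmeticFunction.LSeries_mul' h5 ((LSeriesSummable_congr s h4).2 h3), LSeries_congr h4]
  simp only [ArithmeticFunction.natCoe_apply]

/-- The class number formula for imaginary quadratic fields. -/
theorem LchiD_one_eq (hD : b ^ 2 + 4 * a < 0)
    (hD4 : (b ^ 2 + 4 * a) % 4 = 0 ∨ (b ^ 2 + 4 * a) % 4 = 1) :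
    LchiD (b ^ 2 + 4 * a) 1 = (2 * Real.pi * classNumber K /
      (Nat.card (QuadraticAlgebra ℤ a b)ˣ * Real.sqrt (-(b ^ 2 + 4 * a : ℤ))) : ℝ) := by
  rw [← dedekindZeta_residue_eq e hD]
  have h1 : Tendsto (fun s : ℝ => (s : ℂ)) (𝓝[>] 1) (𝓝[≠] 1) := by
    refine tendsto_nhdsWithin_iff.2 ⟨?_, ?_⟩
    · exact (Complex.continuous_ofReal.tendsto' 1 1 (by simp)).mono_left nhdsWithin_le_nhds
    · filter_upwards [self_mem_nhdsWithin] with s hs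
      have : s ≠ 1 := ne_of_gt hs
      simpa using this
  have h2 := riemannZeta_residue_one.comp h1
  have h3 : Tendsto (fun s : ℝ => LchiD (b ^ 2 + 4 * a) s) (𝓝[>] 1)
      (𝓝 (LchiD (b ^ 2 + 4 * a) 1)) :=
    ((differentiable_LchiD hD hD4).continuous.tendsto 1).comp (h1.mono_right nhdsWithin_le_nhds)
  have h4 := h2.mul h3
  rw [one_mul] at h4
  refine tendsto_nhds_unique h4 ((tendsto_sub_one_mul_dedekindZeta_nhdsGT K).congr' ?_)
  filter_upwards [self_mem_nhdsWithin] with s hs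
  rw [dedekindZeta_eq_mul e hD hD4 (by simpa using hs)]
  simp [mul_assoc]

end

end

section

open Filter Topology NumberField

/-! ### Maximal orders of imaginary quadratic fields -/

theorem fact_quad {a b : ℤ} (hD : b ^ 2 + 4 * a < 0) :
    Fact (∀ r : ℚ, r ^ 2 ≠ (a : ℚ) + (b : ℚ) * r) := by
  refine ⟨fun r hr => ?_⟩
  have h1 : (2 * r - b) ^ 2 = ((b ^ 2 + 4 * a : ℤ) : ℚ) := by push_cast; linear_combination 4 * hr
  have h2 : ((b ^ 2 + 4 * a : ℤ) : ℚ) < 0 := by exact_mod_cast hD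
  nlinarith [sq_nonneg (2 * r - b)]

/-- The base change map `ℤ[ω] → S[ω]`. -/
def intQuad (a b : ℤ) (S : Type*) [CommRing S] :
    QuadraticAlgebra ℤ a b →+* QuadraticAlgebra S (a : S) (b : S) where
  toFun z := ⟨z.re, z.im⟩
  map_one' := by ext <;> simp [QuadraticAlgebra.re_one, QuadraticAlgebra.im_one]
  map_mul' z w := by ext <;> simp
  map_zero' := by ext <;> simp
  map_add' z w := by ext <;> simp

@[simp] theorem intQuad_re (a b : ℤ) (S : Type*) [CommRing S] (z : QuadraticAlgebra ℤ a b) :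
    (intQuad a b S z).re = z.re := rfl

@[simp] theorem intQuad_im (a b : ℤ) (S : Type*) [CommRing S] (z : QuadraticAlgebra ℤ a b) :
    (intQuad a b S z).im = z.im := rfl

theorem intQuad_injective (a b : ℤ) : Function.Injective (intQuad a b ℚ) := by
  intro z w h
  have h1 := congrArg QuadraticAlgebra.re h
  have h2 := congrArg QuadraticAlgebra.im h
  simp at h1 h2
  exact QuadraticAlgebra.ext h1 h2

/-- The square of the denominator of `y` divides the squarefree `d`, so the denominator is one. -/
theorem exists_int_of_sq_mul {y : ℚ} {d k : ℤ} (hd : Squarefree d) (h : y ^ 2 * d = k) :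
    ∃ n : ℤ, y = n := by
  have h1 : (y.num : ℚ) ^ 2 * d = k * (y.den : ℚ) ^ 2 := by
    have h0 : (y.den : ℚ) ≠ 0 := by exact_mod_cast y.den_nz
    have hy : (y.num : ℚ) = y * y.den := (Rat.mul_den_eq_num y).symm
    rw [hy, ← h]; ring
  have h2 : y.num ^ 2 * d = k * (y.den : ℤ) ^ 2 := by exact_mod_cast h1
  have h3 : (y.den : ℤ) * y.den ∣ d := by
    have hc : IsCoprime ((y.den : ℤ) ^ 2) (y.num ^ 2) :=
      (Int.isCoprime_iff_gcd_eq_one.2 (by rw [Int.gcd_comm]; exact y.reduced)).pow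
    rw [← pow_two]
    exact hc.dvd_of_dvd_mul_left (Dvd.intro_left k h2.symm)
  have h4 : y.den = 1 := by
    have := Int.isUnit_iff_natAbs_eq.1 (hd _ h3)
    simpa using this
  exact ⟨y.num, by rw [← Rat.num_div_den y, h4]; simp⟩

theorem even_of_four_dvd {X c : ℤ} (h : (4 : ℤ) ∣ X ^ 2 + 2 * c * X) : ∃ n, X = 2 * n := by
  rcases Int.even_or_odd' X with ⟨k, rfl | rfl⟩
  · exact ⟨k, rfl⟩
  · exfalso
    obtain ⟨m, hm⟩ := h
    have : (2 * k + 1) ^ 2 + 2 * c * (2 * k + 1) = 2 * (2 * k ^ 2 + 2 * k + c * (2 * k + 1)) + 1 := by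
      ring
    omega

/-- If `D = b² + 4a` is fundamental then `x + y ω` with integral trace and norm is in `ℤ[ω]`. -/
theorem exists_int_of_trace_norm {a b : ℤ} (hf : IsFundamentalDiscriminant (b ^ 2 + 4 * a))
    {x y : ℚ} {t n : ℤ} (ht : 2 * x + b * y = t) (hn : x ^ 2 + b * x * y - a * y ^ 2 = n) :
    (∃ k : ℤ, x = k) ∧ ∃ k : ℤ, y = k := by
  have hy : ∃ k : ℤ, y = k := by
    have h1 : y ^ 2 * (b ^ 2 + 4 * a) = t ^ 2 - 4 * n := by
      rw [← ht, ← hn]; ring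
    rcases hf with ⟨-, hsq, -⟩ | ⟨m, hm, hm4, hsq⟩
    · exact exists_int_of_sq_mul (k := t ^ 2 - 4 * n) hsq (by push_cast; exact h1)
    · have h2 : (2 * y) ^ 2 * m = t ^ 2 - 4 * n := by
        have : ((b : ℚ) ^ 2 + 4 * a) = 4 * m := by exact_mod_cast hm
        rw [← h1, this]; ring
      obtain ⟨Y, hY⟩ := exists_int_of_sq_mul (k := t ^ 2 - 4 * n) hsq (by push_cast; exact h2)
      rw [hY] at h2
      have h3 : Y ^ 2 * m = t ^ 2 - 4 * n := by exact_mod_cast h2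
      rcases Int.even_or_odd' Y with ⟨k, rfl | rfl⟩
      · exact ⟨k, by push_cast at hY; linarith⟩
      -- For `D = 4m` only `2y` is known to be integral; were it odd, `m` would be a square modulo
      -- four, against `m ≡ 2, 3`.
      · exfalso
        have h4 : t ^ 2 % 4 = 0 ∨ t ^ 2 % 4 = 1 := by
          rcases Int.even_or_odd' t with ⟨j, rfl | rfl⟩
          · left; ring_nf; omega
          · right; ring_nf; omega
        have h5 : m = t ^ 2 - 4 * (n + (k ^ 2 + k) * m) := by linear_combination h3
        omega
  refine ⟨?_, hy⟩
  obtain ⟨Y, rfl⟩ := hy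
  have h1 : 2 * x = ((t - b * Y : ℤ) : ℚ) := by push_cast; linarith
  have h2 : (t - b * Y) ^ 2 + 2 * (b * Y) * (t - b * Y) = 4 * (n + a * Y ^ 2) := by
    have : ((t - b * Y : ℤ) : ℚ) ^ 2 + 2 * (b * Y) * ((t - b * Y : ℤ) : ℚ) =
        4 * (n + a * Y ^ 2) := by
      rw [← h1, ← hn]; ring
    exact_mod_cast this
  obtain ⟨k, hk⟩ := even_of_four_dvd (Dvd.intro _ h2.symm)
  rw [hk] at h1
  exact ⟨k, by push_cast at h1; linarith⟩

section

variable {a b : ℤ} [hfact : Fact (∀ r : ℚ, r ^ 2 ≠ (a : ℚ) + (b : ℚ) * r)]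

instance : CharZero (QuadraticAlgebra ℚ (a : ℚ) (b : ℚ)) :=
  charZero_of_injective_algebraMap
    (algebraMap ℚ (QuadraticAlgebra ℚ (a : ℚ) (b : ℚ))).injective

instance : NumberField (QuadraticAlgebra ℚ (a : ℚ) (b : ℚ)) where
  to_finiteDimensional := by
    convert (inferInstance : Module.Finite ℚ (QuadraticAlgebra ℚ (a : ℚ) (b : ℚ)))

instance : Algebra (QuadraticAlgebra ℤ a b) (QuadraticAlgebra ℚ (a : ℚ) (b : ℚ)) :=
  (intQuad a b ℚ).toAlgebra

theorem quadraticAlgebra_ext_int {z : QuadraticAlgebra ℚ (a : ℚ) (b : ℚ)}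
    (h : (∃ k : ℤ, z.re = k) ∧ ∃ k : ℤ, z.im = k) : ∃ w, intQuad a b ℚ w = z := by
  obtain ⟨⟨k, hk⟩, ⟨l, hl⟩⟩ := h
  exact ⟨⟨k, l⟩, QuadraticAlgebra.ext hk.symm hl.symm⟩

/-- Integral elements have integral trace and norm, and for a fundamental discriminant these force
integral coordinates. -/
theorem isIntegralClosure_quadraticAlgebra (hf : IsFundamentalDiscriminant (b ^ 2 + 4 * a)) :
    IsIntegralClosure (QuadraticAlgebra ℤ a b) ℤ (QuadraticAlgebra ℚ (a : ℚ) (b : ℚ)) where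
  algebraMap_injective := intQuad_injective a b
  isIntegral_iff {z} := by
    constructor
    · intro hz
      have hs : _root_.IsIntegral ℤ (star z) := hz.map ((starRingEnd _).toIntAlgHom)
      have h1 : _root_.IsIntegral ℤ (z + star z) := hz.add hs
      have h2 : _root_.IsIntegral ℤ (z * star z) := hz.mul hs
      rw [← QuadraticAlgebra.algebraMap_trace_eq_add_star] at h1
      rw [← QuadraticAlgebra.algebraMap_norm_eq_mul_star] at h2
      rw [isIntegral_algebraMap_iff QuadraticAlgebra.algebraMap_injective] at h1 h2
      obtain ⟨t, ht⟩ := IsIntegrallyClosed.isIntegral_iff.1 h1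
      obtain ⟨n, hn⟩ := IsIntegrallyClosed.isIntegral_iff.1 h2
      refine quadraticAlgebra_ext_int (exists_int_of_trace_norm hf (t := t) (n := n) ?_ ?_)
      · simpa [QuadraticAlgebra.trace_def] using ht.symm
      · have := hn.symm
        simp [QuadraticAlgebra.norm_def] at this
        rw [← this]; ring
    · rintro ⟨w, rfl⟩
      have : Module.Finite ℤ (QuadraticAlgebra ℤ a b) := inferInstance
      exact (Algebra.IsIntegral.isIntegral (R := ℤ) w).map (intQuad a b ℚ).toIntAlgHom

/-- The ring of integers of `ℚ(ω)`. -/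
def ringOfIntegersEquiv (hf : IsFundamentalDiscriminant (b ^ 2 + 4 * a)) :
    𝓞 (QuadraticAlgebra ℚ (a : ℚ) (b : ℚ)) ≃+* QuadraticAlgebra ℤ a b :=
  haveI := isIntegralClosure_quadraticAlgebra hf
  RingOfIntegers.equiv _

theorem isDomain_quadraticAlgebra : IsDomain (QuadraticAlgebra ℤ a b) :=
  (intQuad_injective a b).isDomain

theorem isDedekindDomain_quadraticAlgebra (hf : IsFundamentalDiscriminant (b ^ 2 + 4 * a)) :
    IsDedekindDomain (QuadraticAlgebra ℤ a b) := by
  have := isIntegralClosure_quadraticAlgebra hf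
  have := isDomain_quadraticAlgebra (a := a) (b := b)
  exact IsIntegralClosure.isDedekindDomain ℤ ℚ (QuadraticAlgebra ℚ (a : ℚ) (b : ℚ)) _

theorem card_classGroup_quadraticAlgebra [IsDomain (QuadraticAlgebra ℤ a b)]
    (hf : IsFundamentalDiscriminant (b ^ 2 + 4 * a)) :
    Nat.card (ClassGroup (QuadraticAlgebra ℤ a b)) =
      classNumber (QuadraticAlgebra ℚ (a : ℚ) (b : ℚ)) := by
  rw [classNumber, ← Nat.card_eq_fintype_card]
  exact (Nat.card_congr (ClassGroup.mulEquiv (ringOfIntegersEquiv hf)).toEquiv).symm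

omit hfact in
theorem LchiD_one_eq_card [IsDomain (QuadraticAlgebra ℤ a b)] (hD : b ^ 2 + 4 * a < 0)
    (hf : IsFundamentalDiscriminant (b ^ 2 + 4 * a)) :
    LchiD (b ^ 2 + 4 * a) 1 = (2 * Real.pi * Nat.card (ClassGroup (QuadraticAlgebra ℤ a b)) /
      (Nat.card (QuadraticAlgebra ℤ a b)ˣ * Real.sqrt (-(b ^ 2 + 4 * a : ℤ))) : ℝ) := by
  have := fact_quad hD
  have hD4 : (b ^ 2 + 4 * a) % 4 = 0 ∨ (b ^ 2 + 4 * a) % 4 = 1 := by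
    rcases hf with h | ⟨m, h, -⟩ <;> omega
  rw [card_classGroup_quadraticAlgebra hf, LchiD_one_eq (ringOfIntegersEquiv hf) hD hD4]

end

end

section

open IsDedekindDomain HeightOneSpectrum

/-! ### Finite adeles of `ℚ` -/

section

theorem IsIntegral.add {x y : Af} (hx : IsIntegral x) (hy : IsIntegral y) : IsIntegral (x + y) :=
  fun v => add_mem (hx v) (hy v)

theorem IsIntegral.mul {x y : Af} (hx : IsIntegral x) (hy : IsIntegral y) : IsIntegral (x * y) :=
  fun v => mul_mem (hx v) (hy v)

theorem IsIntegral.sub {x y : Af} (hx : IsIntegral x) (hy : IsIntegral y) : IsIntegral (x - y) :=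
  fun v => sub_mem (hx v) (hy v)

theorem isIntegral_zero : IsIntegral 0 := fun _ => zero_mem _

theorem isIntegral_one : IsIntegral 1 := fun _ => one_mem _

theorem isIntegral_intCast (n : ℤ) : IsIntegral (n : Af) := by
  induction n using Int.induction_on with
  | zero => simpa using isIntegral_zero
  | succ n ih => push_cast at *; exact ih.add isIntegral_one
  | pred n ih => push_cast at *; exact ih.sub isIntegral_one

theorem valued_algebraMap (v : HeightOneSpectrum ℤ) (q : ℚ) :
    Valued.v (algebraMap ℚ (v.adicCompletion ℚ) q) = v.valuation ℚ q :=
  valuedAdicCompletion_eq_valuation' v q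

theorem algebraMap_mem_adicCompletionIntegers {v : HeightOneSpectrum ℤ} {q : ℚ} :
    algebraMap ℚ (v.adicCompletion ℚ) q ∈ v.adicCompletionIntegers ℚ ↔ v.valuation ℚ q ≤ 1 := by
  rw [mem_adicCompletionIntegers, valued_algebraMap]

theorem isIntegral_algebraMap_iff {q : ℚ} :
    IsIntegral (algebraMap ℚ Af q) ↔ ∀ v : HeightOneSpectrum ℤ, v.valuation ℚ q ≤ 1 :=
  forall_congr' fun v => algebraMap_mem_adicCompletionIntegers (v := v)

theorem isIntegral_algebraMap_iff_exists {q : ℚ} :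
    IsIntegral (algebraMap ℚ Af q) ↔ ∃ n : ℤ, q = n := by
  constructor
  · intro h
    obtain ⟨n, hn⟩ := mem_integers_of_valuation_le_one (R := ℤ) ℚ q (isIntegral_algebraMap_iff.1 h)
    exact ⟨n, hn.symm⟩
  · rintro ⟨n, rfl⟩
    rw [map_intCast]
    exact isIntegral_intCast n

/-- The prime number belonging to a place. -/
def placeGen (v : HeightOneSpectrum ℤ) : ℤ := Submodule.IsPrincipal.generator v.asIdeal

theorem asIdeal_eq_span (v : HeightOneSpectrum ℤ) : v.asIdeal = Ideal.span {placeGen v} :=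
  (Ideal.span_singleton_generator _).symm

theorem placeGen_ne_zero (v : HeightOneSpectrum ℤ) : placeGen v ≠ 0 := by
  intro h
  have := asIdeal_eq_span v
  rw [h, Ideal.span_singleton_eq_bot.2 rfl] at this
  exact v.ne_bot this

theorem valuation_placeGen (v : HeightOneSpectrum ℤ) :
    v.valuation ℚ (placeGen v : ℚ) = WithZero.exp (-1 : ℤ) := by
  rw [← eq_intCast (algebraMap ℤ ℚ), valuation_of_algebraMap]
  exact intValuation_singleton v (placeGen_ne_zero v) (asIdeal_eq_span v)

theorem valuation_intCast_eq_one {v : HeightOneSpectrum ℤ} {n : ℤ} (hn : n ∉ v.asIdeal) :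
    v.valuation ℚ (n : ℚ) = 1 := by
  rw [← eq_intCast (algebraMap ℤ ℚ)]
  exact (valuation_eq_one_iff_notMem v).2 hn

theorem valuation_intCast_le_one (v : HeightOneSpectrum ℤ) (n : ℤ) :
    v.valuation ℚ (n : ℚ) ≤ 1 := by
  rw [← eq_intCast (algebraMap ℤ ℚ)]
  exact valuation_le_one v n

theorem valuation_placeGen_of_ne {v w : HeightOneSpectrum ℤ} (h : w ≠ v) :
    w.valuation ℚ (placeGen v : ℚ) = 1 := by
  refine valuation_intCast_eq_one fun hmem => h (HeightOneSpectrum.ext ?_)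
  have hle : v.asIdeal ≤ w.asIdeal := by
    rw [asIdeal_eq_span v, Ideal.span_singleton_le_iff_mem]; exact hmem
  exact ((v.isPrime.isMaximal v.ne_bot).eq_of_le w.isPrime.ne_top hle).symm

/-- Partial fractions: a `p`-adic number is congruent to a rational number which is integral
outside `p`. -/
theorem exists_rat_sub_mem (v : HeightOneSpectrum ℤ) (x : v.adicCompletion ℚ) :
    ∃ q : ℚ, x - algebraMap ℚ _ q ∈ v.adicCompletionIntegers ℚ ∧ ∀ w ≠ v, w.valuation ℚ q ≤ 1 := by
  obtain ⟨q', hq'⟩ : ∃ q' : ℚ, x - algebraMap ℚ _ q' ∈ v.adicCompletionIntegers ℚ := by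
    have hopen : IsOpen {y : v.adicCompletion ℚ | x - y ∈ v.adicCompletionIntegers ℚ} :=
      (Valued.isOpen_valuationSubring _).preimage (continuous_const.sub continuous_id)
    obtain ⟨q', h⟩ := (denseRange_algebraMap (K := ℚ) (v := v)).exists_mem_open hopen
      ⟨x, by simp [zero_mem]⟩
    exact ⟨q', h⟩
  set p := placeGen v with hp
  have hprime : Prime p :=
    (Ideal.span_singleton_prime (placeGen_ne_zero v)).1 (asIdeal_eq_span v ▸ v.isPrime)
  have hden : (q'.den : ℤ) ≠ 0 := by exact_mod_cast q'.den_nz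
  obtain ⟨m, hm, hdm⟩ := (FiniteMultiplicity.of_prime_left hprime hden).exists_eq_pow_mul_and_not_dvd
  set k := multiplicity p (q'.den : ℤ)
  have hcop : IsCoprime (p ^ k) m :=
    ((Prime.coprime_iff_not_dvd hprime).2 (by simpa using hdm)).pow_left
  obtain ⟨α, β, hαβ⟩ := hcop
  have hp0 : (p : ℚ) ≠ 0 := by exact_mod_cast placeGen_ne_zero v
  have hm0 : (m : ℚ) ≠ 0 := by
    rintro h
    rw [Int.cast_eq_zero.1 h, mul_zero] at hm
    exact hden hm
  -- With denominator `p^k m` and `αp^k + βm = 1`, this is the partial fraction with denominator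
  -- `p^k`.
  refine ⟨q'.num * β / p ^ k, ?_, fun w hw => ?_⟩
  · have h1 : (q' : ℚ) - q'.num * β / p ^ k = (q'.num * α : ℤ) / (m : ℚ) := by
      have hd : (q'.den : ℚ) = p ^ k * m := by exact_mod_cast hm
      have hab : (α : ℚ) * p ^ k + β * m = 1 := by exact_mod_cast hαβ
      have hq : q' = q'.num / (p ^ k * m) := by rw [← hd, Rat.num_div_den]
      rw [eq_div_iff hm0, sub_mul]
      nth_rw 1 [hq]
      push_cast
      field_simp
      linear_combination -q'.num * hab
    have h2 : v.valuation ℚ (q' - q'.num * β / p ^ k) ≤ 1 := by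
      rw [h1, map_div₀, valuation_intCast_eq_one (n := m), div_one]
      · exact valuation_intCast_le_one _ _
      · rw [asIdeal_eq_span, Ideal.mem_span_singleton]; exact hdm
    have h3 := add_mem hq' (algebraMap_mem_adicCompletionIntegers.2 h2)
    convert h3 using 1
    rw [map_sub]
    ring
  · rw [map_div₀, map_pow, valuation_placeGen_of_ne hw, one_pow, div_one]
    exact_mod_cast valuation_intCast_le_one w (q'.num * β)

/-- `𝔸_f = ℚ + \hat ℤ`: sum the principal parts at the finitely many places where `a` is not
integral; each of them is integral at all other places. -/
theorem exists_rat_sub_isIntegral (a : Af) : ∃ q : ℚ, IsIntegral (a - algebraMap ℚ Af q) := by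
  classical
  have hfin : {v : HeightOneSpectrum ℤ | a v ∉ v.adicCompletionIntegers ℚ}.Finite := a.2
  choose q hq hq' using fun v : HeightOneSpectrum ℤ => exists_rat_sub_mem v (a v)
  refine ⟨∑ v ∈ hfin.toFinset, q v, fun w => ?_⟩
  change a w - algebraMap ℚ (w.adicCompletion ℚ) (∑ v ∈ hfin.toFinset, q v) ∈
    w.adicCompletionIntegers ℚ
  have hrest : algebraMap ℚ (w.adicCompletion ℚ) (∑ v ∈ hfin.toFinset.erase w, q v) ∈
      w.adicCompletionIntegers ℚ := by
    rw [algebraMap_mem_adicCompletionIntegers]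
    exact Valuation.map_sum_le _ fun v hv => hq' v w (Finset.ne_of_mem_erase hv).symm
  by_cases hw : w ∈ hfin.toFinset
  · rw [← Finset.add_sum_erase _ _ hw]
    convert sub_mem (hq w) hrest using 1
    rw [map_add]; ring
  · rw [Finset.erase_eq_of_notMem hw] at hrest
    refine sub_mem ?_ hrest
    simpa using hw

theorem exists_nat_mul_isIntegral (a : Af) : ∃ n : ℕ, n ≠ 0 ∧ IsIntegral ((n : Af) * a) := by
  obtain ⟨q, hq⟩ := exists_rat_sub_isIntegral a
  refine ⟨q.den, q.den_nz, ?_⟩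
  have h1 : (q.den : Af) * a = (q.den : ℤ) * (a - algebraMap ℚ Af q) + (q.num : Af) := by
    have : (q.den : Af) * algebraMap ℚ Af q = q.num := by
      rw [← map_natCast (algebraMap ℚ Af), ← map_mul, Rat.den_mul_eq_num, map_intCast]
    rw [← this]
    push_cast; ring
  rw [h1]
  exact ((isIntegral_intCast _).mul hq).add (isIntegral_intCast _)

theorem exists_rat_add_mul (a : Af) {m : ℕ} (hm : m ≠ 0) :
    ∃ q : ℚ, ∃ z, IsIntegral z ∧ a = algebraMap ℚ Af q + m * z := by
  have hm' : (m : ℚ) ≠ 0 := by exact_mod_cast hm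
  obtain ⟨q, hq⟩ := exists_rat_sub_isIntegral (algebraMap ℚ Af (m : ℚ)⁻¹ * a)
  refine ⟨m * q, _, hq, ?_⟩
  rw [mul_sub, ← mul_assoc, ← map_natCast (algebraMap ℚ Af), ← map_mul, ← map_mul,
    mul_inv_cancel₀ hm', map_one]
  ring

/-- `𝔸_f^× = ℚ^× \hat ℤ^×`, because `ℤ` is principal: `q` is the product of the generators of the
places raised to the orders of `a`. -/
theorem exists_rat_mul_mem_zhatUnits (a : Afˣ) :
    ∃ q : ℚˣ, a * (Units.map (algebraMap ℚ Af : ℚ →* Af) q)⁻¹ ∈ ZhatUnits := by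
  classical
  have hu := FiniteAdeleRing.isUnit_iff.1 a.isUnit
  have hfin : {v : HeightOneSpectrum ℤ | Valued.v ((a : Af) v) ≠ 1}.Finite := hu.2
  set q : ℚ := ∏ v ∈ hfin.toFinset, (placeGen v : ℚ) ^ (-WithZero.log (Valued.v ((a : Af) v)))
  have hq0 : q ≠ 0 := Finset.prod_ne_zero_iff.2 fun v _ =>
    zpow_ne_zero _ (by exact_mod_cast placeGen_ne_zero v)
  have hval (w : HeightOneSpectrum ℤ) : w.valuation ℚ q = Valued.v ((a : Af) w) := by
    rw [map_prod]
    have h1 (v : HeightOneSpectrum ℤ) : w.valuation ℚ ((placeGen v : ℚ) ^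
        (-WithZero.log (Valued.v ((a : Af) v)))) =
        if v = w then Valued.v ((a : Af) w) else 1 := by
      rw [map_zpow₀]
      split_ifs with h
      · subst h
        rw [valuation_placeGen, ← WithZero.exp_zsmul]
        have h0 : Valued.v ((a : Af) v) ≠ 0 := (Valuation.ne_zero_iff _).2 (hu.1 v)
        simp [WithZero.exp_log h0]
      · rw [valuation_placeGen_of_ne (Ne.symm h), one_zpow]
    simp only [h1, Finset.prod_ite_eq']
    split_ifs with h
    · rfl
    · simp at h; exact h.symm
  have hq1 (w : HeightOneSpectrum ℤ) : w.valuation ℚ q ≠ 0 := (Valuation.ne_zero_iff _).2 hq0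
  refine ⟨Units.mk0 q hq0, fun w => ?_, fun w => ?_⟩
  · have h1 : ((a * (Units.map (algebraMap ℚ Af : ℚ →* Af) (Units.mk0 q hq0))⁻¹ : Afˣ) : Af) =
        a * algebraMap ℚ Af q⁻¹ := by
      rw [Units.val_mul, ← map_inv]; rfl
    rw [h1, mem_adicCompletionIntegers]
    change Valued.v ((a : Af) w * algebraMap ℚ (w.adicCompletion ℚ) q⁻¹) ≤ 1
    rw [map_mul, valued_algebraMap, map_inv₀, hval, mul_inv_cancel₀ (hval w ▸ hq1 w)]
  · have h1 : ((a * (Units.map (algebraMap ℚ Af : ℚ →* Af) (Units.mk0 q hq0))⁻¹)⁻¹ : Afˣ) *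
        (a : Af) = algebraMap ℚ Af q := by
      rw [← Units.val_mul, mul_inv_rev, inv_inv, mul_assoc, inv_mul_cancel, mul_one]; rfl
    have h2 := congrArg (fun x : Af => Valued.v (x w)) h1
    rw [mem_adicCompletionIntegers]
    change Valued.v (_ * (a : Af) w) = Valued.v (algebraMap ℚ (w.adicCompletion ℚ) q) at h2
    rw [map_mul, valued_algebraMap, hval] at h2
    exact (mul_eq_right₀ (hval w ▸ hq1 w)).1 h2 |>.le

theorem isOpen_isIntegral : IsOpen {a : Af | IsIntegral a} :=
  RestrictedProduct.isOpen_forall_mem fun _ => Valued.isOpen_valuationSubring _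

end

end

section

open IsDedekindDomain HeightOneSpectrum

/-! ### Idempotents in the finite adeles -/

open Classical in
/-- The finite adele which is `x v` at the places dividing `n` and `y` elsewhere. -/
def adeleAt {n : ℤ} (hn : n ≠ 0) (x : ∀ v : HeightOneSpectrum ℤ, v.adicCompletion ℚ) (y : Af) : Af :=
  ⟨fun v => if n ∈ v.asIdeal then x v else y v, by
    have h1 : {v : HeightOneSpectrum ℤ | n ∈ v.asIdeal}.Finite := by
      refine (HeightOneSpectrum.Support.finite ℤ (K := ℚ) ((n : ℚ)⁻¹)).subset fun v hv => ?_
      have h2 : v.valuation ℚ (n : ℚ) < 1 := by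
        rw [← eq_intCast (algebraMap ℤ ℚ)]
        exact (valuation_lt_one_iff_mem v n).2 hv
      have h0 : v.valuation ℚ (n : ℚ) ≠ 0 := (Valuation.ne_zero_iff _).2 (by exact_mod_cast hn)
      change 1 < v.valuation ℚ ((n : ℚ)⁻¹)
      rw [map_inv₀]
      exact (one_lt_inv₀ (zero_lt_iff.2 h0)).2 h2
    filter_upwards [h1.compl_mem_cofinite, y.2] with v hv hy
    rw [if_neg (show n ∉ v.asIdeal from hv)]
    exact hy⟩

open Classical in
theorem adeleAt_apply {n : ℤ} (hn : n ≠ 0) (x : ∀ v : HeightOneSpectrum ℤ, v.adicCompletion ℚ)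
    (y : Af) (v : HeightOneSpectrum ℤ) :
    adeleAt hn x y v = if n ∈ v.asIdeal then x v else y v := rfl

/-- The idempotent of the finite adeles belonging to the places dividing `n`. -/
def adeleIdem {n : ℤ} (hn : n ≠ 0) : Af := adeleAt hn (fun _ => 1) 0

open Classical in
theorem adeleIdem_apply {n : ℤ} (hn : n ≠ 0) (v : HeightOneSpectrum ℤ) :
    adeleIdem hn v = if n ∈ v.asIdeal then 1 else 0 := rfl

theorem isIntegral_adeleIdem {n : ℤ} (hn : n ≠ 0) : IsIntegral (adeleIdem hn) := by
  intro v
  rw [adeleIdem_apply]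
  split_ifs
  · exact one_mem _
  · exact zero_mem _

theorem adeleIdem_mul_self {n : ℤ} (hn : n ≠ 0) : adeleIdem hn * adeleIdem hn = adeleIdem hn := by
  refine DFunLike.ext _ _ fun v => ?_
  change adeleIdem hn v * adeleIdem hn v = adeleIdem hn v
  rw [adeleIdem_apply]
  split_ifs <;> simp

theorem notMem_asIdeal_of_isCoprime {m n : ℤ} (h : IsCoprime m n) {v : HeightOneSpectrum ℤ}
    (hn : n ∈ v.asIdeal) : m ∉ v.asIdeal := by
  intro hm
  obtain ⟨x, y, hxy⟩ := h
  refine v.isPrime.ne_top ((Ideal.eq_top_iff_one _).2 ?_)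
  rw [← hxy]
  exact add_mem (Ideal.mul_mem_left _ _ hm) (Ideal.mul_mem_left _ _ hn)

/-- An integer prime to `n` is a unit at every place dividing `n`. -/
theorem exists_isIntegral_mul_adeleIdem {m n : ℤ} (hn : n ≠ 0) (hm : IsCoprime m n) :
    ∃ w : Af, IsIntegral w ∧ w * m * adeleIdem hn = adeleIdem hn := by
  refine ⟨adeleAt hn (fun v => algebraMap ℚ _ (m : ℚ)⁻¹) 0, fun v => ?_, ?_⟩
  · rw [adeleAt_apply]
    split_ifs with h
    · rw [algebraMap_mem_adicCompletionIntegers, map_inv₀,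
        valuation_intCast_eq_one (notMem_asIdeal_of_isCoprime hm h), inv_one]
    · exact zero_mem _
  · rw [← map_intCast (algebraMap ℚ Af)]
    refine DFunLike.ext _ _ fun v => ?_
    change adeleAt hn _ 0 v * algebraMap ℚ (v.adicCompletion ℚ) m * adeleIdem hn v = adeleIdem hn v
    rw [adeleIdem_apply, adeleAt_apply]
    split_ifs with h
    · have hm0 : (m : ℚ) ≠ 0 := by
        have := notMem_asIdeal_of_isCoprime hm h
        intro h0
        rw [Int.cast_eq_zero.1 h0] at this
        exact this (zero_mem _)
      rw [← map_mul, inv_mul_cancel₀ hm0, map_one, mul_one]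
    · simp

/-- The witness `m` is the denominator of `q`: a prime dividing it and `n` would be a place dividing
`n` where `q` is not integral. -/
theorem exists_intCast_of_isIntegral_adeleIdem_mul {n : ℤ} (hn : n ≠ 0) {q : ℚ}
    (h : IsIntegral (adeleIdem hn * algebraMap ℚ Af q)) :
    ∃ m k : ℤ, IsCoprime m n ∧ m * q = k := by
  refine ⟨q.den, q.num, ?_, by exact_mod_cast Rat.den_mul_eq_num q⟩
  rw [Int.isCoprime_iff_gcd_eq_one]
  by_contra hg
  obtain ⟨p, hp, hdvd⟩ := Nat.exists_prime_and_dvd hg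
  have hp' : Prime (p : ℤ) := Nat.prime_iff_prime_int.1 hp
  let v : HeightOneSpectrum ℤ := ⟨Ideal.span {(p : ℤ)},
    (Ideal.span_singleton_prime hp'.ne_zero).2 hp', by simpa using hp'.ne_zero⟩
  have h1 : n ∈ v.asIdeal := Ideal.mem_span_singleton.2
    ((Int.natCast_dvd_natCast.2 hdvd).trans (Int.gcd_dvd_right ..))
  have h2 : ((q.den : ℕ) : ℤ) ∈ v.asIdeal := Ideal.mem_span_singleton.2
    ((Int.natCast_dvd_natCast.2 hdvd).trans (Int.gcd_dvd_left ..))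
  have h3 := h v
  change adeleIdem hn v * algebraMap ℚ (v.adicCompletion ℚ) q ∈ _ at h3
  rw [adeleIdem_apply, if_pos h1, one_mul, algebraMap_mem_adicCompletionIntegers,
    Rat.valuation_le_one_iff_den] at h3
  exact h3 h2

/-! ### The adelic quadratic algebra -/

section

variable {a b : ℤ}

variable (a b) in
/-- The finite adeles of `ℚ(ω)`, `ω² = a + b ω`. -/
abbrev QAf : Type := QuadraticAlgebra Af (a : Af) (b : Af)

/-- Integral elements of the adelic quadratic algebra. -/
def QInt (z : QAf a b) : Prop := IsIntegral z.re ∧ IsIntegral z.im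

theorem QInt.add {x y : QAf a b} (hx : QInt x) (hy : QInt y) : QInt (x + y) :=
  ⟨hx.1.add hy.1, hx.2.add hy.2⟩

theorem QInt.sub {x y : QAf a b} (hx : QInt x) (hy : QInt y) : QInt (x - y) :=
  ⟨hx.1.sub hy.1, hx.2.sub hy.2⟩

theorem QInt.mul {x y : QAf a b} (hx : QInt x) (hy : QInt y) : QInt (x * y) :=
  ⟨(hx.1.mul hy.1).add (((isIntegral_intCast a).mul hx.2).mul hy.2),
    ((hx.1.mul hy.2).add (hx.2.mul hy.1)).add (((isIntegral_intCast b).mul hx.2).mul hy.2)⟩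

theorem qInt_one : QInt (1 : QAf a b) := ⟨isIntegral_one, isIntegral_zero⟩

theorem qInt_zero : QInt (0 : QAf a b) := ⟨isIntegral_zero, isIntegral_zero⟩

theorem qInt_algebraMap {x : Af} : QInt (algebraMap Af (QAf a b) x) ↔ IsIntegral x :=
  ⟨fun h => h.1, fun h => ⟨h, isIntegral_zero⟩⟩

theorem qInt_intQuad (z : QuadraticAlgebra ℤ a b) : QInt (intQuad a b Af z) :=
  ⟨isIntegral_intCast _, isIntegral_intCast _⟩

variable (a b) in
/-- The base change `ℚ[ω] → 𝔸_f[ω]`. -/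
def ratQuad : QuadraticAlgebra ℚ (a : ℚ) (b : ℚ) →+* QAf a b where
  toFun z := ⟨algebraMap ℚ Af z.re, algebraMap ℚ Af z.im⟩
  map_one' := by ext1 <;> simp [QuadraticAlgebra.re_one, QuadraticAlgebra.im_one]
  map_mul' z w := by ext1 <;> simp
  map_zero' := by ext1 <;> simp
  map_add' z w := by ext1 <;> simp

theorem ratQuad_intQuad (z : QuadraticAlgebra ℤ a b) :
    ratQuad a b (intQuad a b ℚ z) = intQuad a b Af z := by
  ext1 <;> simp [ratQuad]

theorem qInt_ratQuad {z : QuadraticAlgebra ℚ (a : ℚ) (b : ℚ)} :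
    QInt (ratQuad a b z) ↔ ∃ w, intQuad a b ℚ w = z := by
  constructor
  · rintro ⟨h1, h2⟩
    obtain ⟨k, hk⟩ := isIntegral_algebraMap_iff_exists.1 h1
    obtain ⟨l, hl⟩ := isIntegral_algebraMap_iff_exists.1 h2
    exact ⟨⟨k, l⟩, QuadraticAlgebra.ext hk.symm hl.symm⟩
  · rintro ⟨w, rfl⟩
    rw [ratQuad_intQuad]
    exact qInt_intQuad w

theorem exists_ratQuad_add_mul (t : QAf a b) {m : ℕ} (hm : m ≠ 0) :
    ∃ z, ∃ y : QAf a b, QInt y ∧ t = ratQuad a b z + (m : QAf a b) * y := by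
  obtain ⟨q, x, hx, h1⟩ := exists_rat_add_mul t.re hm
  obtain ⟨q', x', hx', h2⟩ := exists_rat_add_mul t.im hm
  refine ⟨⟨q, q'⟩, ⟨x, x'⟩, ⟨hx, hx'⟩, ?_⟩
  ext1
  · simpa [ratQuad] using h1
  · simpa [ratQuad] using h2

theorem exists_nat_mul_qInt (t : QAf a b) : ∃ n : ℕ, n ≠ 0 ∧ QInt ((n : QAf a b) * t) := by
  obtain ⟨n, hn, h⟩ := exists_nat_mul_isIntegral t.re
  obtain ⟨m, hm, h'⟩ := exists_nat_mul_isIntegral t.im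
  refine ⟨m * n, mul_ne_zero hm hn, ?_, ?_⟩
  · have := (isIntegral_intCast m).mul h
    simpa [mul_assoc] using this
  · have := (isIntegral_intCast n).mul h'
    simpa [mul_assoc, mul_left_comm] using this

end

end

section

open QuadraticAlgebra

/-! ### Ideals and ideles of an imaginary quadratic order -/

variable {a b : ℤ}

local notation "ℤω" => QuadraticAlgebra ℤ a b
local notation "ℚω" => QuadraticAlgebra ℚ (a : ℚ) (b : ℚ)

/-- The ideal of the `z ∈ ℤ[ω]` with `t⁻¹ z` integral. -/
def ideleIdeal (t : (QAf a b)ˣ) : Ideal (QuadraticAlgebra ℤ a b) where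
  carrier := {z | QInt (((t⁻¹ : (QAf a b)ˣ) : QAf a b) * intQuad a b Af z)}
  zero_mem' := by simpa using qInt_zero
  add_mem' {x y} hx hy := by
    simp only [Set.mem_ofPred_eq, map_add, mul_add] at hx hy ⊢
    exact hx.add hy
  smul_mem' c x hx := by
    simp only [Set.mem_ofPred_eq, smul_eq_mul, map_mul] at hx ⊢
    rw [mul_left_comm]
    exact (qInt_intQuad c).mul hx

theorem mem_ideleIdeal {t : (QAf a b)ˣ} {z : ℤω} :
    z ∈ ideleIdeal t ↔ QInt (((t⁻¹ : (QAf a b)ˣ) : QAf a b) * intQuad a b Af z) := Iff.rfl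

variable (a b) in
/-- The group `\hat ℤ[ω]^×`. -/
def quadZhatUnits : Subgroup (QAf a b)ˣ where
  carrier := {u | QInt (u : QAf a b) ∧ QInt ((u⁻¹ : (QAf a b)ˣ) : QAf a b)}
  one_mem' := by simpa using qInt_one
  mul_mem' {x y} hx hy := by
    refine ⟨hx.1.mul hy.1, ?_⟩
    rw [mul_inv]
    exact hx.2.mul hy.2
  inv_mem' {x} hx := ⟨hx.2, by rw [inv_inv]; exact hx.1⟩

theorem mem_quadZhatUnits {u : (QAf a b)ˣ} :
    u ∈ quadZhatUnits a b ↔ QInt (u : QAf a b) ∧ QInt ((u⁻¹ : (QAf a b)ˣ) : QAf a b) := Iff.rfl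

theorem ideleIdeal_mul_of_mem (t : (QAf a b)ˣ) {u : (QAf a b)ˣ} (hu : u ∈ quadZhatUnits a b) :
    ideleIdeal (t * u) = ideleIdeal t := by
  ext z
  rw [mem_ideleIdeal, mem_ideleIdeal]
  constructor
  · intro h
    have := hu.1.mul h
    rw [mul_inv_rev, Units.val_mul, mul_assoc, Units.mul_inv_cancel_left] at this
    exact this
  · intro h
    have := hu.2.mul h
    rwa [mul_inv_rev, Units.val_mul, mul_assoc]

theorem ideleIdeal_ne_bot (t : (QAf a b)ˣ) : ideleIdeal t ≠ ⊥ := by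
  obtain ⟨n, hn, h⟩ := exists_nat_mul_qInt ((t⁻¹ : (QAf a b)ˣ) : QAf a b)
  intro h0
  have : (n : ℤω) ∈ ideleIdeal t := by
    rw [mem_ideleIdeal, map_natCast, mul_comm]
    exact h
  rw [h0, Ideal.mem_bot] at this
  have h1 := congrArg QuadraticAlgebra.re this
  simp at h1
  exact hn h1

/-- Approximate `t'` by a global `z` so closely that `z` lies in the ideal of `t'`, hence in that of
`t`, and that `t⁻¹(t' - z)` is integral. Then `t⁻¹t' = t⁻¹z + t⁻¹(t' - z)` is integral. -/
theorem mem_quadZhatUnits_of_ideleIdeal_le {t t' : (QAf a b)ˣ} (ht' : QInt (t' : QAf a b))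
    (h : ideleIdeal t' ≤ ideleIdeal t) : QInt ((t⁻¹ * t' : (QAf a b)ˣ) : QAf a b) := by
  obtain ⟨m, hm, h1⟩ := exists_nat_mul_qInt ((t⁻¹ : (QAf a b)ˣ) : QAf a b)
  obtain ⟨m', hm', h2⟩ := exists_nat_mul_qInt ((t'⁻¹ : (QAf a b)ˣ) : QAf a b)
  obtain ⟨q, y, hy, hq⟩ := exists_ratQuad_add_mul (t' : QAf a b) (mul_ne_zero hm hm')
  have hint (k : ℕ) : QInt (k : QAf a b) := by
    simpa using qInt_intQuad (a := a) (b := b) (k : ℤω)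
  have hz : ratQuad a b q = t' - ((m * m' : ℕ) : QAf a b) * y := by rw [hq]; ring
  obtain ⟨z, rfl⟩ := qInt_ratQuad.1 (hz ▸ ht'.sub ((hint _).mul hy))
  rw [ratQuad_intQuad] at hz hq
  have h3 : z ∈ ideleIdeal t' := by
    rw [mem_ideleIdeal, hz, mul_sub, Units.inv_mul]
    refine qInt_one.sub ?_
    have := ((hint m).mul h2).mul hy
    convert this using 1
    push_cast
    ring
  have h4 := mem_ideleIdeal.1 (h h3)
  have h5 : ((t⁻¹ * t' : (QAf a b)ˣ) : QAf a b) =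
      ((t⁻¹ : (QAf a b)ˣ) : QAf a b) * intQuad a b Af z + ((m' : QAf a b) *
        ((m : QAf a b) * ((t⁻¹ : (QAf a b)ˣ) : QAf a b))) * y := by
    rw [Units.val_mul, hq]
    push_cast
    ring
  rw [h5]
  exact h4.add (((hint m').mul h1).mul hy)

theorem inv_mul_mem_quadZhatUnits {t t' : (QAf a b)ˣ} (ht : QInt (t : QAf a b))
    (ht' : QInt (t' : QAf a b)) (h : ideleIdeal t = ideleIdeal t') :
    t⁻¹ * t' ∈ quadZhatUnits a b := by
  refine ⟨mem_quadZhatUnits_of_ideleIdeal_le ht' h.ge, ?_⟩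
  rw [mul_inv_rev, inv_inv]
  exact mem_quadZhatUnits_of_ideleIdeal_le ht h.le

theorem exists_coprime_mul_of_qInt {n : ℤ} (hn : n ≠ 0) {q : ℚω}
    (h : QInt (algebraMap Af (QAf a b) (adeleIdem hn) * ratQuad a b q)) :
    ∃ m : ℤ, IsCoprime m n ∧ ∃ z : ℤω, intQuad a b ℚ z = m * q := by
  obtain ⟨h1, h2⟩ := h
  rw [← Algebra.smul_def] at h1 h2
  obtain ⟨m, k, hm, hk⟩ := exists_intCast_of_isIntegral_adeleIdem_mul hn (q := q.re) h1
  obtain ⟨m', k', hm', hk'⟩ := exists_intCast_of_isIntegral_adeleIdem_mul hn (q := q.im) h2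
  refine ⟨m * m', hm.mul_left hm', ⟨m' * k, m * k'⟩, ?_⟩
  ext1
  · simp [← hk]; ring
  · simp [← hk']; ring

variable (a b) in
/-- Principal ideles. -/
def principalIdele : (QuadraticAlgebra ℚ (a : ℚ) (b : ℚ))ˣ →* (QAf a b)ˣ :=
  Units.map (ratQuad a b).toMonoidHom

theorem coe_principalIdele (k : (ℚω)ˣ) :
    ((principalIdele a b k : (QAf a b)ˣ) : QAf a b) = ratQuad a b k := rfl

section

variable [Fact (∀ r : ℚ, r ^ 2 ≠ (a : ℚ) + (b : ℚ) * r)]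

/-- Nonzero elements of `ℤ[ω]` as units of `ℚ[ω]`. -/
def fracUnit {x : QuadraticAlgebra ℤ a b} (hx : x ≠ 0) : (QuadraticAlgebra ℚ (a : ℚ) (b : ℚ))ˣ :=
  Units.mk0 (intQuad a b ℚ x) ((map_ne_zero_iff _ (intQuad_injective a b)).2 hx)

theorem coe_principalIdele_fracUnit {x : ℤω} (hx : x ≠ 0) :
    ((principalIdele a b (fracUnit hx) : (QAf a b)ˣ) : QAf a b) = intQuad a b Af x :=
  ratQuad_intQuad x

theorem ideleIdeal_fracUnit_mul {t : (QAf a b)ˣ} (ht : QInt (t : QAf a b)) {x : ℤω} (hx : x ≠ 0) :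
    ideleIdeal (principalIdele a b (fracUnit hx) * t) = Ideal.span {x} * ideleIdeal t := by
  ext z
  rw [Ideal.mem_span_singleton_mul, mem_ideleIdeal, mul_inv_rev, Units.val_mul]
  constructor
  · intro h
    have h1 := ht.mul h
    rw [← mul_assoc, Units.mul_inv_cancel_left, ← map_inv, coe_principalIdele, ← ratQuad_intQuad,
      ← map_mul] at h1
    obtain ⟨w, hw⟩ := qInt_ratQuad.1 h1
    have h2 : x * w = z := by
      apply intQuad_injective a b
      rw [map_mul, hw]
      exact (fracUnit hx).mul_inv_cancel_left _
    refine ⟨w, ?_, h2⟩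
    rw [mem_ideleIdeal]
    rw [← h2, map_mul, ← coe_principalIdele_fracUnit hx, mul_assoc, Units.inv_mul_cancel_left] at h
    exact h
  · rintro ⟨w, hw, rfl⟩
    rw [map_mul, ← coe_principalIdele_fracUnit hx, mul_assoc, Units.inv_mul_cancel_left]
    exact hw

theorem exists_fracUnit (k : (ℚω)ˣ) :
    ∃ (x y : ℤω) (hx : x ≠ 0) (hy : y ≠ 0), k * fracUnit hy = fracUnit hx := by
  obtain ⟨q, hq⟩ : ∃ q : ℚω, q = k := ⟨_, rfl⟩
  have hq0 : q ≠ 0 := hq ▸ k.ne_zero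
  have hd : (q.re.den : ℤ) * q.im.den ≠ 0 := by
    have := q.re.den_nz
    have := q.im.den_nz
    positivity
  have hy : ((q.re.den * q.im.den : ℤ) : ℤω) ≠ 0 := by
    intro h
    have := congrArg QuadraticAlgebra.re h
    rw [QuadraticAlgebra.re_intCast] at this
    exact hd this
  have h1 := Rat.den_mul_eq_num q.re
  have h2 := Rat.den_mul_eq_num q.im
  have key : intQuad a b ℚ ⟨q.im.den * q.re.num, q.re.den * q.im.num⟩ =
      q * intQuad a b ℚ ((q.re.den * q.im.den : ℤ) : ℤω) := by
    rw [map_intCast]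
    ext1
    · rw [intQuad_re, re_mul, re_intCast, im_intCast]
      push_cast
      linear_combination (-q.im.den : ℚ) * h1
    · rw [intQuad_im, im_mul, re_intCast, im_intCast]
      push_cast
      linear_combination (-q.re.den : ℚ) * h2
  have hx : (⟨q.im.den * q.re.num, q.re.den * q.im.num⟩ : ℤω) ≠ 0 := by
    intro h
    rw [h, map_zero] at key
    exact mul_ne_zero hq0 ((map_ne_zero_iff _ (intQuad_injective a b)).2 hy) key.symm
  refine ⟨_, _, hx, hy, Units.ext ?_⟩
  rw [Units.val_mul, ← hq]
  exact key.symm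

end

end

section

open QuadraticAlgebra

/-! ### The class of an idele -/

variable {a b : ℤ}

local notation "ℤω" => QuadraticAlgebra ℤ a b
local notation "ℚω" => QuadraticAlgebra ℚ (a : ℚ) (b : ℚ)

theorem exists_int_mem_ideal [IsDomain ℤω] {I : Ideal ℤω} (hI : I ≠ ⊥) :
    ∃ n : ℤ, n ≠ 0 ∧ (n : ℤω) ∈ I := by
  obtain ⟨x, hx, hx0⟩ := Submodule.exists_mem_ne_zero_of_ne_bot hI
  have h := algebraMap_norm_eq_mul_star x
  refine ⟨x.norm, fun h0 => ?_, ?_⟩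
  · rw [h0, map_zero, eq_comm, mul_eq_zero] at h
    exact hx0 (h.elim id fun h => star_eq_zero.1 h)
  · rw [← eq_intCast (algebraMap ℤ ℤω), h]
    exact I.mul_mem_right _ hx

/-- Write `1 = cn + j` with `j ∈ J`; the norm of `j` lies in `J` and is congruent to one modulo `n`.
-/
theorem exists_coprime_mem_ideal {J : Ideal ℤω} {n : ℤ} (h : Ideal.span {(n : ℤω)} ⊔ J = ⊤) :
    ∃ m : ℤ, IsCoprime m n ∧ (m : ℤω) ∈ J := by
  obtain ⟨c, j, hj, hcj⟩ := Ideal.mem_span_singleton_sup.1 ((Ideal.eq_top_iff_one _).1 h)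
  have hj' : j = 1 - c * n := by rw [← hcj]; ring
  refine ⟨j.norm, ⟨1, 2 * c.re + b * c.im - n * c.norm, ?_⟩, ?_⟩
  · rw [hj', norm_def, norm_def]
    simp only [re_sub, im_sub, re_mul, im_mul, re_intCast, im_intCast, re_one, im_one,
      Int.cast_id]
    ring
  · rw [← eq_intCast (algebraMap ℤ ℤω), algebraMap_norm_eq_mul_star]
    exact J.mul_mem_right _ hj

/-- Choose an integer `n ≠ 0` in `I` and `α` with `I = nI + (α)`. At places dividing `n` the ideal
is generated by `α`, elsewhere it is trivial; the idele is accordingly `α` at the former places and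
`1` at the others. -/
theorem exists_ideleIdeal_eq [IsDedekindDomain ℤω]
    [Fact (∀ r : ℚ, r ^ 2 ≠ (a : ℚ) + (b : ℚ) * r)] {I : Ideal ℤω}
    (hI : I ≠ ⊥) : ∃ t : (QAf a b)ˣ, QInt (t : QAf a b) ∧ ideleIdeal t = I := by
  obtain ⟨n, hn, hnI⟩ := exists_int_mem_ideal hI
  have hn0 : (n : ℤω) ≠ 0 := by
    intro h
    exact hn (by simpa using congrArg QuadraticAlgebra.re h)
  obtain ⟨α, hα⟩ := IsDedekindDomain.exists_sup_span_eq (I := I * Ideal.span {(n : ℤω)}) (J := I)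
    Ideal.mul_le_left (mul_ne_zero hI (by simpa using hn0))
  have hαI : α ∈ I := by
    rw [← hα]
    exact Ideal.mem_sup_right (Ideal.mem_span_singleton_self α)
  obtain ⟨J, hJ⟩ := Ideal.dvd_iff_le.2 ((Ideal.span_singleton_le_iff_mem I).2 hαI)
  rw [hJ, ← Ideal.mul_sup] at hα
  have htop : Ideal.span {(n : ℤω)} ⊔ J = ⊤ :=
    mul_left_cancel₀ (a := I) hI (by rw [hα, Ideal.mul_top])
  obtain ⟨m, hmn, hmJ⟩ := exists_coprime_mem_ideal htop
  have hdiv {z : ℤω} (hz : z ∈ I) : ∃ y, α * y = m * z := by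
    have : (m : ℤω) * z ∈ Ideal.span {α} := by
      rw [hJ, mul_comm]
      exact Ideal.mul_mem_mul hmJ hz
    obtain ⟨y, hy⟩ := Ideal.mem_span_singleton.1 this
    exact ⟨y, hy.symm⟩
  obtain ⟨β, hβ⟩ := hdiv hnI
  obtain ⟨w, hwi, hw⟩ := exists_isIntegral_mul_adeleIdem hn hmn
  obtain ⟨e, he⟩ : ∃ e, e = algebraMap Af (QAf a b) (adeleIdem hn) := ⟨_, rfl⟩
  obtain ⟨W, hW⟩ : ∃ W, W = algebraMap Af (QAf a b) w := ⟨_, rfl⟩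
  obtain ⟨c, hc⟩ : ∃ c, c = ratQuad a b ((n : ℚω)⁻¹) := ⟨_, rfl⟩
  have hnQ : (n : ℚω) ≠ 0 := by exact_mod_cast hn
  have hcn : c * n = 1 := by
    rw [hc, ← map_intCast (ratQuad a b), ← map_mul, inv_mul_cancel₀ hnQ, map_one]
  have hee : e * e = e := by rw [he, ← map_mul, adeleIdem_mul_self]
  have hWe : W * m * e = e := by
    rw [he, hW, ← map_intCast (algebraMap Af (QAf a b)), ← map_mul, ← map_mul, hw]
  have hei : QInt e := he ▸ qInt_algebraMap.2 (isIntegral_adeleIdem hn)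
  have hWi : QInt W := hW ▸ qInt_algebraMap.2 hwi
  have hβ' : intQuad a b Af α * intQuad a b Af β = m * n := by
    rw [← map_mul, hβ, map_mul, map_intCast, map_intCast]
  obtain ⟨A, hA⟩ : ∃ A, A = intQuad a b Af α := ⟨_, rfl⟩
  obtain ⟨B, hB⟩ : ∃ B, B = intQuad a b Af β := ⟨_, rfl⟩
  rw [← hA, ← hB] at hβ'
  have hAi : QInt A := hA ▸ qInt_intQuad α
  -- At places dividing `n`, `βW/n` is the inverse of `α`, since `αβ = mn` and `W` inverts `m`
  -- there.
  have hmul : (e * A + (1 - e)) * (e * (B * W * c) + (1 - e)) = 1 := by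
    linear_combination (A * (B * W * c) - A - B * W * c + 1) * hee + (e * W * c) * hβ' +
      (W * m * e) * hcn + hWe
  refine ⟨⟨_, _, hmul, by rw [mul_comm]; exact hmul⟩,
    (hei.mul hAi).add (qInt_one.sub hei), ?_⟩
  ext z
  rw [mem_ideleIdeal]
  change QInt ((e * (B * W * c) + (1 - e)) * intQuad a b Af z) ↔ z ∈ I
  have hnm (z : ℤω) (y : ℤω) (m : ℤ) (h : α * y = m * z) :
      A * intQuad a b Af y = m * intQuad a b Af z := by
    rw [hA, ← map_mul, h, map_mul, map_intCast]
  constructor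
  -- Integrality at the places dividing `n` gives `kmz ∈ I` with `k` prime to `n`; as also `nz ∈ I`
  -- and `km` is prime to `n`, it follows that `z ∈ I`.
  · intro h
    have h1 : QInt (e * ratQuad a b (intQuad a b ℚ (β * z) * (n : ℚω)⁻¹)) := by
      have := (hei.mul h).mul (qInt_intQuad (m : ℤω))
      convert this using 1
      rw [map_mul, ratQuad_intQuad, ← hc, map_mul, map_intCast, ← hB]
      linear_combination (-(B * W * c * m * intQuad a b Af z) + m * intQuad a b Af z) * hee
        - (B * c * intQuad a b Af z) * hWe
    rw [he] at h1
    obtain ⟨k, hk, y, hy⟩ := exists_coprime_mul_of_qInt hn h1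
    have h2 : (n : ℤω) * y = k * (β * z) := by
      apply intQuad_injective a b
      rw [map_mul, hy]
      simp only [map_mul, map_intCast]
      field_simp
    have h3 : α * y = (k * m) * z := by
      apply mul_left_cancel₀ hn0
      linear_combination α * h2 + k * z * hβ
    have h4 : ((k * m : ℤ) : ℤω) * z ∈ I := by
      push_cast
      rw [← h3]
      exact I.mul_mem_right _ hαI
    obtain ⟨x, y, hxy⟩ := hk.mul_left hmn
    have h5 : z = x * (((k * m : ℤ) : ℤω) * z) + y * z * n := by
      have : ((x * (k * m) + y * n : ℤ) : ℤω) = 1 := by rw [hxy]; simp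
      push_cast at this ⊢
      linear_combination -z * this
    rw [h5]
    exact I.add_mem (I.mul_mem_left _ h4) (I.mul_mem_left _ hnI)
  · intro hz
    obtain ⟨y, hy⟩ := hdiv hz
    have h1 := hnm z y m hy
    have h2 : (e * (B * W * c) + (1 - e)) * intQuad a b Af z =
        e * (W * intQuad a b Af y) + (1 - e) * intQuad a b Af z := by
      linear_combination (-(B * W * c * intQuad a b Af z)) * hWe +
        (e * W * W * B * c) * (-h1) + (e * W * W * c * intQuad a b Af y) * hβ' +
        (e * W * W * m * intQuad a b Af y) * hcn + (W * intQuad a b Af y) * hWe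
    rw [h2]
    exact (hei.mul (hWi.mul (qInt_intQuad y))).add ((qInt_one.sub hei).mul (qInt_intQuad z))

end

section

open QuadraticAlgebra
open scoped nonZeroDivisors

/-! ### Idele classes and the class group -/

variable {a b : ℤ}

local notation "ℤω" => QuadraticAlgebra ℤ a b
local notation "ℚω" => QuadraticAlgebra ℚ (a : ℚ) (b : ℚ)

section

variable [Fact (∀ r : ℚ, r ^ 2 ≠ (a : ℚ) + (b : ℚ) * r)]

theorem fracUnit_mul [IsDomain ℤω] {x y : ℤω} (hx : x ≠ 0) (hy : y ≠ 0) :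
    fracUnit (mul_ne_zero hx hy) = fracUnit hx * fracUnit hy :=
  Units.ext (map_mul (intQuad a b ℚ) x y)

theorem qInt_fracUnit_mul {x : ℤω} (hx : x ≠ 0) {t : (QAf a b)ˣ} (ht : QInt (t : QAf a b)) :
    QInt ((principalIdele a b (fracUnit hx) * t : (QAf a b)ˣ) : QAf a b) := by
  rw [Units.val_mul, coe_principalIdele_fracUnit]
  exact (qInt_intQuad x).mul ht

theorem exists_fracUnit_qInt (t : (QAf a b)ˣ) : ∃ (x : ℤω) (hx : x ≠ 0),
    QInt ((principalIdele a b (fracUnit hx) * t : (QAf a b)ˣ) : QAf a b) := by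
  obtain ⟨n, hn, h⟩ := exists_nat_mul_qInt (t : QAf a b)
  refine ⟨n, fun h0 => hn (by simpa using congrArg QuadraticAlgebra.re h0), ?_⟩
  rw [Units.val_mul, coe_principalIdele_fracUnit, map_natCast]
  exact h

variable [IsDedekindDomain (QuadraticAlgebra ℤ a b)]

/-- The class of an ideal belonging to an integral idele. -/
def ideleMk (t : (QAf a b)ˣ) : ClassGroup (QuadraticAlgebra ℤ a b) :=
  ClassGroup.mk0 ⟨ideleIdeal t, mem_nonZeroDivisors_of_ne_zero (ideleIdeal_ne_bot t)⟩

/-- Two ideals are in one class when they agree after multiplication by principal ideals, and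
integral ideles with equal ideals differ by `\hat ℤ[ω]^×`. The factors `x`, `y` only make the ideles
integral and are absorbed into `k`. -/
theorem ideleMk_eq_iff {t t' : (QAf a b)ˣ} {x y : ℤω} (hx : x ≠ 0) (hy : y ≠ 0)
    (h : QInt ((principalIdele a b (fracUnit hx) * t : (QAf a b)ˣ) : QAf a b))
    (h' : QInt ((principalIdele a b (fracUnit hy) * t' : (QAf a b)ˣ) : QAf a b)) :
    ideleMk (principalIdele a b (fracUnit hx) * t) = ideleMk (principalIdele a b (fracUnit hy) * t')
      ↔ ∃ k : (ℚω)ˣ, ∃ u ∈ quadZhatUnits a b, t' = principalIdele a b k * t * u := by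
  rw [ideleMk, ideleMk, ClassGroup.mk0_eq_mk0_iff]
  constructor
  · rintro ⟨p, q, hp, hq, hpq⟩
    simp only at hpq
    rw [← ideleIdeal_fracUnit_mul h hp, ← ideleIdeal_fracUnit_mul h' hq] at hpq
    refine ⟨(fracUnit hq * fracUnit hy)⁻¹ * (fracUnit hp * fracUnit hx), _,
      inv_mul_mem_quadZhatUnits (qInt_fracUnit_mul hp h) (qInt_fracUnit_mul hq h') hpq, ?_⟩
    simp only [map_mul, map_inv, ← mul_assoc]
    rw [mul_assoc _ _ t, mul_assoc _ _ (_ * t), ← mul_assoc _ _ t, mul_inv_cancel_right]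
    simp [mul_assoc]
  · rintro ⟨k, u, hu, rfl⟩
    obtain ⟨X, Y, hX, hY, hk⟩ := exists_fracUnit k
    refine ⟨X * y, Y * x, mul_ne_zero hX hy, mul_ne_zero hY hx, ?_⟩
    simp only
    rw [← ideleIdeal_fracUnit_mul h (mul_ne_zero hX hy),
      ← ideleIdeal_fracUnit_mul h' (mul_ne_zero hY hx), fracUnit_mul hX hy,
      fracUnit_mul hY hx, ← hk, ← ideleIdeal_mul_of_mem _ hu]
    congr 1
    simp only [map_mul]
    ac_rfl

theorem exists_ideleClass : ∃ cls : (QAf a b)ˣ → ClassGroup (QuadraticAlgebra ℤ a b),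
    Function.Surjective cls ∧ ∀ t t', cls t = cls t' ↔
      ∃ k : (ℚω)ˣ, ∃ u ∈ quadZhatUnits a b, t' = principalIdele a b k * t * u := by
  choose x hx h using exists_fracUnit_qInt (a := a) (b := b)
  refine ⟨fun t => ideleMk (principalIdele a b (fracUnit (hx t)) * t), fun c => ?_,
    fun t t' => ideleMk_eq_iff (hx t) (hx t') (h t) (h t')⟩
  obtain ⟨⟨I, hI⟩, rfl⟩ := ClassGroup.mk0_surjective c
  obtain ⟨t, ht, rfl⟩ := exists_ideleIdeal_eq (nonZeroDivisors.ne_zero hI)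
  refine ⟨t, ?_⟩
  have := (ideleMk_eq_iff (hx t) one_ne_zero (h t) (qInt_fracUnit_mul one_ne_zero ht)).2
    ⟨1, 1, one_mem _, by simp⟩
  dsimp only
  rw [this]
  have h1 : fracUnit (one_ne_zero : (1 : ℤω) ≠ 0) = 1 := Units.ext (map_one _)
  rw [h1, map_one, one_mul]
  rfl

end

/-! ### Units -/

variable (a b) in
/-- The scalars in the adelic quadratic algebra. -/
def scalarIdele : Afˣ →* (QAf a b)ˣ := Units.map (algebraMap Af (QAf a b)).toMonoidHom

variable (a b) in
/-- The principal ideles given by units of `ℤ[ω]`. -/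
def unitIdele : (QuadraticAlgebra ℤ a b)ˣ →* (QAf a b)ˣ := Units.map (intQuad a b Af).toMonoidHom

theorem unitIdele_mem (ε : (ℤω)ˣ) : unitIdele a b ε ∈ quadZhatUnits a b :=
  ⟨qInt_intQuad _, by rw [← map_inv]; exact qInt_intQuad _⟩

theorem scalarIdele_mem_iff {x : Afˣ} :
    scalarIdele a b x ∈ quadZhatUnits a b ↔ x ∈ ZhatUnits := by
  rw [mem_quadZhatUnits, ← map_inv]
  exact and_congr qInt_algebraMap qInt_algebraMap

theorem unitIdele_eq_principalIdele (ε : (ℤω)ˣ) :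
    unitIdele a b ε = principalIdele a b (Units.map (intQuad a b ℚ).toMonoidHom ε) :=
  Units.ext (ratQuad_intQuad _).symm

instance : Nontrivial Af := by
  obtain ⟨v⟩ : Nonempty (IsDedekindDomain.HeightOneSpectrum ℤ) :=
    ⟨⟨Ideal.span {2}, (Ideal.span_singleton_prime two_ne_zero).2 Int.prime_two, by simp⟩⟩
  exact ⟨0, 1, fun h => zero_ne_one (congrArg (fun x : Af => x v) h)⟩

theorem exists_unit_of_principalIdele_mem {k : (ℚω)ˣ} (h : principalIdele a b k ∈ quadZhatUnits a b) :
    ∃ ε : (ℤω)ˣ, principalIdele a b k = unitIdele a b ε := by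
  rw [mem_quadZhatUnits, ← map_inv] at h
  obtain ⟨z, hz⟩ := qInt_ratQuad.1 h.1
  obtain ⟨w, hw⟩ := qInt_ratQuad.1 h.2
  have h1 : z * w = 1 := by
    apply intQuad_injective a b
    rw [map_mul, hz, hw, map_one]
    exact k.mul_inv
  refine ⟨⟨z, w, h1, by rw [mul_comm]; exact h1⟩, Units.ext ?_⟩
  change ratQuad a b k = intQuad a b Af z
  rw [← ratQuad_intQuad, hz]

theorem scalarIdele_map (q : ℚˣ) :
    scalarIdele a b (Units.map (algebraMap ℚ Af : ℚ →* Af) q) = principalIdele a b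
      (Units.map (algebraMap ℚ (QuadraticAlgebra ℚ (a : ℚ) (b : ℚ)) : ℚ →* ℚω) q) := by
  refine Units.ext ?_
  ext1
  · rfl
  · exact (map_zero (algebraMap ℚ Af)).symm

/-- By `𝔸_f^× = ℚ^× \hat ℤ^×` the scalar may be taken rational and absorbed into `k`; what remains
is a principal idele integral together with its inverse. -/
theorem exists_unit_of_principalIdele_mul_mem {k : (ℚω)ˣ} {x : Afˣ}
    (h : principalIdele a b k * scalarIdele a b x ∈ quadZhatUnits a b) :
    ∃ (ε : (ℤω)ˣ) (y : Afˣ), principalIdele a b k = unitIdele a b ε * scalarIdele a b y := by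
  obtain ⟨q, hq⟩ := exists_rat_mul_mem_zhatUnits x
  have h1 := scalarIdele_map (a := a) (b := b) q
  have h2 : principalIdele a b k * scalarIdele a b (Units.map (algebraMap ℚ Af : ℚ →* Af) q) ∈
      quadZhatUnits a b := by
    have := (quadZhatUnits a b).mul_mem h ((quadZhatUnits a b).inv_mem (scalarIdele_mem_iff.2 hq))
    rw [map_mul, map_inv, mul_inv, inv_inv, mul_assoc, mul_inv_cancel_left] at this
    exact this
  rw [h1, ← map_mul] at h2
  obtain ⟨ε, hε⟩ := exists_unit_of_principalIdele_mem h2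
  refine ⟨ε, (Units.map (algebraMap ℚ Af : ℚ →* Af) q)⁻¹, ?_⟩
  rw [← hε, map_inv, h1, map_mul, mul_inv_cancel_right]

theorem unitIdele_mem_range_scalarIdele {ε : (ℤω)ˣ} :
    unitIdele a b ε ∈ (scalarIdele a b).range ↔ ε = 1 ∨ ε = -1 := by
  constructor
  · rintro ⟨x, hx⟩
    have h1 : (ε : ℤω).im = 0 := by
      have := congrArg (fun u : (QAf a b)ˣ => (u : QAf a b).im) hx
      change 0 = (((ε : ℤω).im : ℤ) : Af) at this
      rw [← map_intCast (algebraMap ℚ Af), eq_comm, map_eq_zero] at this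
      exact_mod_cast this
    have h2 := congrArg QuadraticAlgebra.re ε.mul_inv
    rw [re_mul, h1, re_one] at h2
    have h3 : (ε : ℤω).re * (ε⁻¹ : (ℤω)ˣ).val.re = 1 := by simpa using h2
    rcases Int.eq_one_or_neg_one_of_mul_eq_one h3 with h | h
    · exact .inl (Units.ext (QuadraticAlgebra.ext (by simpa using h) (by simpa using h1)))
    · exact .inr (Units.ext (QuadraticAlgebra.ext (by simpa using h) (by simpa using h1)))
  · rintro (rfl | rfl)
    · exact ⟨1, by simp⟩
    · refine ⟨-1, Units.ext ?_⟩
      change algebraMap Af (QAf a b) (-1) = intQuad a b Af (-1)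
      simp

end

section

open MeasureTheory

/-! ### Volumes and double cosets -/

section

open scoped Pointwise ENNReal

variable {G : Type*} [Group G] [MeasurableSpace G] [MeasurableMul G] {C : Type*} [Finite C]

/-- If the double cosets `Γ \ G / W` of a commutative group are parametrised by `C`, then
`|C| vol(W) = |Γ ∩ W| vol(Γ \ G)`. -/
theorem card_mul_measure_eq (hcomm : ∀ x y : G, x * y = y * x) {μ : Measure G}
    [μ.IsMulLeftInvariant] {Γ W : Subgroup G} [Countable Γ] {F : Set G}
    (hF : IsFundamentalDomain Γ F μ) (hW : MeasurableSet (W : Set G)) [Finite (W.subgroupOf Γ)]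
    {cls : G → C} (hsurj : Function.Surjective cls)
    (hcls : ∀ x y, cls x = cls y ↔ ∃ γ ∈ Γ, ∃ u ∈ W, y = γ * x * u) :
    (Nat.card C : ℝ≥0∞) * μ W = Nat.card (W.subgroupOf Γ) * μ F := by
  classical
  have := Fintype.ofFinite C
  have hinv : SMulInvariantMeasure Γ G μ := ⟨fun γ s _ => measure_preimage_mul μ (γ : G) s⟩
  have hmeas : MeasurableConstSMul Γ G := ⟨fun γ => measurable_const_mul (γ : G)⟩
  choose g hg using hsurj
  have hmem (c : C) (γ : Γ) (x : G) : x ∈ γ • (g c • (W : Set G)) ↔ (γ : G)⁻¹ * x * (g c)⁻¹ ∈ W := by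
    rw [Set.mem_smul_set_iff_inv_smul_mem, Set.mem_smul_set_iff_inv_smul_mem, SetLike.mem_coe,
      smul_eq_mul, hcomm (g c)⁻¹]
    rfl
  have hset (c : C) (γ : Γ) : MeasurableSet (γ • (g c • (W : Set G))) :=
    (hW.const_smul (g c)).const_smul γ
  have h1 (c : C) : μ W = ∫⁻ x, ∑' γ : Γ, (γ • (g c • (W : Set G))).indicator 1 x
      ∂(μ.restrict F) := by
    rw [lintegral_tsum fun γ => ((measurable_one.indicator (hset c γ)).aemeasurable)]
    rw [← measure_smul (g c) (W : Set G) (μ := μ), hF.measure_eq_tsum]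
    refine tsum_congr fun γ => ?_
    rw [lintegral_indicator_one (hset c γ), Measure.restrict_apply (hset c γ)]
  -- A point lies in translates of only one `g c • W`, and in `|Γ ∩ W|` of those.
  have h2 (x : G) : ∑ c, ∑' γ : Γ, (γ • (g c • (W : Set G))).indicator (1 : G → ℝ≥0∞) x =
      Nat.card (W.subgroupOf Γ) := by
    rw [Finset.sum_eq_single (cls x)]
    · obtain ⟨γ₀, hγ₀, u, hu, hx⟩ := (hcls (g (cls x)) x).1 (hg _)
      have h3 (γ : Γ) : ((Equiv.divLeft ⟨γ₀, hγ₀⟩ γ : Γ) • (g (cls x) • (W : Set G))).indicator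
          (1 : G → ℝ≥0∞) x = (W.subgroupOf Γ : Set Γ).indicator 1 γ := by
        have : x ∈ (Equiv.divLeft (⟨γ₀, hγ₀⟩ : Γ) γ : Γ) • (g (cls x) • (W : Set G)) ↔
            γ ∈ (W.subgroupOf Γ : Set Γ) := by
          rw [hmem, SetLike.mem_coe, Subgroup.mem_subgroupOf, Equiv.divLeft_apply, Subgroup.coe_div,
            hcomm _ (g (cls x))⁻¹, hcomm _ x]
          have : (g (cls x))⁻¹ * (x * (γ₀ / (γ : G))⁻¹) = γ * u := by
            generalize g (cls x) = y at hx ⊢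
            rw [hx, hcomm γ₀, div_eq_mul_inv, mul_inv_rev, inv_inv, hcomm (_ * u)]
            rw [hcomm y γ₀]
            simp only [mul_assoc, inv_mul_cancel_left]
            rw [hcomm _ (γ * _), ← mul_assoc, hcomm _ u]
            simp [mul_assoc, hcomm u]
          rw [this]
          exact Subgroup.mul_mem_cancel_right W hu
        by_cases h : γ ∈ (W.subgroupOf Γ : Set Γ)
        · rw [Set.indicator_of_mem h, Set.indicator_of_mem (this.2 h), Pi.one_apply, Pi.one_apply]
        · rw [Set.indicator_of_notMem h, Set.indicator_of_notMem (mt this.1 h)]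
      rw [← (Equiv.divLeft (⟨γ₀, hγ₀⟩ : Γ)).tsum_eq, tsum_congr h3, ← tsum_subtype]
      have := Fintype.ofFinite (W.subgroupOf Γ)
      rw [← Nat.card_congr (Equiv.refl (W.subgroupOf Γ)), Nat.card_eq_fintype_card]
      change ∑' _ : W.subgroupOf Γ, (1 : ℝ≥0∞) = _
      rw [tsum_fintype]
      simp
    · intro c _ hc
      refine ENNReal.tsum_eq_zero.2 fun γ => Set.indicator_of_notMem (fun h => hc ?_) _
      rw [hmem] at h
      rw [← hg c, hcls]
      refine ⟨γ, γ.2, _, h, ?_⟩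
      rw [mul_assoc, ← hcomm (_ * _) (g c), inv_mul_cancel_right, mul_inv_cancel_left]
    · exact fun h => absurd (Finset.mem_univ _) h
  calc (Nat.card C : ℝ≥0∞) * μ W = ∑ c : C, μ W := by simp
    _ = ∫⁻ x, ∑ c, ∑' γ : Γ, (γ • (g c • (W : Set G))).indicator 1 x ∂(μ.restrict F) := by
      rw [lintegral_finsetSum _ fun c _ => Measurable.tsum fun γ =>
        measurable_one.indicator (hset c γ)]
      exact Finset.sum_congr rfl fun c _ => h1 c
    _ = Nat.card (W.subgroupOf Γ) * μ F := by
      simp_rw [h2]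
      rw [lintegral_const, Measure.restrict_apply_univ]

end

/-! ### The torus as the group of units of a quadratic algebra -/

section

variable {R : Type} [CommRing R] {a b : R}

variable (a b) in
/-- The regular representation of a quadratic algebra. -/
def quadMatrix : QuadraticAlgebra R a b →+* Matrix (Fin 2) (Fin 2) R where
  toFun z := !![z.re, z.im; a * z.im, z.re + b * z.im]
  map_one' := by
    ext i j; fin_cases i <;> fin_cases j <;>
      simp [QuadraticAlgebra.re_one, QuadraticAlgebra.im_one]
  map_mul' z w := by
    ext i j; fin_cases i <;> fin_cases j <;> simp [Matrix.mul_apply, Fin.sum_univ_two] <;> ring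
  map_zero' := by ext i j; fin_cases i <;> fin_cases j <;> simp
  map_add' z w := by ext i j; fin_cases i <;> fin_cases j <;> simp <;> ring

theorem quadMatrix_apply (z : QuadraticAlgebra R a b) :
    quadMatrix a b z = !![z.re, z.im; a * z.im, z.re + b * z.im] := rfl

theorem quadMatrix_injective : Function.Injective (quadMatrix a b) := by
  intro z w h
  ext1
  · exact congrFun (congrFun h 0) 0
  · exact congrFun (congrFun h 0) 1

/-- As the entry `1/N` of `x` is a unit, the upper row of the commutation relation already implies
the lower one. The two surviving equations describe the regular representation of `R[ω]`, `ω² = NC -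
rω`. -/
theorem mem_torus_iff {N : ℕ} [NeZero N] {D r C : ℤ} (h : IsCMDatum N D r C) [Algebra ℚ R]
    (t : GL (Fin 2) R) :
    t ∈ torus N D r R ↔ t 1 0 = ((N * C : ℤ) : R) * t 0 1 ∧ t 1 1 = t 0 0 + ((-r : ℤ) : R) * t 0 1 := by
  have hN : (N : ℚ) ≠ 0 := NeZero.ne _
  have hC : ((D : ℚ) - r ^ 2) / (4 * N) = C := by
    rw [h.eq]; push_cast; field_simp; ring
  obtain ⟨i, hi⟩ : ∃ i, i = algebraMap ℚ R (1 / N) := ⟨_, rfl⟩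
  obtain ⟨j, hj⟩ : ∃ j, j = algebraMap ℚ R (r / (2 * N)) := ⟨_, rfl⟩
  have hNi : (N : R) * i = 1 := by
    rw [hi, ← map_natCast (algebraMap ℚ R), ← map_mul, mul_one_div_cancel hN, map_one]
  have hNj : 2 * j = r * i := by
    rw [hi, hj, ← map_intCast (algebraMap ℚ R), ← map_mul, ← map_ofNat (algebraMap ℚ R) 2,
      ← map_mul]
    congr 1
    field_simp
  have hx : (xvec N D r : Matrix (Fin 2) (Fin 2) ℚ).map (algebraMap ℚ R) =
      !![j, i; (C : R), -j] := by
    rw [xvec, hC, V.mk]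
    ext k l; fin_cases k <;> fin_cases l <;> simp [hi, hj]
  change (t : Matrix (Fin 2) (Fin 2) R) * _ = _ * (t : Matrix (Fin 2) (Fin 2) R) ↔ _
  rw [hx, ← Matrix.ext_iff]
  simp only [Fin.forall_fin_two, Matrix.mul_apply, Fin.sum_univ_two, Matrix.of_apply,
    Matrix.cons_val', Matrix.cons_val_zero, Matrix.cons_val_one, Matrix.cons_val_fin_one]
  push_cast
  constructor
  · rintro ⟨⟨h00, h01⟩, -, -⟩
    constructor
    · linear_combination (-N : R) * h00 - (t 1 0) * hNi
    · linear_combination (-N : R) * h01 + (t 0 0 - t 1 1) * hNi - N * t 0 1 * hNj - r * t 0 1 * hNi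
  · rintro ⟨h10, h11⟩
    rw [h10, h11]
    refine ⟨⟨?_, ?_⟩, ?_, ?_⟩
    · linear_combination (-(C : R) * t 0 1) * hNi
    · linear_combination (-t 0 1) * hNj
    · linear_combination (N * C * t 0 1 : R) * hNj + (C * t 0 1 * r : R) * hNi
    · linear_combination (C * t 0 1 : R) * hNi

end

end

section

open MeasureTheory

/-! ### The volume of `K_T` -/

section

variable {N : ℕ} [NeZero N] {D r C : ℤ}

local notation "𝔞" => ((N : ℤ) * C)
local notation "𝔟" => (-r)

/-- The torus `T(R)` is the group of units of `R[ω]`, `ω² = N C - r ω`. -/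
def torusHom (h : IsCMDatum N D r C) (R : Type) [CommRing R] [Algebra ℚ R] :
    (QuadraticAlgebra R (((N : ℤ) * C : ℤ) : R) ((-r : ℤ) : R))ˣ →* torus N D r R :=
  (Units.map (quadMatrix (((N : ℤ) * C : ℤ) : R) ((-r : ℤ) : R)).toMonoidHom).codRestrict _
    fun _ => (mem_torus_iff h _).2 ⟨rfl, rfl⟩

theorem coe_torusHom (h : IsCMDatum N D r C) (R : Type) [CommRing R] [Algebra ℚ R]
    (u : (QuadraticAlgebra R ((𝔞 : ℤ) : R) ((𝔟 : ℤ) : R))ˣ) :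
    ((torusHom h R u : GL (Fin 2) R) : Matrix (Fin 2) (Fin 2) R) = quadMatrix ((𝔞 : ℤ) : R)
      ((𝔟 : ℤ) : R) u.val := rfl

theorem torusHom_injective (h : IsCMDatum N D r C) (R : Type) [CommRing R] [Algebra ℚ R] :
    Function.Injective (torusHom h R) := by
  intro u v huv
  apply Units.ext
  apply quadMatrix_injective
  rw [← coe_torusHom h, huv, coe_torusHom]

theorem torusHom_surjective (h : IsCMDatum N D r C) (R : Type) [CommRing R] [Algebra ℚ R] :
    Function.Surjective (torusHom h R) := by
  intro t
  have key (s : torus N D r R) : quadMatrix ((𝔞 : ℤ) : R) ((𝔟 : ℤ) : R)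
      ⟨(s : GL (Fin 2) R) 0 0, (s : GL (Fin 2) R) 0 1⟩ = (s : GL (Fin 2) R) := by
    obtain ⟨h1, h2⟩ := (mem_torus_iff h _).1 s.2
    rw [quadMatrix_apply]
    ext i j; fin_cases i <;> fin_cases j
    · rfl
    · rfl
    · exact h1.symm
    · exact h2.symm
  have hmul (s s' : torus N D r R) (hs : s * s' = 1) :
      (⟨(s : GL (Fin 2) R) 0 0, (s : GL (Fin 2) R) 0 1⟩ :
        QuadraticAlgebra R ((𝔞 : ℤ) : R) ((𝔟 : ℤ) : R)) *
      ⟨(s' : GL (Fin 2) R) 0 0, (s' : GL (Fin 2) R) 0 1⟩ = 1 := by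
    apply quadMatrix_injective
    rw [map_mul, key, key, map_one, ← Units.val_mul, ← Subgroup.coe_mul, hs]
    rfl
  exact ⟨⟨_, _, hmul t t⁻¹ (mul_inv_cancel t), hmul t⁻¹ t (inv_mul_cancel t)⟩,
    Subtype.ext (Units.ext (key t))⟩

theorem torusHom_scalarIdele (h : IsCMDatum N D r C) (x : Afˣ) :
    torusHom h Af (scalarIdele 𝔞 𝔟 x) = scalarHom N D r x := by
  refine Subtype.ext (Units.ext ?_)
  rw [coe_torusHom]
  change quadMatrix _ _ (algebraMap Af (QAf _ _) (x : Af)) = Matrix.scalar (Fin 2) (x : Af)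
  rw [quadMatrix_apply]
  ext i j; fin_cases i <;> fin_cases j <;> simp

/-- On `T` the lower left entry is `NC` times the upper right one, so the level condition is
automatic and only integrality remains. -/
theorem torusHom_mem_KT_iff (h : IsCMDatum N D r C) (u : (QAf 𝔞 𝔟)ˣ) :
    torusHom h Af u ∈ KT N D r ↔ u ∈ quadZhatUnits 𝔞 𝔟 := by
  have hinv : ((torusHom h Af u : GL (Fin 2) Af)⁻¹ : GL (Fin 2) Af) =
      (torusHom h Af u⁻¹ : GL (Fin 2) Af) := by
    rw [map_inv]; rfl
  have hint (u : (QAf 𝔞 𝔟)ˣ) (hu : QInt (u : QAf 𝔞 𝔟)) (i j : Fin 2) :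
      IsIntegral ((torusHom h Af u : GL (Fin 2) Af) i j) := by
    have h10 := (isIntegral_intCast 𝔞).mul hu.2
    have h11 := hu.1.add ((isIntegral_intCast 𝔟).mul hu.2)
    fin_cases i <;> fin_cases j
    exacts [hu.1, hu.2, h10, h11]
  constructor
  · rintro ⟨h1, -⟩
    refine ⟨⟨(h1 0 0).1, (h1 0 1).1⟩, ?_⟩
    rw [hinv] at h1
    exact ⟨(h1 0 0).2, (h1 0 1).2⟩
  · intro hu
    refine ⟨fun i j => ⟨hint u hu.1 i j, ?_⟩, C * (u : QAf 𝔞 𝔟).im,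
      (isIntegral_intCast C).mul hu.1.2, ?_⟩
    · rw [hinv]
      exact hint _ hu.2 i j
    · change ((𝔞 : ℤ) : Af) * (u : QAf 𝔞 𝔟).im = _
      push_cast
      ring

theorem map_torusHom (h : IsCMDatum N D r C) (k : (QuadraticAlgebra ℚ ((𝔞 : ℤ) : ℚ) ((𝔟 : ℤ) : ℚ))ˣ) :
    Matrix.GeneralLinearGroup.map (algebraMap ℚ Af) (torusHom h ℚ k : GL (Fin 2) ℚ) =
      (torusHom h Af (principalIdele 𝔞 𝔟 k) : GL (Fin 2) Af) := by
  refine Units.ext ?_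
  refine Matrix.ext fun i j => ?_
  fin_cases i <;> fin_cases j
  · rfl
  · rfl
  · change algebraMap ℚ Af (((𝔞 : ℤ) : ℚ) * k.val.im) = ((𝔞 : ℤ) : Af) * algebraMap ℚ Af k.val.im
    rw [map_mul, map_intCast]
  · change algebraMap ℚ Af (k.val.re + ((𝔟 : ℤ) : ℚ) * k.val.im) =
      algebraMap ℚ Af k.val.re + ((𝔟 : ℤ) : Af) * algebraMap ℚ Af k.val.im
    rw [map_add, map_mul, map_intCast]

variable (h : IsCMDatum N D r C)
include h

theorem mem_SOUQ_iff (x : SOUAf N D r) : x ∈ SOUQ N D r ↔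
    ∃ k, x = toSOU N D r (torusHom h Af (principalIdele 𝔞 𝔟 k)) := by
  constructor
  · rintro ⟨t, ⟨s, hs, hst⟩, rfl⟩
    obtain ⟨k, hk⟩ := torusHom_surjective h ℚ ⟨s, hs⟩
    refine ⟨k, congrArg _ (Subtype.ext ?_)⟩
    rw [← map_torusHom, hk]
    exact hst.symm
  · rintro ⟨k, rfl⟩
    exact ⟨torusHom h Af (principalIdele 𝔞 𝔟 k), ⟨_, (torusHom h ℚ k).2, map_torusHom h k⟩, rfl⟩

end

section

variable (N : ℕ) (D r : ℤ)

instance : BorelSpace (TAf N D r) := ⟨rfl⟩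
instance : BorelSpace Afˣ := ⟨rfl⟩
instance : BorelSpace (SOUAf N D r) := ⟨rfl⟩

instance : IsTopologicalGroup (SOUAf N D r) :=
  inferInstanceAs (IsTopologicalGroup (TAf N D r ⧸ (scalarHom N D r).range))

theorem isOpenMap_toSOU : IsOpenMap (toSOU N D r) := QuotientGroup.isOpenMap_coe

theorem toSOU_surjective : Function.Surjective (toSOU N D r) := QuotientGroup.mk'_surjective _

theorem toSOU_eq_iff {s t : TAf N D r} :
    toSOU N D r s = toSOU N D r t ↔ ∃ x, t = s * scalarHom N D r x := by
  refine (QuotientGroup.mk'_eq_mk' _).trans ⟨?_, ?_⟩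
  · rintro ⟨_, ⟨x, rfl⟩, rfl⟩
    exact ⟨x, rfl⟩
  · rintro ⟨x, rfl⟩
    exact ⟨_, ⟨x, rfl⟩, rfl⟩

theorem isOpen_zhatUnits : IsOpen ZhatUnits :=
  (isOpen_isIntegral.preimage Units.continuous_val).inter
    (isOpen_isIntegral.preimage Units.continuous_coe_inv)

end

end

section

open MeasureTheory

/-! ### The volume of `K_T` and the class number -/

variable {N : ℕ} [NeZero N] {D r C : ℤ}

local notation "𝔞" => ((N : ℤ) * C)
local notation "𝔟" => (-r)

theorem mem_KT_iff (h : IsCMDatum N D r C) (t : TAf N D r) : t ∈ KT N D r ↔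
    (IsIntegral ((t : GL (Fin 2) Af) 0 0) ∧ IsIntegral ((t : GL (Fin 2) Af) 0 1)) ∧
    (IsIntegral ((t⁻¹ : TAf N D r).val 0 0) ∧ IsIntegral ((t⁻¹ : TAf N D r).val 0 1)) := by
  obtain ⟨u, rfl⟩ := torusHom_surjective h Af t
  rw [torusHom_mem_KT_iff, ← map_inv]
  rfl

theorem isOpen_KT (h : IsCMDatum N D r C) : IsOpen (KT N D r) := by
  have hc (i j : Fin 2) : Continuous fun t : TAf N D r => (t : GL (Fin 2) Af) i j :=
    (Units.continuous_val.comp continuous_subtype_val).matrix_elem i j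
  have : KT N D r = {t : TAf N D r | (IsIntegral ((t : GL (Fin 2) Af) 0 0) ∧
      IsIntegral ((t : GL (Fin 2) Af) 0 1)) ∧ (IsIntegral ((t⁻¹ : TAf N D r).val 0 0) ∧
      IsIntegral ((t⁻¹ : TAf N D r).val 0 1))} := Set.ext (mem_KT_iff h)
  rw [this]
  exact ((isOpen_isIntegral.preimage (hc 0 0)).inter (isOpen_isIntegral.preimage (hc 0 1))).inter
    ((isOpen_isIntegral.preimage ((hc 0 0).comp continuous_inv)).inter
      (isOpen_isIntegral.preimage ((hc 0 1).comp continuous_inv)))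

/-- The image of `K_T` in `SO(U)(𝔸_f)`. -/
def imageKT (h : IsCMDatum N D r C) : Subgroup (SOUAf N D r) :=
  ((quadZhatUnits ((N : ℤ) * C) (-r)).map (torusHom h Af)).map (toSOU N D r)

theorem coe_imageKT (h : IsCMDatum N D r C) :
    (imageKT h : Set (SOUAf N D r)) = toSOU N D r '' KT N D r := by
  rw [imageKT, Subgroup.coe_map]
  congr 1
  ext t
  obtain ⟨u, rfl⟩ := torusHom_surjective h Af t
  rw [torusHom_mem_KT_iff, SetLike.mem_coe, Subgroup.mem_map]
  constructor
  · rintro ⟨v, hv, hvu⟩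
    rwa [← torusHom_injective h Af hvu]
  · exact fun hu => ⟨u, hu, rfl⟩

theorem measurableSet_imageKT (h : IsCMDatum N D r C) :
    MeasurableSet (imageKT h : Set (SOUAf N D r)) := by
  rw [coe_imageKT]
  exact (isOpenMap_toSOU N D r _ (isOpen_KT h)).measurableSet

theorem mul_scalarHom_mem_KT_iff (h : IsCMDatum N D r C) {t : TAf N D r} (ht : t ∈ KT N D r)
    (x : Afˣ) : t * scalarHom N D r x ∈ KT N D r ↔ x ∈ ZhatUnits := by
  obtain ⟨u, rfl⟩ := torusHom_surjective h Af t
  rw [torusHom_mem_KT_iff] at ht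
  rw [← torusHom_scalarIdele h, ← map_mul, torusHom_mem_KT_iff, Subgroup.mul_mem_cancel_left _ ht,
    scalarIdele_mem_iff]

/-- Over a point of the image the fibre of `K_T` is a translate of `\hat ℤ^×`, of volume one;
elsewhere it is empty. -/
theorem IsTamagawa.measure_KT (h : IsCMDatum N D r C) {μT : Measure (TAf N D r)} {μA : Measure Afˣ}
    {μS : Measure (SOUAf N D r)} (hT : IsTamagawa N D r μT μA μS) :
    μT (KT N D r) = μS (imageKT h) := by
  have := hT.haarA
  have hK := (isOpen_KT h).measurableSet
  have hZ := isOpen_zhatUnits.measurableSet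
  rw [← lintegral_indicator_one hK, ← lintegral_indicator_one (measurableSet_imageKT h)]
  refine hT.fubini _ _ (measurable_one.indicator hK) fun t => ?_
  rw [coe_imageKT]
  by_cases ht : toSOU N D r t ∈ toSOU N D r '' KT N D r
  · rw [Set.indicator_of_mem ht]
    obtain ⟨k, hk, hkt⟩ := ht
    obtain ⟨y, rfl⟩ := (toSOU_eq_iff N D r).1 hkt
    have h1 (x : Afˣ) : (KT N D r).indicator (1 : TAf N D r → ENNReal)
        (k * scalarHom N D r y * scalarHom N D r x) =
        ((fun x => y * x) ⁻¹' ZhatUnits).indicator 1 x := by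
      have := mul_scalarHom_mem_KT_iff h hk (y * x)
      rw [map_mul, ← mul_assoc] at this
      by_cases hx : y * x ∈ ZhatUnits
      · rw [Set.indicator_of_mem (this.2 hx), Set.indicator_of_mem (by exact hx)]
        rfl
      · rw [Set.indicator_of_notMem (mt this.1 hx), Set.indicator_of_notMem (by exact hx)]
    simp_rw [h1]
    rw [lintegral_indicator_one ((measurable_const_mul y) hZ), measure_preimage_mul, hT.volA]
    rfl
  · rw [Set.indicator_of_notMem ht]
    have h1 (x : Afˣ) : (KT N D r).indicator (1 : TAf N D r → ENNReal)
        (t * scalarHom N D r x) = 0 :=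
      Set.indicator_of_notMem (fun hx => ht ⟨_, hx, ((toSOU_eq_iff N D r).2 ⟨x, rfl⟩).symm⟩) _
    simp_rw [h1]
    rw [lintegral_zero]

/-- The projection of the adelic quadratic algebra to `SO(U)(𝔸_f)`. -/
def ideleToSOU (h : IsCMDatum N D r C) : (QAf ((N : ℤ) * C) (-r))ˣ →* SOUAf N D r :=
  (toSOU N D r).comp (torusHom h Af)

theorem ideleToSOU_surjective (h : IsCMDatum N D r C) : Function.Surjective (ideleToSOU h) :=
  (toSOU_surjective N D r).comp (torusHom_surjective h Af)

theorem exists_of_ideleToSOU_eq (h : IsCMDatum N D r C) {s t : (QAf 𝔞 𝔟)ˣ}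
    (hst : ideleToSOU h s = ideleToSOU h t) : ∃ x, t = s * scalarIdele 𝔞 𝔟 x := by
  obtain ⟨x, hx⟩ := (toSOU_eq_iff N D r).1 hst
  refine ⟨x, torusHom_injective h Af ?_⟩
  rw [hx, map_mul, torusHom_scalarIdele]

theorem ideleToSOU_scalarIdele (h : IsCMDatum N D r C) (x : Afˣ) :
    ideleToSOU h (scalarIdele 𝔞 𝔟 x) = 1 := by
  refine ((toSOU_eq_iff N D r).2 ⟨x, ?_⟩).symm.trans (map_one (toSOU N D r))
  rw [one_mul, torusHom_scalarIdele]

theorem mem_SOUQ_iff_ideleToSOU (h : IsCMDatum N D r C) {x : SOUAf N D r} : x ∈ SOUQ N D r ↔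
    ∃ k, x = ideleToSOU h (principalIdele 𝔞 𝔟 k) := mem_SOUQ_iff h x

theorem mem_imageKT_iff (h : IsCMDatum N D r C) {x : SOUAf N D r} : x ∈ imageKT h ↔
    ∃ u ∈ quadZhatUnits 𝔞 𝔟, x = ideleToSOU h u := by
  constructor
  · rintro ⟨_, ⟨u, hu, rfl⟩, rfl⟩
    exact ⟨u, hu, rfl⟩
  · rintro ⟨u, hu, rfl⟩
    exact ⟨_, ⟨u, hu, rfl⟩, rfl⟩

theorem SOUAf_mul_comm (h : IsCMDatum N D r C) (x y : SOUAf N D r) : x * y = y * x := by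
  obtain ⟨s, rfl⟩ := ideleToSOU_surjective h x
  obtain ⟨t, rfl⟩ := ideleToSOU_surjective h y
  rw [← map_mul, mul_comm s t, map_mul]

theorem countable_SOUQ (h : IsCMDatum N D r C) : Countable (SOUQ N D r) := by
  have : Countable (QuadraticAlgebra ℚ ((𝔞 : ℤ) : ℚ) ((𝔟 : ℤ) : ℚ)) :=
    (QuadraticAlgebra.equivProd _ _).countable_iff.2 inferInstance
  have : Countable (QuadraticAlgebra ℚ ((𝔞 : ℤ) : ℚ) ((𝔟 : ℤ) : ℚ))ˣ :=
    Units.val_injective.countable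
  refine Set.Countable.to_subtype (s := (SOUQ N D r : Set (SOUAf N D r))) ?_
  refine (Set.countable_range fun k => ideleToSOU h (principalIdele 𝔞 𝔟 k)).mono fun x hx => ?_
  obtain ⟨k, hk⟩ := (mem_SOUQ_iff_ideleToSOU h).1 hx
  exact ⟨k, hk.symm⟩

/-- Scalar ideles have trivial class by `𝔸_f^× = ℚ^× \hat ℤ^×`, so the class map on ideles descends
to `SO(U)(𝔸_f)`. -/
theorem exists_classMap (h : IsCMDatum N D r C)
    [Fact (∀ q : ℚ, q ^ 2 ≠ ((𝔞 : ℤ) : ℚ) + ((𝔟 : ℤ) : ℚ) * q)]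
    [IsDedekindDomain (QuadraticAlgebra ℤ ((N : ℤ) * C) (-r))] :
    ∃ cls : SOUAf N D r → ClassGroup (QuadraticAlgebra ℤ ((N : ℤ) * C) (-r)),
      Function.Surjective cls ∧ ∀ x y, cls x = cls y ↔
        ∃ γ ∈ SOUQ N D r, ∃ u ∈ imageKT h, y = γ * x * u := by
  obtain ⟨cls, hsurj, hcls⟩ := exists_ideleClass (a := 𝔞) (b := 𝔟)
  have hcls' {s t : (QAf 𝔞 𝔟)ˣ} (hst : ideleToSOU h s = ideleToSOU h t) : cls s = cls t := by
    obtain ⟨x, rfl⟩ := exists_of_ideleToSOU_eq h hst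
    obtain ⟨q, hq⟩ := exists_rat_mul_mem_zhatUnits x
    obtain ⟨k, hk⟩ : ∃ k, scalarIdele 𝔞 𝔟 (Units.map (algebraMap ℚ Af : ℚ →* Af) q) =
      principalIdele 𝔞 𝔟 k := ⟨_, scalarIdele_map q⟩
    refine (hcls _ _).2 ⟨k, _, scalarIdele_mem_iff.2 hq, ?_⟩
    rw [← hk, map_mul, map_inv, mul_comm _ s, mul_assoc s,
      mul_comm (scalarIdele 𝔞 𝔟 x) _, mul_inv_cancel_left]
  have hp := ideleToSOU_surjective h
  refine ⟨fun x => cls (Function.surjInv hp x), fun c => ?_, fun x y => ?_⟩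
  · obtain ⟨t, rfl⟩ := hsurj c
    exact ⟨ideleToSOU h t, hcls' (Function.surjInv_eq hp _)⟩
  · have hx := Function.surjInv_eq hp x
    have hy := Function.surjInv_eq hp y
    rw [hcls]
    constructor
    · rintro ⟨k, u, hu, hk⟩
      refine ⟨_, (mem_SOUQ_iff_ideleToSOU h).2 ⟨k, rfl⟩, _, (mem_imageKT_iff h).2 ⟨u, hu, rfl⟩, ?_⟩
      rw [← hy, hk, map_mul, map_mul, hx]
    · rintro ⟨γ, hγ, w, hw, hxy⟩
      obtain ⟨k, rfl⟩ := (mem_SOUQ_iff_ideleToSOU h).1 hγ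
      obtain ⟨u, hu, rfl⟩ := (mem_imageKT_iff h).1 hw
      have : ideleToSOU h (principalIdele 𝔞 𝔟 k * Function.surjInv hp x * u) =
          ideleToSOU h (Function.surjInv hp y) := by
        rw [map_mul, map_mul, hx, hy, hxy]
      rw [← hcls, ← hcls' this, hcls]
      exact ⟨k, u, hu, rfl⟩

/-- The units of `ℤ[ω]` map onto the intersection of `SO(U)(ℚ)` with the image of `K_T`; the kernel
consists of the scalar units `±1`. -/
theorem card_imageKT_subgroupOf (h : IsCMDatum N D r C) :
    Nat.card ((imageKT h).subgroupOf (SOUQ N D r)) * 2 =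
      Nat.card (QuadraticAlgebra ℤ ((N : ℤ) * C) (-r))ˣ := by
  let ψ : (QuadraticAlgebra ℤ ((N : ℤ) * C) (-r))ˣ →* SOUAf N D r :=
    (ideleToSOU h).comp (unitIdele 𝔞 𝔟)
  have hrange : ψ.range = SOUQ N D r ⊓ imageKT h := by
    ext x
    rw [Subgroup.mem_inf, mem_SOUQ_iff_ideleToSOU h, mem_imageKT_iff]
    constructor
    · rintro ⟨ε, rfl⟩
      exact ⟨⟨_, congrArg (ideleToSOU h) (unitIdele_eq_principalIdele ε)⟩, _, unitIdele_mem ε, rfl⟩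
    · rintro ⟨⟨k, rfl⟩, u, hu, hku⟩
      obtain ⟨x, hx⟩ := exists_of_ideleToSOU_eq h hku
      obtain ⟨ε, y, hε⟩ := exists_unit_of_principalIdele_mul_mem (hx ▸ hu)
      refine ⟨ε, ?_⟩
      change ideleToSOU h _ = ideleToSOU h _
      rw [hε, map_mul, ideleToSOU_scalarIdele, mul_one]
  have hker : Nat.card ψ.ker = 2 := by
    have : (ψ.ker : Set (QuadraticAlgebra ℤ ((N : ℤ) * C) (-r))ˣ) = {1, -1} := by
      ext ε
      rw [SetLike.mem_coe, MonoidHom.mem_ker, Set.mem_insert_iff, Set.mem_singleton_iff,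
        ← unitIdele_mem_range_scalarIdele]
      constructor
      · intro hε
        obtain ⟨x, hx⟩ := exists_of_ideleToSOU_eq h (s := 1) (t := unitIdele 𝔞 𝔟 ε)
          ((map_one _).trans hε.symm)
        exact ⟨x, by rw [hx, one_mul]⟩
      · rintro ⟨x, hx⟩
        change ideleToSOU h _ = 1
        rw [← hx, ideleToSOU_scalarIdele]
    rw [← SetLike.coe_sort_coe, this, Nat.card_coe_set_eq, Set.ncard_pair]
    intro h1
    have := congrArg (fun ε : (QuadraticAlgebra ℤ ((N : ℤ) * C) (-r))ˣ => ε.val.re) h1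
    simp [QuadraticAlgebra.re_one] at this
  rw [← Subgroup.card_mul_index ψ.ker, hker, Subgroup.index_ker, hrange, mul_comm,
    ← Subgroup.inf_subgroupOf_left]
  congr 1
  exact Nat.card_congr (Subgroup.subgroupOfEquivOfLe inf_le_left).toEquiv

/-- `h vol(K_T) = w`. -/
theorem IsTamagawa.card_mul_measure_KT (h : IsCMDatum N D r C)
    [IsDomain (QuadraticAlgebra ℤ ((N : ℤ) * C) (-r))]
    (hf : IsFundamentalDiscriminant D) {μT : Measure (TAf N D r)} {μA : Measure Afˣ}
    {μS : Measure (SOUAf N D r)} (hT : IsTamagawa N D r μT μA μS) :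
    (Nat.card (ClassGroup (QuadraticAlgebra ℤ ((N : ℤ) * C) (-r))) : ENNReal) * μT (KT N D r) =
      Nat.card (QuadraticAlgebra ℤ ((N : ℤ) * C) (-r))ˣ := by
  have hD : (-r) ^ 2 + 4 * ((N : ℤ) * C) = D := by rw [h.eq]; ring
  have hneg : (-r) ^ 2 + 4 * ((N : ℤ) * C) < 0 := hD ▸ h.neg
  have hfact := fact_quad hneg
  have hded := isDedekindDomain_quadraticAlgebra (hD.symm ▸ hf)
  have hL := LchiD_one_eq_card hneg (hD.symm ▸ hf)
  rw [hD] at hL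
  have hL0 : LchiD D 1 ≠ 0 := LchiD_ne_zero h.neg h.mod_four (by simp)
  -- `Nat.card` of an infinite type is zero, so the class number formula together with `L(χ, 1) ≠ 0`
  -- yields finiteness of the units and of the class group.
  have hfinU : Finite (QuadraticAlgebra ℤ ((N : ℤ) * C) (-r))ˣ := by
    refine Nat.finite_of_card_ne_zero fun h0 => hL0 ?_
    rw [hL, h0]
    simp
  have hfinC : Finite (ClassGroup (QuadraticAlgebra ℤ ((N : ℤ) * C) (-r))) := by
    refine Nat.finite_of_card_ne_zero fun h0 => hL0 ?_
    rw [hL, h0]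
    simp
  obtain ⟨F, hF, hF2⟩ := hT.volS
  have := hT.haarS
  obtain ⟨cls, hsurj, hcls⟩ := exists_classMap h
  have := countable_SOUQ h
  have hcard := card_imageKT_subgroupOf h
  have hfin : Finite ((imageKT h).subgroupOf (SOUQ N D r)) := by
    refine Nat.finite_of_card_ne_zero fun h0 => ?_
    rw [h0, zero_mul] at hcard
    exact Nat.card_pos.ne hcard
  have key := card_mul_measure_eq (SOUAf_mul_comm h) hF (measurableSet_imageKT h) hsurj hcls
  rw [hT.measure_KT h, key, hF2, ← hcard]
  push_cast
  rfl

end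

section

open MeasureTheory

/-! ### The constant in the central derivative -/

variable {N : ℕ} [NeZero N] {D r C : ℤ}

theorem Q_mu (N : ℕ) [NeZero N] (r : ℤ) : Q N (mu N r) = -(r : ℚ) ^ 2 / (4 * N) := by
  have hN : (N : ℚ) ≠ 0 := NeZero.ne _
  change (N : ℚ) * (!![(r : ℚ) / (2 * N), 0; 0, -(r / (2 * N))] : Matrix (Fin 2) (Fin 2) ℚ).det = _
  rw [Matrix.det_fin_two_of]
  field_simp
  ring

/-- The integer `C` is `Q(μ₀) - m₀`, because `Q(μ₀) = -r²/(4N)`. -/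
theorem exists_isCMDatum {m₀ : ℚ} (hm₀ : 0 < m₀) (hμ₀ : ∃ k : ℤ, m₀ - Q N (mu N r) = k)
    (hD : (D : ℚ) = -4 * N * m₀) : ∃ C, IsCMDatum N D r C := by
  have hN : (0 : ℚ) < N := by exact_mod_cast NeZero.pos N
  obtain ⟨k, hk⟩ := hμ₀
  refine ⟨-k, ?_, ?_⟩
  · have : (D : ℚ) < 0 := by rw [hD]; nlinarith [mul_pos hN hm₀]
    exact_mod_cast this
  · have : (D : ℚ) = r ^ 2 + 4 * N * (-k) := by
      rw [hD, ← hk, Q_mu]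
      field_simp
      ring
    exact_mod_cast this

/-- Insert `L(χ, 1) = 2πh/(w√|D|)`, `w = h vol(K_T)` and `√|D| = 2√N√m₀` into `1/(√m₀ L(χ, 1))`. -/
theorem archFactor_zero_eq (h : IsCMDatum N D r C) (hf : IsFundamentalDiscriminant D) {m₀ : ℚ}
    (hm₀ : 0 < m₀) (hD : (D : ℚ) = -4 * N * m₀) {μT : Measure (TAf N D r)} {μA : Measure Afˣ}
    {μS : Measure (SOUAf N D r)} (hT : IsTamagawa N D r μT μA μS) :
    archFactor D m₀ 0 = (Real.sqrt N * (μT (KT N D r)).toReal / Real.pi : ℝ) := by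
  have hab : (-r) ^ 2 + 4 * ((N : ℤ) * C) = D := by rw [h.eq]; ring
  have hneg : (-r) ^ 2 + 4 * ((N : ℤ) * C) < 0 := hab ▸ h.neg
  have hfact := fact_quad hneg
  have hdom := isDomain_quadraticAlgebra (a := (N : ℤ) * C) (b := -r)
  have hL := LchiD_one_eq_card hneg (hab.symm ▸ hf)
  have hvol := congrArg ENNReal.toReal (hT.card_mul_measure_KT h hf)
  rw [ENNReal.toReal_mul, ENNReal.toReal_natCast, ENNReal.toReal_natCast] at hvol
  rw [hab, ← hvol] at hL
  have hL0 : LchiD D 1 ≠ 0 := LchiD_ne_zero h.neg h.mod_four (by simp)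
  have hcard : (Nat.card (ClassGroup (QuadraticAlgebra ℤ ((N : ℤ) * C) (-r))) : ℝ) ≠ 0 := by
    intro h0
    rw [h0] at hL
    exact hL0 (by simpa using hL)
  have hμ : (μT (KT N D r)).toReal ≠ 0 := by
    intro h0
    rw [h0] at hL
    exact hL0 (by simpa using hL)
  have hm : (0 : ℝ) < m₀ := by exact_mod_cast hm₀
  have hN : (0 : ℝ) < N := by exact_mod_cast NeZero.pos N
  have hsqrt : Real.sqrt (-(D : ℝ)) = 2 * Real.sqrt N * Real.sqrt m₀ := by
    have h1 : -(D : ℝ) = 2 ^ 2 * N * m₀ := by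
      have : (D : ℝ) = -4 * N * m₀ := by exact_mod_cast congrArg (Rat.cast (K := ℝ)) hD
      rw [this]; ring
    rw [h1, Real.sqrt_mul (by positivity), Real.sqrt_mul (by positivity),
      Real.sqrt_sq (by norm_num)]
  have hs : Real.sqrt m₀ ≠ 0 := (Real.sqrt_pos.2 hm).ne'
  have hs' : Real.sqrt N ≠ 0 := (Real.sqrt_pos.2 hN).ne'
  rw [archFactor_zero D hm₀, hL, ← Complex.ofReal_inv, ← Complex.ofReal_mul]
  congr 1
  rw [hsqrt]
  have := Real.pi_ne_zero
  field_simp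

end

end RankinShimura

end

/-! ### Assembly of the theorem -/

open RankinShimura MeasureTheory ComplexConjugate in
theorem lemma7p2
    (N : ℕ) [NeZero N]
    (m₀ : ℚ) (hm₀ : 0 < m₀)
    -- the class `μ₀ = μ_r` in `L'/L`, with `m₀ ≡ Q(μ₀) (mod 1)`
    (r : ℤ) (hμ₀ : ∃ k : ℤ, m₀ - Q N (mu N r) = k)
    (D₀ : ℤ) (hD₀ : (D₀ : ℚ) = -4 * N * m₀) (hfund : IsFundamentalDiscriminant D₀)
    (g : ℍ → V → ℂ) (hg : IsCuspFormL N g) :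
    -- convergence of the series and integrals involved
    (∀ s : ℂ, 1 < s.re →
      (∀ (τ : ℍ) (x : V), Summable fun c : GammaInftyCosets =>
        eisTerm (Q N) (latN N D₀ r) τ s c.out x) ∧
      IntegrableOn (rankinIntegrand (Q N) (latP N D₀ r) (latN N D₀ r) g s) ModularGroup.fd) ∧
    (∀ s : ℂ, 3 / 2 < s.re → LSeriesSummable (shimuraCoeff N D₀ m₀ (mu N r) g) (s + 1)) ∧
    -- the identity in the region of convergence
    (∀ s : ℂ, 1 < s.re → LSeriesSummable (shimuraCoeff N D₀ m₀ (mu N r) g) (s + 1) →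
      LgU N D₀ r g s =
        archFactor D₀ m₀ s * conj (LSeries (shimuraCoeff N D₀ m₀ (mu N r) g) (conj s + 1)) ∧
      (HasRealCoeffs N g →
        LgU N D₀ r g s =
          archFactor D₀ m₀ s * LSeries (shimuraCoeff N D₀ m₀ (mu N r) g) (s + 1))) ∧
    -- the identity of meromorphic functions on the complex plane
    ((∃ Λ, IsContinuationLgU N D₀ r g Λ) ↔
      ∃ ℓ, IsContinuationLSeries (shimuraCoeff N D₀ m₀ (mu N r) g) ℓ) ∧
    (∀ Λ ℓ : ℂ → ℂ, IsContinuationLgU N D₀ r g Λ →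
      IsContinuationLSeries (shimuraCoeff N D₀ m₀ (mu N r) g) ℓ →
      Λ =ᶠ[Filter.codiscrete ℂ] (fun s => archFactor D₀ m₀ s * conj (ℓ (conj s + 1))) ∧
      (HasRealCoeffs N g →
        Λ =ᶠ[Filter.codiscrete ℂ] fun s => archFactor D₀ m₀ s * ℓ (s + 1))) ∧
    -- the central derivative
    (∀ G : S2 N, IsFrickeInvariant N G →
      (∃ σ : ℝ, ∀ s : ℂ, σ < s.re → LSeries (shimuraCoeff N D₀ m₀ (mu N r) g) s =
        coeff (Q N) g m₀ (mu N r) * heckeL N G s) →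
      (∃ Λ, IsContinuationLgU N D₀ r g Λ ∧ AnalyticAt ℂ Λ 0) ∧
      ∀ Λ, IsContinuationLgU N D₀ r g Λ → AnalyticAt ℂ Λ 0 →
        ∀ (μT : Measure (TAf N D₀ r)) (μA : Measure Afˣ) (μS : Measure (SOUAf N D₀ r)),
          IsTamagawa N D₀ r μT μA μS →
          deriv Λ 0 = (Real.sqrt N * (μT (KT N D₀ r)).toReal / Real.pi : ℝ) *
            conj (coeff (Q N) g m₀ (mu N r) * deriv (heckeL N G) 1) ∧
          (HasRealCoeffs N g →
            deriv Λ 0 = (Real.sqrt N * (μT (KT N D₀ r)).toReal / Real.pi : ℝ) *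
              coeff (Q N) g m₀ (mu N r) * deriv (heckeL N G) 1)) := by 
  obtain ⟨C, h⟩ := exists_isCMDatum hm₀ hμ₀ hD₀
  have hN : (N : ℚ) ≠ 0 := NeZero.ne _
  have hm : Q N (xvec N D₀ r) = m₀ := by
    rw [h.Q_xvec, hD₀]
    field_simp
  obtain ⟨y, K, k, hr, -⟩ := h.exists_isRankOne
  refine ⟨fun s hs => ⟨fun τ x => h.isEvenLattice_latN.summable_eisTerm τ hs x,
      integrableOn_rankinIntegrand h.isSplit hr hg hs⟩,
    fun s hs => LSeriesSummable_shimuraCoeff h hm hg hm₀ ?_, fun s hs hsum => ?_,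
    exists_continuationLgU_iff h hm hg hm₀,
    fun Λ ℓ hΛ hℓ => ⟨continuation_eq h hm hg hm₀ hΛ hℓ,
      continuation_eq_of_real h hm hg hm₀ hΛ hℓ⟩,
    fun G hG hL => ⟨exists_analyticAt_continuationLgU h hm hg hm₀ hL,
      fun Λ hΛ hΛ0 μT μA μS hT => ?_⟩⟩
  · rw [Complex.add_re, Complex.one_re]
    linarith
  · have hid := LgU_eq h hm hg hm₀ hs hsum
    exact ⟨hid, fun hreal => by rw [hid, hreal.conj_LSeries]⟩
  · rw [← archFactor_zero_eq h hfund hm₀ hD₀ hT]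
    refine ⟨deriv_continuationLgU h hm hg hm₀ hG hL hΛ hΛ0, fun hreal => ?_⟩
    rw [mul_assoc]
    exact deriv_continuationLgU_of_real h hm hg hm₀ hG hL hΛ hΛ0 hreal
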